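/- Let $q>0$. For $(\vartheta,\mathbf a)\in\mathbb R^3\times(\mathbb R^3\setminus\{0\})$ put $$a=|\mathbf a|,\quad \xi=\frac qa,\quad \eta=\frac aq\,\vartheta\cdot\mathbf a,\quad \mathbf u=\frac{\mathbf a}{a},\quad \mathbf L=\vartheta\times\mathbf a,\quad \lambda=|\mathbf L|,\quad \kappa=\frac{\lambda}{\xi},$$ and let $\mathbf X(\vartheta,\mathbf a)$ be the position component of the inverse of the (future) asymptotic action-angle diffeomorphism of the repulsive Kepler problem $\ddot{\mathbf x}=\frac q2\frac{\mathbf x}{|\mathbf x|^3}$; explicitly, $$\mathbf X=\frac{\xi^2}{q}\Big(\eta+\sigma+\tfrac12+\frac{D}{1+4\kappa^2}\Big)\mathbf u-\frac{\xi}{q}\Big(1+\frac{2D}{1+4\kappa^2}\Big)\mathbf L\times\mathbf u,\qquad D=\sqrt{(\eta+\sigma)^2+\kappa^2+\tfrac14}-(\eta+\sigma),$$ where $\sigma=-\iota\ln(\sqrt\rho+\sqrt{\rho-1})$, $\iota=1$ if $\eta>-\kappa^2$ and $\iota=-1$ otherwise, and $\rho\ge1$ is the unique solution of $\eta-\iota\big[\sqrt{\rho(\rho-1)}+\ln(\sqrt\rho+\sqrt{\rho-1})\big]+\kappa^2\big[2\rho-1-2\iota\sqrt{\rho(\rho-1)}\big]=0$.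 For $t>0$ let $\widetilde{\mathbf X}(\vartheta,\mathbf a)=\mathbf X(\vartheta+t\mathbf a,\mathbf a)$. Fix a smooth radial function $\varphi$ on $\mathbb R^3$ supported in $\{1/2\le|\mathbf x|\le2\}$ with $\int\varphi(\mathbf x)|\mathbf x|^{-2}d\mathbf x=1$. For a real density $\gamma=\gamma(\vartheta,\mathbf a,t)$ and $\mathbf y\in\mathbb R^3$ define $$\mathcal E_j(\mathbf y,t)=\frac1{4\pi}\iint\frac{(\mathbf y-\widetilde{\mathbf X})^j}{|\mathbf y-\widetilde{\mathbf X}|^3}\gamma^2\,d\vartheta d\mathbf a,\qquad \mathcal E^{eff}_j(\mathbf y,t)=\int_0^\infty\Big(-R^{-2}\iint(\partial_j\varphi)\big(R^{-1}(\mathbf y-t\mathbf a)\big)\gamma^2\,d\vartheta d\mathbf a\Big)\frac{dR}{R},$$ $$\mathcal F_{jk}(\mathbf y,t)=\int_0^\infty\Big(-R^{-3}\iint(\partial_j\partial_k\varphi)\big(R^{-1}(\mathbf y-\widetilde{\mathbf X})\big)\gamma^2\,d\vartheta d\mathbf a\Big)\frac{dR}{R},$$ and let $\mathcal F^{eff}_{jk}$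 be given by the formula for $\mathcal F_{jk}$ with $\widetilde{\mathbf X}$ replaced by $t\mathbf a$. With $\{f,g\}=\nabla_\vartheta f\cdot\nabla_{\mathbf a}g-\nabla_{\mathbf a}f\cdot\nabla_\vartheta g$ (componentwise for vector-valued $f$) and $\mathfrak w_\xi=\frac{1+\xi}{\xi^2}$, $\mathfrak w_\eta=\frac{\xi^2}{1+\xi}$, $\mathfrak w_{\mathbf u}=1$, $\mathfrak w_{\mathbf L}=\frac{\xi}{1+\xi}$, set $$N_1=\big\|[\xi^2+a^3+|\eta|^2+\lambda]\gamma\big\|_{L^2_{\vartheta,\mathbf a}}^2+\big\|[\xi^4+a^{10}+|\eta|^{10}+\lambda^5]\gamma\big\|_{L^\infty_{\vartheta,\mathbf a}}^2,$$ $$N_2=N_1+\big\|[\xi^2+a^2+|\eta|^2+\lambda^2]^{12}\gamma\big\|_{L^\infty_{\vartheta,\mathbf a}}^2+\sum_{f\in\{\xi,\eta,\mathbf u,\mathbf L\}}\big\|\mathfrak w_f\{f,\gamma\}\big\|_{L^\infty_{\vartheta,\mathbf a}}^2 .$$ **Proposition.** There is a constant $C>0$, depending only on $q$ and $\varphi$,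 such that the following holds for every $t>0$ and every density $\gamma$. (i) If $\gamma(\cdot,\cdot,t)$ is measurable and $N_1<\infty$, then for all $\mathbf y\in\mathbb R^3$ and all $j$ the integral defining $\mathcal E_j(\mathbf y,t)$ and the integral over $R$ defining $\mathcal E^{eff}_j(\mathbf y,t)$ converge absolutely, and $$\big[t^2+|\mathbf y|^2\big]\,\big|\mathcal E_j(\mathbf y,t)-\mathcal E^{eff}_j(\mathbf y,t)\big|\le C\,t^{-1/5}N_1 .$$ (ii) If $\gamma(\cdot,\cdot,t)$ is $C^1$ on $\{\mathbf a\ne0\}$ and $N_2<\infty$, then for all $\mathbf y\in\mathbb R^3$ and all $j,k$ the integrals over $R$ defining $\mathcal F_{jk}(\mathbf y,t)$ and $\mathcal F^{eff}_{jk}(\mathbf y,t)$ converge absolutely, $\mathcal F_{jk}(\mathbf y,t)=\partial_{\mathbf y^k}\mathcal E_j(\mathbf y,t)$, and $$\big[t^2+|\mathbf y|^2\big]^{3/2}\,\big|\mathcal F_{jk}(\mathbf y,t)-\mathcal F^{eff}_{jk}(\mathbf y,t)\big|\le C\,t^{-1/5}N_2 .$$ -/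

import Mathlib

open MeasureTheory Set
open scoped ContDiff ENNReal

noncomputable section

namespace KeplerGas

/-- Physical space `ℝ³` with its Euclidean norm. -/
abbrev E3 : Type := EuclideanSpace ℝ (Fin 3)

/-- Pairs `p = (ϑ, a)` of an angle `p.1 = ϑ` and an action `p.2 = a`, with Lebesgue measure
`dϑ da`. -/
abbrev Phase : Type := E3 × E3

/-- The phase space `{(ϑ, a) : |a| > 0}`; its complement in `ℝ³ × ℝ³` is a null set. -/
def phaseSpace : Set Phase := {p | p.2 ≠ 0}

/-- The vector product in `ℝ³`. -/
def cross (x y : E3) : E3 := WithLp.toLp 2 (crossProduct (WithLp.ofLp x) (WithLp.ofLp y))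

/-! ### Super-integrable coordinates -/

/-- `a = |𝐚|`. -/
def act (p : Phase) : ℝ := ‖p.2‖

/-- `ξ = q / a`. -/
def xi (q : ℝ) (p : Phase) : ℝ := q / act p

/-- `η = (a / q) ϑ · 𝐚`. -/
def eta (q : ℝ) (p : Phase) : ℝ := act p / q * inner ℝ p.1 p.2

/-- `𝐮 = 𝐚 / a`. -/
def dir (p : Phase) : E3 := (act p)⁻¹ • p.2

/-- The angular momentum `𝐋 = ϑ × 𝐚`. -/
def angMom (p : Phase) : E3 := cross p.1 p.2

/-- `λ = |𝐋|`. -/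
def lam (p : Phase) : ℝ := ‖angMom p‖

/-- `κ = a λ / q = λ / ξ`. -/
def kappa (q : ℝ) (p : Phase) : ℝ := act p * lam p / q

/-! ### The position map of the asymptotic action-angle variables -/

/-- `G(y) = √(y(y-1)) + ln(√y + √(y-1))`, for `y ≥ 1`. -/
def funG (y : ℝ) : ℝ := √(y * (y - 1)) + Real.log (√y + √(y - 1))

/-- `P_ι(y) = 2y - 1 + 2ι√(y(y-1))`, for `y ≥ 1` and `ι = ±1`. -/
def funP (ι y : ℝ) : ℝ := 2 * y - 1 + ι * (2 * √(y * (y - 1)))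

/-- `ι = +1` on `Ω₊ = {η > -κ²}` and `ι = -1` on `Ω₋ = {η < -κ²}` (the value on the fold
`{η = -κ²}`, where `ρ = 1` and `σ = 0`, is immaterial). -/
def foldSign (η κ : ℝ) : ℝ := if -κ ^ 2 < η then 1 else -1

/-- `ρ(η, κ)`: the unique `y ≥ 1` with `η - ι G(y) + κ² P_{-ι}(y) = 0`; see `rho_unique`. -/
def rho (η κ : ℝ) : ℝ :=
  sInf {y : ℝ | 1 ≤ y ∧ η - foldSign η κ * funG y + κ ^ 2 * funP (-foldSign η κ) y = 0}

/-- `σ(η, κ) = -ι ln(√ρ + √(ρ-1))`. -/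
def sigma (η κ : ℝ) : ℝ :=
  -foldSign η κ * Real.log (√(rho η κ) + √(rho η κ - 1))

/-- `D(κ, y) = √(y² + κ² + 1/4) - y`. -/
def funD (κ y : ℝ) : ℝ := √(y ^ 2 + κ ^ 2 + 1 / 4) - y

/-- The position `𝐗(ϑ, 𝐚)` of the particle with asymptotic angle `ϑ` and asymptotic action `𝐚`
in the repulsive Kepler problem `ẍ = q x / (2|x|³)`, i.e. the position component of the inverse of
the canonical asymptotic action-angle diffeomorphism `(x, v) ↦ (ϑ, 𝐚)`:
`𝐗 = (ξ²/q)(η + σ + 1/2 + D/(1+4κ²)) 𝐮 - (ξ/q)(1 + 2D/(1+4κ²)) 𝐋 × 𝐮`, `D = D(κ, η + σ)`. -/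
def posX (q : ℝ) (p : Phase) : E3 :=
  (xi q p ^ 2 / q * (eta q p + sigma (eta q p) (kappa q p) + 1 / 2
      + funD (kappa q p) (eta q p + sigma (eta q p) (kappa q p)) / (1 + 4 * kappa q p ^ 2)))
    • dir p
  - (xi q p / q * (1
      + 2 * funD (kappa q p) (eta q p + sigma (eta q p) (kappa q p)) / (1 + 4 * kappa q p ^ 2)))
    • cross (angMom p) (dir p)

/-- `𝐗̃(ϑ, 𝐚) = 𝐗(ϑ + t𝐚, 𝐚)`. -/
def posXt (q t : ℝ) (p : Phase) : E3 := posX q (p.1 + t • p.2, p.2)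

/-! ### Well-definedness of `ρ` -/

theorem existsUnique_root (η κ : ℝ) :
    ∃! s : ℝ, s + Real.sinh (2 * s) / 2 + κ ^ 2 * Real.exp (2 * s) + η = 0 := by
  have hmono : StrictMono
      (fun s : ℝ => s + Real.sinh (2 * s) / 2 + κ ^ 2 * Real.exp (2 * s) + η) := by
    intro a b hab
    have h1 : Real.sinh (2 * a) < Real.sinh (2 * b) := Real.sinh_lt_sinh.2 (by linarith)
    have h2 : κ ^ 2 * Real.exp (2 * a) ≤ κ ^ 2 * Real.exp (2 * b) :=
      mul_le_mul_of_nonneg_left (Real.exp_le_exp.2 (by linarith)) (sq_nonneg κ)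
    change a + Real.sinh (2 * a) / 2 + κ ^ 2 * Real.exp (2 * a) + η
      < b + Real.sinh (2 * b) / 2 + κ ^ 2 * Real.exp (2 * b) + η
    linarith
  have hcont : Continuous
      (fun s : ℝ => s + Real.sinh (2 * s) / 2 + κ ^ 2 * Real.exp (2 * s) + η) := by
    fun_prop
  have hlo : -(|η| + κ ^ 2) + Real.sinh (2 * -(|η| + κ ^ 2)) / 2
      + κ ^ 2 * Real.exp (2 * -(|η| + κ ^ 2)) + η ≤ 0 := by
    have h0 : (0 : ℝ) ≤ |η| + κ ^ 2 := by positivity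
    have h1 : Real.sinh (2 * -(|η| + κ ^ 2)) ≤ 0 := Real.sinh_nonpos_iff.2 (by linarith)
    have h2 : κ ^ 2 * Real.exp (2 * -(|η| + κ ^ 2)) ≤ κ ^ 2 * 1 :=
      mul_le_mul_of_nonneg_left (Real.exp_le_one_iff.2 (by linarith)) (sq_nonneg κ)
    have h3 := le_abs_self η
    linarith
  have hhi : 0 ≤ |η| + Real.sinh (2 * |η|) / 2 + κ ^ 2 * Real.exp (2 * |η|) + η := by
    have h1 : 0 ≤ Real.sinh (2 * |η|) := Real.sinh_nonneg_iff.2 (by positivity)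
    have h2 : 0 ≤ κ ^ 2 * Real.exp (2 * |η|) := by positivity
    have h3 := neg_abs_le η
    linarith
  have hle : -(|η| + κ ^ 2) ≤ |η| := by
    have := abs_nonneg η
    nlinarith [sq_nonneg κ]
  obtain ⟨s, -, hs⟩ := intermediate_value_Icc hle hcont.continuousOn (mem_Icc.2 ⟨hlo, hhi⟩)
  exact ⟨s, hs, fun s' hs' => hmono.injective (hs'.trans hs.symm)⟩

theorem cosh_log {y : ℝ} (hy : 1 ≤ y) :
    0 ≤ Real.log (√y + √(y - 1)) ∧ Real.cosh (Real.log (√y + √(y - 1))) = √y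
      ∧ Real.sinh (Real.log (√y + √(y - 1))) = √(y - 1) := by
  have h1 : √y ^ 2 = y := Real.sq_sqrt (by linarith)
  have h2 : √(y - 1) ^ 2 = y - 1 := Real.sq_sqrt (by linarith)
  have h3 : 1 ≤ √y := Real.one_le_sqrt.2 hy
  have h4 : 0 ≤ √(y - 1) := Real.sqrt_nonneg _
  have hpos : 0 < √y + √(y - 1) := by linarith
  have hinv : (√y + √(y - 1))⁻¹ = √y - √(y - 1) := by
    refine inv_eq_of_mul_eq_one_right ?_
    nlinarith
  refine ⟨Real.log_nonneg (by linarith), ?_, ?_⟩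
  · rw [Real.cosh_eq, Real.exp_neg, Real.exp_log hpos, hinv]; ring
  · rw [Real.sinh_eq, Real.exp_neg, Real.exp_log hpos, hinv]; ring

theorem relation_eq (η κ ι y : ℝ) (hι : ι = 1 ∨ ι = -1) (hy : 1 ≤ y) :
    η - ι * funG y + κ ^ 2 * funP (-ι) y
      = -ι * Real.log (√y + √(y - 1)) + Real.sinh (2 * (-ι * Real.log (√y + √(y - 1)))) / 2
        + κ ^ 2 * Real.exp (2 * (-ι * Real.log (√y + √(y - 1)))) + η := by
  obtain ⟨-, hc, hs⟩ := cosh_log hy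
  set w := Real.log (√y + √(y - 1)) with hw
  have hy' : y = Real.cosh w ^ 2 := by rw [hc, Real.sq_sqrt (by linarith)]
  have hp : √(y * (y - 1)) = Real.cosh w * Real.sinh w := by
    rw [Real.sqrt_mul (by linarith), hc, hs]
  have hcs := Real.cosh_sq w
  unfold funG funP
  rw [hp, ← hw]
  rcases hι with rfl | rfl
  · have e1 : Real.sinh (2 * (-1 * w)) = -(2 * Real.sinh w * Real.cosh w) := by
      rw [show 2 * (-1 * w) = -(2 * w) by ring, Real.sinh_neg, Real.sinh_two_mul]
    have e2 : Real.exp (2 * (-1 * w)) = (Real.cosh w - Real.sinh w) ^ 2 := by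
      rw [show 2 * (-1 * w) = -w + -w by ring, Real.exp_add, Real.cosh_sub_sinh]; ring
    rw [e1, e2]
    have hy2 : 2 * y - 1 = Real.cosh w ^ 2 + Real.sinh w ^ 2 := by rw [hy']; linarith
    rw [hy2]; ring
  · have e1 : Real.sinh (2 * (- -1 * w)) = 2 * Real.sinh w * Real.cosh w := by
      rw [show 2 * (- -1 * w) = 2 * w by ring, Real.sinh_two_mul]
    have e2 : Real.exp (2 * (- -1 * w)) = (Real.cosh w + Real.sinh w) ^ 2 := by
      rw [show 2 * (- -1 * w) = w + w by ring, Real.exp_add, Real.cosh_add_sinh]; ring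
    rw [e1, e2]
    have hy2 : 2 * y - 1 = Real.cosh w ^ 2 + Real.sinh w ^ 2 := by rw [hy']; linarith
    rw [hy2]; ring

theorem foldSign_cases (η κ : ℝ) : foldSign η κ = 1 ∨ foldSign η κ = -1 := by
  unfold foldSign; split_ifs <;> simp

theorem rho_unique (η κ : ℝ) :
    ∃! y : ℝ, 1 ≤ y ∧ η - foldSign η κ * funG y + κ ^ 2 * funP (-foldSign η κ) y = 0 := by
  obtain ⟨s, hs, hu⟩ := existsUnique_root η κ
  have hι := foldSign_cases η κ
  have hsign : 0 ≤ -foldSign η κ * s := by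
    unfold foldSign
    split_ifs with h
    · by_contra! hc
      have h0 : 0 < s := by linarith
      have h1 : 0 < Real.sinh (2 * s) := Real.sinh_pos_iff.2 (by linarith)
      have h2 : κ ^ 2 * 1 ≤ κ ^ 2 * Real.exp (2 * s) :=
        mul_le_mul_of_nonneg_left (Real.one_le_exp (by linarith)) (sq_nonneg κ)
      linarith
    · by_contra! hc
      have h0 : s < 0 := by linarith
      have h1 : Real.sinh (2 * s) < 0 := Real.sinh_neg_iff.2 (by linarith)
      have h2 : κ ^ 2 * Real.exp (2 * s) ≤ κ ^ 2 * 1 :=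
        mul_le_mul_of_nonneg_left (Real.exp_le_one_iff.2 (by linarith)) (sq_nonneg κ)
      linarith
  have hιι : foldSign η κ * foldSign η κ = 1 := by rcases hι with h | h <;> rw [h] <;> norm_num
  set w := -foldSign η κ * s with hw
  have hsw : s = -foldSign η κ * w := by rw [hw]; linear_combination (-s) * hιι
  have hsh : 0 ≤ Real.sinh w := Real.sinh_nonneg_iff.2 hsign
  have h1y : 1 ≤ Real.cosh w ^ 2 := by nlinarith [Real.cosh_sq w]
  have hlog : Real.log (√(Real.cosh w ^ 2) + √(Real.cosh w ^ 2 - 1)) = w := by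
    rw [Real.sqrt_sq (Real.cosh_pos w).le,
      show Real.cosh w ^ 2 - 1 = Real.sinh w ^ 2 by linarith [Real.cosh_sq w],
      Real.sqrt_sq hsh, Real.cosh_add_sinh, Real.log_exp]
  refine ⟨Real.cosh w ^ 2, ⟨h1y, ?_⟩, ?_⟩
  · rw [relation_eq η κ _ _ hι h1y, hlog, ← hsw]; exact hs
  · rintro y ⟨hy, hy0⟩
    rw [relation_eq η κ _ _ hι hy] at hy0
    have h := hu _ hy0
    have hwy : Real.log (√y + √(y - 1)) = w := by
      rw [hw, ← h]; linear_combination (-Real.log (√y + √(y - 1))) * hιι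
    rw [← hwy, (cosh_log hy).2.1, Real.sq_sqrt (by linarith)]

theorem rho_spec (η κ : ℝ) :
    1 ≤ rho η κ
      ∧ η - foldSign η κ * funG (rho η κ) + κ ^ 2 * funP (-foldSign η κ) (rho η κ) = 0 := by
  obtain ⟨y, hy, hu⟩ := rho_unique η κ
  have : {y : ℝ | 1 ≤ y ∧ η - foldSign η κ * funG y + κ ^ 2 * funP (-foldSign η κ) y = 0} = {y} :=
    Set.eq_singleton_iff_unique_mem.2 ⟨hy, fun z hz => hu z hz⟩
  have hr : rho η κ = y := by unfold rho; rw [this, csInf_singleton]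
  rw [hr]; exact hy

/-- `σ` as the root of a single smooth equation. -/
theorem sigma_spec (η κ : ℝ) :
    sigma η κ + Real.sinh (2 * sigma η κ) / 2 + κ ^ 2 * Real.exp (2 * sigma η κ) + η = 0 := by
  have h := rho_spec η κ
  rw [relation_eq η κ _ _ (foldSign_cases η κ) h.1] at h
  exact h.2

/-! ### Electric field, its derivative, and the effective fields -/

/-- The `j`-th partial derivative of a scalar function on `ℝ³`. -/
def pd (j : Fin 3) (f : E3 → ℝ) (x : E3) : ℝ := fderiv ℝ f x (EuclideanSpace.single j 1)

/-- `φ` is a smooth radial function supported in `{1/2 ≤ |x| ≤ 2}` with `∫ φ(x)/|x|² dx = 1`;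
equivalent to the last condition is `1/(4π|x|) = ∫₀^∞ φ(x/R) dR/R²`. -/
structure IsStandardCutoff (φ : E3 → ℝ) : Prop where
  smooth : ContDiff ℝ ∞ φ
  radial : ∀ x y : E3, ‖x‖ = ‖y‖ → φ x = φ y
  support_subset : tsupport φ ⊆ {x | 1 / 2 ≤ ‖x‖ ∧ ‖x‖ ≤ 2}
  normalized : ∫ x : E3, φ x / ‖x‖ ^ 2 = 1

/-- The kernel `U_j(y) = ∂_j(-1/|y|) = y_j / |y|³`. -/
def coulombKernel (j : Fin 3) (y : E3) : ℝ := y j / ‖y‖ ^ 3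

/-- `𝓔_j(y, t) = (1/4π) ∬ U_j(y - 𝐗̃(ϑ, 𝐚)) γ²(ϑ, 𝐚, t) dϑ d𝐚`; here `γ` is the density at
time `t`. -/
def fieldE (q t : ℝ) (γ : Phase → ℝ) (j : Fin 3) (y : E3) : ℝ :=
  1 / (4 * Real.pi) * ∫ p : Phase, coulombKernel j (y - posXt q t p) * γ p ^ 2

/-- `𝓔^eff_{j,R}(y, t) = -R⁻² ∬ (∂_jφ)(R⁻¹(y - t𝐚)) γ² dϑ d𝐚`. -/
def effScaleE (φ : E3 → ℝ) (t : ℝ) (γ : Phase → ℝ) (j : Fin 3) (y : E3) (R : ℝ) : ℝ :=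
  -(R ^ 2)⁻¹ * ∫ p : Phase, pd j φ (R⁻¹ • (y - t • p.2)) * γ p ^ 2

/-- `𝓔^eff_j(y, t) = ∫₀^∞ 𝓔^eff_{j,R}(y, t) dR/R`. -/
def effE (φ : E3 → ℝ) (t : ℝ) (γ : Phase → ℝ) (j : Fin 3) (y : E3) : ℝ :=
  ∫ R in Ioi (0 : ℝ), effScaleE φ t γ j y R / R

/-- `𝓕_{jk,R}(y, t) = -R⁻³ ∬ (∂_j∂_kφ)(R⁻¹(y - 𝐗̃(ϑ, 𝐚))) γ² dϑ d𝐚`. -/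
def scaleF (φ : E3 → ℝ) (q t : ℝ) (γ : Phase → ℝ) (j k : Fin 3) (y : E3) (R : ℝ) : ℝ :=
  -(R ^ 3)⁻¹ * ∫ p : Phase, pd j (pd k φ) (R⁻¹ • (y - posXt q t p)) * γ p ^ 2

/-- `𝓕_{jk}(y, t) = ∫₀^∞ 𝓕_{jk,R}(y, t) dR/R`, the derivative of the electric field. -/
def fieldF (φ : E3 → ℝ) (q t : ℝ) (γ : Phase → ℝ) (j k : Fin 3) (y : E3) : ℝ :=
  ∫ R in Ioi (0 : ℝ), scaleF φ q t γ j k y R / R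

/-- `𝓕^eff_{jk,R}(y, t) = -R⁻³ ∬ (∂_j∂_kφ)(R⁻¹(y - t𝐚)) γ² dϑ d𝐚`. -/
def effScaleF (φ : E3 → ℝ) (t : ℝ) (γ : Phase → ℝ) (j k : Fin 3) (y : E3) (R : ℝ) : ℝ :=
  -(R ^ 3)⁻¹ * ∫ p : Phase, pd j (pd k φ) (R⁻¹ • (y - t • p.2)) * γ p ^ 2

/-- `𝓕^eff_{jk}(y, t) = ∫₀^∞ 𝓕^eff_{jk,R}(y, t) dR/R`. -/
def effF (φ : E3 → ℝ) (t : ℝ) (γ : Phase → ℝ) (j k : Fin 3) (y : E3) : ℝ :=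
  ∫ R in Ioi (0 : ℝ), effScaleF φ t γ j k y R / R

/-! ### Poisson brackets and the norms -/

/-- `{f, g} = ∇_ϑ f · ∇_𝐚 g - ∇_𝐚 f · ∇_ϑ g`. -/
def poisson (f g : Phase → ℝ) (p : Phase) : ℝ :=
  inner ℝ (gradient (fun θ => f (θ, p.2)) p.1) (gradient (fun a => g (p.1, a)) p.2)
    - inner ℝ (gradient (fun a => f (p.1, a)) p.2) (gradient (fun θ => g (θ, p.2)) p.1)

/-- `{f, g}` for a vector-valued `f`, componentwise. -/
def poissonVec (f : Phase → E3) (g : Phase → ℝ) (p : Phase) : E3 :=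
  WithLp.toLp 2 fun i => poisson (fun p' => f p' i) g p

/-- `N₁ = ‖[ξ² + a³ + |η|² + λ] γ‖²_{L²} + ‖[ξ⁴ + a¹⁰ + |η|¹⁰ + λ⁵] γ‖²_{L^∞}`. -/
def normN1 (q : ℝ) (γ : Phase → ℝ) : ℝ≥0∞ :=
  eLpNorm (fun p => (xi q p ^ 2 + act p ^ 3 + |eta q p| ^ 2 + lam p) * γ p) 2 volume ^ 2
  + eLpNorm (fun p => (xi q p ^ 4 + act p ^ 10 + |eta q p| ^ 10 + lam p ^ 5) * γ p) ∞ volume ^ 2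

/-- `∑_f ‖𝔴_f {f, γ}‖²_{L^∞}` over `f ∈ {ξ, η, 𝐮, 𝐋}`, with the weights `𝔴_ξ = (1+ξ)/ξ²`,
`𝔴_η = ξ²/(1+ξ)`, `𝔴_𝐮 = 1`, `𝔴_𝐋 = ξ/(1+ξ)`. -/
def normBrackets (q : ℝ) (γ : Phase → ℝ) : ℝ≥0∞ :=
  eLpNorm (fun p => (1 + xi q p) / xi q p ^ 2 * poisson (xi q) γ p) ∞ volume ^ 2
  + eLpNorm (fun p => xi q p ^ 2 / (1 + xi q p) * poisson (eta q) γ p) ∞ volume ^ 2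
  + eLpNorm (fun p => poissonVec dir γ p) ∞ volume ^ 2
  + eLpNorm (fun p => (xi q p / (1 + xi q p)) • poissonVec angMom γ p) ∞ volume ^ 2

/-- `N₂ = N₁ + ‖[ξ² + a² + |η|² + λ²]¹² γ‖²_{L^∞} + ∑_f ‖𝔴_f {f, γ}‖²_{L^∞}`. -/
def normN2 (q : ℝ) (γ : Phase → ℝ) : ℝ≥0∞ :=
  normN1 q γ
  + eLpNorm (fun p => (xi q p ^ 2 + act p ^ 2 + |eta q p| ^ 2 + lam p ^ 2) ^ 12 * γ p)
      ∞ volume ^ 2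
  + normBrackets q γ

end KeplerGas

end

/-! Parabolic coordinates. The number `σ` is the root of one monotone equation `s + sinh(2s)/2 + κ²
exp(2s) + η = 0`. In terms of `σ` the square roots in `𝐗` disappear. In the frame of `𝐮` and the
part of `ϑ` orthogonal to `𝐚`, with `c = q/a²`, the position has components `c(cosh² σ - κ²
exp(2σ))` and `1 + exp(2σ)`, and its length is `c(cosh² σ + κ² exp(2σ))`. Three facts follow.

Small displacement: free transport moves only `η`, by `τ = t a³/q`, and `σ` depends on `τ`
logarithmically. Hence `|𝐗̃ - t𝐚| ≤ C_δ c (1 + |η| + κ)(1 + τ)^δ` for every `δ > 0`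
(`norm_posXt_sub_le`).

Lower bounds: `|𝐗̃| ≥ c` and `t a ≤ (2 + |η|)|𝐗̃|` (`scl_le_norm_posX`, `mul_act_le`).

Fold: at fixed `𝐚` and fixed transverse component of `𝐗`, the values `σ` and `-σ` give the same
point, so `ϑ ↦ 𝐗` degenerates along `σ = 0`. With the weight `1/(1 + κ)`, the preimage of a ball of
radius `r` has measure `O(r³ + √c r^(5/2))` (`lintegral_posX_ball_le`). This still makes `|y -
𝐗̃|⁻²` integrable.

Part (i). `abs_coulombKernel_sub_le` compares the kernels at `y - 𝐗̃` and `y - t𝐚` with a free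
Hölder exponent, taken as `0` for `t < 1` and `1/4` for `t ≥ 1`. The displacement costs `(1 +
t)^(1/20)`, which leaves `t^(-1/5)`. The majorant is integrated in `ϑ` by the fold estimate near `y`
and by the decay of the weight elsewhere, then in `𝐚` against `|y/t - 𝐚|^(-9/4)`. The weights needed
are dominated by those of `N₁` (`exists_weight_le`). The effective field is itself a Coulomb
integral, by the scale representation `integral_pd_scale` and Fubini.

Part (ii). A kernel of degree `-3` is beyond the fold estimate, so at each scale `R` one derivative
is moved from the cutoff onto `γ²`. A partial derivative splits into rotations and the radial
derivative (`apply_single_eq`). Joint rotations of `ϑ` and `𝐚` rotate `𝐗̃`, and are generated by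
`𝐋`. The radial derivative comes from the similarity `(e^(-2s) ϑ, e^s 𝐚)` of the Kepler problem,
used in two ways. Conjugated by free transport (`flowT`) it scales `𝐗̃` exactly by `e^(-2s)`, but
its generator contains `t` times the transport field. Unconjugated (`flowS`) it scales `t𝐚` exactly
and `𝐗̃` up to the small error `errX`, and dividing by `|𝐗̃|` gains `t⁻¹`. The generators are
controlled by the brackets in `N₂`, and the common bound is `abs_integral_fderiv_le`.

With the localized majorants (`exists_near_le` for `R ≤ 1`, `exists_far_le` for all `R`) this yields
the six estimates of `ScaleBounds`. Interpolating them produces `t^(-1/5)` times a profile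
integrable in `dR/R`. The identity `𝓕_jk = ∂_k 𝓔_j` follows by differentiating the scale integral of
`𝓔_j`, with domination uniform in `y`.

All polynomial weight inequalities are reduced to counting exponents of a single gauge `w`
(`PowBound`). -/

noncomputable section

namespace KeplerGas

/-! ### The position map in parabolic coordinates -/

/-- The length scale `q / a²`. -/
def scl (q : ℝ) (p : Phase) : ℝ := q / act p ^ 2

/-- The component of `ϑ` orthogonal to `𝐚`. -/
def perp (p : Phase) : E3 := p.1 - inner ℝ p.1 (dir p) • dir p

/-- `σ` as a function on phase space. -/
def sg (q : ℝ) (p : Phase) : ℝ := sigma (eta q p) (kappa q p)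

/-- `|𝐗|` in units of `q / a²`. -/
def psi (q : ℝ) (p : Phase) : ℝ :=
  Real.cosh (sg q p) ^ 2 + kappa q p ^ 2 * Real.exp (2 * sg q p)

theorem act_pos {p : Phase} (hp : p ∈ phaseSpace) : 0 < act p := norm_pos_iff.2 hp

theorem norm_dir {p : Phase} (hp : p ∈ phaseSpace) : ‖dir p‖ = 1 := by
  have := act_pos hp
  rw [dir, norm_smul, norm_inv, Real.norm_of_nonneg this.le]
  exact inv_mul_cancel₀ this.ne'

theorem inner_dir_dir {p : Phase} (hp : p ∈ phaseSpace) : inner ℝ (dir p) (dir p) = 1 := by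
  rw [real_inner_self_eq_norm_sq, norm_dir hp]; norm_num

theorem act_smul_dir {p : Phase} (hp : p ∈ phaseSpace) : act p • dir p = p.2 := by
  rw [dir, smul_smul, mul_inv_cancel₀ (act_pos hp).ne', one_smul]

theorem inner_perp_dir {p : Phase} (hp : p ∈ phaseSpace) : inner ℝ (perp p) (dir p) = 0 := by
  rw [perp, inner_sub_left, inner_smul_left, inner_dir_dir hp]; simp

theorem inner_dir_perp {p : Phase} (hp : p ∈ phaseSpace) : inner ℝ (dir p) (perp p) = 0 := by
  rw [real_inner_comm, inner_perp_dir hp]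

theorem inner_E3 (x y : E3) : inner ℝ x y = x 0 * y 0 + x 1 * y 1 + x 2 * y 2 := by
  simp [PiLp.inner_apply, Fin.sum_univ_three]; ring

theorem norm_sq_E3 (x : E3) : ‖x‖ ^ 2 = x 0 ^ 2 + x 1 ^ 2 + x 2 ^ 2 := by
  rw [← real_inner_self_eq_norm_sq, inner_E3]; ring

theorem cross_apply_zero (x y : E3) : cross x y 0 = x 1 * y 2 - x 2 * y 1 := by
  simp [cross, cross_apply]
theorem cross_apply_one (x y : E3) : cross x y 1 = x 2 * y 0 - x 0 * y 2 := by
  simp [cross, cross_apply]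
theorem cross_apply_two (x y : E3) : cross x y 2 = x 0 * y 1 - x 1 * y 0 := by
  simp [cross, cross_apply]

/-- This is the triple product expansion. It rewrites `𝐋 × 𝐮` in the frame `dir p`, `perp p`, which
free transport preserves. -/
theorem cross_angMom_dir {p : Phase} (hp : p ∈ phaseSpace) :
    cross (angMom p) (dir p) = -(act p • perp p) := by
  have ha := act_pos hp
  have h2 : act p ^ 2 = p.2 0 ^ 2 + p.2 1 ^ 2 + p.2 2 ^ 2 := norm_sq_E3 _
  ext i
  fin_cases i
  · simp only [Fin.zero_eta, cross_apply_zero, angMom, cross_apply_one, cross_apply_two, perp,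
      inner_E3, dir, PiLp.neg_apply, PiLp.smul_apply, PiLp.sub_apply, smul_eq_mul]
    field_simp
    rw [h2]; ring
  · simp only [Fin.mk_one, cross_apply_zero, angMom, cross_apply_one, cross_apply_two, perp,
      inner_E3, dir, PiLp.neg_apply, PiLp.smul_apply, PiLp.sub_apply, smul_eq_mul]
    field_simp
    rw [h2]; ring
  · simp only [Fin.reduceFinMk, cross_apply_zero, angMom, cross_apply_one, cross_apply_two, perp,
      inner_E3, dir, PiLp.neg_apply, PiLp.smul_apply, PiLp.sub_apply, smul_eq_mul]
    field_simp
    rw [h2]; ring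

theorem norm_perp_sq {p : Phase} (hp : p ∈ phaseSpace) :
    ‖perp p‖ ^ 2 = ‖p.1‖ ^ 2 - inner ℝ p.1 (dir p) ^ 2 := by
  rw [← real_inner_self_eq_norm_sq, perp, inner_sub_left, inner_sub_right, inner_sub_right,
    inner_smul_left, inner_smul_right, inner_smul_left, inner_smul_right, inner_dir_dir hp,
    real_inner_self_eq_norm_sq, real_inner_comm p.1 (dir p)]
  simp only [conj_trivial]; ring

theorem inner_dir_right (p : Phase) : inner ℝ p.1 (dir p) = (act p)⁻¹ * inner ℝ p.1 p.2 := by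
  rw [dir, inner_smul_right]

theorem lam_eq {p : Phase} (hp : p ∈ phaseSpace) : lam p = act p * ‖perp p‖ := by
  have ha := act_pos hp
  have h2 : act p ^ 2 = p.2 0 ^ 2 + p.2 1 ^ 2 + p.2 2 ^ 2 := norm_sq_E3 _
  have h : lam p ^ 2 = (act p * ‖perp p‖) ^ 2 := by
    rw [mul_pow, norm_perp_sq hp, inner_dir_right, mul_sub, lam, norm_sq_E3, angMom,
      cross_apply_zero, cross_apply_one, cross_apply_two, norm_sq_E3 p.1, inner_E3, mul_pow]
    field_simp
    rw [h2]; ring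
  exact (pow_left_inj₀ (norm_nonneg _) (by positivity) two_ne_zero).1 h

theorem kappa_eq {q : ℝ} {p : Phase} (hp : p ∈ phaseSpace) :
    kappa q p = act p ^ 2 / q * ‖perp p‖ := by
  rw [kappa, lam_eq hp]; ring

theorem eta_eq {q : ℝ} {p : Phase} (hp : p ∈ phaseSpace) :
    eta q p = act p ^ 2 / q * inner ℝ p.1 (dir p) := by
  have := act_pos hp
  rw [eta, inner_dir_right]; field_simp

theorem scl_pos {q : ℝ} (hq : 0 < q) {p : Phase} (hp : p ∈ phaseSpace) : 0 < scl q p :=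
  div_pos hq (pow_pos (act_pos hp) 2)

theorem scl_mul_eta {q : ℝ} (hq : 0 < q) {p : Phase} (hp : p ∈ phaseSpace) :
    scl q p * eta q p = inner ℝ p.1 (dir p) := by
  have := act_pos hp
  rw [eta_eq hp, scl]; field_simp

theorem scl_mul_kappa {q : ℝ} (hq : 0 < q) {p : Phase} (hp : p ∈ phaseSpace) :
    scl q p * kappa q p = ‖perp p‖ := by
  have := act_pos hp
  rw [kappa_eq hp, scl]; field_simp

theorem kappa_nonneg {q : ℝ} (hq : 0 < q) (p : Phase) : 0 ≤ kappa q p :=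
  div_nonneg (mul_nonneg (norm_nonneg _) (norm_nonneg _)) hq.le

/-- `y = η + σ`. -/
theorem eta_add_sigma (η κ : ℝ) : η + sigma η κ =
    -(Real.sinh (2 * sigma η κ) / 2 + κ ^ 2 * Real.exp (2 * sigma η κ)) := by
  linarith [sigma_spec η κ]

/-- Once `η + σ` is expressed through `σ`, the radicand is a perfect square, by `cosh² - sinh² = 1`
and `exp(2s)(cosh 2s - sinh 2s) = 1`. This makes `σ` a parabolic coordinate. -/
theorem sqrt_sigma (η κ : ℝ) : √((η + sigma η κ) ^ 2 + κ ^ 2 + 1 / 4)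
    = Real.cosh (2 * sigma η κ) / 2 + κ ^ 2 * Real.exp (2 * sigma η κ) := by
  rw [eta_add_sigma]
  set s := sigma η κ
  rw [Real.sqrt_eq_iff_mul_self_eq (by positivity)
    (by have := Real.cosh_pos (2 * s); positivity)]
  have h := Real.cosh_sq (2 * s)
  have h2 : Real.exp (2 * s) * (Real.cosh (2 * s) - Real.sinh (2 * s)) = 1 := by
    rw [Real.cosh_sub_sinh, ← Real.exp_add]; simp
  linear_combination (-1 / 4) * h - κ ^ 2 * h2

theorem funD_sigma (η κ : ℝ) : funD κ (η + sigma η κ) / (1 + 4 * κ ^ 2)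
    = Real.exp (2 * sigma η κ) / 2 := by
  have h : 0 < 1 + 4 * κ ^ 2 := by positivity
  rw [funD, sqrt_sigma, div_eq_iff h.ne', eta_add_sigma]
  rw [← Real.cosh_add_sinh (2 * sigma η κ)]; ring

/-- In this form `ϑ` is split off, so that after the time shift the subtraction of `t𝐚` leaves only
terms in `σ`. -/
theorem posX_eq_add {q : ℝ} (hq : 0 < q) {p : Phase} (hp : p ∈ phaseSpace) :
    posX q p = p.1 + (scl q p * (sg q p + 1 / 2 + Real.exp (2 * sg q p) / 2)) • dir p
      + Real.exp (2 * sg q p) • perp p := by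
  have ha := act_pos hp
  have h1 : xi q p ^ 2 / q = scl q p := by rw [xi, scl]; field_simp
  have h2 : xi q p / q = (act p)⁻¹ := by rw [xi]; field_simp
  rw [posX, mul_div_assoc 2, funD_sigma, h1, h2, cross_angMom_dir hp, smul_neg, sub_neg_eq_add,
    smul_smul]
  have h3 : p.1 = perp p + (scl q p * eta q p) • dir p := by
    rw [scl_mul_eta hq hp, perp]; abel
  rw [← sg]
  have h4 : (act p)⁻¹ * (1 + 2 * (Real.exp (2 * sg q p) / 2)) * act p = 1 + Real.exp (2 * sg q p) := by
    field_simp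
  rw [h4]
  conv_rhs => rw [h3]
  module

theorem sg_spec (q : ℝ) (p : Phase) : sg q p + Real.sinh (2 * sg q p) / 2
    + kappa q p ^ 2 * Real.exp (2 * sg q p) + eta q p = 0 := sigma_spec _ _

/-- `𝐗` in parabolic coordinates. -/
theorem posX_eq {q : ℝ} (hq : 0 < q) {p : Phase} (hp : p ∈ phaseSpace) :
    posX q p = (scl q p * (Real.cosh (sg q p) ^ 2 - kappa q p ^ 2 * Real.exp (2 * sg q p))) • dir p
      + (1 + Real.exp (2 * sg q p)) • perp p := by
  have h3 : p.1 = perp p + (scl q p * eta q p) • dir p := by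
    rw [scl_mul_eta hq hp, perp]; abel
  rw [posX_eq_add hq hp]
  nth_rw 1 [h3]
  have h : Real.cosh (sg q p) ^ 2 - kappa q p ^ 2 * Real.exp (2 * sg q p)
      = eta q p + sg q p + 1 / 2 + Real.exp (2 * sg q p) / 2 := by
    have e := sg_spec q p
    have e1 := Real.cosh_two_mul (sg q p)
    have e2 := Real.cosh_sq (sg q p)
    have e3 := Real.cosh_add_sinh (2 * sg q p)
    linarith
  rw [h]
  module

theorem one_add_exp_sq (s : ℝ) : (1 + Real.exp (2 * s)) ^ 2 = 4 * Real.exp (2 * s) * Real.cosh s ^ 2 := by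
  rw [Real.cosh_eq, Real.exp_neg, show 2 * s = s + s by ring, Real.exp_add]
  have := Real.exp_pos s
  field_simp
  ring

theorem norm_smul_dir_add {p : Phase} (hp : p ∈ phaseSpace) (x y : ℝ) :
    ‖x • dir p + y • perp p‖ ^ 2 = x ^ 2 + y ^ 2 * ‖perp p‖ ^ 2 := by
  rw [← real_inner_self_eq_norm_sq, inner_add_left, inner_add_right, inner_add_right,
    inner_smul_left, inner_smul_left, inner_smul_left, inner_smul_left, inner_smul_right,
    inner_smul_right, inner_smul_right, inner_smul_right, inner_dir_dir hp, inner_dir_perp hp,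
    inner_perp_dir hp, real_inner_self_eq_norm_sq]
  simp only [conj_trivial]; ring

theorem psi_pos (q : ℝ) (p : Phase) : 1 ≤ psi q p := by
  have h1 := Real.one_le_cosh (sg q p)
  have h2 : 0 ≤ kappa q p ^ 2 * Real.exp (2 * sg q p) := by positivity
  rw [psi]; nlinarith

/-- With `A = cosh² σ` and `B = κ² exp(2σ)` the longitudinal part contributes `(A - B)²` and, by
`one_add_exp_sq`, the transverse part `4AB`. The sum is `(A + B)²`. -/
theorem norm_posX {q : ℝ} (hq : 0 < q) {p : Phase} (hp : p ∈ phaseSpace) :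
    ‖posX q p‖ = scl q p * psi q p := by
  have h0 := psi_pos q p
  have h1 := scl_pos hq hp
  refine (pow_left_inj₀ (norm_nonneg _) (by positivity) two_ne_zero).1 ?_
  rw [posX_eq hq hp, norm_smul_dir_add hp, ← scl_mul_kappa hq hp, one_add_exp_sq, psi]
  ring

theorem scl_le_norm_posX {q : ℝ} (hq : 0 < q) {p : Phase} (hp : p ∈ phaseSpace) :
    scl q p ≤ ‖posX q p‖ := by
  rw [norm_posX hq hp]
  exact le_mul_of_one_le_right (scl_pos hq hp).le (psi_pos q p)

/-! ### Symmetries -/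

theorem dir_isometry (O : E3 ≃ₗᵢ[ℝ] E3) (p : Phase) : dir (O p.1, O p.2) = O (dir p) := by
  simp [dir, act]

theorem act_isometry (O : E3 ≃ₗᵢ[ℝ] E3) (p : Phase) : act (O p.1, O p.2) = act p := by
  simp [act]

theorem perp_isometry (O : E3 ≃ₗᵢ[ℝ] E3) (p : Phase) : perp (O p.1, O p.2) = O (perp p) := by
  simp [perp, dir_isometry]

theorem eta_isometry (q : ℝ) (O : E3 ≃ₗᵢ[ℝ] E3) (p : Phase) : eta q (O p.1, O p.2) = eta q p := by
  simp [eta, act]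

theorem mem_phaseSpace_isometry (O : E3 ≃ₗᵢ[ℝ] E3) {p : Phase} (hp : p ∈ phaseSpace) :
    (O p.1, O p.2) ∈ phaseSpace := by
  simpa [phaseSpace] using hp

theorem lam_isometry (O : E3 ≃ₗᵢ[ℝ] E3) {p : Phase} (hp : p ∈ phaseSpace) :
    lam (O p.1, O p.2) = lam p := by
  rw [lam_eq (mem_phaseSpace_isometry O hp), lam_eq hp, act_isometry, perp_isometry,
    LinearIsometryEquiv.norm_map]

theorem kappa_isometry (q : ℝ) (O : E3 ≃ₗᵢ[ℝ] E3) {p : Phase} (hp : p ∈ phaseSpace) :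
    kappa q (O p.1, O p.2) = kappa q p := by
  rw [kappa, kappa, lam_isometry O hp, act_isometry]

theorem posX_isometry {q : ℝ} (hq : 0 < q) (O : E3 ≃ₗᵢ[ℝ] E3) {p : Phase} (hp : p ∈ phaseSpace) :
    posX q (O p.1, O p.2) = O (posX q p) := by
  rw [posX_eq hq hp, posX_eq hq (mem_phaseSpace_isometry O hp), sg, sg, scl, scl,
    eta_isometry, kappa_isometry q O hp, act_isometry, dir_isometry, perp_isometry]
  simp

theorem posXt_isometry {q : ℝ} (hq : 0 < q) (t : ℝ) (O : E3 ≃ₗᵢ[ℝ] E3) {p : Phase}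
    (hp : p ∈ phaseSpace) : posXt q t (O p.1, O p.2) = O (posXt q t p) := by
  have h : (p.1 + t • p.2, p.2) ∈ phaseSpace := hp
  rw [posXt, posXt, ← posX_isometry hq O h]
  simp

/-- The similarity of the Kepler problem: `η` and `κ` are invariant, while the length unit `q/a²`
scales by `r⁻²`. This is the source of the radial derivative in the integration by parts. -/
theorem posX_scaling {q : ℝ} (hq : 0 < q) {r : ℝ} (hr : 0 < r) {p : Phase} (hp : p ∈ phaseSpace) :
    posX q ((r ^ 2)⁻¹ • p.1, r • p.2) = (r ^ 2)⁻¹ • posX q p := by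
  have hp' : ((r ^ 2)⁻¹ • p.1, r • p.2) ∈ phaseSpace := smul_ne_zero hr.ne' hp
  have ha := act_pos hp
  have h1 : act ((r ^ 2)⁻¹ • p.1, r • p.2) = r * act p := by
    simp [act, norm_smul, abs_of_pos hr]
  have h2 : dir ((r ^ 2)⁻¹ • p.1, r • p.2) = dir p := by
    rw [dir, h1, dir, smul_smul]; congr 1; field_simp
  have h3 : perp ((r ^ 2)⁻¹ • p.1, r • p.2) = (r ^ 2)⁻¹ • perp p := by
    rw [perp, perp, h2]
    simp only [inner_smul_left, conj_trivial]; module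
  have h4 : eta q ((r ^ 2)⁻¹ • p.1, r • p.2) = eta q p := by
    rw [eta_eq hp', eta_eq hp, h1, h2]; simp only [inner_smul_left, conj_trivial]; field_simp
  have h5 : kappa q ((r ^ 2)⁻¹ • p.1, r • p.2) = kappa q p := by
    rw [kappa_eq hp', kappa_eq hp, h1, h3, norm_smul, norm_inv, norm_pow, Real.norm_of_nonneg hr.le]
    field_simp
  rw [posX_eq hq hp', posX_eq hq hp, sg, sg, h4, h5, h2, h3, scl, scl, h1, smul_add, smul_smul,
    smul_smul, smul_smul, mul_comm (1 + _)]
  congr 2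
  field_simp

/-! ### Measurability -/

/-- Comparing `σ` with a level amounts to a strict inequality for the explicit monotone function
that defines it. Sublevel and superlevel sets are therefore open in `(η, κ)`, which gives
continuity. -/
theorem sigma_lt_iff (η κ s : ℝ) : sigma η κ < s ↔
    0 < s + Real.sinh (2 * s) / 2 + κ ^ 2 * Real.exp (2 * s) + η := by
  have hmono : StrictMono
      (fun s : ℝ => s + Real.sinh (2 * s) / 2 + κ ^ 2 * Real.exp (2 * s) + η) := by
    intro a b hab
    have h1 : Real.sinh (2 * a) < Real.sinh (2 * b) := Real.sinh_lt_sinh.2 (by linarith)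
    have h2 : κ ^ 2 * Real.exp (2 * a) ≤ κ ^ 2 * Real.exp (2 * b) :=
      mul_le_mul_of_nonneg_left (Real.exp_le_exp.2 (by linarith)) (sq_nonneg κ)
    change a + Real.sinh (2 * a) / 2 + κ ^ 2 * Real.exp (2 * a) + η
      < b + Real.sinh (2 * b) / 2 + κ ^ 2 * Real.exp (2 * b) + η
    linarith
  rw [← hmono.lt_iff_lt, sigma_spec]

theorem lt_sigma_iff (η κ s : ℝ) : s < sigma η κ ↔
    s + Real.sinh (2 * s) / 2 + κ ^ 2 * Real.exp (2 * s) + η < 0 := by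
  have hmono : StrictMono
      (fun s : ℝ => s + Real.sinh (2 * s) / 2 + κ ^ 2 * Real.exp (2 * s) + η) := by
    intro a b hab
    have h1 : Real.sinh (2 * a) < Real.sinh (2 * b) := Real.sinh_lt_sinh.2 (by linarith)
    have h2 : κ ^ 2 * Real.exp (2 * a) ≤ κ ^ 2 * Real.exp (2 * b) :=
      mul_le_mul_of_nonneg_left (Real.exp_le_exp.2 (by linarith)) (sq_nonneg κ)
    change a + Real.sinh (2 * a) / 2 + κ ^ 2 * Real.exp (2 * a) + η
      < b + Real.sinh (2 * b) / 2 + κ ^ 2 * Real.exp (2 * b) + η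
    linarith
  rw [← hmono.lt_iff_lt, sigma_spec]

theorem continuous_sigma : Continuous (fun x : ℝ × ℝ => sigma x.1 x.2) := by
  rw [continuous_iff_continuousAt]
  intro x
  refine tendsto_order.2 ⟨fun s hs => ?_, fun s hs => ?_⟩
  · simp only [lt_sigma_iff] at hs ⊢
    exact (isOpen_lt (by fun_prop) continuous_const).mem_nhds hs
  · simp only [sigma_lt_iff] at hs ⊢
    exact (isOpen_lt continuous_const (by fun_prop)).mem_nhds hs

theorem measurable_sigma : Measurable (fun x : ℝ × ℝ => sigma x.1 x.2) :=
  continuous_sigma.measurable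

theorem measurable_act : Measurable act := by unfold act; fun_prop

theorem measurable_xi (q : ℝ) : Measurable (xi q) := by
  unfold xi; exact measurable_const.div measurable_act

theorem measurable_eta (q : ℝ) : Measurable (eta q) := by
  unfold eta; have := measurable_act; fun_prop

theorem measurable_dir : Measurable dir := by
  unfold dir; have := measurable_act; fun_prop

theorem continuous_cross : Continuous (fun x : E3 × E3 => cross x.1 x.2) := by
  unfold cross
  refine (PiLp.continuous_toLp 2 _).comp ?_
  refine continuous_pi fun i => ?_
  fin_cases i <;> simp [cross_apply] <;> fun_prop

theorem measurable_angMom : Measurable angMom := continuous_cross.measurable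

theorem measurable_lam : Measurable lam := measurable_angMom.norm

theorem measurable_kappa (q : ℝ) : Measurable (kappa q) := by
  unfold kappa; exact (measurable_act.mul measurable_lam).div_const q

theorem measurable_sg (q : ℝ) : Measurable (sg q) :=
  measurable_sigma.comp ((measurable_eta q).prodMk (measurable_kappa q))

theorem measurable_posX (q : ℝ) : Measurable (posX q) := by
  have h1 := measurable_xi q
  have h2 := measurable_eta q
  have h3 : Measurable (fun p => sigma (eta q p) (kappa q p)) := measurable_sg q
  have h4 := measurable_kappa q
  have h5 := measurable_dir
  have h6 : Measurable (fun p => cross (angMom p) (dir p)) :=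
    continuous_cross.measurable.comp (measurable_angMom.prodMk measurable_dir)
  unfold posX funD
  fun_prop

theorem measurable_posXt (q t : ℝ) : Measurable (posXt q t) := by
  have := measurable_posX q
  unfold posXt
  exact this.comp (by fun_prop)

theorem isOpen_phaseSpace : IsOpen phaseSpace := isOpen_ne_fun continuous_snd continuous_const

theorem measurableSet_phaseSpace : MeasurableSet phaseSpace := isOpen_phaseSpace.measurableSet

theorem ae_mem_phaseSpace : ∀ᵐ p : Phase, p ∈ phaseSpace := by
  have h : ∀ᵐ a : E3, a ≠ 0 := by simp [ae_iff]
  exact Measure.quasiMeasurePreserving_snd.ae h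

/-! ### Bounds on the position -/

theorem psi_eq (q : ℝ) (p : Phase) :
    psi q p = √((eta q p + sg q p) ^ 2 + kappa q p ^ 2 + 1 / 4) + 1 / 2 := by
  rw [sg, sqrt_sigma, psi, sg]
  have e1 := Real.cosh_two_mul (sigma (eta q p) (kappa q p))
  have e2 := Real.cosh_sq (sigma (eta q p) (kappa q p))
  linarith

/-- Both `|η + σ|` and `|σ|` are at most `|𝐗|` in units of `q/a²`. The bound turns growth of `η`
along free transport into growth of `|𝐗̃|`. -/
theorem abs_eta_le_psi (q : ℝ) (p : Phase) : |eta q p| ≤ 2 * psi q p := by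
  have h1 : |eta q p + sg q p| ≤ psi q p := by
    rw [psi_eq]
    have : |eta q p + sg q p| ≤ √((eta q p + sg q p) ^ 2 + kappa q p ^ 2 + 1 / 4) := by
      rw [← Real.sqrt_sq_eq_abs]
      exact Real.sqrt_le_sqrt (by nlinarith [sq_nonneg (kappa q p)])
    linarith
  have h2 : |sg q p| ≤ psi q p := by
    have h3 : sg q p ^ 2 ≤ Real.sinh (sg q p) ^ 2 := sq_le_sq.2 (by
      rw [Real.abs_sinh]; exact Real.self_le_sinh_iff.2 (abs_nonneg _))
    have h4 : 0 ≤ kappa q p ^ 2 * Real.exp (2 * sg q p) := by positivity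
    rw [psi, Real.cosh_sq, abs_le]
    -- `|σ| ≤ σ² + 1 ≤ sinh² σ + 1 = cosh² σ`.
    constructor <;> nlinarith [sq_nonneg (sg q p - 1), sq_nonneg (sg q p + 1)]
  have h3 : |eta q p| ≤ |eta q p + sg q p| + |sg q p| := by
    have := abs_sub (eta q p + sg q p) (sg q p)
    simpa using this
  linarith

/-- `S = 1 + |η| + κ`. -/
def wS (q : ℝ) (p : Phase) : ℝ := 1 + |eta q p| + kappa q p

/-- For `σ > 0` the defining equation forces `sinh(2σ)/2 ≤ -η ≤ e`. Free transport to positive times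
only increases `η`, so `e = |η|` at time zero serves for all `t ≥ 0`. -/
theorem exp_sigma_le {η κ e : ℝ} (he : 0 ≤ e) (h : -η ≤ e) : Real.exp (2 * sigma η κ) ≤ 1 + 4 * e := by
  rcases le_or_gt (sigma η κ) 0 with h0 | h0
  · have : Real.exp (2 * sigma η κ) ≤ 1 := Real.exp_le_one_iff.2 (by linarith)
    linarith
  · have h1 := sigma_spec η κ
    have h2 : 0 ≤ κ ^ 2 * Real.exp (2 * sigma η κ) := by positivity
    rw [Real.sinh_eq] at h1
    have h3 : Real.exp (-(2 * sigma η κ)) ≤ 1 := Real.exp_le_one_iff.2 (by linarith)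
    linarith

/-- For `σ > 0` both `κ² exp(2σ) ≤ e` and `exp(2σ) ≤ 1 + 4e`; multiplying them bounds the square of
the left side. -/
theorem kappa_mul_exp_sigma_le {η κ e : ℝ} (hκ : 0 ≤ κ) (he : 0 ≤ e) (h : -η ≤ e) :
    κ * Real.exp (2 * sigma η κ) ≤ κ + 1 + 4 * e := by
  rcases le_or_gt (sigma η κ) 0 with h0 | h0
  · have : Real.exp (2 * sigma η κ) ≤ 1 := Real.exp_le_one_iff.2 (by linarith)
    nlinarith
  · have h1 := sigma_spec η κ
    have h4 := exp_sigma_le (κ := κ) he h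
    have h5 := Real.sinh_pos_iff.2 (show 0 < 2 * sigma η κ by linarith)
    have h2 : κ ^ 2 * Real.exp (2 * sigma η κ) ≤ e := by linarith
    have h6 := Real.exp_pos (2 * sigma η κ)
    have h7 : (κ * Real.exp (2 * sigma η κ)) ^ 2 ≤ (1 + 4 * e) ^ 2 := by
      calc (κ * Real.exp (2 * sigma η κ)) ^ 2
          = κ ^ 2 * Real.exp (2 * sigma η κ) * Real.exp (2 * sigma η κ) := by ring
        _ ≤ e * (1 + 4 * e) := mul_le_mul h2 h4 h6.le he
        _ ≤ _ := by nlinarith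
    have h8 := abs_le_of_sq_le_sq h7 (by linarith)
    linarith [le_abs_self (κ * Real.exp (2 * sigma η κ))]

/-- For `σ ≤ 0` the equation gives `exp(-2σ) ≤ 4(1 + e + κ)²(1 + τ)`, so `|σ|` is logarithmic in
`τ`. Replacing the logarithm by `(1 + τ)^δ/δ` is the only place where time growth enters the
displacement. -/
theorem abs_sigma_le {δ : ℝ} (hδ : 0 < δ) {η κ e τ : ℝ} (hκ : 0 ≤ κ) (he : 0 ≤ e) (hτ : 0 ≤ τ)
    (h : |η - τ| ≤ e) :
    |sigma η κ| ≤ (2 + 1 / (2 * δ)) * (1 + e + κ) * (1 + τ) ^ δ := by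
  have hT : 1 ≤ (1 + τ) ^ δ := Real.one_le_rpow (by linarith) hδ.le
  have h1 := sigma_spec η κ
  set s := sigma η κ
  have hδ' : 0 ≤ 1 / (2 * δ) := by positivity
  have hb := abs_le.1 h
  have hS : 1 ≤ 1 + e + κ := by linarith
  have hST : 1 + e + κ ≤ (1 + e + κ) * (1 + τ) ^ δ := le_mul_of_one_le_right (by linarith) hT
  rcases le_or_gt s 0 with h0 | h0
  · have h2 : κ ^ 2 * Real.exp (2 * s) ≤ κ ^ 2 :=
      mul_le_of_le_one_right (sq_nonneg _) (Real.exp_le_one_iff.2 (by linarith))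
    have h3 : Real.exp (2 * s) ≤ 1 := Real.exp_le_one_iff.2 (by linarith)
    rw [Real.sinh_eq] at h1
    have h4 : Real.exp (-(2 * s)) ≤ 4 * (1 + e + κ) ^ 2 * (1 + τ) := by
      have h41 : Real.exp (-(2 * s)) ≤ 1 + 4 * (κ ^ 2 + e + τ) := by linarith
      have h42 : 1 + e + κ ^ 2 ≤ (1 + e + κ) ^ 2 := by nlinarith [mul_nonneg he hκ]
      have h43 : 1 ≤ (1 + e + κ) ^ 2 := one_le_pow₀ hS
      have h44 : τ ≤ (1 + e + κ) ^ 2 * τ := le_mul_of_one_le_left hτ h43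
      linarith
    have h5 := Real.log_le_log (Real.exp_pos _) h4
    rw [Real.log_exp, Real.log_mul (by positivity) (by positivity),
      Real.log_mul (by positivity) (by positivity), Real.log_pow] at h5
    have h6 : Real.log 4 ≤ 2 := by
      rw [show (4 : ℝ) = 2 ^ 2 by norm_num, Real.log_pow]
      push_cast; linarith [Real.log_two_lt_d9]
    have h7 : Real.log (1 + e + κ) ≤ 1 + e + κ := by
      linarith [Real.log_le_sub_one_of_pos (show 0 < 1 + e + κ by linarith)]
    have h8 : Real.log (1 + τ) ≤ (1 + τ) ^ δ / δ := Real.log_le_rpow_div (by linarith) hδ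
    rw [abs_of_nonpos h0]
    have h9 : (1 + τ) ^ δ / δ / 2 = 1 / (2 * δ) * (1 + τ) ^ δ := by field_simp
    have h10 : 1 / (2 * δ) * (1 + τ) ^ δ ≤ 1 / (2 * δ) * ((1 + e + κ) * (1 + τ) ^ δ) :=
      mul_le_mul_of_nonneg_left (le_mul_of_one_le_left (by linarith) hS) hδ'
    push_cast at h5
    nlinarith
  · have h5 : 2 * s ≤ Real.sinh (2 * s) := Real.self_le_sinh_iff.2 (by linarith)
    have h2 : 0 ≤ κ ^ 2 * Real.exp (2 * s) := by positivity
    rw [abs_of_pos h0]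
    have : s ≤ 1 + e + κ := by linarith
    have : 0 ≤ 1 / (2 * δ) * ((1 + e + κ) * (1 + τ) ^ δ) := by positivity
    nlinarith

/-- The time shift `(ϑ, 𝐚) ↦ (ϑ + t𝐚, 𝐚)`. -/
def shift (t : ℝ) (p : Phase) : Phase := (p.1 + t • p.2, p.2)

theorem posXt_eq_shift (q t : ℝ) (p : Phase) : posXt q t p = posX q (shift t p) := rfl

theorem shift_mem {p : Phase} (t : ℝ) (hp : p ∈ phaseSpace) : shift t p ∈ phaseSpace := hp

theorem act_shift (t : ℝ) (p : Phase) : act (shift t p) = act p := rfl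
theorem dir_shift (t : ℝ) (p : Phase) : dir (shift t p) = dir p := rfl
theorem scl_shift (q t : ℝ) (p : Phase) : scl q (shift t p) = scl q p := rfl

theorem inner_snd_dir {p : Phase} (hp : p ∈ phaseSpace) : inner ℝ p.2 (dir p) = act p := by
  nth_rw 1 [← act_smul_dir hp]
  rw [inner_smul_left, inner_dir_dir hp]; simp

theorem perp_shift (t : ℝ) {p : Phase} (hp : p ∈ phaseSpace) : perp (shift t p) = perp p := by
  rw [perp, perp, dir_shift, shift]
  simp only
  rw [inner_add_left, inner_smul_left, inner_snd_dir hp, add_smul]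
  have : t • p.2 = (t * act p) • dir p := by rw [mul_smul, act_smul_dir hp]
  rw [this]
  simp only [conj_trivial]; abel

/-- Free transport is visible only here: `|𝐚|`, `𝐮`, the transverse part of `ϑ` and `κ` are
unchanged. -/
theorem eta_shift (q t : ℝ) (p : Phase) :
    eta q (shift t p) = eta q p + t * act p ^ 3 / q := by
  rw [eta, eta, act_shift, shift]
  simp only
  rw [inner_add_left, inner_smul_left, real_inner_self_eq_norm_sq, ← act]
  simp only [conj_trivial]; ring

theorem kappa_shift (q t : ℝ) {p : Phase} (hp : p ∈ phaseSpace) :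
    kappa q (shift t p) = kappa q p := by
  rw [kappa_eq (shift_mem t hp), kappa_eq hp, act_shift, perp_shift t hp]

theorem norm_fst_le {q : ℝ} (hq : 0 < q) {p : Phase} (hp : p ∈ phaseSpace) :
    ‖p.1‖ ≤ scl q p * (|eta q p| + kappa q p) := by
  have hc := scl_pos hq hp
  have h3 : p.1 = perp p + (scl q p * eta q p) • dir p := by
    rw [scl_mul_eta hq hp, perp]; abel
  rw [h3]
  refine (norm_add_le _ _).trans ?_
  rw [norm_smul, norm_dir hp, ← scl_mul_kappa hq hp, norm_mul, Real.norm_of_nonneg hc.le,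
    Real.norm_eq_abs]
  linarith

theorem one_add_norm_fst_div_le {q : ℝ} (hq : 0 < q) {p : Phase} (hp : p ∈ phaseSpace) :
    1 + ‖p.1‖ / scl q p ≤ wS q p := by
  have := norm_fst_le hq hp
  rw [wS, add_assoc]
  gcongr
  rwa [div_le_iff₀' (scl_pos hq hp)]

/-- After the shift, `𝐗̃ - t𝐚` consists of `ϑ`, a longitudinal term in `σ` and `exp(2σ)`, and
`exp(2σ)` times the transverse part of `ϑ`. The exponentials are bounded independently of `t`, and
`σ` itself costs `(1 + τ)^δ`. -/
theorem norm_posXt_sub_le {δ : ℝ} (hδ : 0 < δ) {q t : ℝ} (hq : 0 < q) (ht : 0 ≤ t) {p : Phase}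
    (hp : p ∈ phaseSpace) : ‖posXt q t p - t • p.2‖
      ≤ (12 + 1 / (2 * δ)) * (scl q p * wS q p) * (1 + t * act p ^ 3 / q) ^ δ := by
  have hp' := shift_mem t hp
  have ha := act_pos hp
  have hτ : 0 ≤ t * act p ^ 3 / q := by positivity
  have hκ := kappa_nonneg hq p
  have hη := abs_nonneg (eta q p)
  have hc := scl_pos hq hp
  have h1 : posXt q t p - t • p.2 = p.1 + (scl q p * (sg q (shift t p) + 1 / 2
      + Real.exp (2 * sg q (shift t p)) / 2)) • dir p + Real.exp (2 * sg q (shift t p)) • perp p := by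
    rw [posXt_eq_shift, posX_eq_add hq hp', scl_shift, dir_shift, perp_shift t hp]
    simp only [shift]
    abel
  have e : sg q (shift t p) = sigma (eta q (shift t p)) (kappa q p) := by
    rw [sg, kappa_shift q t hp]
  have hneg : -eta q (shift t p) ≤ |eta q p| := by
    rw [eta_shift]; linarith [neg_abs_le (eta q p)]
  have hs := abs_sigma_le hδ (η := eta q (shift t p)) hκ hη hτ (by rw [eta_shift]; simp)
  have he := exp_sigma_le (κ := kappa q p) hη hneg
  have hk := kappa_mul_exp_sigma_le hκ hη hneg
  rw [← e] at hs he hk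
  set s := sg q (shift t p)
  have hT : 1 ≤ (1 + t * act p ^ 3 / q) ^ δ := Real.one_le_rpow (by linarith) hδ.le
  set Q := (1 + t * act p ^ 3 / q) ^ δ
  have hS1 : 1 ≤ wS q p := by rw [wS]; linarith
  have hSQ : wS q p ≤ wS q p * Q := le_mul_of_one_le_right (by linarith) hT
  have hex := Real.exp_pos (2 * s)
  rw [h1]
  have h2 := norm_fst_le hq hp
  calc _ ≤ ‖p.1‖ + ‖(scl q p * (s + 1 / 2 + Real.exp (2 * s) / 2)) • dir p‖
        + ‖Real.exp (2 * s) • perp p‖ := norm_add₃_le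
    _ = ‖p.1‖ + scl q p * |s + 1 / 2 + Real.exp (2 * s) / 2|
        + scl q p * (kappa q p * Real.exp (2 * s)) := by
      rw [norm_smul, norm_dir hp, norm_smul, ← scl_mul_kappa hq hp, norm_mul,
        Real.norm_of_nonneg hc.le, Real.norm_of_nonneg hex.le, Real.norm_eq_abs]; ring
    _ ≤ scl q p * (|eta q p| + kappa q p) + scl q p * (|s| + 1 / 2 + Real.exp (2 * s) / 2)
        + scl q p * (kappa q p * Real.exp (2 * s)) := by
      gcongr
      refine (abs_add_three _ _ _).trans_eq ?_
      rw [abs_of_pos (show (0 : ℝ) < 1 / 2 by norm_num), abs_of_pos (half_pos hex)]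
    _ = scl q p * (|eta q p| + kappa q p + |s| + 1 / 2 + Real.exp (2 * s) / 2
        + kappa q p * Real.exp (2 * s)) := by ring
    _ ≤ scl q p * (10 * (wS q p * Q) + (2 + 1 / (2 * δ)) * (wS q p * Q)) := by
      refine mul_le_mul_of_nonneg_left ?_ hc.le
      rw [mul_assoc] at hs
      have : |s| ≤ (2 + 1 / (2 * δ)) * (wS q p * Q) := hs
      have : wS q p = 1 + |eta q p| + kappa q p := rfl
      linarith
    _ = _ := by ring

/-- The elapsed `τ` is the difference of the values of `η` after and before transport; the first is
bounded by `2ψ`, and `ψ ≥ 1` absorbs the second. -/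
theorem tau_le (q t : ℝ) (p : Phase) : t * act p ^ 3 / q
    ≤ (2 + |eta q p|) * psi q (shift t p) := by
  have h1 := abs_eta_le_psi q (shift t p)
  have h2 := psi_pos q (shift t p)
  have h3 : t * act p ^ 3 / q = eta q (shift t p) - eta q p := by rw [eta_shift]; ring
  have h4 := abs_sub (eta q (shift t p)) (eta q p)
  have h5 := le_abs_self (eta q (shift t p) - eta q p)
  have := abs_nonneg (eta q p)
  rw [h3]
  nlinarith

/-- `t a ≤ (2 + |η|) |𝐗̃|`. -/
theorem mul_act_le {q t : ℝ} (hq : 0 < q) {p : Phase} (hp : p ∈ phaseSpace) :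
    t * act p ≤ (2 + |eta q p|) * ‖posXt q t p‖ := by
  have h := tau_le q t p
  have ha := act_pos hp
  have hc := scl_pos hq hp
  rw [posXt_eq_shift, norm_posX hq (shift_mem t hp), scl_shift]
  calc t * act p = scl q p * (t * act p ^ 3 / q) := by rw [scl]; field_simp
    _ ≤ scl q p * ((2 + |eta q p|) * psi q (shift t p)) := by gcongr
    _ = _ := by ring

/-! ### The velocity -/

/-- `σ` is the inverse in `η` of the smooth function `s ↦ -(s + sinh(2s)/2 + κ² exp(2s))`, whose
derivative `-2ψ` never vanishes. -/
theorem hasDerivAt_sigma (η κ : ℝ) : HasDerivAt (fun η => sigma η κ)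
    (-(2 * (Real.cosh (sigma η κ) ^ 2 + κ ^ 2 * Real.exp (2 * sigma η κ))))⁻¹ η := by
  have hf : HasDerivAt (fun s : ℝ => -(s + Real.sinh (2 * s) / 2 + κ ^ 2 * Real.exp (2 * s)))
      (-(2 * (Real.cosh (sigma η κ) ^ 2 + κ ^ 2 * Real.exp (2 * sigma η κ)))) (sigma η κ) := by
    have h2 : HasDerivAt (fun s : ℝ => 2 * s) 2 (sigma η κ) := by
      simpa using (hasDerivAt_id (sigma η κ)).const_mul 2
    have := (((hasDerivAt_id (sigma η κ)).add (h2.sinh.div_const 2)).add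
      (h2.exp.const_mul (κ ^ 2))).neg
    refine this.congr_deriv ?_
    rw [Real.cosh_two_mul]
    linear_combination Real.cosh_sq (sigma η κ)
  refine HasDerivAt.of_local_left_inverse ?_ hf ?_ ?_
  · exact (continuous_sigma.comp (continuous_id.prodMk continuous_const)).continuousAt
  · have := Real.cosh_pos (sigma η κ)
    exact neg_ne_zero.2 (by positivity)
  · exact Filter.Eventually.of_forall fun y => by linarith [sigma_spec y κ]

/-- The velocity `𝐚 · ∂_ϑ 𝐗`. -/
def vel (q : ℝ) (p : Phase) : E3 := p.2 - (act p ^ 3 / q / (2 * psi q p)) •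
  ((scl q p * (1 + Real.exp (2 * sg q p))) • dir p + (2 * Real.exp (2 * sg q p)) • perp p)

theorem hasDerivAt_posX_shift {q : ℝ} (hq : 0 < q) {p : Phase} (hp : p ∈ phaseSpace) (r : ℝ) :
    HasDerivAt (fun r => posX q (shift r p)) (vel q (shift r p)) r := by
  have h0 : (fun r => posX q (shift r p)) = fun r => p.1 + r • p.2
      + (scl q p * (sigma (eta q p + r * act p ^ 3 / q) (kappa q p) + 1 / 2
        + Real.exp (2 * sigma (eta q p + r * act p ^ 3 / q) (kappa q p)) / 2)) • dir p
      + Real.exp (2 * sigma (eta q p + r * act p ^ 3 / q) (kappa q p)) • perp p := by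
    ext1 r
    rw [posX_eq_add hq (shift_mem r hp), sg, eta_shift, kappa_shift q r hp, dir_shift, scl_shift,
      perp_shift r hp]
    simp [shift]
  rw [h0]
  have h1 : HasDerivAt (fun r => eta q p + r * act p ^ 3 / q) (act p ^ 3 / q) r := by
    simpa [mul_div_assoc] using
      (((hasDerivAt_id r).mul_const (act p ^ 3)).div_const q).const_add (eta q p)
  have h2 := (hasDerivAt_sigma (eta q p + r * act p ^ 3 / q) (kappa q p)).comp r h1
  have h3 := ((h2.const_mul 2).exp)
  have h4 := ((((hasDerivAt_id r).smul_const p.2).const_add p.1).add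
    ((((h2.add_const (1 / 2)).add (h3.div_const 2)).const_mul (scl q p)).smul_const (dir p))).add
      (h3.smul_const (perp p))
  refine h4.congr_deriv ?_
  rw [vel, psi, sg, eta_shift, kappa_shift q r hp, dir_shift, scl_shift, perp_shift r hp, act_shift]
  simp only [Function.comp, shift, one_smul, mul_inv_rev, inv_neg]
  set s := sigma (eta q p + r * act p ^ 3 / q) (kappa q p)
  set P := Real.cosh s ^ 2 + kappa q p ^ 2 * Real.exp (2 * s) with hP
  have hP0 : P ≠ 0 := by have := Real.cosh_pos s; positivity
  rw [smul_add, smul_smul, smul_smul, sub_eq_add_neg, neg_add, ← neg_smul, ← neg_smul, ← add_assoc]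
  congr 3
  · field_simp
    ring
  · field_simp

/-- The position is almost homogeneous of degree one in `t`. Besides the displacement, only the term
with factor `τ/(2ψ)` remains, and `tau_le` bounds that factor uniformly in time. -/
theorem norm_smul_vel_sub_le {δ : ℝ} (hδ : 0 < δ) {q t : ℝ} (hq : 0 < q) (ht : 0 ≤ t) {p : Phase}
    (hp : p ∈ phaseSpace) : ‖t • vel q (shift t p) - posXt q t p‖
      ≤ (24 + 1 / (2 * δ)) * (scl q p * wS q p ^ 2) * (1 + t * act p ^ 3 / q) ^ δ := by
  have hM := norm_posXt_sub_le hδ hq ht hp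
  have hτ := tau_le q t p
  have hp' := shift_mem t hp
  have ha := act_pos hp
  have hκ := kappa_nonneg hq p
  have hη := abs_nonneg (eta q p)
  have hc := scl_pos hq hp
  have hP := psi_pos q (shift t p)
  have hneg : -eta q (shift t p) ≤ |eta q p| := by
    have : 0 ≤ t * act p ^ 3 / q := by positivity
    rw [eta_shift]; linarith [neg_abs_le (eta q p)]
  have e : sg q (shift t p) = sigma (eta q (shift t p)) (kappa q p) := by
    rw [sg, kappa_shift q t hp]
  have he := exp_sigma_le (κ := kappa q p) hη hneg
  have hk := kappa_mul_exp_sigma_le hκ hη hneg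
  rw [← e] at he hk
  have hT : 1 ≤ (1 + t * act p ^ 3 / q) ^ δ :=
    Real.one_le_rpow (by have : 0 ≤ t * act p ^ 3 / q := by positivity
                         linarith) hδ.le
  have h1 : t • vel q (shift t p) - posXt q t p = -(posXt q t p - t • p.2)
      - (t * act p ^ 3 / q / (2 * psi q (shift t p))) • ((scl q p * (1 + Real.exp
        (2 * sg q (shift t p)))) • dir p + (2 * Real.exp (2 * sg q (shift t p))) • perp p) := by
    rw [vel, act_shift, scl_shift, dir_shift, perp_shift t hp, smul_sub, smul_smul]
    have : t * (act p ^ 3 / q / (2 * psi q (shift t p)))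
      = t * act p ^ 3 / q / (2 * psi q (shift t p)) := by ring
    rw [this]
    simp only [shift]
    abel
  rw [h1]
  set s := sg q (shift t p)
  set P := psi q (shift t p)
  set Q := (1 + t * act p ^ 3 / q) ^ δ
  have hex := Real.exp_pos (2 * s)
  have h2 : t * act p ^ 3 / q / (2 * P) ≤ (2 + |eta q p|) / 2 := by
    rw [div_le_iff₀ (by linarith)]; linarith
  have h20 : 0 ≤ t * act p ^ 3 / q / (2 * P) := by positivity
  have hS1 : 1 ≤ wS q p := by rw [wS]; linarith
  have h3 : ‖(scl q p * (1 + Real.exp (2 * s))) • dir p + (2 * Real.exp (2 * s)) • perp p‖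
      ≤ scl q p * (10 * wS q p + 2 * wS q p) := by
    refine (norm_add_le _ _).trans ?_
    rw [norm_smul, norm_smul, norm_dir hp, ← scl_mul_kappa hq hp, Real.norm_of_nonneg (by positivity),
      Real.norm_of_nonneg (by positivity)]
    have : scl q p * (1 + Real.exp (2 * s)) * 1 + 2 * Real.exp (2 * s) * (scl q p * kappa q p)
      = scl q p * (1 + Real.exp (2 * s) + 2 * (kappa q p * Real.exp (2 * s))) := by ring
    rw [this]
    refine mul_le_mul_of_nonneg_left ?_ hc.le
    rw [wS]; linarith
  have h5 : wS q p ≤ wS q p ^ 2 := by nlinarith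
  have h6 : (2 + |eta q p|) / 2 ≤ wS q p := by rw [wS]; linarith
  calc _ ≤ ‖posXt q t p - t • p.2‖ + ‖(t * act p ^ 3 / q / (2 * P)) • ((scl q p * (1 + Real.exp
        (2 * s))) • dir p + (2 * Real.exp (2 * s)) • perp p)‖ := by
        refine (norm_sub_le _ _).trans ?_
        rw [norm_neg]
    _ ≤ (12 + 1 / (2 * δ)) * (scl q p * wS q p) * Q
        + wS q p * (scl q p * (10 * wS q p + 2 * wS q p)) := by
        rw [norm_smul, Real.norm_of_nonneg h20]
        gcongr
        exact h2.trans h6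
    _ ≤ (12 + 1 / (2 * δ)) * (scl q p * wS q p ^ 2) * Q + 12 * (scl q p * wS q p ^ 2) * Q := by
        have h7 : 0 ≤ scl q p * wS q p ^ 2 := by positivity
        have h8 : scl q p * wS q p ^ 2 ≤ scl q p * wS q p ^ 2 * Q := le_mul_of_one_le_right h7 hT
        refine add_le_add (by gcongr) ?_
        calc _ = 12 * (scl q p * wS q p ^ 2) := by ring
          _ ≤ 12 * (scl q p * wS q p ^ 2 * Q) := by linarith
          _ = _ := by ring
    _ = (24 + 1 / (2 * δ)) * (scl q p * wS q p ^ 2) * Q := by ring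

/-! ### The one-dimensional fold estimate -/

/-- The component of `𝐗` along `𝐮` (in units of `q / a²`) as a function of `σ`, for a fixed
component `P` orthogonal to `𝐮`. -/
def foldFun (P s : ℝ) : ℝ := Real.cosh s ^ 2 - P ^ 2 / (4 * Real.cosh s ^ 2)

/-- The length `|𝐗|` (in units of `q / a²`) in the same variables. -/
def foldLen (P s : ℝ) : ℝ := Real.cosh s ^ 2 + P ^ 2 / (4 * Real.cosh s ^ 2)

theorem continuous_foldFun : Continuous (fun x : ℝ × ℝ => foldFun x.1 x.2) := by
  unfold foldFun
  have : ∀ x : ℝ × ℝ, 4 * Real.cosh x.2 ^ 2 ≠ 0 := fun x => by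
    have := Real.cosh_pos x.2; positivity
  fun_prop (disch := assumption)

theorem continuous_foldLen : Continuous (fun x : ℝ × ℝ => foldLen x.1 x.2) := by
  unfold foldLen
  have : ∀ x : ℝ × ℝ, 4 * Real.cosh x.2 ^ 2 ≠ 0 := fun x => by
    have := Real.cosh_pos x.2; positivity
  fun_prop (disch := assumption)

theorem foldLen_pos (P s : ℝ) : 0 < foldLen P s := by
  have := Real.cosh_pos s
  unfold foldLen; positivity

/-- `foldLen` is also the factor in the Jacobian of the coordinate `σ`. In the quotient only `tanh
s` survives, and it vanishes to first order at the fold. -/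
theorem hasDerivAt_foldFun (P s : ℝ) :
    HasDerivAt (foldFun P) (2 * (Real.sinh s / Real.cosh s) * foldLen P s) s := by
  have hc := Real.cosh_pos s
  have h1 := (Real.hasDerivAt_cosh s).pow 2
  have h2 := h1.sub ((hasDerivAt_const s (P ^ 2)).div (h1.const_mul 4) (by simp [hc.ne']))
  refine h2.congr_deriv ?_
  unfold foldLen
  simp only [Pi.pow_apply]
  field_simp
  push_cast
  ring

/-- The two `sinh` factors show that `foldFun` is even and leaves its minimum `s = 0` quadratically.
Both monotonicity on `s ≥ 0` and the quantitative separation near the fold are read off from this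
product. -/
theorem foldFun_sub (P s₁ s₂ : ℝ) : foldFun P s₂ - foldFun P s₁ =
    Real.sinh (s₂ - s₁) * Real.sinh (s₂ + s₁)
      * (1 + P ^ 2 / (4 * Real.cosh s₁ ^ 2 * Real.cosh s₂ ^ 2)) := by
  have h1 := Real.cosh_pos s₁
  have h2 := Real.cosh_pos s₂
  have h : Real.sinh (s₂ - s₁) * Real.sinh (s₂ + s₁) = Real.cosh s₂ ^ 2 - Real.cosh s₁ ^ 2 := by
    rw [Real.sinh_sub, Real.sinh_add]
    have e1 := Real.cosh_sq s₁
    have e2 := Real.cosh_sq s₂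
    linear_combination (-Real.sinh s₁ ^ 2) * e2 + (Real.sinh s₂ ^ 2) * e1 - e2 + e1
  rw [h]; unfold foldFun; field_simp; ring

theorem foldFun_neg (P s : ℝ) : foldFun P (-s) = foldFun P s := by simp [foldFun]

theorem foldLen_neg (P s : ℝ) : foldLen P (-s) = foldLen P s := by simp [foldLen]

theorem strictMonoOn_foldFun (P : ℝ) : StrictMonoOn (foldFun P) (Ici 0) := by
  intro s₁ h₁ s₂ h₂ h
  have h1 : 0 < Real.sinh (s₂ - s₁) := Real.sinh_pos_iff.2 (by linarith)
  have h2 : 0 < Real.sinh (s₂ + s₁) := Real.sinh_pos_iff.2 (by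
    have := mem_Ici.1 h₁; linarith)
  have := foldFun_sub P s₁ s₂
  have : 0 < Real.sinh (s₂ - s₁) * Real.sinh (s₂ + s₁)
      * (1 + P ^ 2 / (4 * Real.cosh s₁ ^ 2 * Real.cosh s₂ ^ 2)) := by positivity
  linarith

theorem cosh_le_two_mul_sinh {s : ℝ} (hs : 1 ≤ s) : Real.cosh s ≤ 2 * Real.sinh s := by
  have h1 : s ≤ Real.sinh s := Real.self_le_sinh_iff.2 (by linarith)
  have h2 := Real.cosh_sq s
  have h3 := Real.cosh_pos s
  nlinarith

theorem cosh_le_two {s : ℝ} (hs : |s| ≤ 1) : Real.cosh s ≤ 2 := by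
  have h1 : Real.cosh s ≤ Real.cosh 1 := Real.cosh_le_cosh.2 (by simpa using hs)
  have h2 : Real.cosh 1 ≤ 2 := by
    rw [Real.cosh_eq]
    have := Real.exp_one_lt_d9
    have : Real.exp (-1) ≤ 1 := Real.exp_le_one_iff.2 (by norm_num)
    linarith
  linarith

/-- Away from the fold: `foldLen` is comparable to the derivative of `foldFun`. -/
theorem lintegral_foldLen_Ici {P w₀ ρ : ℝ} :
    ∫⁻ s in {s | |foldFun P s - w₀| < ρ} ∩ Ici 1, ENNReal.ofReal (foldLen P s)
      ≤ ENNReal.ofReal (2 * ρ) := by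
  have hm : MeasurableSet ({s | |foldFun P s - w₀| < ρ} ∩ Ici 1) := by
    have : Continuous (foldFun P) := continuous_foldFun.comp (Continuous.prodMk_right P)
    exact (measurableSet_lt (by fun_prop) measurable_const).inter measurableSet_Ici
  calc _ ≤ ∫⁻ s in {s | |foldFun P s - w₀| < ρ} ∩ Ici 1,
        ENNReal.ofReal |2 * (Real.sinh s / Real.cosh s) * foldLen P s| * 1 := by
        refine setLIntegral_mono' hm fun s hs => ?_
        rw [mul_one]
        refine ENNReal.ofReal_le_ofReal (le_trans ?_ (le_abs_self _))
        have h1 := cosh_le_two_mul_sinh hs.2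
        have h2 := Real.cosh_pos s
        refine le_mul_of_one_le_left (foldLen_pos P s).le ?_
        rw [← mul_div_assoc, one_le_div h2]; exact h1
    -- For `s ≥ 1` the factor `2 tanh s` is at least `1`, so the integrand is below the Jacobian of
    -- the injective map `foldFun P`, whose values lie in an interval of length `2ρ`.
    _ = ∫⁻ _ in foldFun P '' ({s | |foldFun P s - w₀| < ρ} ∩ Ici 1), 1 :=
        (lintegral_image_eq_lintegral_abs_deriv_mul hm
          (fun s _ => (hasDerivAt_foldFun P s).hasDerivWithinAt)
          ((strictMonoOn_foldFun P).injOn.mono (inter_subset_right.trans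
            (Ici_subset_Ici.2 zero_le_one))) (fun _ => 1)).symm
    _ ≤ volume (Metric.ball w₀ ρ) := by
        rw [setLIntegral_one]
        refine measure_mono ?_
        rintro _ ⟨s, hs, rfl⟩
        simpa [Real.dist_eq] using hs.1
    _ = _ := by rw [Real.volume_ball]

/-- The set of parameters near the fold has small length. -/
theorem volume_fold_le {P w₀ ρ : ℝ} (hP : 0 ≤ P) :
    volume ({s | |foldFun P s - w₀| < ρ} ∩ Icc 0 1) ≤ ENNReal.ofReal (16 * √ρ / (1 + P)) := by
  refine (Real.volume_le_diam _).trans (Metric.ediam_le ?_)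
  have key : ∀ s₁ ∈ {s | |foldFun P s - w₀| < ρ} ∩ Icc 0 1,
      ∀ s₂ ∈ {s | |foldFun P s - w₀| < ρ} ∩ Icc 0 1, s₁ ≤ s₂ →
      s₂ - s₁ ≤ 16 * √ρ / (1 + P) := by
    rintro s₁ ⟨h1, h1', h1''⟩ s₂ ⟨h2, h2', h2''⟩ h
    have hρ : 0 ≤ ρ := (abs_nonneg _).trans (le_of_lt (mem_ofPred.1 h1))
    have e := foldFun_sub P s₁ s₂
    have d : foldFun P s₂ - foldFun P s₁ ≤ 2 * ρ := by
      have := (abs_lt.1 (mem_ofPred.1 h1)).1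
      have := (abs_lt.1 (mem_ofPred.1 h2)).2
      linarith
    have c1 := cosh_le_two (s := s₁) (by rw [abs_of_nonneg h1']; exact h1'')
    have c2 := cosh_le_two (s := s₂) (by rw [abs_of_nonneg h2']; exact h2'')
    have p1 := Real.one_le_cosh s₁
    have p2 := Real.one_le_cosh s₂
    have a1 : s₂ - s₁ ≤ Real.sinh (s₂ - s₁) := Real.self_le_sinh_iff.2 (by linarith)
    have a2 : s₂ - s₁ ≤ Real.sinh (s₂ + s₁) :=
      le_trans (by linarith) (Real.self_le_sinh_iff.2 (by linarith))
    -- On `[0, 1]` one has `cosh ≤ 2`, so the denominator is at most `64`; then `(1 + P)² ≤ 2(1 +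
    -- P²)` doubles this to `128`.
    have a3 : (1 + P) ^ 2 / 128 ≤ 1 + P ^ 2 / (4 * Real.cosh s₁ ^ 2 * Real.cosh s₂ ^ 2) := by
      have : 4 * Real.cosh s₁ ^ 2 * Real.cosh s₂ ^ 2 ≤ 64 := by
        have : Real.cosh s₁ ^ 2 ≤ 4 := by nlinarith
        have : Real.cosh s₂ ^ 2 ≤ 4 := by nlinarith
        nlinarith [sq_nonneg (Real.cosh s₁), sq_nonneg (Real.cosh s₂)]
      have : P ^ 2 / 64 ≤ P ^ 2 / (4 * Real.cosh s₁ ^ 2 * Real.cosh s₂ ^ 2) :=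
        div_le_div_of_nonneg_left (sq_nonneg P) (by positivity) this
      nlinarith [sq_nonneg (P - 1)]
    have a4 : (s₂ - s₁) * (s₂ - s₁) * ((1 + P) ^ 2 / 128) ≤ 2 * ρ := by
      rw [e] at d
      refine le_trans ?_ d
      have : 0 ≤ s₂ - s₁ := by linarith
      gcongr
    have a5 : ((s₂ - s₁) * (1 + P)) ^ 2 ≤ (16 * √ρ) ^ 2 := by
      rw [mul_pow 16, Real.sq_sqrt hρ]; nlinarith
    rw [le_div_iff₀ (by linarith)]
    exact le_of_sq_le_sq a5 (by positivity)
  intro s₁ h1 s₂ h2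
  rw [edist_dist, Real.dist_eq]
  refine ENNReal.ofReal_le_ofReal ?_
  rcases le_total s₁ s₂ with h | h
  · rw [abs_sub_comm, abs_of_nonneg (by linarith)]; exact key _ h1 _ h2 h
  · rw [abs_of_nonneg (by linarith)]; exact key _ h2 _ h1 h

/-- Near the fold `foldLen ≤ 4(1 + P)²` while the parameter set has length `16√ρ/(1 + P)`. The
weight `1/(1 + P)` is exactly what makes the product uniform in `P`. -/
theorem lintegral_foldLen_Icc {P w₀ ρ : ℝ} (hP : 0 ≤ P) :
    ∫⁻ s in {s | |foldFun P s - w₀| < ρ} ∩ Icc 0 1, ENNReal.ofReal (foldLen P s / (1 + P))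
      ≤ ENNReal.ofReal (64 * √ρ) := by
  have hm : MeasurableSet ({s | |foldFun P s - w₀| < ρ} ∩ Icc 0 1) := by
    have : Continuous (foldFun P) := continuous_foldFun.comp (Continuous.prodMk_right P)
    exact (measurableSet_lt (by fun_prop) measurable_const).inter measurableSet_Icc
  calc _ ≤ ∫⁻ s in {s | |foldFun P s - w₀| < ρ} ∩ Icc 0 1, ENNReal.ofReal (4 * (1 + P)) := by
        refine setLIntegral_mono' hm fun s hs => ENNReal.ofReal_le_ofReal ?_
        have c1 := cosh_le_two (s := s) (by rw [abs_of_nonneg hs.2.1]; exact hs.2.2)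
        have p1 := Real.one_le_cosh s
        have h1 : P ^ 2 / (4 * Real.cosh s ^ 2) ≤ P ^ 2 / 4 :=
          div_le_div_of_nonneg_left (sq_nonneg P) (by norm_num) (by nlinarith)
        rw [div_le_iff₀ (by linarith), foldLen]
        nlinarith
    _ = ENNReal.ofReal (4 * (1 + P)) * volume ({s | |foldFun P s - w₀| < ρ} ∩ Icc 0 1) := by
        rw [setLIntegral_const]
    _ ≤ ENNReal.ofReal (4 * (1 + P)) * ENNReal.ofReal (16 * √ρ / (1 + P)) := by
        gcongr; exact volume_fold_le hP
    _ = _ := by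
        rw [← ENNReal.ofReal_mul (by positivity)]
        congr 1; field_simp; ring

theorem lintegral_fold_Ici {P w₀ ρ : ℝ} (hP : 0 ≤ P) (hρ : 0 < ρ) {h : ℝ → ℝ}
    (h1 : ∀ s, h s ≤ foldLen P s) (h2 : ∀ s, |s| ≤ 1 → h s ≤ foldLen P s / (1 + P)) :
    ∫⁻ s in {s | |foldFun P s - w₀| < ρ} ∩ Ici 0, ENNReal.ofReal (h s)
      ≤ ENNReal.ofReal (64 * (ρ + √ρ)) := by
  have hm : MeasurableSet {s | |foldFun P s - w₀| < ρ} := by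
    have : Continuous (foldFun P) := continuous_foldFun.comp (Continuous.prodMk_right P)
    exact (measurableSet_lt (by fun_prop) measurable_const)
  have hsub : {s | |foldFun P s - w₀| < ρ} ∩ Ici 0 ⊆
      ({s | |foldFun P s - w₀| < ρ} ∩ Ici 1) ∪ ({s | |foldFun P s - w₀| < ρ} ∩ Icc 0 1) := by
    rintro s ⟨hs, hs0⟩
    rcases le_total 1 s with h | h
    · exact Or.inl ⟨hs, h⟩
    · exact Or.inr ⟨hs, hs0, h⟩
  calc _ ≤ _ := lintegral_mono_set hsub
    _ ≤ _ := lintegral_union_le _ _ _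
    _ ≤ ENNReal.ofReal (2 * ρ) + ENNReal.ofReal (64 * √ρ) := by
      refine add_le_add (le_trans ?_ (lintegral_foldLen_Ici (P := P) (w₀ := w₀)))
        (le_trans ?_ (lintegral_foldLen_Icc (w₀ := w₀) hP))
      · exact lintegral_mono fun s => ENNReal.ofReal_le_ofReal (h1 s)
      · refine setLIntegral_mono' (hm.inter measurableSet_Icc) fun s hs =>
          ENNReal.ofReal_le_ofReal (h2 s ?_)
        rw [abs_of_nonneg hs.2.1]; exact hs.2.2
    _ ≤ _ := by
      rw [← ENNReal.ofReal_add (by positivity) (by positivity)]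
      exact ENNReal.ofReal_le_ofReal (by linarith)

/-- The two sides of the fold are exchanged by `s ↦ -s`, under which `foldFun` and `foldLen` are
invariant, so each contributes the half-line bound. -/
theorem lintegral_fold {P w₀ ρ : ℝ} (hP : 0 ≤ P) (hρ : 0 < ρ) {h : ℝ → ℝ}
    (h1 : ∀ s, h s ≤ foldLen P s) (h2 : ∀ s, |s| ≤ 1 → h s ≤ foldLen P s / (1 + P)) :
    ∫⁻ s in {s | |foldFun P s - w₀| < ρ}, ENNReal.ofReal (h s)
      ≤ ENNReal.ofReal (128 * (ρ + √ρ)) := by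
  set E := {s | |foldFun P s - w₀| < ρ} with hE
  have hm : MeasurableSet E := by
    have : Continuous (foldFun P) := continuous_foldFun.comp (Continuous.prodMk_right P)
    exact (measurableSet_lt (by fun_prop) measurable_const)
  have hsub : E ⊆ (E ∩ Ici 0) ∪ (Neg.neg ⁻¹' (E ∩ Ici 0)) := by
    intro s hs
    rcases le_total 0 s with h | h
    · exact Or.inl ⟨hs, h⟩
    · refine Or.inr ⟨?_, by simpa using h⟩
      simpa [hE, foldFun_neg] using hs
  have hneg : ∫⁻ s in Neg.neg ⁻¹' (E ∩ Ici 0), ENNReal.ofReal (h s)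
      = ∫⁻ s in E ∩ Ici 0, ENNReal.ofReal (h (-s)) := by
    have := (Measure.measurePreserving_neg (volume : Measure ℝ)).setLIntegral_comp_preimage_emb
      (MeasurableEquiv.neg ℝ).measurableEmbedding (fun s => ENNReal.ofReal (h (-s))) (E ∩ Ici 0)
    simpa using this
  calc _ ≤ _ := lintegral_mono_set hsub
    _ ≤ _ := lintegral_union_le _ _ _
    _ ≤ ENNReal.ofReal (64 * (ρ + √ρ)) + ENNReal.ofReal (64 * (ρ + √ρ)) := by
      rw [hneg]
      refine add_le_add (lintegral_fold_Ici hP hρ h1 h2) (lintegral_fold_Ici hP hρ ?_ ?_)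
      · intro s; rw [← foldLen_neg]; exact h1 _
      · intro s hs; rw [← foldLen_neg]; exact h2 _ (by simpa using hs)
    _ = _ := by
      rw [← ENNReal.ofReal_add (by positivity) (by positivity)]
      congr 1; ring

/-! ### Lebesgue measure on `ℝ³` in coordinates -/

theorem lintegral_E3 {f : E3 → ℝ≥0∞} (hf : Measurable f) :
    ∫⁻ x, f x = ∫⁻ x₀ : ℝ, ∫⁻ x₁ : ℝ, ∫⁻ x₂ : ℝ, f !₂[x₀, x₁, x₂] := by
  have h1 := (PiLp.volume_preserving_toLp (Fin 3)).lintegral_comp hf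
  rw [← h1]
  have h2 := ((volume_preserving_piFinSuccAbove (fun _ : Fin 3 => ℝ) 0).symm
    (MeasurableEquiv.piFinSuccAbove (fun _ : Fin 3 => ℝ) 0)).lintegral_comp
    (f := fun x => f (WithLp.toLp 2 x)) (by fun_prop)
  rw [← h2]
  have h3 : Measurable fun z : ℝ × (Fin 2 → ℝ) => f (WithLp.toLp 2
      ((MeasurableEquiv.piFinSuccAbove (fun _ : Fin 3 => ℝ) 0).symm z)) := by fun_prop
  rw [Measure.volume_eq_prod, lintegral_prod _ h3.aemeasurable]
  refine lintegral_congr fun x₀ => ?_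
  have h4 := ((volume_preserving_finTwoArrow ℝ).symm
    MeasurableEquiv.finTwoArrow).lintegral_comp
    (f := fun z => f (WithLp.toLp 2 ((MeasurableEquiv.piFinSuccAbove (fun _ : Fin 3 => ℝ) 0).symm
      (x₀, z)))) (by fun_prop)
  rw [← h4]
  have h5 : Measurable fun z : ℝ × ℝ => f (WithLp.toLp 2
      ((MeasurableEquiv.piFinSuccAbove (fun _ : Fin 3 => ℝ) 0).symm
        (x₀, MeasurableEquiv.finTwoArrow.symm z))) := by fun_prop
  rw [Measure.volume_eq_prod, lintegral_prod _ h5.aemeasurable]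
  refine lintegral_congr fun x₁ => lintegral_congr fun x₂ => ?_
  congr 1
  ext i
  fin_cases i <;> rfl

theorem lintegral_comp_mul_left' {m : ℝ} (hm : 0 < m) {f : ℝ → ℝ≥0∞} (hf : Measurable f) :
    ENNReal.ofReal m * ∫⁻ x, f (m * x) = ∫⁻ x, f x := by
  have h := Real.map_volume_mul_left hm.ne'
  have h1 : ∫⁻ x, f (m * x) = ∫⁻ x, f x ∂(Measure.map (m * ·) volume) :=
    (lintegral_map hf (measurable_const_mul m)).symm
  rw [h1, h, lintegral_smul_measure, smul_eq_mul, ← mul_assoc, abs_of_pos (inv_pos.2 hm),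
    ← ENNReal.ofReal_mul hm.le, mul_inv_cancel₀ hm.ne', ENNReal.ofReal_one, one_mul]

/-! ### The fold estimate in three dimensions -/

/-- `η` as a function of `σ` for fixed `κ`. -/
def etaOf (κ s : ℝ) : ℝ := -(s + Real.sinh (2 * s) / 2 + κ ^ 2 * Real.exp (2 * s))

theorem sigma_etaOf (κ s : ℝ) : sigma (etaOf κ s) κ = s := by
  obtain ⟨r, -, hr⟩ := existsUnique_root (etaOf κ s) κ
  rw [hr _ (sigma_spec _ _), hr s (by unfold etaOf; ring)]

theorem etaOf_sigma (η κ : ℝ) : etaOf κ (sigma η κ) = η := by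
  unfold etaOf; linarith [sigma_spec η κ]

theorem hasDerivAt_etaOf (κ s : ℝ) : HasDerivAt (etaOf κ)
    (-(2 * (Real.cosh s ^ 2 + κ ^ 2 * Real.exp (2 * s)))) s := by
  have h2 : HasDerivAt (fun s : ℝ => 2 * s) 2 s := by
    simpa using (hasDerivAt_id s).const_mul 2
  have := (((hasDerivAt_id s).add (h2.sinh.div_const 2)).add (h2.exp.const_mul (κ ^ 2))).neg
  refine this.congr_deriv ?_
  rw [Real.cosh_two_mul]
  linear_combination Real.cosh_sq s

/-- The change of variables `x₀ = c η(σ)`. -/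
theorem lintegral_sigma {c : ℝ} (hc : 0 < c) (κ : ℝ) {f : ℝ → ℝ≥0∞} (hf : Measurable f) :
    ∫⁻ x, f (sigma (x / c) κ) = ∫⁻ s, ENNReal.ofReal
      (2 * c * (Real.cosh s ^ 2 + κ ^ 2 * Real.exp (2 * s))) * f s := by
  have hm : Measurable fun x => f (sigma x κ) :=
    hf.comp (continuous_sigma.comp (continuous_id.prodMk continuous_const)).measurable
  have h1 := lintegral_comp_mul_left' (inv_pos.2 hc) hm
  have h0 : ∫⁻ x, f (sigma (x / c) κ) = ENNReal.ofReal c * ∫⁻ x, f (sigma x κ) := by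
    rw [← h1, ← mul_assoc, ← ENNReal.ofReal_mul hc.le, mul_inv_cancel₀ hc.ne', ENNReal.ofReal_one,
      one_mul]
    simp only [div_eq_inv_mul]
  have hinj : InjOn (etaOf κ) univ := fun a _ b _ hab => by
    rw [← sigma_etaOf κ a, hab, sigma_etaOf]
  have h2 := lintegral_image_eq_lintegral_abs_deriv_mul MeasurableSet.univ
    (fun s _ => (hasDerivAt_etaOf κ s).hasDerivWithinAt) hinj (fun x => f (sigma x κ))
  have h3 : etaOf κ '' univ = univ := by
    rw [image_univ]
    exact (show Function.Surjective (etaOf κ) from fun y => ⟨_, etaOf_sigma y κ⟩).range_eq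
  rw [h3, setLIntegral_univ, setLIntegral_univ] at h2
  rw [h0, h2, ← lintegral_const_mul']
  · refine lintegral_congr fun s => ?_
    have : 0 ≤ Real.cosh s ^ 2 + κ ^ 2 * Real.exp (2 * s) := by positivity
    rw [sigma_etaOf, ← mul_assoc, ← ENNReal.ofReal_mul hc.le, abs_neg, abs_of_nonneg (by positivity)]
    congr 2; ring
  · exact ENNReal.ofReal_ne_top

/-- Here `P` stands for the transverse component of `𝐗` rather than of `ϑ`. In that variable the
quantity is even in `s`, which reveals the fold. -/
theorem kappa_sq_mul_exp {P m s : ℝ} (hm : m = 1 + Real.exp (2 * s)) :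
    (P / m) ^ 2 * Real.exp (2 * s) = P ^ 2 / (4 * Real.cosh s ^ 2) := by
  have h1 := one_add_exp_sq s
  have h2 := Real.cosh_pos s
  have h3 := Real.exp_pos (2 * s)
  rw [← hm] at h1
  rw [div_pow, h1]; field_simp

theorem lintegral_swap₃ {f : ℝ × ℝ × ℝ → ℝ≥0∞} (hf : Measurable f) :
    ∫⁻ x₀ : ℝ, ∫⁻ x₁ : ℝ, ∫⁻ x₂ : ℝ, f (x₀, x₁, x₂)
      = ∫⁻ x₁ : ℝ, ∫⁻ x₂ : ℝ, ∫⁻ x₀ : ℝ, f (x₀, x₁, x₂) := by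
  have h1 : Measurable fun z : (ℝ × ℝ) × ℝ => f (z.1.1, z.1.2, z.2) := hf.comp (by fun_prop)
  rw [lintegral_lintegral_swap (Measurable.lintegral_prod_right' h1).aemeasurable]
  refine lintegral_congr fun x₁ => ?_
  have h2 : Measurable fun z : ℝ × ℝ => f (z.1, x₁, z.2) := hf.comp (by fun_prop)
  rw [lintegral_lintegral_swap h2.aemeasurable]

theorem lintegral_scale₂ {m : ℝ} (hm : 0 < m) {f : ℝ × ℝ → ℝ≥0∞} (hf : Measurable f) :
    ∫⁻ x₁ : ℝ, ∫⁻ x₂ : ℝ, ENNReal.ofReal m * (ENNReal.ofReal m * f (m * x₁, m * x₂))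
      = ∫⁻ x₁ : ℝ, ∫⁻ x₂ : ℝ, f (x₁, x₂) := by
  rw [← lintegral_comp_mul_left' hm (f := fun p₁ => ∫⁻ p₂ : ℝ, f (p₁, p₂))
    (Measurable.lintegral_prod_right' hf), ← lintegral_const_mul' _ _ ENNReal.ofReal_ne_top]
  refine lintegral_congr fun x₁ => ?_
  rw [lintegral_const_mul' _ _ ENNReal.ofReal_ne_top,
    lintegral_const_mul' _ _ ENNReal.ofReal_ne_top,
    lintegral_comp_mul_left' hm (f := fun p₂ => f (m * x₁, p₂)) (hf.comp (by fun_prop))]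

/-- The weighted indicator of `{|𝐗 - y| < r}` (for the maximum norm) in the variables
`(σ, ϑ_⊥)`. -/
def foldKer (c r : ℝ) (y : E3) (z : ℝ × ℝ × ℝ) : ℝ≥0∞ :=
  {z : ℝ × ℝ × ℝ | |c * (Real.cosh z.1 ^ 2
      - (√(z.2.1 ^ 2 + z.2.2 ^ 2) / c) ^ 2 * Real.exp (2 * z.1)) - y 0| < r ∧
    |(1 + Real.exp (2 * z.1)) * z.2.1 - y 1| < r ∧
    |(1 + Real.exp (2 * z.1)) * z.2.2 - y 2| < r}.indicator
    (fun z => ENNReal.ofReal (1 / (1 + √(z.2.1 ^ 2 + z.2.2 ^ 2) / c))) z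

theorem measurable_foldKer (c r : ℝ) (y : E3) : Measurable (foldKer c r y) := by
  refine Measurable.indicator (by fun_prop) ?_
  simp only [ofPred_and]
  refine MeasurableSet.inter ?_ (MeasurableSet.inter ?_ ?_) <;>
  exact measurableSet_lt (by fun_prop) measurable_const

/-- The density of the weighted measure in the variables `(σ, 𝐗_⊥)`. -/
def foldDens (P s : ℝ) : ℝ := 2 * foldLen P s
  / ((1 + Real.exp (2 * s)) ^ 2 * (1 + P / (1 + Real.exp (2 * s))))

theorem measurable_foldDens : Measurable fun x : ℝ × ℝ => foldDens x.1 x.2 := by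
  have := continuous_foldLen.measurable
  unfold foldDens
  fun_prop

/-- The factor of the transformed kernel depending on `σ`. -/
def foldSlice (c r y₀ : ℝ) (P s : ℝ) : ℝ≥0∞ :=
  {s | |c * foldFun P s - y₀| < r}.indicator (fun s => ENNReal.ofReal (c * foldDens P s)) s

theorem measurable_foldSlice (c r y₀ : ℝ) :
    Measurable fun x : ℝ × ℝ => foldSlice c r y₀ x.1 x.2 := by
  have h1 := measurable_foldDens
  have h2 := continuous_foldFun.measurable
  exact Measurable.indicator (s := {x : ℝ × ℝ | |c * foldFun x.1 x.2 - y₀| < r})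
    (f := fun x : ℝ × ℝ => ENNReal.ofReal (c * foldDens x.1 x.2)) (by fun_prop)
    (measurableSet_lt (by fun_prop) measurable_const)

theorem measurable_foldSlice_right (c r y₀ P : ℝ) : Measurable (foldSlice c r y₀ P) := by
  have h1 : Measurable fun s => foldDens P s := by
    have := measurable_foldDens.comp (measurable_prodMk_left (x := P))
    simpa only [Function.comp_def] using this
  have h2 : Measurable (foldFun P) :=
    (continuous_foldFun.comp (Continuous.prodMk_right P)).measurable
  unfold foldSlice
  exact Measurable.indicator (by fun_prop) (measurableSet_lt (by fun_prop) measurable_const)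

/-- The kernel in the variables `(σ, 𝐗_⊥)`. -/
def foldKer' (c r : ℝ) (y : E3) (z : ℝ × ℝ × ℝ) : ℝ≥0∞ :=
  foldSlice c r (y 0) (√(z.2.1 ^ 2 + z.2.2 ^ 2) / c) z.1
    * ({p : ℝ | |p - y 1| < r}.indicator 1 z.2.1 * {p : ℝ | |p - y 2| < r}.indicator 1 z.2.2)

theorem measurable_indicator_abs_sub_lt (w r : ℝ) :
    Measurable ({p : ℝ | |p - w| < r}.indicator (1 : ℝ → ℝ≥0∞)) :=
  measurable_one.indicator (measurableSet_lt (by fun_prop) measurable_const)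

theorem measurable_foldKer' (c r : ℝ) (y : E3) : Measurable (foldKer' c r y) := by
  have h1 := (measurable_foldSlice c r (y 0)).comp (by fun_prop : Measurable fun z : ℝ × ℝ × ℝ =>
    (√(z.2.1 ^ 2 + z.2.2 ^ 2) / c, z.1))
  have h2 := (measurable_indicator_abs_sub_lt (y 1) r).comp
    (by fun_prop : Measurable fun z : ℝ × ℝ × ℝ => z.2.1)
  have h3 := (measurable_indicator_abs_sub_lt (y 2) r).comp
    (by fun_prop : Measurable fun z : ℝ × ℝ × ℝ => z.2.2)
  exact h1.mul (h2.mul h3)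

/-- Change of variables: `2cψ` is the Jacobian of `σ` as a coordinate for the longitudinal component
of `ϑ`, and the two factors `1 + exp(2s)` come from passing to the transverse components of `𝐗` at
fixed `s`. `foldDens` is what remains, the weight `1/(1 + κ)` included. -/
theorem foldKer_eq {c : ℝ} (hc : 0 < c) (r : ℝ) (y : E3) (s x₁ x₂ : ℝ) :
    ENNReal.ofReal (2 * c * (Real.cosh s ^ 2
      + (√(x₁ ^ 2 + x₂ ^ 2) / c) ^ 2 * Real.exp (2 * s))) * foldKer c r y (s, x₁, x₂)
      = ENNReal.ofReal (1 + Real.exp (2 * s)) * (ENNReal.ofReal (1 + Real.exp (2 * s))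
        * foldKer' c r y (s, (1 + Real.exp (2 * s)) * x₁, (1 + Real.exp (2 * s)) * x₂)) := by
  have hex := Real.exp_pos (2 * s)
  have hch := Real.cosh_pos s
  obtain ⟨m, hm⟩ : ∃ m, m = 1 + Real.exp (2 * s) := ⟨_, rfl⟩
  have hm0 : 0 < m := by linarith
  have e1 : √((m * x₁) ^ 2 + (m * x₂) ^ 2) = m * √(x₁ ^ 2 + x₂ ^ 2) := by
    rw [mul_pow, mul_pow, ← mul_add, Real.sqrt_mul (sq_nonneg m), Real.sqrt_sq hm0.le]
  obtain ⟨κ, hκ⟩ : ∃ κ, κ = √(x₁ ^ 2 + x₂ ^ 2) / c := ⟨_, rfl⟩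
  have hκ0 : 0 ≤ κ := by rw [hκ]; positivity
  have e2 : m * √(x₁ ^ 2 + x₂ ^ 2) / c = m * κ := by rw [hκ]; ring
  have e3 : κ ^ 2 * Real.exp (2 * s) = (m * κ) ^ 2 / (4 * Real.cosh s ^ 2) := by
    rw [← kappa_sq_mul_exp hm, mul_div_cancel_left₀ _ hm0.ne']
  simp only [foldKer, foldKer', foldSlice, ← hm, e1, e2, ← hκ, indicator_apply, mem_ofPred_eq,
    foldFun, e3]
  by_cases a0 : |c * (Real.cosh s ^ 2 - (m * κ) ^ 2 / (4 * Real.cosh s ^ 2)) - y 0| < r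
  swap
  · simp [a0]
  by_cases a1 : |m * x₁ - y 1| < r
  swap
  · simp [a1]
  by_cases a2 : |m * x₂ - y 2| < r
  swap
  · simp [a2]
  simp only [a0, a1, a2, and_self, if_true, mul_one, Pi.one_apply]
  rw [← ENNReal.ofReal_mul (by positivity), ← ENNReal.ofReal_mul (by positivity),
    ← ENNReal.ofReal_mul (by positivity)]
  congr 1
  simp only [foldDens, foldLen, ← hm]
  field_simp

theorem lintegral_foldSlice {c r y₀ P : ℝ} (hc : 0 < c) (hr : 0 < r) (hP : 0 ≤ P) :
    ∫⁻ s, foldSlice c r y₀ P s ≤ ENNReal.ofReal (c * (256 * (r / c + √(r / c)))) := by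
  have hset : ∀ s, |c * foldFun P s - y₀| < r ↔ |foldFun P s - y₀ / c| < r / c := by
    intro s
    have : c * foldFun P s - y₀ = c * (foldFun P s - y₀ / c) := by field_simp
    rw [lt_div_iff₀ hc, this, abs_mul, abs_of_pos hc, mul_comm]
  have hms : MeasurableSet {s | |foldFun P s - y₀ / c| < r / c} := by
    have : Continuous (foldFun P) := continuous_foldFun.comp (Continuous.prodMk_right P)
    exact measurableSet_lt (by fun_prop) measurable_const
  have hb := lintegral_fold (w₀ := y₀ / c) hP (div_pos hr hc)
    (h := fun s => (1 / 2) * foldDens P s) (fun s => ?_) (fun s _ => ?_)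
  · calc ∫⁻ s, foldSlice c r y₀ P s = ∫⁻ s, {s | |foldFun P s - y₀ / c| < r / c}.indicator
          (fun s => ENNReal.ofReal (2 * c) * ENNReal.ofReal ((1 / 2) * foldDens P s)) s := by
          refine lintegral_congr fun s => ?_
          simp only [foldSlice, indicator_apply, mem_ofPred_eq, hset]
          split_ifs
          · rw [← ENNReal.ofReal_mul (by positivity)]; congr 1; ring
          · rfl
      _ ≤ _ := by
          rw [lintegral_indicator hms, lintegral_const_mul' _ _ ENNReal.ofReal_ne_top]
          refine (mul_le_mul_right hb _).trans_eq ?_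
          rw [← ENNReal.ofReal_mul (by positivity)]; congr 1; ring
  · have hL := foldLen_pos P s
    have hex := Real.exp_pos (2 * s)
    have h1 : 1 ≤ (1 + Real.exp (2 * s)) ^ 2 * (1 + P / (1 + Real.exp (2 * s))) :=
      one_le_mul_of_one_le_of_one_le (one_le_pow₀ (by linarith))
        (by have : 0 ≤ P / (1 + Real.exp (2 * s)) := by positivity
            linarith)
    simp only [foldDens]
    rw [← mul_div_assoc, div_le_iff₀ (by positivity)]
    nlinarith
  · have hL := foldLen_pos P s
    have hex := Real.exp_pos (2 * s)
    -- With `m = 1 + exp(2s) ≥ 1` the right side is `m² + mP`. The weight `1/(1 + κ) = 1/(1 + P/m)`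
    -- thus supplies the factor `1/(1 + P)` demanded near the fold.
    have h1 : 1 + P ≤ (1 + Real.exp (2 * s)) ^ 2 * (1 + P / (1 + Real.exp (2 * s))) := by
      have : (1 + Real.exp (2 * s)) ^ 2 * (1 + P / (1 + Real.exp (2 * s)))
        = (1 + Real.exp (2 * s)) ^ 2 + (1 + Real.exp (2 * s)) * P := by field_simp
      rw [this]; nlinarith
    simp only [foldDens]
    rw [← mul_div_assoc, div_le_div_iff₀ (by positivity) (by positivity)]
    have : foldLen P s * (1 + P) ≤ foldLen P s * ((1 + Real.exp (2 * s)) ^ 2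
      * (1 + P / (1 + Real.exp (2 * s)))) := by gcongr
    linarith

theorem lintegral_indicator_abs_sub_lt (w r : ℝ) :
    ∫⁻ p, {p : ℝ | |p - w| < r}.indicator (1 : ℝ → ℝ≥0∞) p = ENNReal.ofReal (2 * r) := by
  rw [lintegral_indicator_one (measurableSet_lt (by fun_prop) measurable_const),
    ← Real.volume_ball (a := w)]
  rfl

theorem lintegral_foldKer'_le {c r : ℝ} (hc : 0 < c) (hr : 0 < r) (y : E3) (p₁ p₂ : ℝ) :
    ∫⁻ s : ℝ, foldKer' c r y (s, p₁, p₂) ≤ ENNReal.ofReal (c * (256 * (r / c + √(r / c))))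
      * ({p : ℝ | |p - y 1| < r}.indicator 1 p₁ * {p : ℝ | |p - y 2| < r}.indicator 1 p₂) := by
  have hP : 0 ≤ √(p₁ ^ 2 + p₂ ^ 2) / c := by positivity
  have hsl := measurable_foldSlice_right c r (y 0) (√(p₁ ^ 2 + p₂ ^ 2) / c)
  have h := lintegral_foldSlice (y₀ := y 0) hc hr hP
  change ∫⁻ s : ℝ, foldSlice c r (y 0) (√(p₁ ^ 2 + p₂ ^ 2) / c) s
    * ({p : ℝ | |p - y 1| < r}.indicator 1 p₁ * {p : ℝ | |p - y 2| < r}.indicator 1 p₂) ≤ _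
  rw [lintegral_mul_const'' _ hsl.aemeasurable]
  exact mul_le_mul_left h _

/-- The weighted measure of `{ϑ : |𝐗 - y| < r}`, in coordinates adapted to `𝐚`. -/
theorem lintegral_fold_coords {c r : ℝ} (hc : 0 < c) (hr : 0 < r) (y : E3) :
    ∫⁻ x₀ : ℝ, ∫⁻ x₁ : ℝ, ∫⁻ x₂ : ℝ,
      foldKer c r y (sigma (x₀ / c) (√(x₁ ^ 2 + x₂ ^ 2) / c), x₁, x₂)
      ≤ ENNReal.ofReal (1024 * (r ^ 3 + √c * r ^ 2 * √r)) := by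
  have hFm := measurable_foldKer c r y
  have hHm := measurable_foldKer' c r y
  have hm1 : Measurable fun z : ℝ × ℝ × ℝ =>
      foldKer c r y (sigma (z.1 / c) (√(z.2.1 ^ 2 + z.2.2 ^ 2) / c), z.2.1, z.2.2) := by
    refine hFm.comp (Measurable.prodMk ?_ (by fun_prop))
    exact measurable_sigma.comp (by fun_prop : Measurable fun z : ℝ × ℝ × ℝ =>
      (z.1 / c, √(z.2.1 ^ 2 + z.2.2 ^ 2) / c))
  have hm2 : Measurable fun z : ℝ × ℝ × ℝ => ENNReal.ofReal (1 + Real.exp (2 * z.1))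
      * (ENNReal.ofReal (1 + Real.exp (2 * z.1)) * foldKer' c r y
        (z.1, (1 + Real.exp (2 * z.1)) * z.2.1, (1 + Real.exp (2 * z.1)) * z.2.2)) := by
    fun_prop
  calc _ = ∫⁻ x₁ : ℝ, ∫⁻ x₂ : ℝ, ∫⁻ x₀ : ℝ,
          foldKer c r y (sigma (x₀ / c) (√(x₁ ^ 2 + x₂ ^ 2) / c), x₁, x₂) := lintegral_swap₃ hm1
    _ = ∫⁻ x₁ : ℝ, ∫⁻ x₂ : ℝ, ∫⁻ s : ℝ, ENNReal.ofReal (1 + Real.exp (2 * s))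
          * (ENNReal.ofReal (1 + Real.exp (2 * s)) * foldKer' c r y
            (s, (1 + Real.exp (2 * s)) * x₁, (1 + Real.exp (2 * s)) * x₂)) := by
        refine lintegral_congr fun x₁ => lintegral_congr fun x₂ => ?_
        rw [lintegral_sigma hc (√(x₁ ^ 2 + x₂ ^ 2) / c) (f := fun s => foldKer c r y (s, x₁, x₂))
          (hFm.comp (by fun_prop))]
        exact lintegral_congr fun s => foldKer_eq hc r y s x₁ x₂
    _ = ∫⁻ s : ℝ, ∫⁻ p₁ : ℝ, ∫⁻ p₂ : ℝ, foldKer' c r y (s, p₁, p₂) := by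
        rw [← lintegral_swap₃ hm2]
        refine lintegral_congr fun s => ?_
        exact lintegral_scale₂ (m := 1 + Real.exp (2 * s)) (by positivity) (f := fun z => foldKer' c r y (s, z.1, z.2))
          (hHm.comp (by fun_prop))
    _ = ∫⁻ p₁ : ℝ, ∫⁻ p₂ : ℝ, ∫⁻ s : ℝ, foldKer' c r y (s, p₁, p₂) := lintegral_swap₃ hHm
    _ ≤ ∫⁻ p₁ : ℝ, ∫⁻ p₂ : ℝ, ENNReal.ofReal (c * (256 * (r / c + √(r / c))))
          * ({p : ℝ | |p - y 1| < r}.indicator 1 p₁ * {p : ℝ | |p - y 2| < r}.indicator 1 p₂) := by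
        refine lintegral_mono fun p₁ => lintegral_mono fun p₂ => ?_
        exact lintegral_foldKer'_le hc hr y p₁ p₂
    _ = ENNReal.ofReal (c * (256 * (r / c + √(r / c)))) * (ENNReal.ofReal (2 * r)
          * ENNReal.ofReal (2 * r)) := by
        simp_rw [lintegral_const_mul' _ _ ENNReal.ofReal_ne_top]
        congr 1
        have : ∀ p₁, ∫⁻ p₂, {p : ℝ | |p - y 1| < r}.indicator (1 : ℝ → ℝ≥0∞) p₁
            * {p : ℝ | |p - y 2| < r}.indicator 1 p₂
            = {p : ℝ | |p - y 1| < r}.indicator (1 : ℝ → ℝ≥0∞) p₁ * ENNReal.ofReal (2 * r) := by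
          intro p₁
          rw [lintegral_const_mul', lintegral_indicator_abs_sub_lt]
          rw [indicator_apply]; split_ifs <;> simp
        simp_rw [this]
        rw [lintegral_mul_const' _ _ ENNReal.ofReal_ne_top, lintegral_indicator_abs_sub_lt]
    _ = _ := by
        rw [← ENNReal.ofReal_mul (by positivity), ← ENNReal.ofReal_mul (by positivity)]
        congr 1
        rw [Real.sqrt_div hr.le]
        obtain ⟨d, hd0, rfl⟩ : ∃ d, 0 < d ∧ c = d ^ 2 :=
          ⟨√c, Real.sqrt_pos.2 hc, (Real.sq_sqrt hc.le).symm⟩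
        rw [Real.sqrt_sq hd0.le]
        field_simp
        ring

theorem exists_isometry_single {a : E3} (ha : a ≠ 0) : ∃ O : E3 ≃ₗᵢ[ℝ] E3,
    O (EuclideanSpace.single 0 1) = ‖a‖⁻¹ • a := by
  have h : ‖(EuclideanSpace.single 0 1 : E3)‖ = ‖‖a‖⁻¹ • a‖ := by
    rw [norm_smul, norm_inv, norm_norm, inv_mul_cancel₀ (norm_ne_zero_iff.2 ha)]; simp
  exact ⟨_, Submodule.reflection_sub h⟩

/-- For fixed action `𝐚`, the set of angles with `|𝐗 - y| < r` has measure
`O(r³ + c^{1/2} r^{5/2})` with respect to the weight `(1 + κ)⁻¹`. -/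
theorem lintegral_posX_ball_le {q : ℝ} (hq : 0 < q) {a : E3} (ha : a ≠ 0) (y : E3) {r : ℝ}
    (hr : 0 < r) :
    ∫⁻ θ in {θ | ‖posX q (θ, a) - y‖ < r}, ENNReal.ofReal (1 / (1 + kappa q (θ, a)))
      ≤ ENNReal.ofReal (1024 * (r ^ 3 + √(q / ‖a‖ ^ 2) * r ^ 2 * √r)) := by
  obtain ⟨O, hO⟩ := exists_isometry_single ha
  set c := q / ‖a‖ ^ 2 with hc
  have hna := norm_pos_iff.2 ha
  have hc0 : 0 < c := by positivity
  set e : E3 := ‖a‖ • EuclideanSpace.single 0 1 with he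
  have hOe : O e = a := by
    rw [he, map_smul, hO, smul_smul, mul_inv_cancel₀ hna.ne', one_smul]
  have he0 : ∀ θ : E3, (θ, e) ∈ phaseSpace := fun θ => by
    simp [phaseSpace, he, hna.ne']
  have hms : ∀ b y : E3, MeasurableSet {θ | ‖posX q (θ, b) - y‖ < r} := fun b y => by
    have := (measurable_posX q).comp (by fun_prop : Measurable fun θ : E3 => (θ, b))
    exact measurableSet_lt (by fun_prop) measurable_const
  -- Equivariance under isometries allows `𝐚` to be placed on the first coordinate axis.
  have h1 : ∫⁻ θ in {θ | ‖posX q (θ, a) - y‖ < r}, ENNReal.ofReal (1 / (1 + kappa q (θ, a)))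
      = ∫⁻ θ in {θ | ‖posX q (θ, e) - O.symm y‖ < r}, ENNReal.ofReal (1 / (1 + kappa q (θ, e))) := by
    rw [← lintegral_indicator (hms _ _), ← lintegral_indicator (hms _ _),
      ← O.measurePreserving.lintegral_comp]
    · refine lintegral_congr fun θ => ?_
      have e1 := posX_isometry hq O (he0 θ)
      have e2 := kappa_isometry q O (he0 θ)
      simp only [hOe] at e1 e2
      simp only [indicator_apply, mem_ofPred_eq, e1, e2]
      have : ‖O (posX q (θ, e)) - y‖ = ‖posX q (θ, e) - O.symm y‖ := by
        rw [← O.norm_map (posX q (θ, e) - O.symm y)]; simp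
      rw [this]
    · have := (measurable_kappa q).comp (by fun_prop : Measurable fun θ : E3 => (θ, a))
      exact Measurable.indicator (by fun_prop) (hms _ _)
  rw [h1, ← lintegral_indicator (hms _ _), lintegral_E3]
  · refine le_trans ?_ (lintegral_fold_coords hc0 hr (O.symm y))
    refine lintegral_mono fun x₀ => lintegral_mono fun x₁ => lintegral_mono fun x₂ => ?_
    set θ : E3 := !₂[x₀, x₁, x₂] with hθ
    have hact : act (θ, e) = ‖a‖ := by simp [act, he, norm_smul]
    have hdir : dir (θ, e) = EuclideanSpace.single 0 1 := by
      rw [dir, hact]; simp only [he, smul_smul, inv_mul_cancel₀ hna.ne', one_smul]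
    have hin : inner ℝ θ (EuclideanSpace.single 0 1 : E3) = x₀ := by
      rw [inner_E3]; simp [hθ]
    have hperp : perp (θ, e) = !₂[0, x₁, x₂] := by
      rw [perp, hdir]; simp only [hin]
      ext i; fin_cases i <;> simp [hθ]
    have hnp : ‖perp (θ, e)‖ = √(x₁ ^ 2 + x₂ ^ 2) := by
      rw [eq_comm, Real.sqrt_eq_iff_mul_self_eq (by positivity) (norm_nonneg _), ← pow_two,
        norm_sq_E3, hperp]
      simp
    have hκ : kappa q (θ, e) = √(x₁ ^ 2 + x₂ ^ 2) / c := by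
      rw [kappa_eq (he0 θ), hact, hnp, hc]; field_simp
    have hη : eta q (θ, e) = x₀ / c := by
      rw [eta_eq (he0 θ), hact, hdir, hin, hc]; field_simp
    have hs : sg q (θ, e) = sigma (x₀ / c) (√(x₁ ^ 2 + x₂ ^ 2) / c) := by rw [sg, hη, hκ]
    have hscl : scl q (θ, e) = c := by rw [scl, hact]
    have hX := posX_eq hq (he0 θ)
    rw [hs, hκ, hscl, hdir, hperp] at hX
    simp only [foldKer, indicator_apply, mem_ofPred_eq, hκ]
    split_ifs with h2 h3
    · exact le_rfl
    -- The Euclidean ball lies in the cube that supports `foldKer`, since each coordinate is bounded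
    -- by the norm.
    · refine absurd ⟨?_, ?_, ?_⟩ h3
      · refine lt_of_le_of_lt (le_of_eq_of_le ?_ (PiLp.norm_apply_le _ 0)) h2
        rw [hX]; simp
      · refine lt_of_le_of_lt (le_of_eq_of_le ?_ (PiLp.norm_apply_le _ 1)) h2
        rw [hX]; simp
      · refine lt_of_le_of_lt (le_of_eq_of_le ?_ (PiLp.norm_apply_le _ 2)) h2
        rw [hX]; simp
    · exact bot_le
    · exact le_rfl
  · have := (measurable_kappa q).comp (by fun_prop : Measurable fun θ : E3 => (θ, e))
    exact Measurable.indicator (by fun_prop) (hms _ _)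

/-! ### Integrals of inverse powers -/

/-- If `ν {f < r} ≤ K r^{5/2}` for `r ≤ ℓ`, then `∫_{f < ℓ} f⁻² dν ≤ 16 K ℓ^{1/2}`. -/
theorem lintegral_inv_sq_le {α : Type*} [MeasurableSpace α] {ν : Measure α} {f : α → ℝ}
    (hf : Measurable f) {K ℓ : ℝ} (hK : 0 ≤ K) (hℓ : 0 < ℓ)
    (h : ∀ r, 0 < r → r ≤ ℓ → ν {x | f x < r} ≤ ENNReal.ofReal (K * r ^ 2 * √r)) :
    ∫⁻ x in {x | 0 < f x ∧ f x < ℓ}, ENNReal.ofReal (1 / f x ^ 2) ∂ν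
      ≤ ENNReal.ofReal (16 * K * √ℓ) := by
  set q : ℝ := 1 / √2 with hq
  have h2 : 0 < √2 := by positivity
  have hq0 : 0 ≤ q := by positivity
  have hq1 : q ≤ 3 / 4 := by
    rw [hq, div_le_div_iff₀ h2 (by norm_num)]
    have : (4 : ℝ) / 3 ≤ √2 := Real.le_sqrt_of_sq_le (by norm_num)
    linarith
  have hsub : {x | 0 < f x ∧ f x < ℓ} ⊆ ⋃ n : ℕ, {x | ℓ / 2 ^ (n + 1) ≤ f x ∧ f x < ℓ / 2 ^ n} := by
    rintro x ⟨h0, h1⟩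
    obtain ⟨n, hn1, hn2⟩ := exists_nat_pow_near (show 1 ≤ ℓ / f x by rw [one_le_div h0]; exact h1.le)
      (show (1 : ℝ) < 2 by norm_num)
    -- The dyadic shells are open at their outer end. If `f x` equals a dyadic fraction of `ℓ`, it
    -- belongs to the next larger shell, so the index drops by one; index zero is excluded by `f x <
    -- ℓ`.
    rcases eq_or_lt_of_le hn1 with e | hlt
    · rcases n with _ | n
      · rw [pow_zero, eq_comm, div_eq_one_iff_eq h0.ne'] at e; exact absurd h1 (by rw [e]; simp)
      · refine mem_iUnion.2 ⟨n, ?_, ?_⟩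
        · rw [e, div_div_cancel₀ hℓ.ne']
        · have : f x = ℓ / 2 ^ (n + 1) := by rw [e, div_div_cancel₀ hℓ.ne']
          rw [this]
          exact div_lt_div_of_pos_left hℓ (by positivity) (pow_lt_pow_right₀ (by norm_num) (by omega))
    · refine mem_iUnion.2 ⟨n, ?_, ?_⟩
      · rw [div_le_iff₀ (by positivity), mul_comm, ← div_le_iff₀ h0]; exact hn2.le
      · rw [lt_div_iff₀ (by positivity), mul_comm, ← lt_div_iff₀ h0]; exact hlt
  have hterm : ∀ n : ℕ, ∫⁻ x in {x | ℓ / 2 ^ (n + 1) ≤ f x ∧ f x < ℓ / 2 ^ n},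
      ENNReal.ofReal (1 / f x ^ 2) ∂ν ≤ ENNReal.ofReal (4 * K * √ℓ * q ^ n) := by
    intro n
    have hms : MeasurableSet {x | ℓ / 2 ^ (n + 1) ≤ f x ∧ f x < ℓ / 2 ^ n} := by
      rw [ofPred_and]
      exact (measurableSet_le measurable_const hf).inter (measurableSet_lt hf measurable_const)
    have hp : (0 : ℝ) < 2 ^ n := by positivity
    calc _ ≤ ∫⁻ x in {x | ℓ / 2 ^ (n + 1) ≤ f x ∧ f x < ℓ / 2 ^ n},
          ENNReal.ofReal (1 / (ℓ / 2 ^ (n + 1)) ^ 2) ∂ν := by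
          refine setLIntegral_mono' hms fun x hx => ENNReal.ofReal_le_ofReal ?_
          have : 0 < ℓ / 2 ^ (n + 1) := by positivity
          exact one_div_le_one_div_of_le (by positivity) (pow_le_pow_left₀ this.le hx.1 2)
      _ ≤ ENNReal.ofReal (1 / (ℓ / 2 ^ (n + 1)) ^ 2) * ν {x | f x < ℓ / 2 ^ n} := by
          rw [setLIntegral_const]
          exact mul_le_mul_right (measure_mono fun x hx => hx.2) _
      _ ≤ ENNReal.ofReal (1 / (ℓ / 2 ^ (n + 1)) ^ 2) * ENNReal.ofReal
          (K * (ℓ / 2 ^ n) ^ 2 * √(ℓ / 2 ^ n)) :=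
          mul_le_mul_right (h _ (by positivity) (div_le_self hℓ.le (one_le_pow₀ (by norm_num)))) _
      _ = _ := by
          rw [← ENNReal.ofReal_mul (by positivity)]
          congr 1
          rw [Real.sqrt_div hℓ.le, hq, one_div √2, inv_pow, pow_succ]
          have : √(2 ^ n : ℝ) = √2 ^ n := by
            rw [Real.sqrt_eq_iff_mul_self_eq (by positivity) (by positivity), ← mul_pow]
            norm_num
          rw [this]
          field_simp
          ring
  calc _ ≤ ∫⁻ x in ⋃ n : ℕ, {x | ℓ / 2 ^ (n + 1) ≤ f x ∧ f x < ℓ / 2 ^ n},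
        ENNReal.ofReal (1 / f x ^ 2) ∂ν := lintegral_mono_set hsub
    _ ≤ ∑' n : ℕ, ENNReal.ofReal (4 * K * √ℓ * q ^ n) :=
        (lintegral_iUnion_le _ _).trans (ENNReal.tsum_le_tsum hterm)
    _ = ENNReal.ofReal (∑' n : ℕ, 4 * K * √ℓ * q ^ n) := by
        rw [ENNReal.ofReal_tsum_of_nonneg (fun n => by positivity)]
        exact (summable_geometric_of_lt_one hq0 (by linarith)).mul_left _
    _ ≤ _ := by
        refine ENNReal.ofReal_le_ofReal ?_
        -- The ratio is `1/√2 ≤ 3/4`, so the geometric series sums to at most `4`; another `4` comes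
        -- from comparing inner and outer radius of a shell.
        rw [tsum_mul_left, tsum_geometric_of_lt_one hq0 (by linarith)]
        have : (1 - q)⁻¹ ≤ 4 := by
          rw [inv_le_comm₀ (by linarith) (by norm_num)]; linarith
        have h0 : 0 ≤ K * √ℓ := by positivity
        nlinarith

theorem measurable_posX_left (q : ℝ) (a : E3) : Measurable fun θ : E3 => posX q (θ, a) :=
  (measurable_posX q).comp (by fun_prop : Measurable fun θ : E3 => (θ, a))

theorem measurable_kappa_left (q : ℝ) (a : E3) : Measurable fun θ : E3 => kappa q (θ, a) :=
  (measurable_kappa q).comp (by fun_prop : Measurable fun θ : E3 => (θ, a))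

/-- The fold estimate for the time-shifted position. -/
theorem lintegral_posXt_ball_le {q : ℝ} (hq : 0 < q) (t : ℝ) {a : E3} (ha : a ≠ 0) (y : E3) {r : ℝ}
    (hr : 0 < r) :
    ∫⁻ θ in {θ | ‖y - posXt q t (θ, a)‖ < r}, ENNReal.ofReal (1 / (1 + kappa q (θ, a)))
      ≤ ENNReal.ofReal (1024 * (r ^ 3 + √(q / ‖a‖ ^ 2) * r ^ 2 * √r)) := by
  refine le_trans (le_of_eq ?_) (lintegral_posX_ball_le hq ha y hr)
  have hm1 := measurable_posX_left q a
  have hm2 := measurable_kappa_left q a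
  have hms : MeasurableSet {θ | ‖posX q (θ, a) - y‖ < r} :=
    measurableSet_lt (by fun_prop) measurable_const
  have hm3 : Measurable fun θ : E3 => posXt q t (θ, a) :=
    (measurable_posXt q t).comp (by fun_prop : Measurable fun θ : E3 => (θ, a))
  have hms' : MeasurableSet {θ | ‖y - posXt q t (θ, a)‖ < r} :=
    measurableSet_lt (by fun_prop) measurable_const
  rw [← lintegral_indicator hms, ← lintegral_indicator hms',
    ← (measurePreserving_add_right (volume : Measure E3) (t • a)).lintegral_comp
      (Measurable.indicator (by fun_prop) hms)]
  refine lintegral_congr fun θ => ?_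
  have h1 : posX q (θ + t • a, a) = posXt q t (θ, a) := rfl
  have h2 : kappa q (θ + t • a, a) = kappa q (θ, a) := kappa_shift q t (p := (θ, a)) ha
  simp only [indicator_apply, mem_ofPred_eq, h1, h2, norm_sub_rev y]

/-- The near-field integral at fixed action. -/
theorem lintegral_near_le {q : ℝ} (hq : 0 < q) (t : ℝ) {a : E3} (ha : a ≠ 0) (y : E3) {ℓ : ℝ}
    (hℓ : 0 < ℓ) :
    ∫⁻ θ in {θ | 0 < ‖y - posXt q t (θ, a)‖ ∧ ‖y - posXt q t (θ, a)‖ < ℓ},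
      ENNReal.ofReal (1 / ‖y - posXt q t (θ, a)‖ ^ 2 * (1 / (1 + kappa q (θ, a))))
      ≤ ENNReal.ofReal (32768 * (ℓ + q / ‖a‖ ^ 2)) := by
  set c := q / ‖a‖ ^ 2 with hc
  have hna := norm_pos_iff.2 ha
  have hc0 : 0 < c := by positivity
  have hm2 := measurable_kappa_left q a
  have hm3 : Measurable fun θ : E3 => posXt q t (θ, a) :=
    (measurable_posXt q t).comp (by fun_prop : Measurable fun θ : E3 => (θ, a))
  have hf : Measurable fun θ => ‖y - posXt q t (θ, a)‖ := by fun_prop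
  have hw : Measurable fun θ => ENNReal.ofReal (1 / (1 + kappa q (θ, a))) := by fun_prop
  have hms : ∀ r, MeasurableSet {θ | ‖y - posXt q t (θ, a)‖ < r} := fun r =>
    measurableSet_lt hf measurable_const
  have hms2 : MeasurableSet {θ | 0 < ‖y - posXt q t (θ, a)‖ ∧ ‖y - posXt q t (θ, a)‖ < ℓ} := by
    rw [ofPred_and]; exact (measurableSet_lt measurable_const hf).inter (hms ℓ)
  -- For `r ≤ ℓ` the regular part obeys `r³ ≤ √ℓ r^(5/2)`, so both parts of the fold estimate fit
  -- one power law with constant `1024(√ℓ + √c)`.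
  have := lintegral_inv_sq_le (ν := volume.withDensity
    (fun θ => ENNReal.ofReal (1 / (1 + kappa q (θ, a))))) hf (K := 1024 * (√ℓ + √c)) (by positivity) hℓ
    (fun r hr hrl => by
      rw [withDensity_apply _ (hms r)]
      refine (lintegral_posXt_ball_le hq t ha y hr).trans (ENNReal.ofReal_le_ofReal ?_)
      have e1 : r ^ 3 = √r * r ^ 2 * √r := by
        have := Real.mul_self_sqrt hr.le
        linear_combination (-r ^ 2) * this
      have e2 : √r ≤ √ℓ := Real.sqrt_le_sqrt hrl
      rw [e1]
      have : √r * r ^ 2 * √r ≤ √ℓ * r ^ 2 * √r := by gcongr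
      linarith)
  rw [setLIntegral_withDensity_eq_setLIntegral_mul _ hw (by fun_prop) hms2] at this
  refine le_trans (le_of_eq ?_) (this.trans (ENNReal.ofReal_le_ofReal ?_))
  · refine lintegral_congr fun θ => ?_
    rw [Pi.mul_apply, mul_comm (ENNReal.ofReal _), ENNReal.ofReal_mul (by positivity)]
  · have e1 := Real.sq_sqrt hℓ.le
    have e2 := Real.sq_sqrt hc0.le
    nlinarith [sq_nonneg (√ℓ - √c), sq_nonneg (√ℓ), sq_nonneg √c]

theorem finrank_E3 : Module.finrank ℝ E3 = 3 := by simp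

/-- `∫ S^{-7/2} dϑ = O(c³)` at fixed action. -/
theorem exists_lintegral_wS_le : ∃ C : ℝ, 0 ≤ C ∧ ∀ q : ℝ, 0 < q → ∀ a : E3, a ≠ 0 →
    ∫⁻ θ : E3, ENNReal.ofReal (wS q (θ, a) ^ (-(7 / 2) : ℝ))
      ≤ ENNReal.ofReal (C * (q / ‖a‖ ^ 2) ^ 3) := by
  have hint : Integrable (fun x : E3 => (1 + ‖x‖) ^ (-(7 / 2) : ℝ)) :=
    integrable_one_add_norm (by rw [finrank_E3]; norm_num)
  refine ⟨∫ x : E3, (1 + ‖x‖) ^ (-(7 / 2) : ℝ), integral_nonneg fun x => by positivity,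
    fun q hq a ha => ?_⟩
  set c := q / ‖a‖ ^ 2 with hc
  have hna := norm_pos_iff.2 ha
  have hc0 : 0 < c := by positivity
  have hsc : ∀ θ : E3, scl q (θ, a) = c := fun θ => rfl
  have h1 := Measure.integral_comp_inv_smul_of_nonneg volume
    (fun x : E3 => (1 + ‖x‖) ^ (-(7 / 2) : ℝ)) hc0.le
  have hint' : Integrable fun x : E3 => (1 + ‖c⁻¹ • x‖) ^ (-(7 / 2) : ℝ) :=
    hint.comp_smul (inv_ne_zero hc0.ne')
  calc _ ≤ ∫⁻ θ : E3, ENNReal.ofReal ((1 + ‖c⁻¹ • θ‖) ^ (-(7 / 2) : ℝ)) := by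
        refine lintegral_mono fun θ => ENNReal.ofReal_le_ofReal ?_
        refine Real.rpow_le_rpow_of_nonpos (by positivity) ?_ (by norm_num)
        have := one_add_norm_fst_div_le hq (p := (θ, a)) ha
        rw [hsc] at this
        rwa [norm_smul, norm_inv, Real.norm_of_nonneg hc0.le, ← div_eq_inv_mul]
    _ = ENNReal.ofReal (∫ θ : E3, (1 + ‖c⁻¹ • θ‖) ^ (-(7 / 2) : ℝ)) :=
        (ofReal_integral_eq_lintegral_ofReal hint'
          (Filter.Eventually.of_forall fun x => by positivity)).symm
    _ = _ := by rw [h1, finrank_E3, smul_eq_mul, mul_comm]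

/-- In polar coordinates the integrand becomes `s^(2 - 9/4) = s^(-1/4)` on `(0, 1)`. -/
theorem integrable_indicator_rpow : Integrable
    (fun x : E3 => (Iio (1 : ℝ)).indicator (fun s => s ^ (-(9 / 4) : ℝ)) ‖x‖) := by
  rw [integrable_fun_norm_addHaar volume
    (f := (Iio (1 : ℝ)).indicator (fun s => s ^ (-(9 / 4) : ℝ))), finrank_E3]
  have h1 : IntegrableOn (fun s : ℝ => s ^ (-(1 / 4) : ℝ)) (Ioc 0 1) :=
    (intervalIntegral.intervalIntegrable_rpow' (by norm_num)).1
  have h2 : Integrable ((Ioc (0 : ℝ) 1).indicator (fun s : ℝ => s ^ (-(1 / 4) : ℝ))) :=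
    h1.integrable_indicator measurableSet_Ioc
  refine h2.integrableOn.mono' ?_ ?_
  · exact (Measurable.aestronglyMeasurable (by
      have hm : Measurable ((Iio (1 : ℝ)).indicator (fun s : ℝ => s ^ (-(9 / 4) : ℝ))) :=
        Measurable.indicator (by fun_prop) measurableSet_Iio
      fun_prop))
  · refine (ae_restrict_iff' measurableSet_Ioi).2 (Filter.Eventually.of_forall fun s hs => ?_)
    have hs0 : 0 < s := hs
    by_cases h : s < 1
    · rw [indicator_of_mem (show s ∈ Iio 1 from h), indicator_of_mem (show s ∈ Ioc 0 1 from ⟨hs0, h.le⟩),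
        norm_smul, Real.norm_of_nonneg (by positivity), Real.norm_of_nonneg (by positivity),
        ← Real.rpow_natCast, ← Real.rpow_add hs0]
      norm_num
    · rw [indicator_of_notMem (show s ∉ Iio 1 from h), smul_zero, norm_zero]
      exact indicator_nonneg (fun x hx => Real.rpow_nonneg hx.1.le _) s

/-- `∫ (1 + |z - a|^{-9/4}) (1 + |a|)^{-4} da` is bounded uniformly in `z`. -/
theorem exists_lintegral_riesz_le : ∃ C : ℝ, 0 ≤ C ∧ ∀ z : E3,
    ∫⁻ a : E3, ENNReal.ofReal ((1 + ‖z - a‖ ^ (-(9 / 4) : ℝ)) * (1 + ‖a‖) ^ (-4 : ℝ))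
      ≤ ENNReal.ofReal C := by
  have hint : Integrable (fun x : E3 => (1 + ‖x‖) ^ (-4 : ℝ)) :=
    integrable_one_add_norm (by rw [finrank_E3]; norm_num)
  have hint2 := integrable_indicator_rpow
  have hnn : ∀ x : E3, 0 ≤ (Iio (1 : ℝ)).indicator (fun s => s ^ (-(9 / 4) : ℝ)) ‖x‖ := fun x => by
    rw [indicator_apply]; split_ifs <;> positivity
  refine ⟨(2 * ∫ x : E3, (1 + ‖x‖) ^ (-4 : ℝ)) + ∫ x : E3,
    (Iio (1 : ℝ)).indicator (fun s => s ^ (-(9 / 4) : ℝ)) ‖x‖, ?_, fun z => ?_⟩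
  · have h1 : 0 ≤ ∫ x : E3, (1 + ‖x‖) ^ (-4 : ℝ) := integral_nonneg fun x => by positivity
    have h2 := integral_nonneg (μ := volume) (f := fun x : E3 => (Iio (1 : ℝ)).indicator
      (fun s => s ^ (-(9 / 4) : ℝ)) ‖x‖) hnn
    linarith
  · have h1 := hint2.comp_sub_left z
    have h3 := integral_sub_left_eq_self (fun x : E3 =>
      (Iio (1 : ℝ)).indicator (fun s => s ^ (-(9 / 4) : ℝ)) ‖x‖) volume z
    have h6 := ofReal_integral_eq_lintegral_ofReal ((hint.const_mul 2).add h1)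
      (Filter.Eventually.of_forall fun x => add_nonneg (by positivity) (hnn _))
    rw [integral_add' (hint.const_mul 2) h1, h3, integral_const_mul] at h6
    rw [h6]
    refine lintegral_mono fun a => ENNReal.ofReal_le_ofReal ?_
    rw [Pi.add_apply]
    have h4 : 0 ≤ (1 + ‖a‖) ^ (-4 : ℝ) := by positivity
    have h5 : (1 + ‖a‖) ^ (-4 : ℝ) ≤ 1 :=
      Real.rpow_le_one_of_one_le_of_nonpos (by linarith [norm_nonneg a]) (by norm_num)
    by_cases h : ‖z - a‖ < 1
    · rw [indicator_of_mem (show ‖z - a‖ ∈ Iio 1 from h)]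
      have : 0 ≤ ‖z - a‖ ^ (-(9 / 4) : ℝ) := by positivity
      nlinarith
    · rw [indicator_of_notMem (show ‖z - a‖ ∉ Iio 1 from h)]
      have : ‖z - a‖ ^ (-(9 / 4) : ℝ) ≤ 1 :=
        Real.rpow_le_one_of_one_le_of_nonpos (not_lt.1 h) (by norm_num)
      nlinarith

/-! ### Power bounds -/

/-- `0 ≤ x ≤ A^m w^n`. -/
def PowBound (A w m n x : ℝ) : Prop := 0 ≤ x ∧ x ≤ A ^ m * w ^ n

namespace PowBound

variable {A w m n m' n' x y s : ℝ}

theorem one (A w : ℝ) : PowBound A w 0 0 1 := ⟨zero_le_one, by simp⟩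

theorem mul (hA : 0 < A) (hw : 0 < w) (hx : PowBound A w m n x) (hy : PowBound A w m' n' y) :
    PowBound A w (m + m') (n + n') (x * y) := by
  refine ⟨mul_nonneg hx.1 hy.1, ?_⟩
  rw [Real.rpow_add hA, Real.rpow_add hw]
  calc x * y ≤ (A ^ m * w ^ n) * (A ^ m' * w ^ n') := mul_le_mul hx.2 hy.2 hy.1 (by positivity)
    _ = _ := by ring

theorem rpow (hA : 0 < A) (hw : 0 < w) (hx : PowBound A w m n x) (hs : 0 ≤ s) :
    PowBound A w (m * s) (n * s) (x ^ s) := by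
  refine ⟨Real.rpow_nonneg hx.1 _, ?_⟩
  rw [Real.rpow_mul hA.le, Real.rpow_mul hw.le, ← Real.mul_rpow (by positivity) (by positivity)]
  exact Real.rpow_le_rpow hx.1 hx.2 hs

theorem pow (hA : 0 < A) (hw : 0 < w) (hx : PowBound A w m n x) (k : ℕ) :
    PowBound A w (m * k) (n * k) (x ^ k) := by
  rw [← Real.rpow_natCast x k]; exact hx.rpow hA hw (Nat.cast_nonneg k)

theorem mono (hA : 1 ≤ A) (hw : 1 ≤ w) (hx : PowBound A w m n x) (hm : m ≤ m') (hn : n ≤ n') :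
    PowBound A w m' n' x := by
  refine ⟨hx.1, hx.2.trans ?_⟩
  have : 0 < A := by linarith
  exact mul_le_mul (Real.rpow_le_rpow_of_exponent_le hA hm)
    (Real.rpow_le_rpow_of_exponent_le hw hn) (Real.rpow_nonneg (by linarith) _) (by positivity)

theorem of_le (hx : PowBound A w m n x) (hy0 : 0 ≤ y) (hy : y ≤ x) : PowBound A w m n y :=
  ⟨hy0, hy.trans hx.2⟩

theorem add (hA : 2 ≤ A) (hw : 0 < w) (hx : PowBound A w m n x) (hy : PowBound A w m n y) :
    PowBound A w (m + 1) n (x + y) := by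
  have hA0 : 0 < A := by linarith
  refine ⟨add_nonneg hx.1 hy.1, ?_⟩
  rw [Real.rpow_add hA0, Real.rpow_one]
  have h : 0 ≤ A ^ m * w ^ n := by positivity
  nlinarith [hx.2, hy.2]

theorem one_add (hA : 2 ≤ A) (hw : 1 ≤ w) (hm : 0 ≤ m) (hn : 0 ≤ n) (hx : PowBound A w m n x) :
    PowBound A w (m + 1) n (1 + x) :=
  ((one A w).mono (by linarith) hw hm hn).add hA (by linarith) hx

end PowBound

/-- The weight `ξ⁸ + a²⁰ + |η|²⁰ + λ¹⁰`. -/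
def wB (q : ℝ) (p : Phase) : ℝ := xi q p ^ 8 + act p ^ 20 + |eta q p| ^ 20 + lam p ^ 10

theorem act_nonneg (p : Phase) : 0 ≤ act p := norm_nonneg _
theorem lam_nonneg (p : Phase) : 0 ≤ lam p := norm_nonneg _

theorem xi_nonneg {q : ℝ} (hq : 0 < q) (p : Phase) : 0 ≤ xi q p := div_nonneg hq.le (act_nonneg p)

theorem xi_pos {q : ℝ} (hq : 0 < q) {p : Phase} (hp : p ∈ phaseSpace) : 0 < xi q p :=
  div_pos hq (act_pos hp)

/-- Since `ξ a = q`, the action and `ξ` cannot both be small, so the weight never degenerates. -/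
theorem min_le_wB {q : ℝ} (hq : 0 < q) {p : Phase} (hp : p ∈ phaseSpace) :
    min 1 (q ^ 8) ≤ wB q p := by
  have ha := act_pos hp
  have h1 : 0 ≤ act p ^ 20 := by positivity
  have h2 : 0 ≤ |eta q p| ^ 20 := by positivity
  have h3 : 0 ≤ lam p ^ 10 := pow_nonneg (lam_nonneg p) _
  have h4 : 0 ≤ xi q p ^ 8 := pow_nonneg (xi_nonneg hq p) _
  unfold wB
  rcases le_total (act p) 1 with h | h
  · refine (min_le_right _ _).trans ?_
    have : q ≤ xi q p := by rw [xi, le_div_iff₀ ha]; nlinarith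
    have := pow_le_pow_left₀ hq.le this 8
    linarith
  · refine (min_le_left _ _).trans ?_
    have : 1 ≤ act p ^ 20 := one_le_pow₀ h
    linarith

theorem le_rpow_of_pow_le {B x : ℝ} {n : ℕ} (hx : 0 ≤ x) (h : x ^ n ≤ B) (hn : n ≠ 0) :
    x ≤ B ^ ((n : ℝ)⁻¹) := by
  rw [← Real.pow_rpow_inv_natCast hx hn]
  exact Real.rpow_le_rpow (by positivity) h (by positivity)

/-- The gauge is the `80`th root of the normalized weight. Then `ξ⁸`, `a²⁰`, `|η|²⁰`, `λ¹⁰` are at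
most `w⁸⁰`, which gives the exponents `10`, `4`, `4`, `8`, and the target weight corresponds to the
exponent `80`. -/
theorem exists_gauge {q : ℝ} (hq : 0 < q) : ∃ K : ℝ, 0 < K ∧ ∀ p ∈ phaseSpace, ∃ w : ℝ, 1 ≤ w ∧
    w ^ (80 : ℝ) ≤ K * wB q p ∧ xi q p ≤ w ^ (10 : ℝ) ∧ act p ≤ w ^ (4 : ℝ)
      ∧ |eta q p| ≤ w ^ (4 : ℝ) ∧ lam p ≤ w ^ (8 : ℝ) := by
  set c0 : ℝ := min 1 (q ^ 8) with hc0
  have hc : 0 < c0 := by positivity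
  have hc1 : c0 ≤ 1 := min_le_left _ _
  refine ⟨c0⁻¹, by positivity, fun p hp => ?_⟩
  set B := c0⁻¹ * wB q p with hB
  have hB1 : 1 ≤ B := by
    rw [hB, ← div_eq_inv_mul, one_le_div hc]; exact min_le_wB hq hp
  have hw : wB q p ≤ B := by
    have h0 : 0 ≤ wB q p := hc.le.trans (min_le_wB hq hp)
    have : 1 ≤ c0⁻¹ := (one_le_inv₀ hc).2 hc1
    nlinarith
  have h1 : 0 ≤ act p ^ 20 := pow_nonneg (act_nonneg p) _
  have h2 : 0 ≤ |eta q p| ^ 20 := by positivity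
  have h3 : 0 ≤ lam p ^ 10 := pow_nonneg (lam_nonneg p) _
  have h4 : 0 ≤ xi q p ^ 8 := pow_nonneg (xi_nonneg hq p) _
  have hB0 : 0 ≤ B := by linarith
  unfold wB at hw
  refine ⟨B ^ ((80 : ℝ)⁻¹), Real.one_le_rpow hB1 (by norm_num), ?_, ?_, ?_, ?_, ?_⟩ <;>
    rw [← Real.rpow_mul hB0]
  · norm_num
  · exact (le_rpow_of_pow_le (B := B) (n := 8) (xi_nonneg hq p) (by linarith) (by norm_num)).trans_eq
      (by norm_num)
  · exact (le_rpow_of_pow_le (B := B) (n := 20) (act_nonneg p) (by linarith) (by norm_num)).trans_eq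
      (by norm_num)
  · exact (le_rpow_of_pow_le (B := B) (n := 20) (abs_nonneg _) (by linarith) (by norm_num)).trans_eq
      (by norm_num)
  · exact (le_rpow_of_pow_le (B := B) (n := 10) (lam_nonneg p) (by linarith) (by norm_num)).trans_eq
      (by norm_num)

theorem scl_eq {q : ℝ} (hq : 0 < q) (p : Phase) : scl q p = xi q p * xi q p * (1 / q) := by
  unfold scl xi; field_simp

theorem kappa_eq_div {q : ℝ} (hq : 0 < q) {p : Phase} (hp : p ∈ phaseSpace) :
    kappa q p = lam p / xi q p := by
  have := act_pos hp
  unfold kappa xi; field_simp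

theorem one_le_wS {q : ℝ} (hq : 0 < q) (p : Phase) : 1 ≤ wS q p := by
  have := kappa_nonneg hq p
  have := abs_nonneg (eta q p)
  unfold wS; linarith

set_option maxHeartbeats 1000000 in
/-- The three weight bounds behind the field estimate. -/
theorem exists_weight_le {q : ℝ} (hq : 0 < q) : ∃ C : ℝ, 0 < C ∧ ∀ p ∈ phaseSpace,
    (1 + (scl q p * wS q p) ^ (1 / 4 : ℝ)) * (scl q p ^ 3 * wS q p ^ (7 / 2 : ℝ)) * (1 + act p) ^ 8
      ≤ C * wB q p ∧
    (1 + (scl q p * wS q p) ^ (9 / 4 : ℝ)) * (scl q p * √(xi q p) + scl q p) * (1 + kappa q p)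
      * (1 + act p) ^ 8 ≤ C * wB q p ∧
    (1 + (scl q p * wS q p) ^ (9 / 4 : ℝ)) * (scl q p ^ 3 * wS q p ^ (7 / 2 : ℝ)) * (1 + act p) ^ 8
      ≤ C * wB q p * (scl q p * √(xi q p)) ^ 2 := by
  obtain ⟨K, hK, h⟩ := exists_gauge hq
  set A : ℝ := 2 + q + 1 / q with hA
  have hiq : 0 < 1 / q := by positivity
  have hA2 : 2 ≤ A := by linarith
  have hA1 : 1 ≤ A := by linarith
  have hA0 : 0 < A := by linarith
  have hAq : q ≤ A := by linarith
  have hAiq : 1 / q ≤ A := by linarith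
  -- `200` is a generous cap for the powers of the constant `A`; only the exponent of `w`, which
  -- must not exceed `80`, is delicate.
  refine ⟨A ^ (200 : ℝ) * K, by positivity, fun p hp => ?_⟩
  obtain ⟨w, hw1, hwB, bx, ba, be, bl⟩ := h p hp
  have hw0 : 0 < w := by linarith
  set x := xi q p with hx
  set a := act p with hadef
  set e := |eta q p| with hedef
  set l := lam p with hldef
  set c := scl q p with hcdef
  set k := kappa q p with hkdef
  set S := wS q p with hSdef
  have hSe : S = 1 + e + k := rfl
  have ha : 0 < a := act_pos hp
  have hx0 : 0 < x := xi_pos hq hp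
  have he : 0 ≤ e := abs_nonneg _
  have hl : 0 ≤ l := lam_nonneg p
  have hk : 0 ≤ k := kappa_nonneg hq p
  have hc : 0 < c := scl_pos hq hp
  have hS1 : 1 ≤ S := one_le_wS hq p
  have hS0 : 0 < S := by linarith
  have hkl : k = l / x := kappa_eq_div hq hp
  have hcx : c = x * x * (1 / q) := scl_eq hq p
  have hxa : x * a = q := by rw [hx, xi]; exact div_mul_cancel₀ _ ha.ne'
  have hB0 : 0 ≤ wB q p := le_trans (by positivity) (min_le_wB hq hp)
  have key : ∀ {m y : ℝ}, PowBound A w m 80 y → m ≤ 200 → y ≤ A ^ (200 : ℝ) * K * wB q p := by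
    intro m y hy hm
    have := (hy.mono (m' := 200) (n' := 80) hA1 hw1 hm le_rfl).2
    calc y ≤ _ := this
      _ ≤ A ^ (200 : ℝ) * (K * wB q p) := by gcongr
      _ = _ := by ring
  have pone : ∀ {y : ℝ}, 0 ≤ y → y ≤ A → PowBound A w 1 0 y := fun h0 h1 => ⟨h0, by simpa using h1⟩
  have px : PowBound A w 0 10 x := ⟨hx0.le, by simpa using bx⟩
  have pa : PowBound A w 0 4 a := ⟨ha.le, by simpa using ba⟩
  have pe : PowBound A w 0 4 e := ⟨he, by simpa using be⟩
  have pl : PowBound A w 0 8 l := ⟨hl, by simpa using bl⟩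
  have pq : PowBound A w 1 0 q := pone hq.le hAq
  have piq : PowBound A w 1 0 (1 / q) := pone hiq.le hAiq
  have p1e : PowBound A w 1 4 (1 + e) := (pe.one_add hA2 hw1 le_rfl (by norm_num)).mono hA1 hw1
    (by norm_num) le_rfl
  have p1a : PowBound A w 1 4 (1 + a) := (pa.one_add hA2 hw1 le_rfl (by norm_num)).mono hA1 hw1
    (by norm_num) le_rfl
  have hl2 : (c * √x) ^ 2 = c ^ 2 * x := by rw [mul_pow, Real.sq_sqrt hx0.le]
  -- the third bound, freed of its denominator
  have third : ∀ {m y : ℝ}, PowBound A w m 80 y → m ≤ 200 →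
      y = (1 + (c * S) ^ (9 / 4 : ℝ)) * S ^ (7 / 2 : ℝ) * (1 + a) ^ 8 * (x * (1 / q)) →
      (1 + (c * S) ^ (9 / 4 : ℝ)) * (c ^ 3 * S ^ (7 / 2 : ℝ)) * (1 + a) ^ 8
        ≤ A ^ (200 : ℝ) * K * wB q p * (c * √x) ^ 2 := by
    intro m y hy hm hyy
    have h1 := key hy hm
    rw [hl2]
    have h2 : c ^ 3 = c ^ 2 * x * (x * (1 / q)) := by rw [pow_succ, hcx]; ring
    calc _ = y * (c ^ 2 * x) := by rw [hyy, h2]; ring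
      _ ≤ _ := by gcongr
  -- For slow particles, `a ≤ q`, one has `ξ ≥ 1` and powers of `1 + a` are constants. For fast ones
  -- `ξ ≤ 1`, and powers of `1 + a` must be absorbed.
  rcases le_total a q with haq | haq
  · have hx1 : 1 ≤ x := by rw [hx, xi, one_le_div ha]; exact haq
    have p1a0 : PowBound A w 2 0 (1 + a) :=
      ((pone ha.le (haq.trans hAq)).one_add hA2 hw1 (by norm_num) le_rfl).mono hA1 hw1
        (by norm_num) le_rfl
    have psx : √x = x ^ (1 / 2 : ℝ) := Real.sqrt_eq_rpow x
    have hlc : c * √x + c ≤ 2 * (c * √x) := by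
      have : 1 ≤ √x := Real.one_le_sqrt.2 hx1
      nlinarith
    -- If `κ` is not dominated by `1 + |η|`, then `κ = λ/ξ ≥ 1` gives `ξ ≤ λ`. Hence `ξ` inherits
    -- the better power `w⁸`, and `ξ S ≤ 2λ`.
    rcases le_total k (1 + e) with hke | hke
    · have pS : PowBound A w 2 4 S :=
        ((p1e.add hA2 hw0 p1e).mono hA1 hw1 (by norm_num) le_rfl).of_le hS0.le (by linarith)
      have pc : PowBound A w 1 20 c := by
        rw [hcx]; exact ((px.mul hA0 hw0 px).mul hA0 hw0 piq).mono hA1 hw1 (by norm_num) (by norm_num)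
      have pcS := pc.mul hA0 hw0 pS
      have pQ := (pcS.rpow hA0 hw0 (s := 9 / 4) (by norm_num)).one_add hA2 hw1 (by norm_num) (by norm_num)
      have pQ' := (pcS.rpow hA0 hw0 (s := 1 / 4) (by norm_num)).one_add hA2 hw1 (by norm_num) (by norm_num)
      have pS7 := pS.rpow hA0 hw0 (s := 7 / 2) (by norm_num)
      have p8 := p1a0.pow hA0 hw0 8
      have pc3 := pc.pow hA0 hw0 3
      refine ⟨?_, ?_, ?_⟩
      · refine key ((((pQ'.mul hA0 hw0 (pc3.mul hA0 hw0 pS7)).mul hA0 hw0 p8)).mono hA1 hw1 le_rfl ?_)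
          ?_ <;> norm_num
      · -- `(c√x)(1+k) ≤ (1/q)(x^{5/2} + x^{3/2} l)`
        have e1 : (c * √x) * (1 + k) = (x ^ (5 / 2 : ℝ) + x ^ (3 / 2 : ℝ) * l) * (1 / q) := by
          rw [hkl, hcx, psx, show (5 / 2 : ℝ) = 2 + 1 / 2 by norm_num, show (3 / 2 : ℝ) = 1 + 1 / 2 by norm_num,
            Real.rpow_add hx0, Real.rpow_add hx0]
          norm_num
          field_simp
        have p1 := px.rpow hA0 hw0 (s := 5 / 2) (by norm_num)
        have p2 := (px.rpow hA0 hw0 (s := 3 / 2) (by norm_num)).mul hA0 hw0 pl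
        have p3 := ((p1.mono hA1 hw1 (m' := 0) (n' := 25) (by norm_num) (by norm_num)).add hA2 hw0
          (p2.mono hA1 hw1 (m' := 0) (n' := 25) (by norm_num) (by norm_num))).mul hA0 hw0 piq
        rw [← e1] at p3
        have p4 := p3.mul hA0 hw0 (pone (y := 2) (by norm_num) hA2)
        have p5 := p4.of_le (y := (c * √x + c) * (1 + k)) (by positivity) (by nlinarith)
        have p6 := (pQ.mul hA0 hw0 p5).mul hA0 hw0 p8
        rw [← mul_assoc] at p6
        refine key (p6.mono hA1 hw1 le_rfl ?_) ?_ <;> norm_num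
      · refine third ((((pQ.mul hA0 hw0 pS7).mul hA0 hw0 p8).mul hA0 hw0 (px.mul hA0 hw0 piq)).mono hA1 hw1
          le_rfl ?_) ?_ rfl <;> norm_num
    · have hxl : x ≤ l := by
        have : 1 ≤ k := by linarith
        rw [hkl, le_div_iff₀ hx0] at this; linarith
      have px8 : PowBound A w 0 8 x := pl.of_le hx0.le hxl
      have hS2 : S ≤ 2 * k := by linarith
      have p2 : PowBound A w 1 0 2 := pone (by norm_num) hA2
      have hk' : k = l * x⁻¹ := hkl
      have hS2l : x * S ≤ 2 * l := by
        calc x * S ≤ x * (2 * k) := by gcongr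
          _ = 2 * l := by rw [hkl]; field_simp
      have pxS : PowBound A w 1 8 (x * S) :=
        ((p2.mul hA0 hw0 pl).mono hA1 hw1 (by norm_num) (by norm_num)).of_le (by positivity) hS2l
      have pS : PowBound A w 1 8 S := pxS.of_le hS0.le (by nlinarith)
      have pcS : PowBound A w 2 16 (c * S) := by
        have : c * S = (x * S) * x * (1 / q) := by rw [hcx]; ring
        rw [this]
        exact ((pxS.mul hA0 hw0 px8).mul hA0 hw0 piq).mono hA1 hw1 (by norm_num) (by norm_num)
      have pc : PowBound A w 2 16 c := pcS.of_le hc.le (by nlinarith)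
      have pQ := (pcS.rpow hA0 hw0 (s := 9 / 4) (by norm_num)).one_add hA2 hw1 (by norm_num) (by norm_num)
      have pQ' := (pcS.rpow hA0 hw0 (s := 1 / 4) (by norm_num)).one_add hA2 hw1 (by norm_num) (by norm_num)
      have pS7 := pS.rpow hA0 hw0 (s := 7 / 2) (by norm_num)
      have p8 := p1a0.pow hA0 hw0 8
      have pc3 := pc.pow hA0 hw0 3
      have pS1 : PowBound A w 1 8 (1 + k) := pS.of_le (by positivity) (by linarith)
      refine ⟨?_, ?_, ?_⟩
      · refine key ((((pQ'.mul hA0 hw0 (pc3.mul hA0 hw0 pS7)).mul hA0 hw0 p8)).mono hA1 hw1 le_rfl ?_)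
          ?_ <;> norm_num
      · have p4 : PowBound A w 3 20 (c * √x + c) := by
          have q1 := (pc.mul hA0 hw0 (px8.rpow hA0 hw0 (s := 1 / 2) (by norm_num))).mul hA0 hw0 p2
          refine (q1.mono hA1 hw1 (by norm_num) (by norm_num)).of_le (by positivity) ?_
          rw [← psx]; linarith
        have p6 := ((pQ.mul hA0 hw0 p4).mul hA0 hw0 pS1).mul hA0 hw0 p8
        refine key (p6.mono hA1 hw1 le_rfl ?_) ?_ <;> norm_num
      · refine third ((((pQ.mul hA0 hw0 pS7).mul hA0 hw0 p8).mul hA0 hw0 (px8.mul hA0 hw0 piq)).mono hA1 hw1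
          le_rfl ?_) ?_ rfl <;> norm_num
  · have hx1 : x ≤ 1 := by rw [hx, xi, div_le_one ha]; exact haq
    have hAa : 1 ≤ A * a := by
      calc 1 = 1 / q * q := by field_simp
        _ ≤ A * a := by gcongr
    -- Since `c a² = q`, each factor `c` absorbs two powers of `1 + a` without any cost in `w`.
    have pca : PowBound A w 5 0 (c * (1 + a) ^ 2) := by
      have e0 : c * a ^ 2 = q := by
        rw [hcdef, scl]; exact div_mul_cancel₀ _ (by positivity)
      refine ⟨by positivity, ?_⟩
      have e1 : 1 + a ≤ 2 * A * a := by nlinarith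
      have e2 : c * (1 + a) ^ 2 ≤ c * (2 * A * a) ^ 2 := by gcongr
      have e3 : c * (2 * A * a) ^ 2 = 4 * A ^ 2 * q := by rw [← e0]; ring
      have e4 : 4 * A ^ 2 * q ≤ A ^ 2 * A ^ 2 * A := by
        have : 4 ≤ A ^ 2 := by nlinarith
        gcongr
      have e5 : A ^ (5 : ℝ) * w ^ (0 : ℝ) = A ^ 2 * A ^ 2 * A := by
        rw [Real.rpow_zero, mul_one, show (5 : ℝ) = ((5 : ℕ) : ℝ) by norm_num, Real.rpow_natCast]; ring
      rw [e5]; linarith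
    have pk : PowBound A w 1 12 k := by
      have hkal : k = a * l * (1 / q) := by
        rw [hkdef, kappa]
        ring
      rw [hkal]
      exact ((pa.mul hA0 hw0 pl).mul hA0 hw0 piq).mono hA1 hw1 (by norm_num) (by norm_num)
    have pS : PowBound A w 2 12 S := by
      rw [hSe]
      exact ((p1e.mono hA1 hw1 le_rfl (by norm_num)).add hA2 hw0 pk).mono hA1 hw1 (by norm_num) le_rfl
    have pS7 := pS.rpow hA0 hw0 (s := 7 / 2) (by norm_num)
    have h1a : 1 ≤ 1 + a := by linarith
    have pc : PowBound A w 5 0 c := pca.of_le hc.le (by nlinarith [one_le_pow₀ h1a (n := 2)])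
    have pcS := pc.mul hA0 hw0 pS
    have pQ := (pcS.rpow hA0 hw0 (s := 9 / 4) (by norm_num)).one_add hA2 hw1 (by norm_num) (by norm_num)
    have pQ' := (pcS.rpow hA0 hw0 (s := 1 / 4) (by norm_num)).one_add hA2 hw1 (by norm_num) (by norm_num)
    refine ⟨?_, ?_, ?_⟩
    · have p6 := ((pQ'.mul hA0 hw0 pS7).mul hA0 hw0 (pca.pow hA0 hw0 3)).mul hA0 hw0 (p1a.pow hA0 hw0 2)
      have e1 : (1 + (c * S) ^ (1 / 4 : ℝ)) * (c ^ 3 * S ^ (7 / 2 : ℝ)) * (1 + a) ^ 8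
        = (1 + (c * S) ^ (1 / 4 : ℝ)) * S ^ (7 / 2 : ℝ) * (c * (1 + a) ^ 2) ^ 3 * (1 + a) ^ 2 := by ring
      rw [e1]
      refine key (p6.mono hA1 hw1 le_rfl ?_) ?_ <;> norm_num
    · have pS1 : PowBound A w 2 12 (1 + k) := pS.of_le (by positivity) (by linarith)
      have h2 : √x ≤ 1 := Real.sqrt_le_one.2 hx1
      have p2 : PowBound A w 1 0 (√x + 1) := pone (by positivity) (by linarith)
      have p6 := (((pQ.mul hA0 hw0 p2).mul hA0 hw0 pS1).mul hA0 hw0 pca).mul hA0 hw0 (p1a.pow hA0 hw0 6)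
      have e1 : (1 + (c * S) ^ (9 / 4 : ℝ)) * (c * √x + c) * (1 + k) * (1 + a) ^ 8
        = (1 + (c * S) ^ (9 / 4 : ℝ)) * (√x + 1) * (1 + k) * (c * (1 + a) ^ 2) * (1 + a) ^ 6 := by ring
      rw [e1]
      refine key (p6.mono hA1 hw1 le_rfl ?_) ?_ <;> norm_num
    · have hx' : x * (1 / q) * (1 + a) ≤ 1 + 1 / q := by
        have : x * (1 / q) * a = 1 := by
          rw [mul_right_comm, hxa]; field_simp
        nlinarith
      have pxa : PowBound A w 1 0 (x * (1 / q) * (1 + a)) := pone (by positivity) (by linarith)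
      -- split `Q = 1 + (cS)^{9/4}`
      have q1 := (pS7.mul hA0 hw0 (p1a.pow hA0 hw0 7)).mul hA0 hw0 pxa
      have q2 := (((pca.rpow hA0 hw0 (s := 9 / 4) (by norm_num)).mul hA0 hw0
        (pS.rpow hA0 hw0 (s := 23 / 4) (by norm_num))).mul hA0 hw0
          (p1a.rpow hA0 hw0 (s := 5 / 2) (by norm_num))).mul hA0 hw0 pxa
      have q3 := (q1.mono hA1 hw1 (m' := 100) (n' := 80) (by norm_num) (by norm_num)).add hA2 hw0
        (q2.mono hA1 hw1 (m' := 100) (n' := 80) (by norm_num) (by norm_num))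
      refine third q3 (by norm_num) ?_
      have e1 : (c * S) ^ (9 / 4 : ℝ) * S ^ (7 / 2 : ℝ) * (1 + a) ^ 7
          = (c * (1 + a) ^ 2) ^ (9 / 4 : ℝ) * S ^ (23 / 4 : ℝ) * (1 + a) ^ (5 / 2 : ℝ) := by
        rw [Real.mul_rpow hc.le hS0.le, Real.mul_rpow hc.le (by positivity),
          ← Real.rpow_natCast (1 + a) 2, ← Real.rpow_mul (by positivity),
          ← Real.rpow_natCast (1 + a) 7, show (23 / 4 : ℝ) = 9 / 4 + 7 / 2 by norm_num,
          Real.rpow_add hS0, show ((7 : ℕ) : ℝ) = ((2 : ℕ) : ℝ) * (9 / 4) + 5 / 2 by norm_num,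
          Real.rpow_add (by positivity)]
        ring
      rw [← e1]; ring

/-! ### The Coulomb kernel -/

theorem abs_apply_le (x : E3) (j : Fin 3) : |x j| ≤ ‖x‖ := by
  simpa using PiLp.norm_apply_le x j

theorem abs_coulombKernel_le (j : Fin 3) (b : E3) : |coulombKernel j b| ≤ 1 / ‖b‖ ^ 2 := by
  unfold coulombKernel
  rcases eq_or_ne b 0 with rfl | hb
  · simp
  have h := norm_pos_iff.2 hb
  rw [abs_div, abs_of_pos (pow_pos h 3), div_le_div_iff₀ (pow_pos h 3) (pow_pos h 2)]
  have := abs_apply_le b j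
  have h2 : 0 ≤ ‖b‖ ^ 2 := by positivity
  nlinarith

theorem abs_coulombKernel_sub_le_of_near (j : Fin 3) {b d : E3} (hd : d ≠ 0)
    (h : 2 * ‖b - d‖ ≤ ‖d‖) :
    |coulombKernel j b - coulombKernel j d| ≤ 46 * (‖b - d‖ / ‖d‖ ^ 3) := by
  have hd0 := norm_pos_iff.2 hd
  set M := ‖b - d‖ with hM
  set y := ‖d‖ with hy
  set x := ‖b‖ with hx
  have hM0 : 0 ≤ M := norm_nonneg _
  have h1 : |x - y| ≤ M := abs_norm_sub_norm_le b d
  obtain ⟨h1a, h1b⟩ := abs_le.1 h1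
  have hx0 : 0 < x := by linarith
  have h2 : |b j - d j| ≤ M := by
    have := abs_apply_le (b - d) j
    rwa [PiLp.sub_apply] at this
  have h3 := abs_apply_le d j
  -- The numerator is varied first, then the cubic denominator. Since `|b| ≥ |d|/2`, the two parts
  -- cost `8` and `8(1 + 3/2 + 9/4) = 38`.
  have e : coulombKernel j b - coulombKernel j d
      = (b j - d j) / x ^ 3 + d j * ((y - x) * (y ^ 2 + x * y + x ^ 2)) / (x ^ 3 * y ^ 3) := by
    unfold coulombKernel; rw [← hx, ← hy]; field_simp; ring
  have hxy : y / 2 ≤ x := by linarith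
  have hx3 : y ^ 3 / 8 ≤ x ^ 3 := by
    have := pow_le_pow_left₀ (by positivity) hxy 3
    calc y ^ 3 / 8 = (y / 2) ^ 3 := by ring
      _ ≤ _ := this
  rw [e]
  refine (abs_add_le _ _).trans ?_
  have t1 : |(b j - d j) / x ^ 3| ≤ 8 * (M / y ^ 3) := by
    rw [abs_div, abs_of_pos (pow_pos hx0 3)]
    calc |b j - d j| / x ^ 3 ≤ M / (y ^ 3 / 8) := by gcongr
      _ = _ := by field_simp
  have t2 : |d j * ((y - x) * (y ^ 2 + x * y + x ^ 2)) / (x ^ 3 * y ^ 3)| ≤ 38 * (M / y ^ 3) := by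
    rw [abs_div, abs_mul, abs_mul, abs_of_pos (show 0 < x ^ 3 * y ^ 3 by positivity),
      abs_of_pos (show 0 < y ^ 2 + x * y + x ^ 2 by positivity), abs_sub_comm y x]
    have hx2 : x ≤ 3 / 2 * y := by linarith
    calc |d j| * (|x - y| * (y ^ 2 + x * y + x ^ 2)) / (x ^ 3 * y ^ 3)
        ≤ y * (M * (y ^ 2 + 3 / 2 * y * y + (3 / 2 * y) ^ 2)) / (y ^ 3 / 8 * y ^ 3) := by
          gcongr
      _ = 38 * (M / y ^ 3) := by field_simp; ring
  linarith

/-- The difference of two Coulomb kernels, with a free Hölder exponent. -/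
theorem abs_coulombKernel_sub_le (j : Fin 3) (b : E3) {d : E3} (hd : d ≠ 0) {θ : ℝ} (h0 : 0 ≤ θ)
    (h1 : θ ≤ 1) :
    |coulombKernel j b - coulombKernel j d|
      ≤ 46 * ‖d‖ ^ (-(2 + θ)) * (‖b - d‖ ^ θ + ‖b - d‖ ^ (2 + θ) * (1 / ‖b‖ ^ 2)) := by
  have hd0 := norm_pos_iff.2 hd
  have hM0 : 0 ≤ ‖b - d‖ := norm_nonneg _
  set M := ‖b - d‖ with hM
  set y := ‖d‖ with hy
  have hyk : y ^ (-(2 + θ)) = y ^ (-θ) / y ^ 2 := by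
    rw [show -(2 + θ) = -θ - (2 : ℕ) by push_cast; ring, Real.rpow_sub hd0, Real.rpow_natCast]
  have hb0 : 0 ≤ 1 / ‖b‖ ^ 2 := by positivity
  -- If the displacement is small compared with `d`, the Lipschitz bound is weakened to exponent
  -- `θ`. Otherwise `2M/|d| ≥ 1`, and the two kernels are estimated separately after multiplying by
  -- its power `2 + θ` and `θ` respectively.
  rcases le_total (2 * M) y with h | h
  · refine (abs_coulombKernel_sub_le_of_near j hd h).trans ?_
    have e1 : M / y ≤ M ^ θ * y ^ (-θ) := by
      rw [Real.rpow_neg hd0.le, ← div_eq_mul_inv, ← Real.div_rpow hM0 hd0.le]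
      exact Real.self_le_rpow_of_le_one (by positivity) (by rw [div_le_one hd0]; linarith) h1
    have e2 : M / y ^ 3 ≤ y ^ (-(2 + θ)) * M ^ θ := by
      rw [hyk]
      calc M / y ^ 3 = M / y / y ^ 2 := by field_simp
        _ ≤ M ^ θ * y ^ (-θ) / y ^ 2 := by gcongr
        _ = _ := by ring
    have e3 : 0 ≤ y ^ (-(2 + θ)) * (M ^ (2 + θ) * (1 / ‖b‖ ^ 2)) := by positivity
    linarith
  · have hMp : 0 < M := by linarith
    have e1 : 1 ≤ (2 * M) ^ θ * y ^ (-θ) := by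
      rw [Real.rpow_neg hd0.le, ← div_eq_mul_inv, ← Real.div_rpow (by positivity) hd0.le]
      exact Real.one_le_rpow ((one_le_div hd0).2 h) h0
    have e2 : 1 ≤ (2 * M) ^ (2 + θ) * y ^ (-(2 + θ)) := by
      rw [Real.rpow_neg hd0.le, ← div_eq_mul_inv, ← Real.div_rpow (by positivity) hd0.le]
      exact Real.one_le_rpow ((one_le_div hd0).2 h) (by linarith)
    have e3 : (2 * M) ^ θ ≤ 2 * M ^ θ := by
      rw [Real.mul_rpow (by norm_num) hM0]
      have : (2 : ℝ) ^ θ ≤ 2 ^ (1 : ℝ) := Real.rpow_le_rpow_of_exponent_le (by norm_num) h1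
      rw [Real.rpow_one] at this
      gcongr
    have e4 : (2 * M) ^ (2 + θ) ≤ 8 * M ^ (2 + θ) := by
      rw [Real.mul_rpow (by norm_num) hM0]
      have : (2 : ℝ) ^ (2 + θ) ≤ 2 ^ (3 : ℝ) :=
        Real.rpow_le_rpow_of_exponent_le (by norm_num) (by linarith)
      have h8 : (2 : ℝ) ^ (3 : ℝ) = 8 := by
        rw [show (3 : ℝ) = ((3 : ℕ) : ℝ) by norm_num, Real.rpow_natCast]; norm_num
      rw [h8] at this
      gcongr
    have p1 := abs_coulombKernel_le j b
    have p2 := abs_coulombKernel_le j d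
    have p3 : |coulombKernel j b| ≤ 8 * y ^ (-(2 + θ)) * (M ^ (2 + θ) * (1 / ‖b‖ ^ 2)) := by
      have : 0 ≤ y ^ (-(2 + θ)) := by positivity
      calc _ ≤ 1 * (1 / ‖b‖ ^ 2) := by linarith
        _ ≤ (8 * M ^ (2 + θ) * y ^ (-(2 + θ))) * (1 / ‖b‖ ^ 2) := by
            gcongr; nlinarith
        _ = _ := by ring
    have p4 : |coulombKernel j d| ≤ 2 * y ^ (-(2 + θ)) * M ^ θ := by
      rw [hyk]
      have : 0 ≤ y ^ (-θ) := by positivity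
      calc _ ≤ 1 * (1 / y ^ 2) := by linarith
        _ ≤ (2 * M ^ θ * y ^ (-θ)) * (1 / y ^ 2) := by
            gcongr; nlinarith
        _ = _ := by ring
    have p5 := abs_sub (coulombKernel j b) (coulombKernel j d)
    have p6 : 0 ≤ y ^ (-(2 + θ)) * M ^ θ := by positivity
    have p7 : 0 ≤ y ^ (-(2 + θ)) * (M ^ (2 + θ) * (1 / ‖b‖ ^ 2)) := by positivity
    linarith

theorem measurable_coulombKernel (j : Fin 3) : Measurable (coulombKernel j) := by
  unfold coulombKernel; fun_prop

/-! ### Radial cutoffs and the representation of the Coulomb kernel -/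

/-- The profile of a radial function. -/
def prof (φ : E3 → ℝ) (s : ℝ) : ℝ := φ (s • EuclideanSpace.single 0 1)

variable {φ : E3 → ℝ}

theorem norm_smul_single (s : ℝ) : ‖(s • EuclideanSpace.single 0 1 : E3)‖ = |s| := by
  simp [norm_smul]

theorem eq_prof (hφ : IsStandardCutoff φ) (x : E3) : φ x = prof φ ‖x‖ :=
  hφ.radial _ _ (by rw [norm_smul_single, abs_norm])

theorem contDiff_prof (hφ : IsStandardCutoff φ) : ContDiff ℝ ∞ (prof φ) :=
  hφ.smooth.comp (contDiff_id.smul contDiff_const)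

theorem prof_eq_zero (hφ : IsStandardCutoff φ) {s : ℝ} (hs : s < 1 / 2 ∨ 2 < s) (h0 : 0 ≤ s) :
    prof φ s = 0 := by
  by_contra h
  have h1 := hφ.support_subset (subset_tsupport _ (show _ ∈ Function.support φ from h))
  have h2 := mem_ofPred.1 h1
  rw [norm_smul_single, abs_of_nonneg h0] at h2
  rcases hs with hs | hs <;> linarith

theorem pd_eq_prof (hφ : IsStandardCutoff φ) (j : Fin 3) {x : E3} (hx : x ≠ 0) :
    pd j φ x = deriv (prof φ) ‖x‖ * (x j / ‖x‖) := by
  have hx0 := norm_pos_iff.2 hx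
  have h1 : HasFDerivAt (fun x : E3 => ‖x‖) (‖x‖⁻¹ • innerSL ℝ x) x := by
    have h := ((hasStrictFDerivAt_norm_sq x).hasFDerivAt).sqrt (by positivity)
    simp only [Real.sqrt_sq (norm_nonneg _)] at h
    refine h.congr_fderiv ?_
    ext v
    simp
    field_simp
  have h2 : HasDerivAt (prof φ) (deriv (prof φ) ‖x‖) ‖x‖ :=
    ((contDiff_prof hφ).differentiable (by norm_num)).differentiableAt.hasDerivAt
  have h3 := h2.comp_hasFDerivAt x h1
  have h4 : (prof φ ∘ fun x : E3 => ‖x‖) = φ := by ext x; exact (eq_prof hφ x).symm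
  rw [h4] at h3
  rw [pd, h3.fderiv]
  simp [EuclideanSpace.inner_single_right]
  left; ring

theorem pd_eq_zero_of_norm (hφ : IsStandardCutoff φ) (j : Fin 3) {x : E3}
    (hx : ‖x‖ < 1 / 2 ∨ 2 < ‖x‖) : pd j φ x = 0 := by
  have h : x ∉ tsupport φ := fun h => by
    have := mem_ofPred.1 (hφ.support_subset h)
    rcases hx with hx | hx <;> linarith
  have := fderiv_of_notMem_tsupport (𝕜 := ℝ) h
  rw [pd, this]; rfl

theorem integral_prof (hφ : IsStandardCutoff φ) :
    4 * Real.pi * ∫ s in Ioi (0 : ℝ), prof φ s = 1 := by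
  have h := hφ.normalized
  have e : (fun x : E3 => φ x / ‖x‖ ^ 2) = fun x : E3 => (fun s => prof φ s / s ^ 2) ‖x‖ := by
    ext x; rw [eq_prof hφ x]
  rw [e, integral_fun_norm_addHaar volume (fun s => prof φ s / s ^ 2), finrank_E3] at h
  have e2 : ∫ y in Ioi (0 : ℝ), y ^ (3 - 1) • (prof φ y / y ^ 2) = ∫ s in Ioi (0 : ℝ), prof φ s := by
    refine setIntegral_congr_fun measurableSet_Ioi fun y hy => ?_
    have : (0 : ℝ) < y := hy
    simp only [smul_eq_mul]; field_simp; ring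
  rw [e2] at h
  rw [← h]
  have hv : volume.real (Metric.ball (0 : E3) 1) = 4 / 3 * Real.pi := by
    rw [measureReal_def, EuclideanSpace.volume_ball_fin_three]
    rw [ENNReal.toReal_mul, ENNReal.toReal_ofReal (by positivity)]
    simp
    ring
  rw [hv, nsmul_eq_mul, smul_eq_mul]
  push_cast; ring

theorem prof_abs (hφ : IsStandardCutoff φ) (s : ℝ) : prof φ |s| = prof φ s :=
  hφ.radial _ _ (by rw [norm_smul_single, norm_smul_single, abs_abs])

theorem hasCompactSupport_prof (hφ : IsStandardCutoff φ) : HasCompactSupport (prof φ) := by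
  refine HasCompactSupport.of_support_subset_isCompact (isCompact_Icc (a := -2) (b := 2)) fun s hs => ?_
  by_contra h
  refine hs ?_
  rw [← prof_abs hφ]
  refine prof_eq_zero hφ (Or.inr ?_) (abs_nonneg _)
  by_contra h2
  exact h (abs_le.1 (not_lt.1 h2))

theorem continuous_deriv_prof (hφ : IsStandardCutoff φ) : Continuous (deriv (prof φ)) :=
  (contDiff_prof hφ).continuous_deriv (by norm_num)

/-- Integration by parts turns the integral into minus the integral of the profile, which the
normalization of the cutoff fixes as `1/(4π)`. -/
theorem integral_mul_deriv_prof (hφ : IsStandardCutoff φ) :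
    IntegrableOn (fun s => s * deriv (prof φ) s) (Ioi 0) ∧
    ∫ s in Ioi (0 : ℝ), s * deriv (prof φ) s = -(1 / (4 * Real.pi)) := by
  have hc := hasCompactSupport_prof hφ
  have hd := contDiff_prof hφ
  have i1 : Integrable (prof φ) := hd.continuous.integrable_of_hasCompactSupport hc
  have i2 : Integrable (fun s => s * deriv (prof φ) s) :=
    (continuous_id.mul (continuous_deriv_prof hφ)).integrable_of_hasCompactSupport
      (hc.deriv.mul_left)
  refine ⟨i2.integrableOn, ?_⟩
  have h1 : ∀ s, deriv (fun s => s * prof φ s) s = prof φ s + s * deriv (prof φ) s := fun s => by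
    have := (hasDerivAt_id s).mul (hd.differentiable (by norm_num)).differentiableAt.hasDerivAt
    change deriv (id * prof φ) s = _
    simpa using this.deriv
  have h2 := HasCompactSupport.integral_Ioi_deriv_eq (f := fun s => s * prof φ s)
    (contDiff_id.mul (hd.of_le (by norm_num))) (hc.mul_left) 0
  simp only [h1] at h2
  rw [integral_add i1.integrableOn i2.integrableOn] at h2
  have h3 := integral_prof hφ
  have : ∫ s in Ioi (0 : ℝ), prof φ s = 1 / (4 * Real.pi) := by
    rw [eq_div_iff (by positivity)]; linarith
  rw [this] at h2
  linarith

/-- `∫₀^∞ R⁻³ h(x/R) dR = x⁻² ∫₀^∞ s h(s) ds`. -/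
theorem integral_scale (h : ℝ → ℝ) {x : ℝ} (hx : 0 < x) (hi : IntegrableOn (fun s => s * h s) (Ioi 0)) :
    IntegrableOn (fun R : ℝ => (R ^ 3)⁻¹ * h (R⁻¹ * x)) (Ioi 0) ∧
    ∫ R in Ioi (0 : ℝ), (R ^ 3)⁻¹ * h (R⁻¹ * x) = (x ^ 2)⁻¹ * ∫ s in Ioi (0 : ℝ), s * h s := by
  -- Substitution `s = R⁻¹`, followed by a dilation by `x`.
  have e1 : EqOn (fun R : ℝ => (|(-1 : ℝ)| * R ^ ((-1 : ℝ) - 1)) • (fun s => s * h (x * s)) (R ^ (-1 : ℝ)))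
      (fun R : ℝ => (R ^ 3)⁻¹ * h (R⁻¹ * x)) (Ioi 0) := by
    intro R hR
    have : (0 : ℝ) < R := hR
    have e : R ^ ((-1 : ℝ) - 1) = (R ^ 2)⁻¹ := by
      rw [show (-1 : ℝ) - 1 = -(2 : ℕ) by norm_num, Real.rpow_neg this.le, Real.rpow_natCast]
    simp only [e, Real.rpow_neg_one, smul_eq_mul, abs_neg, abs_one, one_mul]
    rw [mul_comm x]; field_simp
  have e2 : (fun s => s * h (x * s)) = fun s => x⁻¹ * ((fun s => s * h s) (x * s)) := by
    ext s; field_simp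
  have i1 : IntegrableOn (fun s => (fun s => s * h s) (x * s)) (Ioi 0) := by
    have := (integrableOn_Ioi_comp_mul_left_iff (fun s => s * h s) 0 hx).2 (by simpa using hi)
    exact this
  have i2 : IntegrableOn (fun s => s * h (x * s)) (Ioi 0) := by rw [e2]; exact i1.const_mul _
  refine ⟨?_, ?_⟩
  · refine IntegrableOn.congr_fun ?_ e1 measurableSet_Ioi
    exact (integrableOn_Ioi_comp_rpow_iff (fun s => s * h (x * s)) (by norm_num)).2 i2
  · have e3 := integral_comp_rpow_Ioi (fun s => s * h (x * s)) (p := -1) (by norm_num)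
    rw [← setIntegral_congr_fun measurableSet_Ioi e1, e3, e2,
      integral_const_mul, integral_comp_mul_left_Ioi (fun s => s * h s) 0 hx, mul_zero, smul_eq_mul]
    ring

theorem continuous_pd (hφ : IsStandardCutoff φ) (j : Fin 3) : Continuous (pd j φ) :=
  (hφ.smooth.continuous_fderiv (by norm_num)).clm_apply continuous_const

theorem pd_scale (hφ : IsStandardCutoff φ) (j : Fin 3) {x : E3} (hx : x ≠ 0) {R : ℝ} (hR : 0 < R) :
    pd j φ (R⁻¹ • x) = deriv (prof φ) (R⁻¹ * ‖x‖) * (x j / ‖x‖) := by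
  have h0 := norm_pos_iff.2 hx
  rw [pd_eq_prof hφ j (smul_ne_zero (inv_ne_zero hR.ne') hx), norm_smul, norm_inv,
    Real.norm_of_nonneg hR.le, PiLp.smul_apply, smul_eq_mul]
  field_simp

theorem pd_zero (hφ : IsStandardCutoff φ) (j : Fin 3) : pd j φ 0 = 0 :=
  pd_eq_zero_of_norm hφ j (Or.inl (by simp))

/-- The Littlewood–Paley type representation of the Coulomb kernel. -/
theorem integral_pd_scale (hφ : IsStandardCutoff φ) (j : Fin 3) (x : E3) :
    IntegrableOn (fun R : ℝ => (R ^ 3)⁻¹ * pd j φ (R⁻¹ • x)) (Ioi 0) ∧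
    ∫ R in Ioi (0 : ℝ), (R ^ 3)⁻¹ * pd j φ (R⁻¹ • x) = -(1 / (4 * Real.pi)) * coulombKernel j x := by
  rcases eq_or_ne x 0 with rfl | hx
  · simp [pd_zero hφ, coulombKernel]
  have h0 := norm_pos_iff.2 hx
  obtain ⟨h1, h2⟩ := integral_mul_deriv_prof hφ
  obtain ⟨h3, h4⟩ := integral_scale (deriv (prof φ)) h0 h1
  have e : EqOn (fun R : ℝ => (R ^ 3)⁻¹ * deriv (prof φ) (R⁻¹ * ‖x‖) * (x j / ‖x‖))
      (fun R : ℝ => (R ^ 3)⁻¹ * pd j φ (R⁻¹ • x)) (Ioi 0) := fun R hR => by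
    simp only [pd_scale hφ j hx (show 0 < R from hR)]; ring
  refine ⟨IntegrableOn.congr_fun (h3.mul_const _) e measurableSet_Ioi, ?_⟩
  rw [← setIntegral_congr_fun measurableSet_Ioi e, integral_mul_const, h4, h2, coulombKernel]
  field_simp

/-- The absolute version of the scale representation; it justifies Fubini for densities against
which `|x|⁻²` is integrable. -/
theorem integral_abs_pd_scale_le (hφ : IsStandardCutoff φ) (j : Fin 3) (x : E3) :
    ∫ R in Ioi (0 : ℝ), |(R ^ 3)⁻¹ * pd j φ (R⁻¹ • x)|
      ≤ (∫ s in Ioi (0 : ℝ), |s * deriv (prof φ) s|) * (1 / ‖x‖ ^ 2) := by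
  rcases eq_or_ne x 0 with rfl | hx
  · simp [pd_zero hφ]
  have h0 := norm_pos_iff.2 hx
  obtain ⟨h1, -⟩ := integral_mul_deriv_prof hφ
  have h1' : IntegrableOn (fun s => s * |deriv (prof φ) s|) (Ioi 0) :=
    IntegrableOn.congr_fun h1.abs (fun s hs => by
      simp [abs_mul, abs_of_pos (show (0 : ℝ) < s from hs)]) measurableSet_Ioi
  obtain ⟨h3, h4⟩ := integral_scale (fun s => |deriv (prof φ) s|) h0 h1'
  have e : EqOn (fun R : ℝ => (R ^ 3)⁻¹ * |deriv (prof φ) (R⁻¹ * ‖x‖)| * |x j / ‖x‖|)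
      (fun R : ℝ => |(R ^ 3)⁻¹ * pd j φ (R⁻¹ • x)|) (Ioi 0) := fun R hR => by
    have hR' : (0 : ℝ) < R := hR
    simp only [pd_scale hφ j hx hR', abs_mul, abs_of_pos (inv_pos.2 (pow_pos hR' 3))]; ring
  rw [← setIntegral_congr_fun measurableSet_Ioi e, integral_mul_const, h4]
  have e5 : ∫ s in Ioi (0 : ℝ), s * |deriv (prof φ) s| = ∫ s in Ioi (0 : ℝ), |s * deriv (prof φ) s| :=
    setIntegral_congr_fun measurableSet_Ioi fun s hs => by
      simp [abs_mul, abs_of_pos (show (0 : ℝ) < s from hs)]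
  rw [e5]
  have h6 : |x j / ‖x‖| ≤ 1 := by
    rw [abs_div, abs_norm, div_le_one h0]; exact abs_apply_le x j
  have h7 : 0 ≤ ∫ s in Ioi (0 : ℝ), |s * deriv (prof φ) s| := integral_nonneg fun s => abs_nonneg _
  rw [one_div, mul_comm ((‖x‖ ^ 2)⁻¹)]
  exact mul_le_of_le_one_right (by positivity) h6

/-- The Coulomb field of a density, as an integral over scales. -/
theorem integral_scales_coulomb (hφ : IsStandardCutoff φ) (j : Fin 3) {α : Type*} [MeasurableSpace α]
    {μ : Measure α} [SFinite μ] {Y : α → E3} (hY : Measurable Y) {g : α → ℝ}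
    (hg : AEStronglyMeasurable g μ) (hi : Integrable (fun p => 1 / ‖Y p‖ ^ 2 * g p) μ) :
    IntegrableOn (fun R : ℝ => (-(R ^ 2)⁻¹ * ∫ p, pd j φ (R⁻¹ • Y p) * g p ∂μ) / R) (Ioi 0) ∧
    ∫ R in Ioi (0 : ℝ), (-(R ^ 2)⁻¹ * ∫ p, pd j φ (R⁻¹ • Y p) * g p ∂μ) / R
      = 1 / (4 * Real.pi) * ∫ p, coulombKernel j (Y p) * g p ∂μ := by
  set F : α × ℝ → ℝ := fun x => -((x.2 ^ 3)⁻¹ * pd j φ (x.2⁻¹ • Y x.1)) * g x.1 with hF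
  set ν : Measure ℝ := volume.restrict (Ioi 0) with hν
  have hm : AEStronglyMeasurable F (μ.prod ν) := by
    have h1 : Measurable fun x : α × ℝ => -((x.2 ^ 3)⁻¹ * pd j φ (x.2⁻¹ • Y x.1)) := by
      have h2 := (continuous_pd hφ j).measurable
      have h3 : Measurable fun x : α × ℝ => x.2⁻¹ • Y x.1 := by fun_prop
      have h4 := h2.comp h3
      simp only [Function.comp_def] at h4
      fun_prop
    exact h1.aestronglyMeasurable.mul hg.comp_fst
  have hint : Integrable F (μ.prod ν) := by
    rw [integrable_prod_iff hm]
    refine ⟨Filter.Eventually.of_forall fun p => ((integral_pd_scale hφ j (Y p)).1.neg.mul_const (g p)), ?_⟩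
    refine (hi.norm.const_mul (∫ s in Ioi (0 : ℝ), |s * deriv (prof φ) s|)).mono' hm.norm.integral_prod_right'
      (Filter.Eventually.of_forall fun p => ?_)
    rw [Real.norm_of_nonneg (integral_nonneg fun _ => norm_nonneg _)]
    have e1 : ∀ R, ‖F (p, R)‖ = |(R ^ 3)⁻¹ * pd j φ (R⁻¹ • Y p)| * |g p| := fun R => by
      simp only [hF, norm_mul, norm_neg, Real.norm_eq_abs, abs_mul]
    have e2 : ‖1 / ‖Y p‖ ^ 2 * g p‖ = 1 / ‖Y p‖ ^ 2 * |g p| := by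
      rw [norm_mul, Real.norm_of_nonneg (by positivity), Real.norm_eq_abs]
    simp_rw [e1]
    rw [integral_mul_const, e2, ← mul_assoc]
    exact mul_le_mul_of_nonneg_right (integral_abs_pd_scale_le hφ j (Y p)) (abs_nonneg (g p))
  have e : ∀ R : ℝ, ∫ p, F (p, R) ∂μ = (-(R ^ 2)⁻¹ * ∫ p, pd j φ (R⁻¹ • Y p) * g p ∂μ) / R := fun R => by
    rw [mul_div_right_comm, ← integral_const_mul]
    refine integral_congr_ae (Filter.Eventually.of_forall fun p => ?_)
    simp only [hF]
    rcases eq_or_ne R 0 with rfl | hR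
    · simp
    · field_simp
  refine ⟨?_, ?_⟩
  · have := hint.integral_prod_right
    rw [IntegrableOn, ← hν]
    simpa only [e] using this
  · simp_rw [← e]
    rw [← integral_integral_swap (f := fun p R => F (p, R)) hint, ← integral_const_mul]
    refine integral_congr_ae (Filter.Eventually.of_forall fun p => ?_)
    simp only [hF]
    rw [integral_mul_const, integral_neg, (integral_pd_scale hφ j (Y p)).2]
    ring

/-! ### The majorant of the field -/

/-- Majorant of the Coulomb kernel at `y - 𝐗̃` and of its deviation from the effective one. -/
def kerK (q t : ℝ) (y : E3) (p : Phase) : ℝ :=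
  (1 + (scl q p * wS q p) ^ (1 / 4 : ℝ))
    + 1 / ‖y - posXt q t p‖ ^ 2 * (1 + (scl q p * wS q p) ^ (9 / 4 : ℝ))

theorem measurable_scl (q : ℝ) : Measurable (scl q) := by
  unfold scl; have := measurable_act; fun_prop

theorem measurable_wS (q : ℝ) : Measurable (wS q) := by
  unfold wS; have := measurable_eta q; have := measurable_kappa q; fun_prop

theorem measurable_wB (q : ℝ) : Measurable (wB q) := by
  unfold wB
  have := measurable_eta q; have := measurable_xi q; have := measurable_act; have := measurable_lam
  fun_prop

theorem measurable_kerK (q t : ℝ) (y : E3) : Measurable (kerK q t y) := by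
  unfold kerK
  have := measurable_scl q; have := measurable_wS q; have := measurable_posXt q t
  fun_prop

theorem wB_pos {q : ℝ} (hq : 0 < q) {p : Phase} (hp : p ∈ phaseSpace) : 0 < wB q p :=
  lt_of_lt_of_le (by positivity) (min_le_wB hq hp)

theorem wB_nonneg {q : ℝ} (hq : 0 < q) (p : Phase) : 0 ≤ wB q p := by
  have := lam_nonneg p; have := act_nonneg p; have := xi_nonneg hq p
  unfold wB; positivity

theorem scl_nonneg {q : ℝ} (hq : 0 < q) (p : Phase) : 0 ≤ scl q p := by
  unfold scl; positivity

theorem one_le_kerK {q : ℝ} (hq : 0 < q) (t : ℝ) (y : E3) (p : Phase) : 1 ≤ kerK q t y p := by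
  have := scl_nonneg hq p
  have := one_le_wS hq p
  have h : 0 ≤ scl q p * wS q p := by positivity
  unfold kerK
  have h1 : 0 ≤ (scl q p * wS q p) ^ (1 / 4 : ℝ) := by positivity
  have h2 : 0 ≤ 1 / ‖y - posXt q t p‖ ^ 2 * (1 + (scl q p * wS q p) ^ (9 / 4 : ℝ)) := by positivity
  linarith

/-- At distance less than `ℓ` from `y` the singular part is integrated by the weighted fold
estimate. At larger distance it is at most `ℓ⁻²`, and the integrable weight `S^(-7/2)` gives the
volume `c³` in `ϑ`. The three inequalities of `exists_weight_le` serve the regular part, the near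
part and the far part. -/
theorem exists_lintegral_kerK_fst_le {q : ℝ} (hq : 0 < q) : ∃ C : ℝ, 0 ≤ C ∧
    ∀ (t : ℝ) (y a : E3), a ≠ 0 →
      ∫⁻ θ : E3, ENNReal.ofReal (kerK q t y (θ, a) / wB q (θ, a))
        ≤ ENNReal.ofReal (C / (1 + ‖a‖) ^ 8) := by
  obtain ⟨C1, hC1, h1⟩ := exists_weight_le hq
  obtain ⟨C2, hC2, h2⟩ := exists_lintegral_wS_le
  refine ⟨C1 * (2 * C2 + 32768), by positivity, fun t y a ha => ?_⟩
  set c := q / ‖a‖ ^ 2 with hc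
  have hna := norm_pos_iff.2 ha
  have hc0 : 0 < c := by positivity
  -- The splitting radius is `c √ξ`, the one built into the second and third weight inequalities.
  set ℓ := c * √(q / ‖a‖) with hℓ
  have hℓ0 : 0 < ℓ := by positivity
  have hm3 : Measurable fun θ : E3 => posXt q t (θ, a) :=
    (measurable_posXt q t).comp (by fun_prop : Measurable fun θ : E3 => (θ, a))
  have hf : Measurable fun θ => ‖y - posXt q t (θ, a)‖ := by fun_prop
  set s : Set E3 := {θ | 0 < ‖y - posXt q t (θ, a)‖ ∧ ‖y - posXt q t (θ, a)‖ < ℓ} with hs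
  have hms : MeasurableSet s := by
    rw [hs, ofPred_and]
    exact (measurableSet_lt measurable_const hf).inter (measurableSet_lt hf measurable_const)
  set D := C1 / (1 + ‖a‖) ^ 8 with hD
  have hD0 : 0 ≤ D := by positivity
  set f1 : E3 → ℝ≥0∞ := fun θ => ENNReal.ofReal (wS q (θ, a) ^ (-(7 / 2) : ℝ)) with hf1
  set f2 : E3 → ℝ≥0∞ := s.indicator fun θ =>
    ENNReal.ofReal (1 / ‖y - posXt q t (θ, a)‖ ^ 2 * (1 / (1 + kappa q (θ, a)))) with hf2
  have hpt : ∀ θ, ENNReal.ofReal (kerK q t y (θ, a) / wB q (θ, a))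
      ≤ ENNReal.ofReal (D * 2 / c ^ 3) * f1 θ + ENNReal.ofReal (D / (ℓ + c)) * f2 θ := by
    intro θ
    have hp : (θ, a) ∈ phaseSpace := ha
    obtain ⟨w1, w2, w3⟩ := h1 (θ, a) hp
    have hB := wB_pos hq hp
    have hS : 0 < wS q (θ, a) := by have := one_le_wS hq (θ, a); linarith
    have hk := kappa_nonneg hq (θ, a)
    have e1 : scl q (θ, a) = c := rfl
    have e2 : xi q (θ, a) = q / ‖a‖ := rfl
    have e3 : act (θ, a) = ‖a‖ := rfl
    rw [e1, e3] at w1 w2 w3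
    rw [e2, ← hℓ] at w2 w3
    set B := wB q (θ, a) with hBdef
    set S := wS q (θ, a) with hSdef
    set k := kappa q (θ, a) with hkdef
    set n := ‖y - posXt q t (θ, a)‖ with hn
    set P := 1 + (c * S) ^ (1 / 4 : ℝ) with hP
    set Q := 1 + (c * S) ^ (9 / 4 : ℝ) with hQ
    have hP0 : 0 < P := by positivity
    have hQ0 : 0 < Q := by positivity
    have hS7 : S ^ (-(7 / 2) : ℝ) = (S ^ (7 / 2 : ℝ))⁻¹ := Real.rpow_neg hS.le _
    have hS70 : 0 < S ^ (7 / 2 : ℝ) := by positivity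
    have t1 : P / B ≤ D / c ^ 3 * S ^ (-(7 / 2) : ℝ) := by
      rw [hS7, hD, div_div, ← div_eq_mul_inv, div_div, div_le_div_iff₀ hB (by positivity)]
      linarith
    have hker : kerK q t y (θ, a) / B = P / B + 1 / n ^ 2 * Q / B := by
      rw [kerK, e1]; ring
    have hn0 : 0 ≤ n := norm_nonneg _
    rw [hker, hf1, hf2]
    by_cases hθ : θ ∈ s
    · rw [indicator_of_mem hθ]
      have t2 : 1 / n ^ 2 * Q / B ≤ D / (ℓ + c) * (1 / n ^ 2 * (1 / (1 + k))) := by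
        have : Q / B ≤ D / (ℓ + c) * (1 / (1 + k)) := by
          rw [hD, div_div, ← div_eq_mul_one_div, div_div, div_le_div_iff₀ hB (by positivity)]
          linarith
        have h0 : 0 ≤ 1 / n ^ 2 := by positivity
        calc 1 / n ^ 2 * Q / B = 1 / n ^ 2 * (Q / B) := by ring
          _ ≤ 1 / n ^ 2 * (D / (ℓ + c) * (1 / (1 + k))) := by gcongr
          _ = _ := by ring
      have t3 : P / B ≤ D * 2 / c ^ 3 * S ^ (-(7 / 2) : ℝ) := t1.trans (by
        have : 0 ≤ D / c ^ 3 * S ^ (-(7 / 2) : ℝ) := by positivity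
        calc _ ≤ 2 * (D / c ^ 3 * S ^ (-(7 / 2) : ℝ)) := by linarith
          _ = _ := by ring)
      rw [← ENNReal.ofReal_mul (by positivity), ← ENNReal.ofReal_mul (by positivity),
        ← ENNReal.ofReal_add (by positivity) (by positivity)]
      exact ENNReal.ofReal_le_ofReal (add_le_add t3 t2)
    · rw [indicator_of_notMem hθ, mul_zero, add_zero, ← ENNReal.ofReal_mul (by positivity)]
      refine ENNReal.ofReal_le_ofReal ?_
      have t2 : 1 / n ^ 2 * Q / B ≤ D / c ^ 3 * S ^ (-(7 / 2) : ℝ) := by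
        rcases eq_or_lt_of_le hn0 with h0 | h0
        -- The value `n = 0` is excluded from `s`; there `1 / n ^ 2` is zero by convention.
        · rw [← h0]; simp; positivity
        · have hnl : ℓ ≤ n := by
            by_contra hc'
            exact hθ ⟨h0, not_le.1 hc'⟩
          have h3 : 1 / ℓ ^ 2 * Q / B ≤ D / c ^ 3 * S ^ (-(7 / 2) : ℝ) := by
            rw [hS7, hD, div_div, ← div_eq_mul_inv, div_div, one_div, ← div_eq_inv_mul, div_div,
              div_le_div_iff₀ (by positivity) (by positivity)]
            linarith
          refine le_trans ?_ h3
          gcongr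
      calc _ ≤ D / c ^ 3 * S ^ (-(7 / 2) : ℝ) + D / c ^ 3 * S ^ (-(7 / 2) : ℝ) := add_le_add t1 t2
        _ = _ := by ring
  have hmf1 : Measurable f1 := by
    have : Measurable fun θ : E3 => wS q (θ, a) :=
      (measurable_wS q).comp (by fun_prop : Measurable fun θ : E3 => (θ, a))
    fun_prop
  calc _ ≤ ∫⁻ θ, (ENNReal.ofReal (D * 2 / c ^ 3) * f1 θ + ENNReal.ofReal (D / (ℓ + c)) * f2 θ) :=
        lintegral_mono hpt
    _ = ENNReal.ofReal (D * 2 / c ^ 3) * (∫⁻ θ, f1 θ) + ENNReal.ofReal (D / (ℓ + c)) * ∫⁻ θ, f2 θ := by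
        rw [lintegral_add_left (by fun_prop), lintegral_const_mul' _ _ ENNReal.ofReal_ne_top,
          lintegral_const_mul' _ _ ENNReal.ofReal_ne_top]
    _ ≤ ENNReal.ofReal (D * 2 / c ^ 3) * ENNReal.ofReal (C2 * c ^ 3)
        + ENNReal.ofReal (D / (ℓ + c)) * ENNReal.ofReal (32768 * (ℓ + c)) := by
        refine add_le_add (mul_le_mul_right (h2 q hq a ha) _) (mul_le_mul_right ?_ _)
        rw [hf2, lintegral_indicator hms]
        exact lintegral_near_le hq t ha y hℓ0
    _ = _ := by
        rw [← ENNReal.ofReal_mul (by positivity), ← ENNReal.ofReal_mul (by positivity),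
          ← ENNReal.ofReal_add (by positivity) (by positivity)]
        congr 1
        rw [hD]
        field_simp

/-- The integrated majorant. -/
theorem exists_integral_kerK_le {q : ℝ} (hq : 0 < q) : ∃ C : ℝ, 0 ≤ C ∧ ∀ (t : ℝ) (y z : E3),
    Integrable (fun p : Phase => (1 + ‖z - p.2‖ ^ (-(9 / 4) : ℝ)) * (1 + ‖p.2‖) ^ 4
      * (kerK q t y p / wB q p)) ∧
    ∫ p : Phase, (1 + ‖z - p.2‖ ^ (-(9 / 4) : ℝ)) * (1 + ‖p.2‖) ^ 4
      * (kerK q t y p / wB q p) ≤ C := by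
  obtain ⟨C1, hC1, h1⟩ := exists_lintegral_kerK_fst_le hq
  obtain ⟨C2, hC2, h2⟩ := exists_lintegral_riesz_le
  refine ⟨C1 * C2, by positivity, fun t y z => ?_⟩
  have hmK := measurable_kerK q t y
  have hmB := measurable_wB q
  set f : Phase → ℝ := fun p => (1 + ‖z - p.2‖ ^ (-(9 / 4) : ℝ)) * (1 + ‖p.2‖) ^ 4
      * (kerK q t y p / wB q p) with hf
  have hfm : Measurable f := by fun_prop
  have hf0 : ∀ p, 0 ≤ f p := fun p => by
    have := one_le_kerK hq t y p
    have := wB_nonneg hq p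
    positivity
  have hle : ∫⁻ p, ENNReal.ofReal (f p) ≤ ENNReal.ofReal (C1 * C2) := by
    rw [Measure.volume_eq_prod, lintegral_prod_symm' _ (by fun_prop)]
    have hae : ∀ᵐ a : E3, a ≠ 0 := by simp [ae_iff]
    calc _ ≤ ∫⁻ a : E3, ENNReal.ofReal C1
          * ENNReal.ofReal ((1 + ‖z - a‖ ^ (-(9 / 4) : ℝ)) * (1 + ‖a‖) ^ (-4 : ℝ)) := by
          refine lintegral_mono_ae (hae.mono fun a ha => ?_)
          have e : ∀ θ : E3, ENNReal.ofReal (f (θ, a)) = ENNReal.ofReal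
              ((1 + ‖z - a‖ ^ (-(9 / 4) : ℝ)) * (1 + ‖a‖) ^ 4)
              * ENNReal.ofReal (kerK q t y (θ, a) / wB q (θ, a)) := fun θ => by
            rw [← ENNReal.ofReal_mul (by positivity)]
          simp_rw [e]
          rw [lintegral_const_mul' _ _ ENNReal.ofReal_ne_top]
          refine (mul_le_mul_right (h1 t y a ha) _).trans ?_
          rw [← ENNReal.ofReal_mul (by positivity), ← ENNReal.ofReal_mul (by positivity)]
          refine ENNReal.ofReal_le_ofReal (le_of_eq ?_)
          have hp : 0 < 1 + ‖a‖ := by positivity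
          rw [show (-4 : ℝ) = -((4 : ℕ) : ℝ) by norm_num, Real.rpow_neg hp.le, Real.rpow_natCast]
          field_simp
      _ = ENNReal.ofReal C1 * _ := lintegral_const_mul' _ _ ENNReal.ofReal_ne_top
      _ ≤ ENNReal.ofReal C1 * ENNReal.ofReal C2 := mul_le_mul_right (h2 z) _
      _ = _ := (ENNReal.ofReal_mul hC1).symm
  have hint : Integrable f :=
    ⟨hfm.aestronglyMeasurable, by
      rw [hasFiniteIntegral_iff_ofReal (Filter.Eventually.of_forall hf0)]
      exact hle.trans_lt ENNReal.ofReal_lt_top⟩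
  refine ⟨hint, ?_⟩
  rw [integral_eq_lintegral_of_nonneg_ae (Filter.Eventually.of_forall hf0) hfm.aestronglyMeasurable]
  exact ENNReal.toReal_le_of_le_ofReal (by positivity) hle

theorem rpow_le_one_add {x s s' : ℝ} (hx : 0 ≤ x) (hs : 0 ≤ s) (h : s ≤ s') : x ^ s ≤ 1 + x ^ s' := by
  rcases le_total x 1 with h1 | h1
  · have := Real.rpow_le_one hx h1 hs
    have : 0 ≤ x ^ s' := Real.rpow_nonneg hx _
    linarith
  · have := Real.rpow_le_rpow_of_exponent_le h1 h
    linarith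

theorem rpow_neg_le_one_add {x s s' : ℝ} (hx : 0 < x) (hs : 0 ≤ s) (h : s ≤ s') :
    x ^ (-s) ≤ 1 + x ^ (-s') := by
  have := rpow_le_one_add (inv_nonneg.2 hx.le) hs h
  rwa [Real.inv_rpow hx.le, Real.inv_rpow hx.le, ← Real.rpow_neg hx.le, ← Real.rpow_neg hx.le] at this

theorem one_add_tau_le {q t : ℝ} (hq : 0 < q) (ht : 0 ≤ t) (p : Phase) :
    1 + t * act p ^ 3 / q ≤ (1 + 1 / q) * (1 + t) * (1 + act p) ^ 3 := by
  have ha := act_nonneg p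
  have h1 : act p ^ 3 ≤ (1 + act p) ^ 3 := pow_le_pow_left₀ ha (by linarith) 3
  have h2 : 1 ≤ (1 + act p) ^ 3 := one_le_pow₀ (by linarith)
  have h3 : 0 < 1 / q := by positivity
  calc 1 + t * act p ^ 3 / q = 1 + 1 / q * t * act p ^ 3 := by ring
    _ ≤ 1 * (1 + act p) ^ 3 + 1 / q * t * (1 + act p) ^ 3 := by
        rw [one_mul]; gcongr
    _ ≤ _ := by
        have : 0 ≤ (1 / q + t) * (1 + act p) ^ 3 := by positivity
        linarith

/-- Powers of the distance between the exact and the effective position. -/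
theorem norm_posXt_sub_rpow_le {q t : ℝ} (hq : 0 < q) (ht : 0 ≤ t) {p : Phase} (hp : p ∈ phaseSpace)
    {s : ℝ} (hs : 0 ≤ s) (hs' : s ≤ 9 / 4) :
    ‖posXt q t p - t • p.2‖ ^ s
      ≤ (42 * (1 + 1 / q)) ^ 3 * (scl q p * wS q p) ^ s * ((1 + t) ^ (1 / 20 : ℝ) * (1 + act p)) := by
  have ha := act_nonneg p
  have hcS : 0 ≤ scl q p * wS q p :=
    mul_nonneg (scl_nonneg hq p) (by have := one_le_wS hq p; linarith)
  have hQ : 1 ≤ 1 + 1 / q := by have : 0 < 1 / q := by positivity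
                                linarith
  have hT : 1 ≤ 1 + t := by linarith
  have hA : 1 ≤ 1 + act p := by linarith
  -- With `δ = 1/60` the constant is `12 + 30 = 42`. Even at `s = 9/4` the time growth `(1 +
  -- t)^(s/60)` stays below `(1 + t)^(1/20)`.
  have h1 := norm_posXt_sub_le (δ := 1 / 60) (by norm_num) hq ht hp
  have h2 : (1 + t * act p ^ 3 / q) ^ (1 / 60 : ℝ)
      ≤ (1 + 1 / q) * (1 + t) ^ (1 / 60 : ℝ) * (1 + act p) ^ (1 / 20 : ℝ) := by
    refine (Real.rpow_le_rpow (by positivity) (one_add_tau_le hq ht p) (by norm_num)).trans ?_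
    rw [Real.mul_rpow (by positivity) (by positivity), Real.mul_rpow (by positivity) (by positivity),
      ← Real.rpow_natCast (1 + act p) 3, ← Real.rpow_mul (by positivity)]
    have e : (1 + 1 / q) ^ (1 / 60 : ℝ) ≤ 1 + 1 / q := by
      calc _ ≤ (1 + 1 / q) ^ (1 : ℝ) := Real.rpow_le_rpow_of_exponent_le hQ (by norm_num)
        _ = _ := Real.rpow_one _
    norm_num at e ⊢
    gcongr
  have h3 : ‖posXt q t p - t • p.2‖
      ≤ 42 * (1 + 1 / q) * (scl q p * wS q p) * (1 + t) ^ (1 / 60 : ℝ) * (1 + act p) ^ (1 / 20 : ℝ) := by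
    refine h1.trans ?_
    norm_num at h2 ⊢
    calc _ ≤ 42 * (scl q p * wS q p) * ((1 + q⁻¹) * (1 + t) ^ (1 / 60 : ℝ) * (1 + act p) ^ (1 / 20 : ℝ)) := by
          gcongr
      _ = _ := by ring
  refine (Real.rpow_le_rpow (norm_nonneg _) h3 hs).trans ?_
  rw [Real.mul_rpow (by positivity) (by positivity), Real.mul_rpow (by positivity) (by positivity),
    Real.mul_rpow (by positivity) (by positivity), ← Real.rpow_mul (by positivity),
    ← Real.rpow_mul (by positivity), mul_assoc _ ((1 + t) ^ _)]
  have e1 : (42 * (1 + 1 / q)) ^ s ≤ (42 * (1 + 1 / q)) ^ 3 := by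
    rw [← Real.rpow_natCast _ 3]
    exact Real.rpow_le_rpow_of_exponent_le (by linarith) (by norm_num; linarith)
  have e2 : (1 + t) ^ (1 / 60 * s) ≤ (1 + t) ^ (1 / 20 : ℝ) :=
    Real.rpow_le_rpow_of_exponent_le hT (by linarith)
  have e3 : (1 + act p) ^ (1 / 20 * s) ≤ 1 + act p := by
    calc _ ≤ (1 + act p) ^ (1 : ℝ) := Real.rpow_le_rpow_of_exponent_le hA (by linarith)
      _ = _ := Real.rpow_one _
  have : 0 ≤ (scl q p * wS q p) ^ s := by positivity
  gcongr

/-- Spatial weights against inverse powers of the distance to the effective position. -/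
theorem add_sq_mul_rpow_le {t : ℝ} (ht : 0 < t) (y a : E3) (h : y - t • a ≠ 0) {s : ℝ} (hs : 0 ≤ s)
    (hs' : s ≤ 1 / 4) :
    (t ^ 2 + ‖y‖ ^ 2) * ‖y - t • a‖ ^ (-(2 + s))
      ≤ 4 * t ^ (-s) * (1 + ‖a‖) ^ 2 * (1 + ‖t⁻¹ • y - a‖ ^ (-(9 / 4) : ℝ)) := by
  obtain ⟨z, hz⟩ : ∃ z, z = t⁻¹ • y := ⟨_, rfl⟩
  have hy : y = t • z := by rw [hz, smul_smul, mul_inv_cancel₀ ht.ne', one_smul]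
  have hd : y - t • a = t • (z - a) := by rw [smul_sub, ← hy]
  have hza : z - a ≠ 0 := fun h0 => h (by rw [hd, h0, smul_zero])
  have hn : 0 < ‖z - a‖ := norm_pos_iff.2 hza
  rw [hd, ← hz, hy, norm_smul, norm_smul, Real.norm_of_nonneg ht.le, Real.mul_rpow ht.le hn.le]
  set n := ‖z - a‖ with hndef
  have h1 : ‖z‖ ≤ n + ‖a‖ := by
    calc ‖z‖ = ‖(z - a) + a‖ := by rw [sub_add_cancel]
      _ ≤ _ := norm_add_le _ _
  have h2 : 1 + ‖z‖ ^ 2 ≤ 2 * (1 + ‖a‖) ^ 2 + 2 * n ^ 2 := by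
    have := pow_le_pow_left₀ (norm_nonneg z) h1 2
    nlinarith [sq_nonneg (n - ‖a‖), norm_nonneg a]
  have h3 : n ^ (-(2 + s)) ≤ 1 + n ^ (-(9 / 4) : ℝ) := rpow_neg_le_one_add hn (by linarith) (by linarith)
  have h4 : n ^ 2 * n ^ (-(2 + s)) ≤ 1 + n ^ (-(9 / 4) : ℝ) := by
    rw [← Real.rpow_natCast, ← Real.rpow_add hn]
    have : ((2 : ℕ) : ℝ) + -(2 + s) = -s := by push_cast; ring
    rw [this]
    exact rpow_neg_le_one_add hn hs (by linarith)
  have h5 : t ^ 2 * t ^ (-(2 + s)) = t ^ (-s) := by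
    rw [← Real.rpow_natCast, ← Real.rpow_add ht]; congr 1; push_cast; ring
  have h6 : 1 ≤ (1 + ‖a‖) ^ 2 := one_le_pow₀ (by linarith [norm_nonneg a])
  have h7 : 0 ≤ n ^ (-(2 + s)) := by positivity
  have h8 : 0 ≤ n ^ (-(9 / 4) : ℝ) := by positivity
  have h9 : (1 + ‖z‖ ^ 2) * n ^ (-(2 + s)) ≤ 4 * (1 + ‖a‖) ^ 2 * (1 + n ^ (-(9 / 4) : ℝ)) := by
    calc _ ≤ (2 * (1 + ‖a‖) ^ 2 + 2 * n ^ 2) * n ^ (-(2 + s)) := by gcongr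
      _ = 2 * (1 + ‖a‖) ^ 2 * n ^ (-(2 + s)) + 2 * (n ^ 2 * n ^ (-(2 + s))) := by ring
      _ ≤ 2 * (1 + ‖a‖) ^ 2 * (1 + n ^ (-(9 / 4) : ℝ)) + 2 * (1 * (1 + n ^ (-(9 / 4) : ℝ))) := by
          rw [one_mul]; gcongr
      _ ≤ 2 * (1 + ‖a‖) ^ 2 * (1 + n ^ (-(9 / 4) : ℝ))
          + 2 * ((1 + ‖a‖) ^ 2 * (1 + n ^ (-(9 / 4) : ℝ))) := by gcongr
      _ = _ := by ring
  calc _ = t ^ 2 * t ^ (-(2 + s)) * ((1 + ‖z‖ ^ 2) * n ^ (-(2 + s))) := by ring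
    _ ≤ t ^ (-s) * (4 * (1 + ‖a‖) ^ 2 * (1 + n ^ (-(9 / 4) : ℝ))) := by
        rw [h5]; gcongr
    _ = _ := by ring

/-- The pointwise comparison of exact and effective kernels. -/
theorem exists_kernel_diff_le {q : ℝ} (hq : 0 < q) : ∃ C : ℝ, 0 ≤ C ∧ ∀ t : ℝ, 0 < t → ∀ (y : E3)
    (j : Fin 3), ∀ p ∈ phaseSpace, y - t • p.2 ≠ 0 →
    (t ^ 2 + ‖y‖ ^ 2) * |coulombKernel j (y - posXt q t p) - coulombKernel j (y - t • p.2)|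
      ≤ C * t ^ (-(1 / 5) : ℝ) * ((1 + ‖t⁻¹ • y - p.2‖ ^ (-(9 / 4) : ℝ)) * (1 + ‖p.2‖) ^ 4
        * kerK q t y p) := by
  refine ⟨46 * 4 * (42 * (1 + 1 / q)) ^ 3 * 2, by positivity, fun t ht y j p hp hd => ?_⟩
  -- The Hölder exponent is `0` for short times and `1/4` for long times; in the latter case
  -- `t^(-1/4) t^(1/20) = t^(-1/5)`.
  obtain ⟨s, hs0, hs1, hs2, hst⟩ : ∃ s : ℝ, 0 ≤ s ∧ s ≤ 1 / 4 ∧ (∀ x : ℝ, 0 ≤ x → x ^ s ≤ 1 + x ^ (1 / 4 : ℝ))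
      ∧ t ^ (-s) * (1 + t) ^ (1 / 20 : ℝ) ≤ 2 * t ^ (-(1 / 5) : ℝ) := by
    rcases lt_or_ge t 1 with h | h
    · refine ⟨0, le_rfl, by norm_num, fun x hx => rpow_le_one_add hx le_rfl (by norm_num), ?_⟩
      rw [neg_zero, Real.rpow_zero, one_mul]
      have e1 : (1 + t) ^ (1 / 20 : ℝ) ≤ 2 := by
        calc _ ≤ (2 : ℝ) ^ (1 / 20 : ℝ) := Real.rpow_le_rpow (by positivity) (by linarith) (by norm_num)
          _ ≤ 2 ^ (1 : ℝ) := Real.rpow_le_rpow_of_exponent_le (by norm_num) (by norm_num)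
          _ = 2 := Real.rpow_one _
      have e2 : 1 ≤ t ^ (-(1 / 5) : ℝ) :=
        Real.one_le_rpow_of_pos_of_le_one_of_nonpos ht h.le (by norm_num)
      linarith
    · refine ⟨1 / 4, by norm_num, le_rfl, fun x hx => rpow_le_one_add hx (by norm_num) le_rfl, ?_⟩
      have e1 : (1 + t) ^ (1 / 20 : ℝ) ≤ 2 * t ^ (1 / 20 : ℝ) := by
        calc _ ≤ (2 * t) ^ (1 / 20 : ℝ) := Real.rpow_le_rpow (by positivity) (by linarith) (by norm_num)
          _ = 2 ^ (1 / 20 : ℝ) * t ^ (1 / 20 : ℝ) := Real.mul_rpow (by norm_num) ht.le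
          _ ≤ 2 ^ (1 : ℝ) * t ^ (1 / 20 : ℝ) := by
              gcongr
              · norm_num
              · norm_num
          _ = _ := by rw [Real.rpow_one]
      calc _ ≤ t ^ (-(1 / 4) : ℝ) * (2 * t ^ (1 / 20 : ℝ)) := by gcongr
        _ = 2 * (t ^ (-(1 / 4) : ℝ) * t ^ (1 / 20 : ℝ)) := by ring
        _ = _ := by rw [← Real.rpow_add ht]; norm_num
  have hcS : 0 ≤ scl q p * wS q p :=
    mul_nonneg (scl_nonneg hq p) (by have := one_le_wS hq p; linarith)
  have h1 := abs_coulombKernel_sub_le j (y - posXt q t p) hd hs0 (by linarith)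
  have hM : ‖(y - posXt q t p) - (y - t • p.2)‖ = ‖posXt q t p - t • p.2‖ := by
    rw [sub_sub_sub_cancel_left, norm_sub_rev]
  rw [hM] at h1
  have m1 := norm_posXt_sub_rpow_le hq ht.le hp hs0 (by linarith)
  have m2 := norm_posXt_sub_rpow_le hq ht.le hp (s := 2 + s) (by linarith) (by linarith)
  have c1 := hs2 _ hcS
  have c2 : (scl q p * wS q p) ^ (2 + s) ≤ 1 + (scl q p * wS q p) ^ (9 / 4 : ℝ) :=
    rpow_le_one_add hcS (by linarith) (by linarith)
  have hw := add_sq_mul_rpow_le ht y p.2 hd hs0 hs1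
  have ha : act p = ‖p.2‖ := rfl
  rw [ha] at m1 m2
  set A := (42 * (1 + 1 / q)) ^ 3 with hA
  have hA0 : 0 ≤ A := by positivity
  set M := ‖posXt q t p - t • p.2‖ with hMdef
  set x := scl q p * wS q p with hx
  set n2 := 1 / ‖y - posXt q t p‖ ^ 2 with hn2
  have hn20 : 0 ≤ n2 := by positivity
  set T := (1 + t) ^ (1 / 20 : ℝ) with hT
  have hT0 : 0 ≤ T := by positivity
  set Z := 1 + ‖t⁻¹ • y - p.2‖ ^ (-(9 / 4) : ℝ) with hZ
  have hZ0 : 0 ≤ Z := by positivity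
  set a := ‖p.2‖ with hadef
  have ha0 : 0 ≤ a := norm_nonneg _
  have hK : kerK q t y p = (1 + x ^ (1 / 4 : ℝ)) + n2 * (1 + x ^ (9 / 4 : ℝ)) := rfl
  have hK0 : 0 ≤ kerK q t y p := by have := one_le_kerK hq t y p; linarith
  have h2 : M ^ s + M ^ (2 + s) * n2 ≤ A * (T * (1 + a)) * kerK q t y p := by
    calc _ ≤ A * x ^ s * (T * (1 + a)) + A * x ^ (2 + s) * (T * (1 + a)) * n2 := by gcongr
      _ ≤ A * (1 + x ^ (1 / 4 : ℝ)) * (T * (1 + a)) + A * (1 + x ^ (9 / 4 : ℝ)) * (T * (1 + a)) * n2 := by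
          gcongr
      _ = _ := by rw [hK]; ring
  calc (t ^ 2 + ‖y‖ ^ 2) * |coulombKernel j (y - posXt q t p) - coulombKernel j (y - t • p.2)|
      ≤ (t ^ 2 + ‖y‖ ^ 2) * (46 * ‖y - t • p.2‖ ^ (-(2 + s)) * (A * (T * (1 + a)) * kerK q t y p)) := by
        refine mul_le_mul_of_nonneg_left (h1.trans ?_) (by positivity)
        gcongr
    _ = 46 * A * (T * (1 + a)) * kerK q t y p * ((t ^ 2 + ‖y‖ ^ 2) * ‖y - t • p.2‖ ^ (-(2 + s))) := by ring
    _ ≤ 46 * A * (T * (1 + a)) * kerK q t y p * (4 * t ^ (-s) * (1 + a) ^ 2 * Z) := by gcongr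
    _ = 46 * 4 * A * (t ^ (-s) * T) * (Z * (1 + a) ^ 3 * kerK q t y p) := by ring
    _ ≤ 46 * 4 * A * (2 * t ^ (-(1 / 5) : ℝ)) * (Z * (1 + a) ^ 4 * kerK q t y p) := by
        have : (1 + a) ^ 3 ≤ (1 + a) ^ 4 := pow_le_pow_right₀ (by linarith) (by norm_num)
        gcongr
    _ = _ := by ring

/-! ### The field comparison -/

theorem ae_abs_le_of_eLpNorm_top {f : Phase → ℝ} {N : ℝ≥0∞} (hN : N ≠ ⊤)
    (h : eLpNorm f ∞ volume ^ 2 ≤ N) : ∀ᵐ p, f p ^ 2 ≤ N.toReal := by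
  have h1 := ae_le_eLpNormEssSup (f := f) (μ := volume)
  rw [eLpNorm_exponent_top] at h
  filter_upwards [h1] with p hp
  have h2 : ‖f p‖ₑ ^ 2 ≤ N := (pow_le_pow_left₀ bot_le hp 2).trans h
  have h3 := ENNReal.toReal_mono hN h2
  simpa using h3

/-- `wB` is the sum of the squares of the summands in the `L^∞` weight of `N₁`, hence at most the
square of their sum. -/
theorem ae_sq_le_of_normN1 {q : ℝ} (hq : 0 < q) {γ : Phase → ℝ} (h : normN1 q γ ≠ ⊤) :
    ∀ᵐ p : Phase, γ p ^ 2 ≤ (normN1 q γ).toReal / wB q p := by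
  have h1 := ae_abs_le_of_eLpNorm_top h (le_add_left le_rfl :
    eLpNorm (fun p => (xi q p ^ 4 + act p ^ 10 + |eta q p| ^ 10 + lam p ^ 5) * γ p) ∞ volume ^ 2
      ≤ normN1 q γ)
  filter_upwards [h1, ae_mem_phaseSpace] with p hp hps
  rw [le_div_iff₀ (wB_pos hq hps)]
  refine le_trans ?_ hp
  rw [mul_pow, mul_comm (γ p ^ 2)]
  refine mul_le_mul_of_nonneg_right ?_ (sq_nonneg _)
  have e1 := pow_nonneg (xi_nonneg hq p) 4
  have e2 := pow_nonneg (act_nonneg p) 10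
  have e3 := pow_nonneg (abs_nonneg (eta q p)) 10
  have e4 := pow_nonneg (lam_nonneg p) 5
  unfold wB
  have g1 : xi q p ^ 8 = (xi q p ^ 4) ^ 2 := by ring
  have g2 : act p ^ 20 = (act p ^ 10) ^ 2 := by ring
  have g3 : |eta q p| ^ 20 = (|eta q p| ^ 10) ^ 2 := by ring
  have g4 : lam p ^ 10 = (lam p ^ 5) ^ 2 := by ring
  rw [g1, g2, g3, g4]
  have := mul_nonneg e1 e2; have := mul_nonneg e1 e3; have := mul_nonneg e1 e4
  have := mul_nonneg e2 e3; have := mul_nonneg e2 e4; have := mul_nonneg e3 e4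
  nlinarith

theorem ae_sub_smul_ne_zero {t : ℝ} (ht : t ≠ 0) (y : E3) : ∀ᵐ p : Phase, y - t • p.2 ≠ 0 := by
  have h : ∀ᵐ a : E3, y - t • a ≠ 0 := by
    rw [ae_iff]
    refine measure_mono_null (t := {t⁻¹ • y}) (fun a ha => ?_) (measure_singleton _)
    have h0 : y - t • a = 0 := by simpa using ha
    rw [sub_eq_zero.1 h0, smul_smul, inv_mul_cancel₀ ht, one_smul]; rfl
  exact Measure.quasiMeasurePreserving_snd.ae h

/-- The integrability and comparison statements for the field. -/
theorem exists_field_le {q : ℝ} (hq : 0 < q) {φ : E3 → ℝ} (hφ : IsStandardCutoff φ) :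
    ∃ C : ℝ, 0 ≤ C ∧ ∀ t : ℝ, 0 < t → ∀ γ : Phase → ℝ, AEStronglyMeasurable γ volume →
      normN1 q γ ≠ ⊤ → ∀ (y : E3) (j : Fin 3),
      Integrable (fun p : Phase => 1 / ‖y - posXt q t p‖ ^ 2 * γ p ^ 2) ∧
      Integrable (fun p : Phase => coulombKernel j (y - posXt q t p) * γ p ^ 2) ∧
      IntegrableOn (fun R : ℝ => effScaleE φ t γ j y R / R) (Ioi 0) ∧
      (t ^ 2 + ‖y‖ ^ 2) * |fieldE q t γ j y - effE φ t γ j y|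
        ≤ C * t ^ (-(1 / 5) : ℝ) * (normN1 q γ).toReal := by
  obtain ⟨C1, hC1, h1⟩ := exists_integral_kerK_le hq
  obtain ⟨C2, hC2, h2⟩ := exists_kernel_diff_le hq
  refine ⟨1 / (4 * Real.pi) * (C2 * C1), by positivity, fun t ht γ hγ hN y j => ?_⟩
  set N := (normN1 q γ).toReal with hNdef
  have hN0 : 0 ≤ N := ENNReal.toReal_nonneg
  set z := t⁻¹ • y with hz
  obtain ⟨hi, hle⟩ := h1 t y z
  set W : Phase → ℝ := fun p => (1 + ‖z - p.2‖ ^ (-(9 / 4) : ℝ)) * (1 + ‖p.2‖) ^ 4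
      * (kerK q t y p / wB q p) with hW
  have hae := ae_sq_le_of_normN1 hq hN
  have hγ2 : AEStronglyMeasurable (fun p => γ p ^ 2) volume := hγ.pow 2
  have hmX := measurable_posXt q t
  have hcut : ∀ p : Phase, 0 ≤ ‖z - p.2‖ ^ (-(9 / 4) : ℝ) ∧ 1 ≤ (1 + ‖p.2‖) ^ 4 := fun p =>
    ⟨by positivity, one_le_pow₀ (by linarith [norm_nonneg p.2])⟩
  -- domination by `N W`
  have hdom : ∀ {c g : ℝ} {p : Phase}, p ∈ phaseSpace → γ p ^ 2 ≤ N / wB q p → 0 ≤ g →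
      g ≤ c * ((1 + ‖z - p.2‖ ^ (-(9 / 4) : ℝ)) * (1 + ‖p.2‖) ^ 4 * kerK q t y p) →
      g * γ p ^ 2 ≤ c * N * W p := by
    intro c g p hp h3 h4 h5
    have hB := wB_pos hq hp
    calc g * γ p ^ 2 ≤ g * (N / wB q p) := by gcongr
      _ ≤ c * ((1 + ‖z - p.2‖ ^ (-(9 / 4) : ℝ)) * (1 + ‖p.2‖) ^ 4 * kerK q t y p) * (N / wB q p) := by
          gcongr
      _ = _ := by simp only [hW]; ring
  have hnn : ∀ p, 0 ≤ 1 / ‖y - posXt q t p‖ ^ 2 := fun p => by positivity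
  have hk1 : ∀ p, 1 / ‖y - posXt q t p‖ ^ 2 ≤ kerK q t y p := fun p => by
    have h0 : 0 ≤ scl q p * wS q p :=
      mul_nonneg (scl_nonneg hq p) (by have := one_le_wS hq p; linarith)
    have h5 : 0 ≤ (scl q p * wS q p) ^ (1 / 4 : ℝ) := by positivity
    have h6 : 0 ≤ 1 / ‖y - posXt q t p‖ ^ 2 * (scl q p * wS q p) ^ (9 / 4 : ℝ) := by positivity
    unfold kerK; linarith
  have hk2 : ∀ p, kerK q t y p
      ≤ (1 + ‖z - p.2‖ ^ (-(9 / 4) : ℝ)) * (1 + ‖p.2‖) ^ 4 * kerK q t y p := fun p => by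
    obtain ⟨g1, g2⟩ := hcut p
    have := one_le_kerK hq t y p
    have : 1 ≤ (1 + ‖z - p.2‖ ^ (-(9 / 4) : ℝ)) * (1 + ‖p.2‖) ^ 4 := by nlinarith
    nlinarith
  have i1 : Integrable (fun p : Phase => 1 / ‖y - posXt q t p‖ ^ 2 * γ p ^ 2) := by
    refine (hi.const_mul (1 * N)).mono' (AEStronglyMeasurable.mul (Measurable.aestronglyMeasurable
      (by fun_prop)) hγ2) ?_
    filter_upwards [hae, ae_mem_phaseSpace] with p h3 hp
    rw [Real.norm_of_nonneg (by positivity)]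
    exact hdom hp h3 (hnn p) (by rw [one_mul]; exact (hk1 p).trans (hk2 p))
  have i2 : Integrable (fun p : Phase => coulombKernel j (y - posXt q t p) * γ p ^ 2) := by
    refine i1.mono' (AEStronglyMeasurable.mul (Measurable.aestronglyMeasurable
      ((measurable_coulombKernel j).comp (by fun_prop))) hγ2) (Filter.Eventually.of_forall fun p => ?_)
    rw [norm_mul, Real.norm_eq_abs, Real.norm_of_nonneg (sq_nonneg (γ p))]
    exact mul_le_mul_of_nonneg_right (abs_coulombKernel_le _ _) (sq_nonneg _)
  have i3 : Integrable (fun p : Phase => 1 / ‖y - t • p.2‖ ^ 2 * γ p ^ 2) := by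
    refine (hi.const_mul ((t ^ 2)⁻¹ * N)).mono' (AEStronglyMeasurable.mul (Measurable.aestronglyMeasurable
      (by fun_prop)) hγ2) ?_
    filter_upwards [hae, ae_mem_phaseSpace, ae_sub_smul_ne_zero ht.ne' y] with p h3 hp hne
    rw [Real.norm_of_nonneg (by positivity)]
    refine hdom hp h3 (by positivity) ?_
    have e : y - t • p.2 = t • (z - p.2) := by
      rw [smul_sub, hz, smul_smul, mul_inv_cancel₀ ht.ne', one_smul]
    have hn : 0 < ‖z - p.2‖ := norm_pos_iff.2 fun h0 => hne (by rw [e, h0, smul_zero])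
    have h4 : 1 / ‖z - p.2‖ ^ 2 ≤ 1 + ‖z - p.2‖ ^ (-(9 / 4) : ℝ) := by
      have := rpow_neg_le_one_add hn (s := 2) (s' := 9 / 4) (by norm_num) (by norm_num)
      refine le_trans (le_of_eq ?_) this
      rw [show (-2 : ℝ) = -((2 : ℕ) : ℝ) by norm_num, Real.rpow_neg hn.le, Real.rpow_natCast, one_div]
    rw [e, norm_smul, Real.norm_of_nonneg ht.le, mul_pow, one_div, mul_inv]
    refine mul_le_mul_of_nonneg_left ?_ (by positivity)
    rw [← one_div]
    refine h4.trans ?_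
    have g1 := hcut p
    have := one_le_kerK hq t y p
    have g3 : 1 ≤ (1 + ‖p.2‖) ^ 4 * kerK q t y p := by nlinarith [g1.2]
    rw [mul_assoc]
    exact le_mul_of_one_le_right (by linarith [g1.1]) g3
  have i4 : Integrable (fun p : Phase => coulombKernel j (y - t • p.2) * γ p ^ 2) := by
    refine i3.mono' (AEStronglyMeasurable.mul (Measurable.aestronglyMeasurable
      ((measurable_coulombKernel j).comp (by fun_prop))) hγ2) (Filter.Eventually.of_forall fun p => ?_)
    rw [norm_mul, Real.norm_eq_abs, Real.norm_of_nonneg (sq_nonneg (γ p))]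
    exact mul_le_mul_of_nonneg_right (abs_coulombKernel_le _ _) (sq_nonneg _)
  -- Read at `t𝐚`, the scale representation gives absolute convergence of the effective field and
  -- identifies it with a Coulomb integral, so both fields can be compared kernel by kernel.
  obtain ⟨s1, s2⟩ := integral_scales_coulomb hφ j (Y := fun p : Phase => y - t • p.2) (by fun_prop) hγ2 i3
  refine ⟨i1, i2, s1, ?_⟩
  have hE : effE φ t γ j y = 1 / (4 * Real.pi) * ∫ p : Phase, coulombKernel j (y - t • p.2) * γ p ^ 2 := s2
  rw [hE, fieldE, ← mul_sub, ← integral_sub i2 i4, abs_mul, abs_of_pos (show 0 < 1 / (4 * Real.pi) by positivity)]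
  have hfin : (t ^ 2 + ‖y‖ ^ 2) * |∫ p : Phase, (coulombKernel j (y - posXt q t p) * γ p ^ 2
      - coulombKernel j (y - t • p.2) * γ p ^ 2)| ≤ C2 * t ^ (-(1 / 5) : ℝ) * N * C1 := by
    rw [← abs_of_nonneg (show 0 ≤ t ^ 2 + ‖y‖ ^ 2 by positivity), ← abs_mul, ← integral_const_mul,
      ← Real.norm_eq_abs]
    refine (norm_integral_le_of_norm_le (hi.const_mul (C2 * t ^ (-(1 / 5) : ℝ) * N)) ?_).trans ?_
    · filter_upwards [hae, ae_mem_phaseSpace, ae_sub_smul_ne_zero ht.ne' y] with p h3 hp hne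
      have := hdom hp h3 (mul_nonneg (by positivity) (abs_nonneg _)) (h2 t ht y j p hp hne)
      refine le_trans (le_of_eq ?_) this
      rw [← sub_mul, Real.norm_eq_abs, abs_mul, abs_mul, abs_of_nonneg (sq_nonneg (γ p)),
        abs_of_nonneg (show 0 ≤ t ^ 2 + ‖y‖ ^ 2 by positivity), mul_assoc]
    · rw [integral_const_mul]
      gcongr
  calc _ = 1 / (4 * Real.pi) * ((t ^ 2 + ‖y‖ ^ 2) * |∫ p : Phase, (coulombKernel j (y - posXt q t p) * γ p ^ 2
      - coulombKernel j (y - t • p.2) * γ p ^ 2)|) := by ring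
    _ ≤ 1 / (4 * Real.pi) * (C2 * t ^ (-(1 / 5) : ℝ) * N * C1) := by gcongr
    _ = _ := by ring

/-! ### Integration by parts along linear flows -/

/-- A measurable flow on phase space that scales the volume by `exp (c s)`. -/
structure IsScalingFlow (Φ : ℝ → Phase → Phase) (c : ℝ) : Prop where
  meas : Measurable fun x : ℝ × Phase => Φ x.1 x.2
  zero : ∀ p, Φ 0 p = p
  add : ∀ s r p, Φ (s + r) p = Φ r (Φ s p)
  mem : ∀ s, ∀ p ∈ phaseSpace, Φ s p ∈ phaseSpace
  map : ∀ s, Measure.map (Φ s) volume = ENNReal.ofReal (Real.exp (c * s)) • volume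

namespace IsScalingFlow

variable {Φ : ℝ → Phase → Phase} {c : ℝ}

theorem meas_left (h : IsScalingFlow Φ c) (s : ℝ) : Measurable (Φ s) :=
  h.meas.comp measurable_prodMk_left

theorem integrable_comp (h : IsScalingFlow Φ c) (s : ℝ) {f : Phase → ℝ} (hf : Integrable f) :
    Integrable fun p => f (Φ s p) := by
  have h1 : Integrable f (Measure.map (Φ s) volume) := by
    rw [h.map]; exact hf.smul_measure ENNReal.ofReal_ne_top
  exact h1.comp_measurable (h.meas_left s)

theorem integral_comp (h : IsScalingFlow Φ c) (s : ℝ) {f : Phase → ℝ} (hf : Integrable f) :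
    ∫ p, f (Φ s p) = Real.exp (c * s) * ∫ p, f p := by
  have h1 : Integrable f (Measure.map (Φ s) volume) := by
    rw [h.map]; exact hf.smul_measure ENNReal.ofReal_ne_top
  rw [← integral_map (h.meas_left s).aemeasurable h1.aestronglyMeasurable, h.map,
    integral_smul_measure, ENNReal.toReal_ofReal (Real.exp_pos _).le, smul_eq_mul]

/-- `∫ (d/ds f ∘ Φ_s)|₀ = c ∫ f`. -/
theorem integral_deriv (h : IsScalingFlow Φ c) {f g : Phase → ℝ} (hf : Integrable f)
    (hg : Integrable g) (hgm : Measurable g)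
    (hd : ∀ p ∈ phaseSpace, HasDerivAt (fun s => f (Φ s p)) (g p) 0) :
    ∫ p, g p = c * ∫ p, f p := by
  have hd' : ∀ p ∈ phaseSpace, ∀ s, HasDerivAt (fun s => f (Φ s p)) (g (Φ s p)) s := by
    intro p hp s
    have h1 := hd _ (h.mem s p hp)
    have h2 : HasDerivAt (fun r => f (Φ (r - s) (Φ s p))) (g (Φ s p)) s := by
      have := HasDerivAt.comp_sub_const s s (f := fun r => f (Φ r (Φ s p))) (by simpa using h1)
      exact this
    refine h2.congr_of_eventuallyEq (Filter.Eventually.of_forall fun r => ?_)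
    simp only [← h.add, add_sub_cancel]
  -- The derivative is integrated over unit flow time and Fubini is applied. This needs only
  -- integrability of `f` and `g`, and no domination of difference quotients. The common positive
  -- factor `∫₀¹ exp(cs) ds` is cancelled at the end.
  set ν : Measure ℝ := volume.restrict (Ioc 0 1) with hν
  have hm : Measurable fun x : ℝ × Phase => g (Φ x.1 x.2) := hgm.comp h.meas
  have hprod : Integrable (fun x : ℝ × Phase => g (Φ x.1 x.2)) (ν.prod volume) := by
    rw [integrable_prod_iff hm.aestronglyMeasurable]
    refine ⟨Filter.Eventually.of_forall fun s => h.integrable_comp s hg, ?_⟩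
    have e : ∀ s, ∫ p, ‖g (Φ s p)‖ = Real.exp (c * s) * ∫ p, ‖g p‖ := fun s =>
      h.integral_comp s hg.norm
    simp only [e]
    have : IntervalIntegrable (fun s => Real.exp (c * s) * ∫ p, ‖g p‖) volume 0 1 :=
      Continuous.intervalIntegrable (by fun_prop) _ _
    exact (intervalIntegrable_iff_integrableOn_Ioc_of_le zero_le_one).1 this
  have hae := hprod.prod_left_ae
  have h1 : ∀ᵐ p : Phase, ∫ s in Ioc (0 : ℝ) 1, g (Φ s p) = f (Φ 1 p) - f p := by
    filter_upwards [hae, ae_mem_phaseSpace] with p hp hps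
    have hi : IntervalIntegrable (fun s => g (Φ s p)) volume 0 1 :=
      (intervalIntegrable_iff_integrableOn_Ioc_of_le zero_le_one).2 hp
    have := intervalIntegral.integral_eq_sub_of_hasDerivAt (fun s _ => hd' p hps s) hi
    rw [intervalIntegral.integral_of_le zero_le_one, h.zero] at this
    exact this
  have h2 : ∫ p, (f (Φ 1 p) - f p) = (∫ s in Ioc (0 : ℝ) 1, Real.exp (c * s)) * ∫ p, g p := by
    rw [← integral_congr_ae h1]
    rw [← integral_integral_swap (f := fun s p => g (Φ s p)) hprod]
    simp_rw [h.integral_comp _ hg]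
    rw [integral_mul_const]
  rw [integral_sub (h.integrable_comp 1 hf) hf, h.integral_comp 1 hf, mul_one] at h2
  have h3 : c * ∫ s in Ioc (0 : ℝ) 1, Real.exp (c * s) = Real.exp c - 1 := by
    rw [← integral_const_mul, ← intervalIntegral.integral_of_le zero_le_one,
      intervalIntegral.integral_eq_sub_of_hasDerivAt (f := fun s => Real.exp (c * s))]
    · simp
    · intro s _
      have := ((hasDerivAt_id s).const_mul c).exp
      simpa [mul_comm] using this
    · exact Continuous.intervalIntegrable (by fun_prop) _ _
  have h4 : 0 < ∫ s in Ioc (0 : ℝ) 1, Real.exp (c * s) := by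
    rw [← intervalIntegral.integral_of_le zero_le_one]
    exact intervalIntegral.intervalIntegral_pos_of_pos
      (Continuous.intervalIntegrable (by fun_prop) _ _) (fun s => Real.exp_pos _) zero_lt_one
  have h5 : (∫ s in Ioc (0 : ℝ) 1, Real.exp (c * s)) * ((∫ p, g p) - c * ∫ p, f p) = 0 := by
    linear_combination -h2 - (∫ p, f p) * h3
  have h6 := (mul_eq_zero.1 h5).resolve_left h4.ne'
  linarith

end IsScalingFlow

/-- The scaling flow `(e^{-2s} ϑ, e^s 𝐚)`. -/
def flowS (s : ℝ) (p : Phase) : Phase := (Real.exp (-2 * s) • p.1, Real.exp s • p.2)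

/-- The scaling flow conjugated by the free transport. -/
def flowT (t s : ℝ) (p : Phase) : Phase := shift (-t) (flowS s (shift t p))

theorem map_exp_smul (s : ℝ) : Measure.map (fun x : E3 => Real.exp s • x) volume
    = ENNReal.ofReal (Real.exp (-(3 * s))) • volume := by
  rw [Measure.map_addHaar_smul volume (Real.exp_pos s).ne', finrank_E3, abs_of_pos (by positivity),
    Real.exp_neg, mul_comm 3 s, Real.exp_mul]
  norm_num

/-- The push-forward expands volume by `exp(6s)` in the angle and contracts it by `exp(-3s)` in the
action, which leaves the rate `3`. -/
theorem isScalingFlow_flowS : IsScalingFlow flowS 3 where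
  meas := by unfold flowS; fun_prop
  zero p := by simp [flowS]
  add s r p := by
    simp only [flowS, smul_smul, ← Real.exp_add]
    ring_nf
  mem s p hp := smul_ne_zero (Real.exp_pos s).ne' hp
  map s := by
    have h : flowS s = Prod.map (fun x : E3 => Real.exp (-2 * s) • x) (fun x : E3 => Real.exp s • x) := rfl
    rw [h, Measure.volume_eq_prod, ← Measure.map_prod_map _ _ (by fun_prop) (by fun_prop),
      map_exp_smul, map_exp_smul, Measure.prod_smul_left, Measure.prod_smul_right, smul_smul,
      ← ENNReal.ofReal_mul (Real.exp_pos _).le, ← Real.exp_add]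
    ring_nf

theorem shift_shift (s t : ℝ) (p : Phase) : shift s (shift t p) = shift (s + t) p := by
  simp only [shift, add_smul, Prod.mk.injEq, and_true]; abel

theorem shift_zero (p : Phase) : shift 0 p = p := by simp [shift]

theorem measurable_shift (t : ℝ) : Measurable (shift t) := by unfold shift; fun_prop

theorem measurePreserving_shift (t : ℝ) : MeasurePreserving (shift t) (volume : Measure Phase) volume := by
  refine ⟨measurable_shift t, ?_⟩
  ext s hs
  rw [Measure.map_apply (measurable_shift t) hs, Measure.volume_eq_prod,
    Measure.prod_apply_symm (measurable_shift t hs), Measure.prod_apply_symm hs]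
  refine lintegral_congr fun a => ?_
  have : (fun x : E3 => (x, a)) ⁻¹' (shift t ⁻¹' s) = (fun x => x + t • a) ⁻¹' ((fun x => (x, a)) ⁻¹' s) := rfl
  rw [this, measure_preimage_add_right]

theorem isScalingFlow_flowT (t : ℝ) : IsScalingFlow (flowT t) 3 where
  meas := by
    have h := isScalingFlow_flowS.meas
    have h1 : Measurable fun x : ℝ × Phase => (x.1, shift t x.2) := by
      have := measurable_shift t; fun_prop
    exact (measurable_shift (-t)).comp (h.comp h1)
  zero p := by simp [flowT, isScalingFlow_flowS.zero, shift_shift, shift_zero]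
  add s r p := by simp [flowT, isScalingFlow_flowS.add, shift_shift, shift_zero]
  mem s p hp := isScalingFlow_flowS.mem s _ hp
  map s := by
    have h : flowT t s = shift (-t) ∘ (flowS s ∘ shift t) := rfl
    rw [h, ← Measure.map_map (measurable_shift _) ((isScalingFlow_flowS.meas_left s).comp (measurable_shift _)),
      ← Measure.map_map (isScalingFlow_flowS.meas_left s) (measurable_shift _),
      (measurePreserving_shift t).map_eq, isScalingFlow_flowS.map, Measure.map_smul,
      (measurePreserving_shift (-t)).map_eq]

/-! ### Rotations in coordinate planes -/

/-- Infinitesimal rotation in the `(i, j)`-plane. -/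
def rotGen (i j : Fin 3) (x : E3) : E3 := x i • EuclideanSpace.single j 1 - x j • EuclideanSpace.single i 1

/-- Rotation by the angle `s` in the `(i, j)`-plane. -/
def rotFun (i j : Fin 3) (s : ℝ) (x : E3) : E3 :=
  x + (Real.cos s - 1) • (x i • EuclideanSpace.single i 1 + x j • EuclideanSpace.single j 1)
    + Real.sin s • rotGen i j x

theorem rotFun_apply {i j : Fin 3} (s : ℝ) (x : E3) (l : Fin 3) :
    rotFun i j s x l = x l + (Real.cos s - 1) * (x i * (if l = i then 1 else 0) + x j * (if l = j then 1 else 0))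
      + Real.sin s * (x i * (if l = j then 1 else 0) - x j * (if l = i then 1 else 0)) := by
  simp [rotFun, rotGen]
  split_ifs <;> ring

theorem norm_rotFun {i j : Fin 3} (hij : i ≠ j) (s : ℝ) (x : E3) : ‖rotFun i j s x‖ = ‖x‖ := by
  rw [← sq_eq_sq₀ (norm_nonneg _) (norm_nonneg _), norm_sq_E3, norm_sq_E3]
  simp only [rotFun_apply]
  have h := Real.sin_sq_add_cos_sq s
  fin_cases i <;> fin_cases j <;> first | exact absurd rfl hij | (simp; grind)

theorem rotFun_add {i j : Fin 3} (hij : i ≠ j) (s r : ℝ) (x : E3) :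
    rotFun i j (s + r) x = rotFun i j r (rotFun i j s x) := by
  ext l
  simp only [rotFun_apply, Real.sin_add, Real.cos_add]
  fin_cases i <;> fin_cases j <;> first | exact absurd rfl hij | (fin_cases l <;> simp <;> ring)

theorem rotFun_zero (i j : Fin 3) (x : E3) : rotFun i j 0 x = x := by simp [rotFun]

/-- The rotation as a linear isometry. -/
def rotIso {i j : Fin 3} (hij : i ≠ j) (s : ℝ) : E3 ≃ₗᵢ[ℝ] E3 where
  toFun := rotFun i j s
  invFun := rotFun i j (-s)
  map_add' x y := by simp only [rotFun, rotGen, PiLp.add_apply]; module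
  map_smul' c x := by simp only [rotFun, rotGen, PiLp.smul_apply, RingHom.id_apply, smul_eq_mul]; module
  left_inv x := by rw [← rotFun_add hij]; simp [rotFun_zero]
  right_inv x := by rw [← rotFun_add hij]; simp [rotFun_zero]
  norm_map' x := norm_rotFun hij s x

/-- Joint rotation of angle and action. -/
def flowR (i j : Fin 3) (s : ℝ) (p : Phase) : Phase := (rotFun i j s p.1, rotFun i j s p.2)

theorem continuous_rotFun (i j : Fin 3) : Continuous fun x : ℝ × E3 => rotFun i j x.1 x.2 := by
  unfold rotFun rotGen; fun_prop

theorem isScalingFlow_flowR {i j : Fin 3} (hij : i ≠ j) : IsScalingFlow (flowR i j) 0 where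
  meas := by
    have h1 : Measurable fun x : ℝ × Phase => rotFun i j x.1 x.2.1 :=
      ((continuous_rotFun i j).comp (by fun_prop : Continuous fun x : ℝ × Phase => (x.1, x.2.1))).measurable
    have h2 : Measurable fun x : ℝ × Phase => rotFun i j x.1 x.2.2 :=
      ((continuous_rotFun i j).comp (by fun_prop : Continuous fun x : ℝ × Phase => (x.1, x.2.2))).measurable
    exact h1.prodMk h2
  zero p := by simp [flowR, rotFun_zero]
  add s r p := by simp [flowR, rotFun_add hij]
  mem s p hp := by
    have : ‖rotFun i j s p.2‖ ≠ 0 := by rw [norm_rotFun hij]; exact norm_ne_zero_iff.2 hp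
    exact norm_ne_zero_iff.1 this
  map s := by
    have h : flowR i j s = Prod.map (rotIso hij s) (rotIso hij s) := rfl
    rw [h, Measure.volume_eq_prod, ← Measure.map_prod_map _ _ (rotIso hij s).continuous.measurable
      (rotIso hij s).continuous.measurable, (rotIso hij s).measurePreserving.map_eq]
    simp

theorem hasDerivAt_rotFun (i j : Fin 3) (x : E3) :
    HasDerivAt (fun s => rotFun i j s x) (rotGen i j x) 0 := by
  have h1 := (((Real.hasDerivAt_cos 0).sub_const 1).smul_const
    (x i • EuclideanSpace.single i (1 : ℝ) + x j • EuclideanSpace.single j 1 : E3)).const_add x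
  have h2 := (Real.hasDerivAt_sin 0).smul_const (rotGen i j x)
  refine HasDerivAt.congr_deriv (show HasDerivAt (fun s => rotFun i j s x) _ 0 from h1.add h2) ?_
  simp

section Ibp

variable {ψ : E3 → ℝ} {Y Z E : Phase → E3} {γ G J : Phase → ℝ} {i j : Fin 3} {Φ : ℝ → Phase → Phase}

/-- The quantity that is transported along the flow. -/
def ibpF (ψ : E3 → ℝ) (Y : Phase → E3) (γ : Phase → ℝ) (i : Fin 3) (p : Phase) : ℝ :=
  ψ (Y p) * (Y p i / ‖Y p‖ ^ 2) * γ p ^ 2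

/-- Its derivative along a flow under which `Y` and `γ` have derivatives `Z` and `G`. -/
def ibpG (ψ : E3 → ℝ) (Y Z : Phase → E3) (γ G : Phase → ℝ) (i : Fin 3) (p : Phase) : ℝ :=
  fderiv ℝ ψ (Y p) (Z p) * (Y p i / ‖Y p‖ ^ 2) * γ p ^ 2
    + ψ (Y p) * (Z p i / ‖Y p‖ ^ 2 - 2 * Y p i * inner ℝ (Y p) (Z p) / ‖Y p‖ ^ 4) * γ p ^ 2
    + ψ (Y p) * (Y p i / ‖Y p‖ ^ 2) * (2 * γ p * G p)

theorem hasDerivAt_ibpF (hψ : ContDiff ℝ 1 ψ) {c : ℝ} (hΦ : IsScalingFlow Φ c) {p : Phase} (hY : Y p ≠ 0)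
    (hYd : HasDerivAt (fun s => Y (Φ s p)) (Z p) 0) (hγd : HasDerivAt (fun s => γ (Φ s p)) (G p) 0)
    (i : Fin 3) : HasDerivAt (fun s => ibpF ψ Y γ i (Φ s p)) (ibpG ψ Y Z γ G i p) 0 := by
  have h0 := hΦ.zero p
  have hn : 0 < ‖Y p‖ := norm_pos_iff.2 hY
  have d1 : HasDerivAt (fun s => ψ (Y (Φ s p))) (fderiv ℝ ψ (Y p) (Z p)) 0 := by
    have h1 : HasFDerivAt ψ (fderiv ℝ ψ (Y p)) (Y (Φ 0 p)) := by
      rw [h0]; exact (hψ.differentiable (by norm_num)).differentiableAt.hasFDerivAt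
    exact h1.comp_hasDerivAt 0 hYd
  have d2 : HasDerivAt (fun s => Y (Φ s p) i) (Z p i) 0 := by
    have := (EuclideanSpace.proj (𝕜 := ℝ) i : E3 →L[ℝ] ℝ).hasFDerivAt (x := Y (Φ 0 p))
    exact this.comp_hasDerivAt 0 hYd
  have d3 : HasDerivAt (fun s => ‖Y (Φ s p)‖ ^ 2) (2 * inner ℝ (Y p) (Z p)) 0 := by
    have := hYd.norm_sq
    rwa [h0] at this
  have hne : ‖Y (Φ 0 p)‖ ^ 2 ≠ 0 := by rw [h0]; positivity
  have d4 := d2.div d3 hne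
  have d5 := (d1.mul d4).mul (hγd.pow 2)
  refine d5.congr_deriv ?_
  simp only [Pi.mul_apply, Pi.div_apply, Pi.pow_apply, h0, ibpG]
  field_simp
  ring

theorem abs_div_norm_sq_le {y : E3} (hy : y ≠ 0) (i : Fin 3) : |y i / ‖y‖ ^ 2| ≤ 1 / ‖y‖ := by
  have hn := norm_pos_iff.2 hy
  rw [abs_div, abs_of_pos (pow_pos hn 2), div_le_div_iff₀ (pow_pos hn 2) hn]
  have := abs_apply_le y i
  nlinarith

theorem abs_ibpF_le {p : Phase} (hY : Y p ≠ 0) (i : Fin 3) :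
    |ibpF ψ Y γ i p| ≤ |ψ (Y p)| * (1 / ‖Y p‖) * γ p ^ 2 := by
  rw [ibpF, abs_mul, abs_mul, abs_of_nonneg (sq_nonneg (γ p))]
  have := abs_div_norm_sq_le hY i
  gcongr

theorem abs_ibpG_sub_le {p : Phase} (hY : Y p ≠ 0) (i : Fin 3) :
    |ibpG ψ Y Z γ G i p - fderiv ℝ ψ (Y p) (Z p) * (Y p i / ‖Y p‖ ^ 2) * γ p ^ 2|
      ≤ 3 * (|ψ (Y p)| * (‖Z p‖ / ‖Y p‖ ^ 2) * γ p ^ 2)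
        + 2 * (|ψ (Y p)| * (1 / ‖Y p‖) * |γ p * G p|) := by
  have hn : 0 < ‖Y p‖ := norm_pos_iff.2 hY
  rw [ibpG, add_assoc, add_sub_cancel_left]
  refine (abs_add_le _ _).trans (add_le_add ?_ ?_)
  · rw [abs_mul, abs_mul, abs_of_nonneg (sq_nonneg (γ p))]
    have h1 : |Z p i / ‖Y p‖ ^ 2 - 2 * Y p i * inner ℝ (Y p) (Z p) / ‖Y p‖ ^ 4|
        ≤ 3 * (‖Z p‖ / ‖Y p‖ ^ 2) := by
      refine (abs_sub _ _).trans ?_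
      have h2 : |Z p i / ‖Y p‖ ^ 2| ≤ ‖Z p‖ / ‖Y p‖ ^ 2 := by
        rw [abs_div, abs_of_pos (pow_pos hn 2)]
        have := abs_apply_le (Z p) i
        gcongr
      have h3 : |2 * Y p i * inner ℝ (Y p) (Z p) / ‖Y p‖ ^ 4| ≤ 2 * (‖Z p‖ / ‖Y p‖ ^ 2) := by
        rw [abs_div, abs_mul, abs_mul, abs_of_pos (pow_pos hn 4), abs_two]
        have e1 := abs_apply_le (Y p) i
        have e2 := abs_real_inner_le_norm (Y p) (Z p)
        calc _ ≤ 2 * ‖Y p‖ * (‖Y p‖ * ‖Z p‖) / ‖Y p‖ ^ 4 := by gcongr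
          _ = _ := by field_simp
      linarith
    calc _ ≤ |ψ (Y p)| * (3 * (‖Z p‖ / ‖Y p‖ ^ 2)) * γ p ^ 2 := by gcongr
      _ = _ := by ring
  · rw [abs_mul, abs_mul, show 2 * γ p * G p = 2 * (γ p * G p) by ring, abs_mul 2, abs_two]
    have := abs_div_norm_sq_le hY i
    calc _ ≤ |ψ (Y p)| * (1 / ‖Y p‖) * (2 * |γ p * G p|) := by gcongr
      _ = _ := by ring

theorem norm_rotGen_le (i j : Fin 3) (x : E3) : ‖rotGen i j x‖ ≤ 2 * ‖x‖ := by
  unfold rotGen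
  refine (norm_sub_le _ _).trans ?_
  simp only [norm_smul, PiLp.norm_single, norm_one, mul_one]
  have h1 := abs_apply_le x i
  have h2 := abs_apply_le x j
  simp only [Real.norm_eq_abs]
  linarith

theorem sum_single_E3 (x : E3) : ∑ l, x l • EuclideanSpace.single l (1 : ℝ) = x := by
  ext l
  simp [Pi.single_apply]

/-- Decomposition of a partial derivative into rotations and the radial derivative. -/
theorem apply_single_eq (D : E3 →L[ℝ] ℝ) {y : E3} (hy : y ≠ 0) (j : Fin 3) :
    D (EuclideanSpace.single j 1)
      = ∑ i ∈ Finset.univ.erase j, D (rotGen i j y) * (y i / ‖y‖ ^ 2) + D y * (y j / ‖y‖ ^ 2) := by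
  have hn : 0 < ‖y‖ := norm_pos_iff.2 hy
  have e1 : D (rotGen j j y) = 0 := by simp [rotGen]
  have e2 : ∑ i ∈ Finset.univ.erase j, D (rotGen i j y) * (y i / ‖y‖ ^ 2)
      = ∑ i, D (rotGen i j y) * (y i / ‖y‖ ^ 2) := by
    rw [← Finset.sum_erase_add _ _ (Finset.mem_univ j), e1, zero_mul, add_zero]
  have e3 : D y = ∑ i, y i * D (EuclideanSpace.single i 1) := by
    conv_lhs => rw [← sum_single_E3 y]
    simp
  have e4 := norm_sq_E3 y
  rw [e2, e3]
  simp only [rotGen, map_sub, map_smul, smul_eq_mul, Fin.sum_univ_three]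
  field_simp
  rw [e4]
  ring

/-- The unified integration by parts bound. -/
theorem abs_integral_fderiv_le (hψ : ContDiff ℝ 1 ψ) (hΦ : IsScalingFlow Φ 3) (hYm : Measurable Y)
    (hEm : Measurable E) (hγm : Measurable γ) (hGm : Measurable G) {Gr : Fin 3 → Phase → ℝ}
    (hGrm : ∀ i, Measurable (Gr i)) {β : ℝ} (hβ1 : 1 ≤ |β|) (hβ2 : |β| ≤ 2) (j : Fin 3)
    (hY0 : ∀ p ∈ phaseSpace, Y p ≠ 0)
    (hYd : ∀ p ∈ phaseSpace, HasDerivAt (fun s => Y (Φ s p)) (β • Y p + E p) 0)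
    (hγd : ∀ p ∈ phaseSpace, HasDerivAt (fun s => γ (Φ s p)) (G p) 0)
    (hYr : ∀ i, i ≠ j → ∀ p ∈ phaseSpace, HasDerivAt (fun s => Y (flowR i j s p)) (rotGen i j (Y p)) 0)
    (hγr : ∀ i, i ≠ j → ∀ p ∈ phaseSpace, HasDerivAt (fun s => γ (flowR i j s p)) (Gr i p) 0)
    (hJ : Integrable J) {K : ℝ}
    (h1 : ∀ᵐ p, |ψ (Y p)| * (1 / ‖Y p‖) * γ p ^ 2 ≤ J p)
    (h2 : ∀ᵐ p, |ψ (Y p)| * (1 / ‖Y p‖) * |γ p * G p| ≤ J p)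
    (h3 : ∀ i, i ≠ j → ∀ᵐ p, |ψ (Y p)| * (1 / ‖Y p‖) * |γ p * Gr i p| ≤ J p)
    (h4 : ∀ᵐ p, ‖fderiv ℝ ψ (Y p)‖ * (‖E p‖ / ‖Y p‖) * γ p ^ 2 ≤ J p)
    (h5 : ∀ᵐ p, |ψ (Y p)| * (‖E p‖ / ‖Y p‖ ^ 2) * γ p ^ 2 ≤ J p)
    (h6 : ∀ᵐ p, ‖fderiv ℝ ψ (Y p)‖ * γ p ^ 2 ≤ K * J p) :
    |∫ p, fderiv ℝ ψ (Y p) (EuclideanSpace.single j 1) * γ p ^ 2| ≤ 31 * ∫ p, J p := by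
  have hdψ : Continuous (fderiv ℝ ψ) := hψ.continuous_fderiv (by norm_num)
  have hm0 : Measurable ψ := hψ.continuous.measurable
  have hm1 : ∀ {Z : Phase → E3}, Measurable Z → Measurable fun p => fderiv ℝ ψ (Y p) (Z p) := by
    intro Z hZ
    have hc : Continuous fun x : E3 × E3 => fderiv ℝ ψ x.1 x.2 :=
      (hdψ.comp continuous_fst).clm_apply continuous_snd
    exact hc.measurable.comp (hYm.prodMk hZ)
  have hmF : Measurable (ibpF ψ Y γ j) := by unfold ibpF; fun_prop
  have hmG : ∀ {Z : Phase → E3} {G : Phase → ℝ} (i : Fin 3), Measurable Z → Measurable G →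
      Measurable (ibpG ψ Y Z γ G i) := by
    intro Z G i hZ hG
    have := hm1 hZ
    unfold ibpG; fun_prop
  have hmF' : ∀ i, Measurable (ibpF ψ Y γ i) := fun i => by unfold ibpF; fun_prop
  have hZ : Measurable fun p => β • Y p + E p := by fun_prop
  have hRm : ∀ i, Measurable fun p => rotGen i j (Y p) := fun i => by unfold rotGen; fun_prop
  -- pointwise bounds
  have hFle : ∀ i, ∀ᵐ p, |ibpF ψ Y γ i p| ≤ J p := fun i => by
    filter_upwards [h1, ae_mem_phaseSpace] with p a1 hp
    exact (abs_ibpF_le (hY0 p hp) i).trans a1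
  have hRle : ∀ i, i ≠ j → ∀ᵐ p, |ibpG ψ Y (fun p => rotGen i j (Y p)) γ (Gr i) i p
      - fderiv ℝ ψ (Y p) (rotGen i j (Y p)) * (Y p i / ‖Y p‖ ^ 2) * γ p ^ 2| ≤ 8 * J p := fun i hi => by
    filter_upwards [h1, h3 i hi, ae_mem_phaseSpace] with p a1 a3 hp
    have hn : 0 < ‖Y p‖ := norm_pos_iff.2 (hY0 p hp)
    refine (abs_ibpG_sub_le (hY0 p hp) i).trans ?_
    have : |ψ (Y p)| * (‖rotGen i j (Y p)‖ / ‖Y p‖ ^ 2) * γ p ^ 2 ≤ 2 * J p := by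
      calc _ ≤ |ψ (Y p)| * (2 * ‖Y p‖ / ‖Y p‖ ^ 2) * γ p ^ 2 := by
            have := norm_rotGen_le i j (Y p)
            gcongr
        _ = 2 * (|ψ (Y p)| * (1 / ‖Y p‖) * γ p ^ 2) := by field_simp
        _ ≤ _ := by linarith
    linarith
  have hDle : ∀ᵐ p, |ibpG ψ Y (fun p => β • Y p + E p) γ G j p
      - fderiv ℝ ψ (Y p) (β • Y p + E p) * (Y p j / ‖Y p‖ ^ 2) * γ p ^ 2| ≤ 11 * J p := by
    filter_upwards [h1, h2, h5, ae_mem_phaseSpace] with p a1 a2 a5 hp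
    have hn : 0 < ‖Y p‖ := norm_pos_iff.2 (hY0 p hp)
    refine (abs_ibpG_sub_le (Z := fun p => β • Y p + E p) (hY0 p hp) j).trans ?_
    have : |ψ (Y p)| * (‖β • Y p + E p‖ / ‖Y p‖ ^ 2) * γ p ^ 2 ≤ 3 * J p := by
      calc _ ≤ |ψ (Y p)| * ((2 * ‖Y p‖ + ‖E p‖) / ‖Y p‖ ^ 2) * γ p ^ 2 := by
            have : ‖β • Y p + E p‖ ≤ 2 * ‖Y p‖ + ‖E p‖ := by
              refine (norm_add_le _ _).trans ?_
              rw [norm_smul, Real.norm_eq_abs]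
              gcongr
            gcongr
        _ = 2 * (|ψ (Y p)| * (1 / ‖Y p‖) * γ p ^ 2) + |ψ (Y p)| * (‖E p‖ / ‖Y p‖ ^ 2) * γ p ^ 2 := by
            field_simp
        _ ≤ _ := by linarith
    linarith
  -- integrability
  have hDY : ∀ {Z : Phase → E3} (i : Fin 3) {B : ℝ}, (∀ᵐ p, ‖fderiv ℝ ψ (Y p) (Z p) * (Y p i / ‖Y p‖ ^ 2)
      * γ p ^ 2‖ ≤ B * J p) → Measurable Z →
      Integrable fun p => fderiv ℝ ψ (Y p) (Z p) * (Y p i / ‖Y p‖ ^ 2) * γ p ^ 2 := by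
    intro Z i B hB hZ
    have := hm1 hZ
    exact (hJ.const_mul B).mono' (Measurable.aestronglyMeasurable (by fun_prop)) hB
  have iF : ∀ i, Integrable (ibpF ψ Y γ i) := fun i =>
    hJ.mono' (hmF' i).aestronglyMeasurable (hFle i)
  -- The crude bound `h6` serves only to make the individual terms integrable. Its constant does not
  -- enter the final estimate, because these main terms cancel in the remainder.
  have iR0 : ∀ i, Integrable fun p => fderiv ℝ ψ (Y p) (rotGen i j (Y p)) * (Y p i / ‖Y p‖ ^ 2) * γ p ^ 2 :=
    fun i => by
    refine hDY i (B := 2 * K) ?_ (hRm i)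
    filter_upwards [h6, ae_mem_phaseSpace] with p a6 hp
    have hn : 0 < ‖Y p‖ := norm_pos_iff.2 (hY0 p hp)
    rw [norm_mul, norm_mul, Real.norm_of_nonneg (sq_nonneg (γ p)), Real.norm_eq_abs (_ / _)]
    have e1 := (fderiv ℝ ψ (Y p)).le_opNorm (rotGen i j (Y p))
    have e2 := norm_rotGen_le i j (Y p)
    have e3 := abs_div_norm_sq_le (hY0 p hp) i
    calc _ ≤ (‖fderiv ℝ ψ (Y p)‖ * (2 * ‖Y p‖)) * (1 / ‖Y p‖) * γ p ^ 2 := by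
          gcongr
          exact e1.trans (by gcongr)
      _ = 2 * (‖fderiv ℝ ψ (Y p)‖ * γ p ^ 2) := by field_simp
      _ ≤ _ := by linarith
  have hDE : ∀ᵐ p, |fderiv ℝ ψ (Y p) (E p) * (Y p j / ‖Y p‖ ^ 2) * γ p ^ 2| ≤ J p := by
    filter_upwards [h4, ae_mem_phaseSpace] with p a4 hp
    rw [abs_mul, abs_mul, abs_of_nonneg (sq_nonneg (γ p))]
    have e1 := (fderiv ℝ ψ (Y p)).le_opNorm (E p)
    rw [Real.norm_eq_abs] at e1
    have e3 := abs_div_norm_sq_le (hY0 p hp) j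
    calc _ ≤ (‖fderiv ℝ ψ (Y p)‖ * ‖E p‖) * (1 / ‖Y p‖) * γ p ^ 2 := by gcongr
      _ = ‖fderiv ℝ ψ (Y p)‖ * (‖E p‖ / ‖Y p‖) * γ p ^ 2 := by ring
      _ ≤ _ := a4
  have hDYY : ∀ᵐ p, |fderiv ℝ ψ (Y p) (Y p) * (Y p j / ‖Y p‖ ^ 2) * γ p ^ 2| ≤ K * J p := by
    filter_upwards [h6, ae_mem_phaseSpace] with p a6 hp
    have hn : 0 < ‖Y p‖ := norm_pos_iff.2 (hY0 p hp)
    rw [abs_mul, abs_mul, abs_of_nonneg (sq_nonneg (γ p))]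
    have e1 := (fderiv ℝ ψ (Y p)).le_opNorm (Y p)
    rw [Real.norm_eq_abs] at e1
    have e3 := abs_div_norm_sq_le (hY0 p hp) j
    calc _ ≤ (‖fderiv ℝ ψ (Y p)‖ * ‖Y p‖) * (1 / ‖Y p‖) * γ p ^ 2 := by gcongr
      _ = ‖fderiv ℝ ψ (Y p)‖ * γ p ^ 2 := by field_simp
      _ ≤ _ := a6
  have hsplit : ∀ p, fderiv ℝ ψ (Y p) (β • Y p + E p) * (Y p j / ‖Y p‖ ^ 2) * γ p ^ 2
      = β * (fderiv ℝ ψ (Y p) (Y p) * (Y p j / ‖Y p‖ ^ 2) * γ p ^ 2)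
        + fderiv ℝ ψ (Y p) (E p) * (Y p j / ‖Y p‖ ^ 2) * γ p ^ 2 := fun p => by
    rw [map_add, map_smul, smul_eq_mul]; ring
  have iD0 : Integrable fun p => fderiv ℝ ψ (Y p) (β • Y p + E p) * (Y p j / ‖Y p‖ ^ 2) * γ p ^ 2 := by
    simp only [hsplit]
    exact ((hDY j hDYY hYm).const_mul β).add (hDY j (B := 1) (by simpa only [one_mul, Real.norm_eq_abs] using hDE) hEm)
  have iR : ∀ i, i ≠ j → Integrable (ibpG ψ Y (fun p => rotGen i j (Y p)) γ (Gr i) i) := fun i hi => by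
    have h := (iR0 i).add ((hJ.const_mul 8).mono' (((hmG i (hRm i) (hGrm i)).sub
      (show Measurable (fun p => fderiv ℝ ψ (Y p) (rotGen i j (Y p)) * (Y p i / ‖Y p‖ ^ 2) * γ p ^ 2) by
        have := hm1 (hRm i); fun_prop)).aestronglyMeasurable) (hRle i hi))
    refine h.congr (Filter.Eventually.of_forall fun p => ?_)
    simp
  have iD : Integrable (ibpG ψ Y (fun p => β • Y p + E p) γ G j) := by
    have h := iD0.add ((hJ.const_mul 11).mono' (((hmG j hZ hGm).sub
      (show Measurable (fun p => fderiv ℝ ψ (Y p) (β • Y p + E p) * (Y p j / ‖Y p‖ ^ 2) * γ p ^ 2) by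
        have := hm1 hZ; fun_prop)).aestronglyMeasurable) hDle)
    refine h.congr (Filter.Eventually.of_forall fun p => ?_)
    simp
  -- the flow identities
  have eR : ∀ i, i ≠ j → ∫ p, ibpG ψ Y (fun p => rotGen i j (Y p)) γ (Gr i) i p = 0 := fun i hi => by
    rw [(isScalingFlow_flowR hi).integral_deriv (iF i) (iR i hi) (hmG i (hRm i) (hGrm i)), zero_mul]
    exact fun p hp => hasDerivAt_ibpF hψ (isScalingFlow_flowR hi) (hY0 p hp) (hYr i hi p hp) (hγr i hi p hp) i
  have eD : ∫ p, ibpG ψ Y (fun p => β • Y p + E p) γ G j p = 3 * ∫ p, ibpF ψ Y γ j p :=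
    hΦ.integral_deriv (iF j) iD (hmG j hZ hGm) fun p hp =>
      hasDerivAt_ibpF hψ hΦ (hY0 p hp) (hYd p hp) (hγd p hp) j
  have hβ0 : β ≠ 0 := fun h => by rw [h, abs_zero] at hβ1; linarith
  have hβi : |β⁻¹| ≤ 1 := by rw [abs_inv]; exact inv_le_one_of_one_le₀ hβ1
  -- the remainder
  set H : Phase → ℝ := fun p => fderiv ℝ ψ (Y p) (EuclideanSpace.single j 1) * γ p ^ 2 with hH
  set T : Phase → ℝ := fun p => (∑ i ∈ Finset.univ.erase j, ibpG ψ Y (fun p => rotGen i j (Y p)) γ (Gr i) i p)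
    + β⁻¹ * ibpG ψ Y (fun p => β • Y p + E p) γ G j p with hT
  have iT : Integrable T := (integrable_finsetSum _ fun i hi => iR i (Finset.ne_of_mem_erase hi)).add
    (iD.const_mul _)
  have hmH : Measurable H := by
    have := hm1 (Z := fun _ => EuclideanSpace.single j 1) measurable_const
    fun_prop
  -- `28 = 16 + 11 + 1`: two rotations at `8` each, the remainder of the scaling derivative, and the
  -- term with `E`. The integral of `T` itself contributes the missing `3` to `31`.
  have hrem : ∀ᵐ p, |H p - T p| ≤ 28 * J p := by
    have hall : ∀ᵐ p, ∀ i, i ≠ j → |ibpG ψ Y (fun p => rotGen i j (Y p)) γ (Gr i) i p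
      - fderiv ℝ ψ (Y p) (rotGen i j (Y p)) * (Y p i / ‖Y p‖ ^ 2) * γ p ^ 2| ≤ 8 * J p := by
      rw [ae_all_iff]; intro i
      by_cases hi : i = j
      · exact Filter.Eventually.of_forall fun p h => absurd hi h
      · exact (hRle i hi).mono fun p h _ => h
    filter_upwards [hall, hDle, hDE, ae_mem_phaseSpace] with p aR aD aE hp
    have e1 := apply_single_eq (fderiv ℝ ψ (Y p)) (hY0 p hp) j
    have e2 : H p - T p = -(∑ i ∈ Finset.univ.erase j, (ibpG ψ Y (fun p => rotGen i j (Y p)) γ (Gr i) i p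
        - fderiv ℝ ψ (Y p) (rotGen i j (Y p)) * (Y p i / ‖Y p‖ ^ 2) * γ p ^ 2))
        - β⁻¹ * ((ibpG ψ Y (fun p => β • Y p + E p) γ G j p
          - fderiv ℝ ψ (Y p) (β • Y p + E p) * (Y p j / ‖Y p‖ ^ 2) * γ p ^ 2)
          + fderiv ℝ ψ (Y p) (E p) * (Y p j / ‖Y p‖ ^ 2) * γ p ^ 2) := by
      simp only [hH, hT]
      rw [e1, hsplit, Finset.sum_sub_distrib, add_mul, Finset.sum_mul]
      linear_combination (-(fderiv ℝ ψ (Y p) (Y p) * (Y p j / ‖Y p‖ ^ 2) * γ p ^ 2)) * inv_mul_cancel₀ hβ0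
    rw [e2]
    refine (abs_sub _ _).trans ?_
    rw [abs_neg, abs_mul]
    have b1 : |∑ i ∈ Finset.univ.erase j, (ibpG ψ Y (fun p => rotGen i j (Y p)) γ (Gr i) i p
        - fderiv ℝ ψ (Y p) (rotGen i j (Y p)) * (Y p i / ‖Y p‖ ^ 2) * γ p ^ 2)| ≤ 16 * J p := by
      refine (Finset.abs_sum_le_sum_abs _ _).trans ?_
      refine (Finset.sum_le_card_nsmul _ _ (8 * J p) fun i hi => aR i (Finset.ne_of_mem_erase hi)).trans ?_
      rw [Finset.card_erase_of_mem (Finset.mem_univ j)]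
      simp; linarith
    have b2 := (abs_add_le (ibpG ψ Y (fun p => β • Y p + E p) γ G j p
          - fderiv ℝ ψ (Y p) (β • Y p + E p) * (Y p j / ‖Y p‖ ^ 2) * γ p ^ 2)
          (fderiv ℝ ψ (Y p) (E p) * (Y p j / ‖Y p‖ ^ 2) * γ p ^ 2)).trans (add_le_add aD aE)
    have b3 := mul_le_mul hβi b2 (abs_nonneg _) zero_le_one
    linarith
  have iHT : Integrable fun p => H p - T p :=
    (hJ.const_mul 28).mono' (hmH.aestronglyMeasurable.sub iT.aestronglyMeasurable) hrem
  have iH : Integrable H := by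
    refine (iHT.add iT).congr (Filter.Eventually.of_forall fun p => ?_)
    simp
  have eT : ∫ p, T p = β⁻¹ * (3 * ∫ p, ibpF ψ Y γ j p) := by
    simp only [hT]
    rw [integral_add (integrable_finsetSum _ fun i hi => iR i (Finset.ne_of_mem_erase hi)) (iD.const_mul _),
      integral_finsetSum _ fun i hi => iR i (Finset.ne_of_mem_erase hi), integral_const_mul, eD,
      Finset.sum_eq_zero fun i hi => eR i (Finset.ne_of_mem_erase hi), zero_add]
  have eH : ∫ p, H p = (∫ p, (H p - T p)) + β⁻¹ * (3 * ∫ p, ibpF ψ Y γ j p) := by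
    rw [← eT, integral_sub iH iT]; ring
  have b1 : |∫ p, (H p - T p)| ≤ 28 * ∫ p, J p := by
    rw [← integral_const_mul, ← Real.norm_eq_abs]
    exact norm_integral_le_of_norm_le (hJ.const_mul 28) hrem
  have b2 : |∫ p, ibpF ψ Y γ j p| ≤ ∫ p, J p := by
    rw [← Real.norm_eq_abs]
    exact norm_integral_le_of_norm_le hJ (hFle j)
  rw [eH]
  refine (abs_add_le _ _).trans ?_
  rw [abs_mul, abs_mul, abs_of_pos (show (0 : ℝ) < 3 by norm_num)]
  have := mul_le_mul hβi b2 (abs_nonneg _) zero_le_one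
  linarith

end Ibp

/-! ### Derivatives of the position along the flows -/

section Position

variable {q t : ℝ}

theorem shift_flowT (t s : ℝ) (p : Phase) : shift t (flowT t s p) = flowS s (shift t p) := by
  simp [flowT, shift_shift, shift_zero]

theorem posX_flowS (hq : 0 < q) (s : ℝ) {p : Phase} (hp : p ∈ phaseSpace) :
    posX q (flowS s p) = Real.exp (-2 * s) • posX q p := by
  have h := posX_scaling hq (Real.exp_pos s) hp
  have e : (Real.exp s ^ 2)⁻¹ = Real.exp (-2 * s) := by
    rw [← Real.exp_nat_mul, ← Real.exp_neg]; congr 1; push_cast; ring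
  rw [e] at h
  exact h

/-- Conjugating by free transport makes `𝐗̃` exactly homogeneous, so no error term appears. The
price is the summand `3t` times the transport field in the generator. -/
theorem posXt_flowT (hq : 0 < q) (s : ℝ) {p : Phase} (hp : p ∈ phaseSpace) :
    posXt q t (flowT t s p) = Real.exp (-2 * s) • posXt q t p := by
  rw [posXt_eq_shift, shift_flowT, posX_flowS hq s (shift_mem t hp), posXt_eq_shift]

theorem hasDerivAt_exp_neg_two_zero : HasDerivAt (fun s : ℝ => Real.exp (-2 * s)) (-2) 0 := by
  have := ((hasDerivAt_id (0 : ℝ)).const_mul (-2)).exp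
  simpa using this

theorem hasDerivAt_posXt_flowT (hq : 0 < q) (t : ℝ) {p : Phase} (hp : p ∈ phaseSpace) :
    HasDerivAt (fun s => posXt q t (flowT t s p)) ((-2 : ℝ) • posXt q t p + (0 : E3)) 0 := by
  simp only [posXt_flowT hq _ hp, add_zero]
  exact hasDerivAt_exp_neg_two_zero.smul_const _

/-- The deviation of the scaling derivative of `𝐗̃` from `𝐗̃`. -/
def errX (q t : ℝ) (p : Phase) : E3 := (3 : ℝ) • (t • vel q (shift t p) - posXt q t p)

theorem hasDerivAt_posXt_flowS (hq : 0 < q) (t : ℝ) {p : Phase} (hp : p ∈ phaseSpace) :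
    HasDerivAt (fun s => posXt q t (flowS s p)) ((1 : ℝ) • posXt q t p + errX q t p) 0 := by
  -- Without conjugation the scaling rescales time: `𝐗̃` becomes `e^(-2s)` times the position at
  -- time `t e^(3s)`. The derivative is `-2𝐗̃ + 3t` times the velocity, that is `𝐗̃` plus three
  -- times the homogeneity defect.
  have e : ∀ s, posXt q t (flowS s p) = Real.exp (-2 * s) • posX q (shift (t * Real.exp (3 * s)) p) := by
    intro s
    rw [← posX_flowS hq s (shift_mem _ hp), posXt_eq_shift]
    congr 1
    simp only [shift, flowS, smul_add, smul_smul, Prod.mk.injEq, and_true]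
    congr 2
    have : Real.exp s = Real.exp (-2 * s) * Real.exp (3 * s) := by rw [← Real.exp_add]; congr 1; ring
    rw [this]; ring
  simp only [e]
  have h1 : HasDerivAt (fun s : ℝ => t * Real.exp (3 * s)) (t * 3) 0 := by
    have := (((hasDerivAt_id (0 : ℝ)).const_mul 3).exp).const_mul t
    simpa using this
  have h2 := (hasDerivAt_posX_shift hq hp (t * Real.exp (3 * 0)))
  have h3 := HasDerivAt.scomp (0 : ℝ) h2 h1
  have h4 := hasDerivAt_exp_neg_two_zero.smul h3
  refine h4.congr_deriv ?_
  simp only [Function.comp, mul_zero, Real.exp_zero, mul_one, one_smul, errX, posXt_eq_shift]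
  module

theorem hasDerivAt_smul_flowS (t : ℝ) (p : Phase) :
    HasDerivAt (fun s => t • (flowS s p).2) ((1 : ℝ) • (t • p.2) + (0 : E3)) 0 := by
  have h := ((Real.hasDerivAt_exp 0).smul_const p.2).const_smul t
  refine h.congr_deriv ?_
  simp

theorem hasDerivAt_posXt_flowR (hq : 0 < q) (t : ℝ) {i j : Fin 3} (hij : i ≠ j) {p : Phase}
    (hp : p ∈ phaseSpace) :
    HasDerivAt (fun s => posXt q t (flowR i j s p)) (rotGen i j (posXt q t p)) 0 := by
  have e : ∀ s, posXt q t (flowR i j s p) = rotFun i j s (posXt q t p) := fun s =>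
    posXt_isometry hq t (rotIso hij s) hp
  simp only [e]
  exact hasDerivAt_rotFun i j _

theorem hasDerivAt_smul_flowR (t : ℝ) (i j : Fin 3) (p : Phase) :
    HasDerivAt (fun s => t • (flowR i j s p).2) (rotGen i j (t • p.2)) 0 := by
  refine ((hasDerivAt_rotFun i j p.2).const_smul t).congr_deriv ?_
  simp only [rotGen, PiLp.smul_apply, smul_eq_mul]
  module

theorem measurable_psi (q : ℝ) : Measurable (psi q) := by
  unfold psi
  have := measurable_sg q; have := measurable_kappa q
  fun_prop

theorem measurable_perp : Measurable perp := by
  unfold perp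
  have := measurable_dir
  fun_prop

theorem measurable_vel (q : ℝ) : Measurable (vel q) := by
  unfold vel
  have := measurable_sg q; have := measurable_psi q; have := measurable_act; have := measurable_scl q
  have := measurable_dir; have := measurable_perp
  fun_prop

theorem measurable_errX (q t : ℝ) : Measurable (errX q t) := by
  have h := (measurable_vel q).comp (measurable_shift t)
  simp only [Function.comp_def] at h
  have := measurable_posXt q t
  unfold errX; fun_prop

end Position

/-! ### Derivatives of the density along the flows -/

section Density

variable {γ : Phase → ℝ}

/-- The derivative of `γ` along a vector field, set to zero outside the phase space. -/
def dAlong (γ : Phase → ℝ) (v : Phase → Phase) (p : Phase) : ℝ :=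
  phaseSpace.indicator (fun p => fderiv ℝ γ p (v p)) p

theorem differentiableAt_of_contDiffOn (hγ : ContDiffOn ℝ 1 γ phaseSpace) {p : Phase} (hp : p ∈ phaseSpace) :
    DifferentiableAt ℝ γ p :=
  (hγ.differentiableOn (by norm_num)).differentiableAt (isOpen_phaseSpace.mem_nhds hp)

theorem measurable_indicator_of_continuousOn {f : Phase → ℝ} (hf : ContinuousOn f phaseSpace) :
    Measurable (phaseSpace.indicator f) := by
  classical
  rw [← piecewise_eq_indicator]
  exact hf.measurable_piecewise continuousOn_const measurableSet_phaseSpace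

theorem measurable_dAlong (hγ : ContDiffOn ℝ 1 γ phaseSpace) {v : Phase → Phase} (hv : Continuous v) :
    Measurable (dAlong γ v) :=
  measurable_indicator_of_continuousOn
    ((hγ.continuousOn_fderiv_of_isOpen isOpen_phaseSpace le_rfl).clm_apply hv.continuousOn)

theorem hasDerivAt_indicator_flow (hγ : ContDiffOn ℝ 1 γ phaseSpace) {Φ : ℝ → Phase → Phase} {c : ℝ}
    (hΦ : IsScalingFlow Φ c) {v : Phase → Phase} {p : Phase} (hp : p ∈ phaseSpace)
    (hv : HasDerivAt (fun s => Φ s p) (v p) 0) :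
    HasDerivAt (fun s => phaseSpace.indicator γ (Φ s p)) (dAlong γ v p) 0 := by
  have e : ∀ s, phaseSpace.indicator γ (Φ s p) = γ (Φ s p) := fun s => indicator_of_mem (hΦ.mem s p hp) _
  simp only [e]
  rw [dAlong, indicator_of_mem hp]
  have h1 : HasFDerivAt γ (fderiv ℝ γ p) (Φ 0 p) := by
    rw [hΦ.zero]; exact (differentiableAt_of_contDiffOn hγ hp).hasFDerivAt
  exact h1.comp_hasDerivAt 0 hv

/-- Generator of `flowS`. -/
def vecS (p : Phase) : Phase := ((-2 : ℝ) • p.1, p.2)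
/-- Generator of the free transport. -/
def vecH (p : Phase) : Phase := (p.2, 0)
/-- Generator of `flowT`. -/
def vecT (t : ℝ) (p : Phase) : Phase := vecS p - (3 * t) • vecH p
/-- Generator of `flowR`. -/
def vecR (i j : Fin 3) (p : Phase) : Phase := (rotGen i j p.1, rotGen i j p.2)

theorem continuous_rotGen (i j : Fin 3) : Continuous (rotGen i j) := by unfold rotGen; fun_prop

theorem continuous_vecS : Continuous vecS := by unfold vecS; fun_prop
theorem continuous_vecH : Continuous vecH := by unfold vecH; fun_prop
theorem continuous_vecT (t : ℝ) : Continuous (vecT t) := by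
  unfold vecT; have := continuous_vecS; have := continuous_vecH; fun_prop
theorem continuous_vecR (i j : Fin 3) : Continuous (vecR i j) := by
  unfold vecR; have := continuous_rotGen i j; fun_prop

theorem hasDerivAt_flowS (p : Phase) : HasDerivAt (fun s => flowS s p) (vecS p) 0 := by
  have h1 := hasDerivAt_exp_neg_two_zero.smul_const p.1
  have h2 := (Real.hasDerivAt_exp 0).smul_const p.2
  rw [Real.exp_zero, one_smul] at h2
  exact h1.prodMk h2

theorem hasDerivAt_flowT (t : ℝ) (p : Phase) : HasDerivAt (fun s => flowT t s p) (vecT t p) 0 := by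
  have h1 := hasDerivAt_exp_neg_two_zero.smul_const (p.1 + t • p.2)
  have h2 := (Real.hasDerivAt_exp 0).smul_const p.2
  rw [Real.exp_zero, one_smul] at h2
  have h3 := (h1.add (h2.const_smul (-t))).prodMk h2
  refine HasDerivAt.congr_deriv (show HasDerivAt (fun s => flowT t s p) _ 0 from h3) ?_
  simp only [vecT, vecS, vecH, Prod.smul_mk, Prod.mk_sub_mk, Prod.mk.injEq, smul_zero, sub_zero, and_true]
  module

theorem hasDerivAt_flowR (i j : Fin 3) (p : Phase) : HasDerivAt (fun s => flowR i j s p) (vecR i j p) 0 :=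
  (hasDerivAt_rotFun i j p.1).prodMk (hasDerivAt_rotFun i j p.2)

theorem dAlong_vecT (t : ℝ) (p : Phase) :
    dAlong γ (vecT t) p = dAlong γ vecS p - 3 * t * dAlong γ vecH p := by
  unfold dAlong
  by_cases hp : p ∈ phaseSpace
  · simp only [indicator_of_mem hp, vecT, map_sub, map_smul, smul_eq_mul]
  · simp only [indicator_of_notMem hp]; ring

/-! ### Poisson brackets -/

/-- The bracket with `f` is the derivative of `γ` along the Hamiltonian field `(-∇_𝐚 f, ∇_ϑ f)`;
this converts the bracket norms into derivatives along explicit vector fields. -/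
theorem poisson_eq_fderiv {f : Phase → ℝ} {p : Phase} {u v : E3} (hγ : DifferentiableAt ℝ γ p)
    (h1 : HasGradientAt (fun θ => f (θ, p.2)) u p.1) (h2 : HasGradientAt (fun a => f (p.1, a)) v p.2) :
    poisson f γ p = fderiv ℝ γ p (-v, u) := by
  have d1 : HasFDerivAt (fun a => γ (p.1, a)) ((fderiv ℝ γ p).comp (ContinuousLinearMap.inr ℝ E3 E3)) p.2 :=
    HasFDerivAt.comp p.2 (f := fun a => (p.1, a)) hγ.hasFDerivAt (hasFDerivAt_prodMk_right p.1 p.2)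
  have d2 : HasFDerivAt (fun θ => γ (θ, p.2)) ((fderiv ℝ γ p).comp (ContinuousLinearMap.inl ℝ E3 E3)) p.1 :=
    HasFDerivAt.comp p.1 (f := fun θ => (θ, p.2)) hγ.hasFDerivAt (hasFDerivAt_prodMk_left p.1 p.2)
  have g1 : ∀ x : E3, inner ℝ x (gradient (fun a => γ (p.1, a)) p.2) = fderiv ℝ γ p (0, x) := fun x => by
    rw [real_inner_comm, gradient, d1.fderiv, InnerProductSpace.toDual_symm_apply]; rfl
  have g2 : ∀ x : E3, inner ℝ x (gradient (fun θ => γ (θ, p.2)) p.1) = fderiv ℝ γ p (x, 0) := fun x => by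
    rw [real_inner_comm, gradient, d2.fderiv, InnerProductSpace.toDual_symm_apply]; rfl
  rw [poisson, h1.gradient, h2.gradient, g1, g2, ← map_sub]
  simp

theorem hasGradientAt_of_inner {f : E3 → ℝ} {c : E3} (h : ∀ x, f x = inner ℝ c x) (x : E3) :
    HasGradientAt f c x := by
  have : f = fun x => inner ℝ c x := funext h
  rw [hasGradientAt_iff_hasFDerivAt, this]
  exact (InnerProductSpace.toDual ℝ E3 c).hasFDerivAt

theorem hasFDerivAt_norm {x : E3} (hx : x ≠ 0) :
    HasFDerivAt (fun x : E3 => ‖x‖) (‖x‖⁻¹ • innerSL ℝ x) x := by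
  have hx0 := norm_pos_iff.2 hx
  have h := ((hasStrictFDerivAt_norm_sq x).hasFDerivAt).sqrt (by positivity)
  simp only [Real.sqrt_sq (norm_nonneg _)] at h
  refine h.congr_fderiv ?_
  ext v
  simp
  field_simp

/-- `ξ` depends on `|𝐚|` alone, so its Hamiltonian field is a multiple of free transport. -/
theorem poisson_xi {q : ℝ} {p : Phase} (hγ : DifferentiableAt ℝ γ p) (hp : p ∈ phaseSpace) :
    poisson (xi q) γ p = q / act p ^ 3 * fderiv ℝ γ p (vecH p) := by
  have ha : 0 < ‖p.2‖ := act_pos hp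
  have h1 : HasGradientAt (fun θ : E3 => xi q (θ, p.2)) 0 p.1 := by
    rw [hasGradientAt_iff_hasFDerivAt, map_zero]
    exact hasFDerivAt_const (q / ‖p.2‖) p.1
  have h2 : HasGradientAt (fun a : E3 => xi q (p.1, a)) (-(q / ‖p.2‖ ^ 3) • p.2) p.2 := by
    rw [hasGradientAt_iff_hasFDerivAt]
    have := (((hasDerivAt_inv ha.ne').comp_hasFDerivAt p.2 (hasFDerivAt_norm hp)).const_mul q)
    refine HasFDerivAt.congr_fderiv (show HasFDerivAt (fun a : E3 => xi q (p.1, a)) _ p.2 from this) ?_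
    ext v
    simp
    field_simp
  rw [poisson_eq_fderiv hγ h1 h2, vecH]
  have : ((-(-(q / ‖p.2‖ ^ 3) • p.2), 0) : Phase) = (q / act p ^ 3) • (p.2, (0 : E3)) := by
    simp [act]
  rw [this, map_smul, smul_eq_mul]

theorem poisson_eta {q : ℝ} {p : Phase} (hγ : DifferentiableAt ℝ γ p) (hp : p ∈ phaseSpace) :
    poisson (eta q) γ p = fderiv ℝ γ p
      (-((act p)⁻¹ * inner ℝ p.1 p.2 / q) • p.2 - (act p / q) • p.1, (act p / q) • p.2) := by
  have ha : 0 < ‖p.2‖ := act_pos hp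
  have h1 : HasGradientAt (fun θ : E3 => eta q (θ, p.2)) ((act p / q) • p.2) p.1 := by
    refine hasGradientAt_of_inner (fun θ => ?_) _
    rw [eta, inner_smul_left, real_inner_comm]; rfl
  have h2 : HasGradientAt (fun a : E3 => eta q (p.1, a))
      (((act p)⁻¹ * inner ℝ p.1 p.2 / q) • p.2 + (act p / q) • p.1) p.2 := by
    rw [hasGradientAt_iff_hasFDerivAt]
    have := ((hasFDerivAt_norm hp).mul_const q⁻¹).mul (innerSL ℝ p.1).hasFDerivAt
    refine HasFDerivAt.congr_fderiv (show HasFDerivAt (fun a : E3 => eta q (p.1, a)) _ p.2 from this) ?_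
    ext v
    simp [act]
    ring
  rw [poisson_eq_fderiv hγ h1 h2]
  congr 2
  module

theorem poisson_dir {p : Phase} (hγ : DifferentiableAt ℝ γ p) (hp : p ∈ phaseSpace) (i : Fin 3) :
    poisson (fun p' => dir p' i) γ p = fderiv ℝ γ p
      ((p.2 i / act p ^ 3) • p.2 - (act p)⁻¹ • EuclideanSpace.single i 1, 0) := by
  have ha : 0 < ‖p.2‖ := act_pos hp
  have h1 : HasGradientAt (fun θ : E3 => dir (θ, p.2) i) 0 p.1 := by
    rw [hasGradientAt_iff_hasFDerivAt, map_zero]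
    exact hasFDerivAt_const (dir p i) p.1
  have h2 : HasGradientAt (fun a : E3 => dir (p.1, a) i)
      (-(p.2 i / act p ^ 3) • p.2 + (act p)⁻¹ • EuclideanSpace.single i 1) p.2 := by
    rw [hasGradientAt_iff_hasFDerivAt]
    have := ((hasDerivAt_inv ha.ne').comp_hasFDerivAt p.2 (hasFDerivAt_norm hp)).mul
      (EuclideanSpace.proj (𝕜 := ℝ) i : E3 →L[ℝ] ℝ).hasFDerivAt
    refine HasFDerivAt.congr_fderiv (show HasFDerivAt (fun a : E3 => dir (p.1, a) i) _ p.2 from this) ?_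
    ext v
    simp [act, EuclideanSpace.inner_single_left]
    field_simp
    ring
  rw [poisson_eq_fderiv hγ h1 h2]
  congr 2
  module

theorem inner_rotGen (i j : Fin 3) (x y : E3) : inner ℝ (rotGen i j x) y = x i * y j - x j * y i := by
  simp [rotGen, inner_sub_left, inner_smul_left, EuclideanSpace.inner_single_left]

/-- Components of angular momentum generate the joint rotations of angle and action in the
complementary coordinate plane. -/
theorem poisson_angMom {p : Phase} (hγ : DifferentiableAt ℝ γ p) {l i j : Fin 3}
    (h : ∀ x y : E3, cross x y l = x i * y j - x j * y i) :
    poisson (fun p' => angMom p' l) γ p = -fderiv ℝ γ p (vecR i j p) := by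
  have h1 : HasGradientAt (fun θ : E3 => angMom (θ, p.2) l) (-rotGen i j p.2) p.1 := by
    refine hasGradientAt_of_inner (fun θ => ?_) _
    rw [inner_neg_left, inner_rotGen, angMom, h]; ring
  have h2 : HasGradientAt (fun a : E3 => angMom (p.1, a) l) (rotGen i j p.1) p.2 := by
    refine hasGradientAt_of_inner (fun a => ?_) _
    rw [inner_rotGen, angMom, h]
  rw [poisson_eq_fderiv hγ h1 h2, ← map_neg]
  rfl

theorem rotGen_swap (i j : Fin 3) (x : E3) : rotGen j i x = -rotGen i j x := by simp [rotGen]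

theorem abs_fderiv_vecR_le {p : Phase} (hγ : DifferentiableAt ℝ γ p) {i j : Fin 3} (hij : i ≠ j) :
    |fderiv ℝ γ p (vecR i j p)| ≤ ‖poissonVec angMom γ p‖ := by
  have key : ∀ {l i j : Fin 3}, (∀ x y : E3, cross x y l = x i * y j - x j * y i) →
      |fderiv ℝ γ p (vecR i j p)| ≤ ‖poissonVec angMom γ p‖ ∧
      |fderiv ℝ γ p (vecR j i p)| ≤ ‖poissonVec angMom γ p‖ := by
    intro l i j h
    have h1 := abs_apply_le (poissonVec angMom γ p) l
    have h2 : poissonVec angMom γ p l = -fderiv ℝ γ p (vecR i j p) := poisson_angMom hγ h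
    rw [h2, abs_neg] at h1
    refine ⟨h1, ?_⟩
    have : vecR j i p = -vecR i j p := by
      simp [vecR, rotGen_swap i j]
    rwa [this, map_neg, abs_neg]
  have k0 := key (l := 0) (i := 1) (j := 2) fun x y => cross_apply_zero x y
  have k1 := key (l := 1) (i := 2) (j := 0) fun x y => cross_apply_one x y
  have k2 := key (l := 2) (i := 0) (j := 1) fun x y => cross_apply_two x y
  fin_cases i <;> fin_cases j <;> first
    | exact absurd rfl hij | exact k0.1 | exact k0.2 | exact k1.1 | exact k1.2 | exact k2.1 | exact k2.2

/-- The field `ξ{η, ·}` already equals `(-ϑ - (ϑ·𝐮)𝐮, 𝐚)`. What is missing to `(-2ϑ, 𝐚)` is minus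
the transverse part of `ϑ`, which the brackets with `𝐮` supply with a coefficient of size `a |ϑ_⊥| =
λ`. -/
theorem abs_fderiv_vecS_le {q : ℝ} (hq : 0 < q) {p : Phase} (hγ : DifferentiableAt ℝ γ p) (hp : p ∈ phaseSpace) :
    |fderiv ℝ γ p (vecS p)| ≤ xi q p * |poisson (eta q) γ p| + lam p * ‖poissonVec dir γ p‖ := by
  have ha : 0 < act p := act_pos hp
  set w := perp p with hw
  -- The term along `𝐚` in the Hamiltonian field of `𝐮` drops out because `w` is orthogonal to `𝐚`.
  have hsum : ∑ i, w i * poissonVec dir γ p i = fderiv ℝ γ p (-(act p)⁻¹ • w, 0) := by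
    have e1 : ∀ i, poissonVec dir γ p i = fderiv ℝ γ p
      ((p.2 i / act p ^ 3) • p.2 - (act p)⁻¹ • EuclideanSpace.single i 1, 0) := fun i => poisson_dir hγ hp i
    have e2 : ∀ i, w i * poissonVec dir γ p i = fderiv ℝ γ p (w i •
      ((p.2 i / act p ^ 3) • p.2 - (act p)⁻¹ • EuclideanSpace.single i 1, (0 : E3))) := fun i => by
      rw [e1, map_smul, smul_eq_mul]
    simp only [e2]
    rw [← map_sum]
    congr 1
    have h0 : inner ℝ w p.2 = 0 := by
      rw [← act_smul_dir hp, inner_smul_right, hw, inner_perp_dir hp, mul_zero]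
    rw [inner_E3] at h0
    simp only [Prod.smul_mk, smul_zero, Fin.sum_univ_three, Prod.mk_add_mk, add_zero, Prod.mk.injEq, and_true]
    have h1 := sum_single_E3 w
    rw [Fin.sum_univ_three] at h1
    calc _ = ((w 0 * p.2 0 + w 1 * p.2 1 + w 2 * p.2 2) / act p ^ 3) • p.2
          - (act p)⁻¹ • (w 0 • EuclideanSpace.single 0 (1 : ℝ) + w 1 • EuclideanSpace.single 1 1
            + w 2 • EuclideanSpace.single 2 1) := by module
      _ = _ := by rw [h0, h1]; simp
  have hdec : fderiv ℝ γ p (vecS p) = xi q p * poisson (eta q) γ p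
      + act p * ∑ i, w i * poissonVec dir γ p i := by
    have hs : ∀ (r : ℝ) (v : Phase), r * fderiv ℝ γ p v = fderiv ℝ γ p (r • v) := fun r v => by
      rw [map_smul, smul_eq_mul]
    rw [hsum, poisson_eta hγ hp, hs, hs, ← map_add]
    congr 1
    simp only [vecS, Prod.smul_mk, Prod.mk_add_mk, Prod.mk.injEq, smul_zero, add_zero]
    have hd : dir p = (act p)⁻¹ • p.2 := rfl
    constructor
    · rw [hw, perp, inner_dir_right, hd, xi]
      simp only [smul_sub, smul_smul]
      have c1 : q / act p * (-((act p)⁻¹ * inner ℝ p.1 p.2 / q)) = -((act p)⁻¹ * inner ℝ p.1 p.2 * (act p)⁻¹) := by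
        field_simp
      have c2 : q / act p * (act p / q) = 1 := by field_simp
      have c3 : act p * -(act p)⁻¹ = -1 := by field_simp
      have c4 : act p * (-(act p)⁻¹ * ((act p)⁻¹ * inner ℝ p.1 p.2 * (act p)⁻¹))
        = -((act p)⁻¹ * inner ℝ p.1 p.2 * (act p)⁻¹) := by field_simp
      rw [c1, c2, c3]
      rw [c4]
      module
    · rw [smul_smul, xi]
      have : q / act p * (act p / q) = 1 := by field_simp
      rw [this, one_smul]
  have hcs : |∑ i, w i * poissonVec dir γ p i| ≤ ‖w‖ * ‖poissonVec dir γ p‖ := by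
    have := abs_real_inner_le_norm w (poissonVec dir γ p)
    rwa [inner_E3, ← Fin.sum_univ_three (fun i => w i * poissonVec dir γ p i)] at this
  rw [hdec, lam_eq hp]
  refine (abs_add_le _ _).trans ?_
  rw [abs_mul, abs_mul, abs_of_pos ha, abs_of_pos (xi_pos hq hp), mul_assoc]
  gcongr

end Density

/-! ### The majorant for derivatives -/

/-- The weight `ξ² + a² + |η|² + λ²`. -/
def wW (q : ℝ) (p : Phase) : ℝ := xi q p ^ 2 + act p ^ 2 + |eta q p| ^ 2 + lam p ^ 2

/-- The size of the inverse positions `|𝐗|⁻¹`, `t |𝐗̃|⁻¹` and `a⁻¹`. -/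
def majV (q : ℝ) (p : Phase) : ℝ := 1 + 1 / scl q p + (2 + |eta q p|) / act p

/-- The slowly growing factor `(1 + t a³/q)^{1/100}`. -/
def tauD (q t : ℝ) (p : Phase) : ℝ := (1 + t * act p ^ 3 / q) ^ (1 / 100 : ℝ)

/-- Majorant for the squared density and its products with derivatives of the density. -/
def majG (q t : ℝ) (p : Phase) : ℝ := (1 + act p + lam p) / wW q p ^ 12
  + (1 + scl q p) * wS q p ^ 2 * tauD q t p / wW q p ^ 24

/-- The combined majorant. -/
def maj (q t : ℝ) (p : Phase) : ℝ := majV q p * majG q t p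

/-- Distance between exact and effective position. -/
def disp (q t : ℝ) (p : Phase) : ℝ := ‖posXt q t p - t • p.2‖

theorem disp_nonneg (q t : ℝ) (p : Phase) : 0 ≤ disp q t p := norm_nonneg _

/-- Arithmetic-geometric mean for `ξ` and `a`, whose product is `q`. -/
theorem two_mul_le_wW (q : ℝ) {p : Phase} (hp : p ∈ phaseSpace) : 2 * q ≤ wW q p := by
  have ha := act_pos hp
  have h : xi q p * act p = q := div_mul_cancel₀ _ ha.ne'
  unfold wW
  nlinarith [sq_nonneg (xi q p - act p), sq_nonneg (lam p), sq_nonneg |eta q p|]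

theorem wW_pos {q : ℝ} (hq : 0 < q) {p : Phase} (hp : p ∈ phaseSpace) : 0 < wW q p := by
  have := two_mul_le_wW q hp; linarith

theorem wW_nonneg (q : ℝ) (p : Phase) : 0 ≤ wW q p := by unfold wW; positivity

theorem one_le_tauD {q t : ℝ} (hq : 0 < q) (ht : 0 ≤ t) (p : Phase) : 1 ≤ tauD q t p := by
  have := act_nonneg p
  have h : 0 ≤ t * act p ^ 3 / q := by positivity
  exact Real.one_le_rpow (by linarith) (by norm_num)

theorem one_le_majV {q : ℝ} (hq : 0 < q) (p : Phase) : 1 ≤ majV q p := by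
  have := scl_nonneg hq p; have := act_nonneg p
  have h1 : 0 ≤ 1 / scl q p := by positivity
  have h2 : 0 ≤ (2 + |eta q p|) / act p := by positivity
  unfold majV; linarith

theorem majG_nonneg {q t : ℝ} (hq : 0 < q) (ht : 0 ≤ t) (p : Phase) : 0 ≤ majG q t p := by
  have := scl_nonneg hq p; have := act_nonneg p; have := one_le_tauD hq ht p; have := lam_nonneg p
  have := wW_nonneg q p
  unfold majG; positivity

theorem maj_nonneg {q t : ℝ} (hq : 0 < q) (ht : 0 ≤ t) (p : Phase) : 0 ≤ maj q t p :=
  mul_nonneg (by have := one_le_majV hq p; linarith) (majG_nonneg hq ht p)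

theorem measurable_wW (q : ℝ) : Measurable (wW q) := by
  unfold wW
  have := measurable_eta q; have := measurable_xi q; have := measurable_act; have := measurable_lam
  fun_prop

theorem measurable_maj (q t : ℝ) : Measurable (maj q t) := by
  unfold maj majV majG tauD
  have := measurable_eta q; have := measurable_wW q; have := measurable_act; have := measurable_lam
  have := measurable_scl q; have := measurable_wS q
  fun_prop

theorem measurable_disp (q t : ℝ) : Measurable (disp q t) := by
  unfold disp; have := measurable_posXt q t; fun_prop

/-- The gauge is the square root of the normalized weight, so the four basic quantities are at most
`w`, and the twelfth power of the weight gives the decay `w^(-24)`. -/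
theorem exists_gauge_wW {q : ℝ} (hq : 0 < q) : ∃ K : ℝ, 1 ≤ K ∧ ∀ p ∈ phaseSpace, ∃ w : ℝ, 1 ≤ w ∧
    1 / wW q p ^ 12 ≤ K * w ^ (-24 : ℝ) ∧ 1 / wW q p ^ 24 ≤ K * w ^ (-48 : ℝ) ∧ xi q p ≤ w ∧ act p ≤ w
      ∧ |eta q p| ≤ w ∧ lam p ≤ w := by
  set m : ℝ := min 1 (2 * q) with hm
  have hm0 : 0 < m := by positivity
  have hm1 : m ≤ 1 := min_le_left _ _
  have hmi : 1 ≤ m⁻¹ := (one_le_inv₀ hm0).2 hm1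
  refine ⟨m⁻¹ ^ 24, one_le_pow₀ hmi, fun p hp => ?_⟩
  have hW := wW_pos hq hp
  have hmW : m ≤ wW q p := (min_le_right _ _).trans (two_mul_le_wW q hp)
  set w := √(wW q p / m) with hw
  have hw2 : w ^ 2 = wW q p / m := Real.sq_sqrt (by positivity)
  have hw1 : 1 ≤ w := Real.one_le_sqrt.2 ((one_le_div hm0).2 hmW)
  have hw0 : 0 < w := by linarith
  have hWw : wW q p = m * w ^ 2 := by rw [hw2]; field_simp
  have hle : wW q p ≤ w ^ 2 := by rw [hWw]; nlinarith [sq_nonneg w]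
  have hx := xi_nonneg hq p
  have ha := act_nonneg p
  have hl := lam_nonneg p
  have hs : ∀ {x : ℝ}, 0 ≤ x → x ^ 2 ≤ wW q p → x ≤ w := fun h0 h =>
    abs_le_of_sq_le_sq' (h.trans hle) hw0.le |>.2
  have b1 := sq_nonneg (xi q p); have b2 := sq_nonneg (act p)
  have b3 := sq_nonneg |eta q p|; have b4 := sq_nonneg (lam p)
  refine ⟨w, hw1, ?_, ?_, hs hx ?_, hs ha ?_, hs (abs_nonneg _) ?_, hs hl ?_⟩
  · rw [hWw, show (-24 : ℝ) = -((24 : ℕ) : ℝ) by norm_num, Real.rpow_neg hw0.le, Real.rpow_natCast]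
    have e : 1 / (m * w ^ 2) ^ 12 = m⁻¹ ^ 12 * (w ^ 24)⁻¹ := by field_simp
    rw [e]
    have : m⁻¹ ^ 12 ≤ m⁻¹ ^ 24 := pow_le_pow_right₀ hmi (by norm_num)
    gcongr
  · rw [hWw, show (-48 : ℝ) = -((48 : ℕ) : ℝ) by norm_num, Real.rpow_neg hw0.le, Real.rpow_natCast]
    refine le_of_eq ?_
    field_simp
  all_goals unfold wW; linarith

set_option maxHeartbeats 1000000 in
/-- The time-independent weight bound behind all derivative estimates. -/
theorem exists_majorant_le {q : ℝ} (hq : 0 < q) : ∃ C : ℝ, 0 < C ∧ ∀ p ∈ phaseSpace,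
    majV q p * ((1 + act p + lam p) * (1 / wW q p ^ 12)
        + (1 + scl q p) * wS q p ^ 2 * (1 / wW q p ^ 24))
      * (1 + scl q p * wS q p) ^ (7 / 2 : ℝ) * (1 + act p) ^ 8
      * ((1 + kappa q p) * (1 + √(scl q p)) + scl q p ^ 3 * wS q p ^ (7 / 2 : ℝ)) ≤ C := by
  obtain ⟨K, hK, h⟩ := exists_gauge_wW hq
  set A : ℝ := 2 + q + 1 / q + K with hA
  have hiq : 0 < 1 / q := by positivity
  have hA2 : 2 ≤ A := by linarith
  have hA1 : 1 ≤ A := by linarith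
  have hA0 : 0 < A := by linarith
  have hAq : q ≤ A := by linarith
  have hAiq : 1 / q ≤ A := by linarith
  refine ⟨A ^ (200 : ℝ), by positivity, fun p hp => ?_⟩
  obtain ⟨w, hw1, g12, g24, bx, ba, be, bl⟩ := h p hp
  have hw0 : 0 < w := by linarith
  have hW := wW_pos hq hp
  have hx0 : 0 < xi q p := xi_pos hq hp
  have ha : 0 < act p := act_pos hp
  have he : 0 ≤ |eta q p| := abs_nonneg _
  have hl : 0 ≤ lam p := lam_nonneg p
  have hk : 0 ≤ kappa q p := kappa_nonneg hq p
  have hc : 0 < scl q p := scl_pos hq hp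
  have hS1 : 1 ≤ wS q p := one_le_wS hq p
  have hkl : kappa q p = lam p / xi q p := kappa_eq_div hq hp
  have hcx : scl q p = xi q p * xi q p * (1 / q) := scl_eq hq p
  have hxa : xi q p * act p = q := div_mul_cancel₀ _ ha.ne'
  have hSe : wS q p = 1 + |eta q p| + kappa q p := rfl
  have hka : kappa q p = act p * lam p * (1 / q) := by unfold kappa; ring
  have hVe : majV q p = 1 + 1 / scl q p + (2 + |eta q p|) / act p := rfl
  have hc1 : scl q p * act p ^ 2 = q := div_mul_cancel₀ _ (by positivity)
  generalize xi q p = x at *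
  generalize act p = a at *
  generalize |eta q p| = e at *
  generalize lam p = l at *
  generalize scl q p = c at *
  generalize kappa q p = k at *
  generalize wS q p = S at *
  generalize majV q p = V at *
  generalize wW q p = W at *
  have hS0 : 0 < S := by linarith
  have pone : ∀ {y : ℝ}, 0 ≤ y → y ≤ A → PowBound A w 1 0 y := fun h0 h1 => ⟨h0, by simpa using h1⟩
  have px : PowBound A w 0 1 x := ⟨hx0.le, by simpa using bx⟩
  have pa : PowBound A w 0 1 a := ⟨ha.le, by simpa using ba⟩
  have pe : PowBound A w 0 1 e := ⟨he, by simpa using be⟩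
  have pl : PowBound A w 0 1 l := ⟨hl, by simpa using bl⟩
  have pq : PowBound A w 1 0 q := pone hq.le hAq
  have piq : PowBound A w 1 0 (1 / q) := pone hiq.le hAiq
  have p12 : PowBound A w 1 (-24) (1 / W ^ 12) := ⟨by positivity, by
    rw [Real.rpow_one]; exact g12.trans (by gcongr; linarith)⟩
  have p24 : PowBound A w 1 (-48) (1 / W ^ 24) := ⟨by positivity, by
    rw [Real.rpow_one]; exact g24.trans (by gcongr; linarith)⟩
  have p1e : PowBound A w 1 1 (1 + e) := (pe.one_add hA2 hw1 le_rfl (by norm_num)).mono hA1 hw1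
    (by norm_num) le_rfl
  have p1a : PowBound A w 1 1 (1 + a) := (pa.one_add hA2 hw1 le_rfl (by norm_num)).mono hA1 hw1
    (by norm_num) le_rfl
  have p1al : PowBound A w 2 1 (1 + a + l) :=
    (p1a.add hA2 hw0 (pl.mono hA1 hw1 (by norm_num) le_rfl)).mono hA1 hw1 (by norm_num) le_rfl
  have p2e : PowBound A w 2 1 (2 + e) := by
    have := p1e.add hA2 hw0 p1e
    exact (this.mono hA1 hw1 (by norm_num) le_rfl).of_le (by positivity) (by linarith)
  have key : ∀ {m n y : ℝ}, PowBound A w m n y → m ≤ 200 → n ≤ 0 → y ≤ A ^ (200 : ℝ) := by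
    intro m n y hy hm hn
    have := (hy.mono (m' := 200) (n' := 0) hA1 hw1 hm hn).2
    simpa using this
  -- assembling the factors
  have fin : ∀ {mV mS mc ms na nn : ℝ}, mV ≤ 10 → mS ≤ 10 → mc ≤ 10 → ms ≤ 10 →
      PowBound A w mV 2 V → PowBound A w mS 2 S → PowBound A w mc 2 c →
      PowBound A w 10 4 ((1 + c) * S ^ 2) → PowBound A w ms nn (c * S) → 0 ≤ ms → 0 ≤ nn →
      PowBound A w 3 na (1 + a) →
      ∀ {nf : ℝ}, PowBound A w 80 nf ((1 + k) * (1 + √c) + c ^ 3 * S ^ (7 / 2 : ℝ)) →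
      2 - 23 + nn * (7 / 2) + na * 8 + nf ≤ 0 →
      V * ((1 + a + l) * (1 / W ^ 12) + (1 + c) * S ^ 2 * (1 / W ^ 24)) * (1 + c * S) ^ (7 / 2 : ℝ)
        * (1 + a) ^ 8 * ((1 + k) * (1 + √c) + c ^ 3 * S ^ (7 / 2 : ℝ)) ≤ A ^ (200 : ℝ) := by
    intro mV mS mc ms na nn h1 h2 h3 h4 pV pS pc pcS2 ps h5 h6 p1a' nf pf hn
    -- Both halves of the density bound are at most `w^(-23)`: the first as `w · w^(-24)`, the
    -- second as `w⁴ · w^(-48)`. All remaining factors must be paid out of this decay.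
    have pG := ((p1al.mul hA0 hw0 p12).mono hA1 hw1 (m' := 11) (n' := -23) (by norm_num) (by norm_num)).add hA2 hw0
      ((pcS2.mul hA0 hw0 p24).mono hA1 hw1 (m' := 11) (n' := -23) (by norm_num) (by norm_num))
    have p6 := (((pV.mul hA0 hw0 pG).mul hA0 hw0 ((ps.one_add hA2 hw1 h5 h6).rpow hA0 hw0 (s := 7 / 2)
      (by norm_num))).mul hA0 hw0 (p1a'.pow hA0 hw0 8)).mul hA0 hw0 pf
    refine key p6 ?_ ?_ <;> push_cast <;> linarith
  rcases le_total a q with haq | haq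
  · have hx1 : 1 ≤ x := by
      by_contra! hc'
      nlinarith
    have p1a0 : PowBound A w 3 0 (1 + a) :=
      ((pone ha.le (haq.trans hAq)).one_add hA2 hw1 (by norm_num) le_rfl).mono hA1 hw1
        (by norm_num) le_rfl
    have pk : PowBound A w 0 1 k := pl.of_le hk (by rw [hkl]; exact div_le_self hl hx1)
    have pS : PowBound A w 2 1 S := by
      rw [hSe]
      exact (p1e.add hA2 hw0 (pk.mono hA1 hw1 (by norm_num) le_rfl)).mono hA1 hw1 (by norm_num) le_rfl
    have pc : PowBound A w 1 2 c := by
      rw [hcx]; exact ((px.mul hA0 hw0 px).mul hA0 hw0 piq).mono hA1 hw1 (by norm_num) (by norm_num)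
    have pia : PowBound A w 1 1 (1 / a) := by
      have : 1 / a = x * (1 / q) := by rw [← hxa]; field_simp
      rw [this]; exact (px.mul hA0 hw0 piq).mono hA1 hw1 (by norm_num) (by norm_num)
    have pic : PowBound A w 3 0 (1 / c) := by
      have : 1 / c = a * a * (1 / q) := by rw [← hc1]; field_simp
      rw [this]
      have paq := pone ha.le (haq.trans hAq)
      exact ((paq.mul hA0 hw0 paq).mul hA0 hw0 piq).mono hA1 hw1 (by norm_num) (by norm_num)
    have pV : PowBound A w 10 2 V := by
      rw [hVe, div_eq_mul_one_div (2 + e) a]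
      have h1 := (pic.one_add hA2 hw1 (by norm_num) le_rfl).mono hA1 hw1 (m' := 5) (n' := 2)
        (by norm_num) (by norm_num)
      exact (h1.add hA2 hw0 ((p2e.mul hA0 hw0 pia).mono hA1 hw1 (by norm_num) (by norm_num))).mono hA1 hw1
        (by norm_num) le_rfl
    have p1c : PowBound A w 2 2 (1 + c) := (pc.one_add hA2 hw1 (by norm_num) (by norm_num)).mono hA1 hw1
      (by norm_num) le_rfl
    have pcS2 : PowBound A w 10 4 ((1 + c) * S ^ 2) :=
      (p1c.mul hA0 hw0 (pS.pow hA0 hw0 2)).mono hA1 hw1 (by norm_num) (by norm_num)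
    have ps := pc.mul hA0 hw0 pS
    have pf : PowBound A w 80 (19 / 2) ((1 + k) * (1 + √c) + c ^ 3 * S ^ (7 / 2 : ℝ)) := by
      have h1 : PowBound A w 2 1 (1 + √c) := by
        have := pc.rpow hA0 hw0 (s := 1 / 2) (by norm_num)
        rw [Real.sqrt_eq_rpow]
        exact (this.one_add hA2 hw1 (by norm_num) (by norm_num)).mono hA1 hw1 (by norm_num) (by norm_num)
      have h2 := (pk.one_add hA2 hw1 le_rfl (by norm_num)).mul hA0 hw0 h1
      have h3 := (pc.pow hA0 hw0 3).mul hA0 hw0 (pS.rpow hA0 hw0 (s := 7 / 2) (by norm_num))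
      exact ((h2.mono hA1 hw1 (m' := 60) (n' := 19 / 2) (by norm_num) (by norm_num)).add hA2 hw0
        (h3.mono hA1 hw1 (m' := 60) (n' := 19 / 2) (by norm_num) (by norm_num))).mono hA1 hw1
          (by norm_num) le_rfl
    exact fin (mV := 10) (mS := 2) (mc := 1) (ms := 1 + 2) (na := 0) (nn := 2 + 1) (by norm_num)
      (by norm_num) (by norm_num) (by norm_num) pV (pS.mono hA1 hw1 le_rfl (by norm_num)) pc pcS2 ps
      (by norm_num) (by norm_num) p1a0 pf (by norm_num)
  · have hia : 1 / a ≤ 1 / q := one_div_le_one_div_of_le hq haq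
    have pia : PowBound A w 1 0 (1 / a) := piq.of_le (by positivity) hia
    have pc : PowBound A w 3 0 c := by
      have : c = q * (1 / a) * (1 / a) := by rw [← hc1]; field_simp
      rw [this]
      exact ((pq.mul hA0 hw0 pia).mul hA0 hw0 pia).mono hA1 hw1 (by norm_num) (by norm_num)
    have pic : PowBound A w 1 2 (1 / c) := by
      have : 1 / c = a * a * (1 / q) := by rw [← hc1]; field_simp
      rw [this]
      exact ((pa.mul hA0 hw0 pa).mul hA0 hw0 piq).mono hA1 hw1 (by norm_num) (by norm_num)
    have pk : PowBound A w 1 2 k := by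
      rw [hka]; exact ((pa.mul hA0 hw0 pl).mul hA0 hw0 piq).mono hA1 hw1 (by norm_num) (by norm_num)
    have pS : PowBound A w 2 2 S := by
      rw [hSe]
      exact ((p1e.mono hA1 hw1 le_rfl (by norm_num)).add hA2 hw0 pk).mono hA1 hw1 (by norm_num) le_rfl
    have pV : PowBound A w 10 2 V := by
      rw [hVe, div_eq_mul_one_div (2 + e) a]
      have h1 := (pic.one_add hA2 hw1 (by norm_num) (by norm_num)).mono hA1 hw1 (m' := 5) (n' := 2)
        (by norm_num) (by norm_num)
      exact (h1.add hA2 hw0 ((p2e.mul hA0 hw0 pia).mono hA1 hw1 (by norm_num) (by norm_num))).mono hA1 hw1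
        (by norm_num) le_rfl
    have p1c : PowBound A w 4 0 (1 + c) := (pc.one_add hA2 hw1 (by norm_num) (by norm_num)).mono hA1 hw1
      (by norm_num) le_rfl
    have pcS2 : PowBound A w 10 4 ((1 + c) * S ^ 2) :=
      (p1c.mul hA0 hw0 (pS.pow hA0 hw0 2)).mono hA1 hw1 (by norm_num) (by norm_num)
    -- For fast particles `c κ = λ/a`, so `c S` grows linearly in `w` although `κ` alone may be
    -- quadratic.
    have ps : PowBound A w 5 1 (c * S) := by
      have e1 : c * S = c * (1 + e) + l * (1 / a) := by
        rw [hSe, hka]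
        have : c = q * (1 / a) * (1 / a) := by rw [← hc1]; field_simp
        rw [this]; field_simp
      rw [e1]
      exact ((pc.mul hA0 hw0 p1e).mono hA1 hw1 (m' := 4) (n' := 1) (by norm_num) (by norm_num)).add hA2 hw0
        ((pl.mul hA0 hw0 pia).mono hA1 hw1 (m' := 4) (n' := 1) (by norm_num) (by norm_num)) |>.mono hA1 hw1
          (by norm_num) le_rfl
    have pf : PowBound A w 80 7 ((1 + k) * (1 + √c) + c ^ 3 * S ^ (7 / 2 : ℝ)) := by
      have h1 : PowBound A w 3 0 (1 + √c) := by
        have := pc.rpow hA0 hw0 (s := 1 / 2) (by norm_num)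
        rw [Real.sqrt_eq_rpow]
        exact (this.one_add hA2 hw1 (by norm_num) (by norm_num)).mono hA1 hw1 (by norm_num) (by norm_num)
      have h2 := (pk.one_add hA2 hw1 (by norm_num) (by norm_num)).mul hA0 hw0 h1
      have h3 := (pc.pow hA0 hw0 3).mul hA0 hw0 (pS.rpow hA0 hw0 (s := 7 / 2) (by norm_num))
      exact ((h2.mono hA1 hw1 (m' := 60) (n' := 7) (by norm_num) (by norm_num)).add hA2 hw0
        (h3.mono hA1 hw1 (m' := 60) (n' := 7) (by norm_num) (by norm_num))).mono hA1 hw1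
          (by norm_num) le_rfl
    exact fin (mV := 10) (mS := 2) (mc := 3) (ms := 5) (na := 1) (nn := 1) (by norm_num)
      (by norm_num) (by norm_num) (by norm_num) pV pS (pc.mono hA1 hw1 le_rfl (by norm_num)) pcS2 ps
      (by norm_num) (by norm_num) (p1a.mono hA1 hw1 (by norm_num) le_rfl) pf (by norm_num)

/-- The choice `δ = 1/100` gives the constant `12 + 50`. -/
theorem disp_le {q t : ℝ} (hq : 0 < q) (ht : 0 ≤ t) {p : Phase} (hp : p ∈ phaseSpace) :
    disp q t p ≤ 62 * (scl q p * wS q p) * tauD q t p := by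
  have := norm_posXt_sub_le (δ := 1 / 100) (by norm_num) hq ht hp
  norm_num at this
  unfold disp tauD
  norm_num
  exact this

/-- With `δ = 1/100` the constant is `3 · (24 + 50)`. -/
theorem norm_errX_le {q t : ℝ} (hq : 0 < q) (ht : 0 ≤ t) {p : Phase} (hp : p ∈ phaseSpace) :
    ‖errX q t p‖ ≤ 222 * (scl q p * wS q p ^ 2) * tauD q t p := by
  have := norm_smul_vel_sub_le (δ := 1 / 100) (by norm_num) hq ht hp
  rw [errX, norm_smul]
  unfold tauD
  norm_num at this ⊢
  linarith

/-- The weight bound with the displacement. -/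
theorem exists_maj_le {q : ℝ} (hq : 0 < q) : ∃ C : ℝ, 0 < C ∧ ∀ t : ℝ, 0 ≤ t → ∀ p ∈ phaseSpace,
    maj q t p * (1 + disp q t p) ^ (7 / 2 : ℝ) * (1 + act p) ^ 7
      * ((1 + kappa q p) * (1 + √(scl q p)) + scl q p ^ 3 * wS q p ^ (7 / 2 : ℝ))
      ≤ C * (1 + t) ^ (1 / 20 : ℝ) := by
  obtain ⟨C, hC, h⟩ := exists_majorant_le hq
  refine ⟨(62 : ℝ) ^ (7 / 2 : ℝ) * (1 + 1 / q) * C, by positivity, fun t ht p hp => ?_⟩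
  have h0 := h p hp
  have hd := disp_le hq ht hp
  have hd0 := disp_nonneg q t p
  have hτ := one_le_tauD hq ht p
  have ha := act_nonneg p
  have hc := scl_nonneg hq p
  have hS := one_le_wS hq p
  have hk := kappa_nonneg hq p
  have hV := one_le_majV hq p
  have hW := wW_pos hq hp
  have hl := lam_nonneg p
  set s := scl q p * wS q p with hs
  have hs0 : 0 ≤ s := by positivity
  set F := (1 + kappa q p) * (1 + √(scl q p)) + scl q p ^ 3 * wS q p ^ (7 / 2 : ℝ) with hF
  have hF0 : 0 ≤ F := by positivity
  set G0 := (1 + act p + lam p) * (1 / wW q p ^ 12) + (1 + scl q p) * wS q p ^ 2 * (1 / wW q p ^ 24) with hG0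
  have hG00 : 0 ≤ G0 := by positivity
  have e1 : majG q t p ≤ tauD q t p * G0 := by
    have h1 : 0 ≤ (1 + act p + lam p) * (1 / wW q p ^ 12) := by positivity
    have h2 : majG q t p = (1 + act p + lam p) * (1 / wW q p ^ 12)
      + tauD q t p * ((1 + scl q p) * wS q p ^ 2 * (1 / wW q p ^ 24)) := by unfold majG; ring
    rw [h2, hG0, mul_add]
    nlinarith
  have e2 : (1 + disp q t p) ^ (7 / 2 : ℝ) ≤ (62 : ℝ) ^ (7 / 2 : ℝ) * (1 + s) ^ (7 / 2 : ℝ)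
      * tauD q t p ^ (7 / 2 : ℝ) := by
    rw [← Real.mul_rpow (by norm_num) (by positivity), ← Real.mul_rpow (by positivity) (by linarith)]
    refine Real.rpow_le_rpow (by positivity) ?_ (by norm_num)
    have h1 : 62 * (1 + s) * tauD q t p = 62 * tauD q t p + 62 * s * tauD q t p := by ring
    rw [h1]
    linarith
  -- The total power of `1 + τ` is `9/200`, below `1/20`; the resulting `(1 + a)^(27/200)` is
  -- absorbed in one factor `1 + a`.
  have e3 : tauD q t p * tauD q t p ^ (7 / 2 : ℝ) ≤ (1 + 1 / q) * (1 + t) ^ (1 / 20 : ℝ) * (1 + act p) := by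
    have hx : 0 < 1 + t * act p ^ 3 / q := by positivity
    have hT : 1 ≤ 1 + t := by linarith
    have hQ : 1 ≤ 1 + 1 / q := by have : 0 < 1 / q := by positivity
                                  linarith
    have hA : 1 ≤ 1 + act p := by linarith
    unfold tauD
    rw [← Real.rpow_mul hx.le, ← Real.rpow_add hx]
    refine (Real.rpow_le_rpow hx.le (one_add_tau_le hq ht p) (by norm_num)).trans ?_
    rw [Real.mul_rpow (by positivity) (by positivity), Real.mul_rpow (by positivity) (by positivity),
      ← Real.rpow_natCast (1 + act p) 3, ← Real.rpow_mul (by positivity)]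
    gcongr
    · calc _ ≤ (1 + 1 / q) ^ (1 : ℝ) := Real.rpow_le_rpow_of_exponent_le hQ (by norm_num)
        _ = _ := Real.rpow_one _
    · norm_num
    · calc _ ≤ (1 + act p) ^ (1 : ℝ) := Real.rpow_le_rpow_of_exponent_le hA (by norm_num)
        _ = _ := Real.rpow_one _
  have hτ7 : 0 ≤ tauD q t p ^ (7 / 2 : ℝ) := by positivity
  calc maj q t p * (1 + disp q t p) ^ (7 / 2 : ℝ) * (1 + act p) ^ 7 * F
      ≤ (majV q p * (tauD q t p * G0)) * ((62 : ℝ) ^ (7 / 2 : ℝ) * (1 + s) ^ (7 / 2 : ℝ)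
          * tauD q t p ^ (7 / 2 : ℝ)) * (1 + act p) ^ 7 * F := by
        unfold maj; gcongr
    _ = (62 : ℝ) ^ (7 / 2 : ℝ) * (tauD q t p * tauD q t p ^ (7 / 2 : ℝ))
          * (majV q p * G0 * (1 + s) ^ (7 / 2 : ℝ) * (1 + act p) ^ 7 * F) := by ring
    _ ≤ (62 : ℝ) ^ (7 / 2 : ℝ) * ((1 + 1 / q) * (1 + t) ^ (1 / 20 : ℝ) * (1 + act p))
          * (majV q p * G0 * (1 + s) ^ (7 / 2 : ℝ) * (1 + act p) ^ 7 * F) := by gcongr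
    _ = (62 : ℝ) ^ (7 / 2 : ℝ) * (1 + 1 / q) * (1 + t) ^ (1 / 20 : ℝ)
          * (majV q p * G0 * (1 + s) ^ (7 / 2 : ℝ) * (1 + act p) ^ 8 * F) := by ring
    _ ≤ (62 : ℝ) ^ (7 / 2 : ℝ) * (1 + 1 / q) * (1 + t) ^ (1 / 20 : ℝ) * C := by gcongr
    _ = _ := by ring

/-! ### Localization of the majorant -/

/-- The decay weight `(t² + |y|²)^{3/2}`. -/
def cubicWeight (t : ℝ) (y : E3) : ℝ := (t ^ 2 + ‖y‖ ^ 2) ^ (3 / 2 : ℝ)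

theorem cubicWeight_pos {t : ℝ} (ht : 0 < t) (y : E3) : 0 < cubicWeight t y := by
  unfold cubicWeight; positivity

theorem cubicWeight_le {t : ℝ} (y : E3) {B : ℝ} (hB : 0 ≤ B) (h : |t| + ‖y‖ ≤ B) :
    cubicWeight t y ≤ B ^ 3 := by
  have h1 : t ^ 2 + ‖y‖ ^ 2 ≤ B ^ 2 := by
    have h0 : t ^ 2 + ‖y‖ ^ 2 ≤ (|t| + ‖y‖) ^ 2 := by
      rw [← sq_abs t]
      nlinarith [mul_nonneg (abs_nonneg t) (norm_nonneg y)]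
    exact h0.trans (pow_le_pow_left₀ (by positivity) h 2)
  unfold cubicWeight
  calc _ ≤ (B ^ 2) ^ (3 / 2 : ℝ) := Real.rpow_le_rpow (by positivity) h1 (by norm_num)
    _ = B ^ 3 := by
      rw [← Real.rpow_natCast B 2, ← Real.rpow_mul hB, ← Real.rpow_natCast B 3]; norm_num

theorem cubicWeight_scale {t R : ℝ} (hR : 0 < R) (y : E3) :
    cubicWeight t y = R ^ 3 * cubicWeight (t / R) (R⁻¹ • y) := by
  have e : t ^ 2 + ‖y‖ ^ 2 = R ^ 2 * ((t / R) ^ 2 + ‖R⁻¹ • y‖ ^ 2) := by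
    rw [norm_smul, Real.norm_eq_abs, abs_of_pos (inv_pos.2 hR)]
    field_simp
  unfold cubicWeight
  rw [e, Real.mul_rpow (by positivity) (by positivity), ← Real.rpow_natCast R 2, ← Real.rpow_mul hR.le,
    ← Real.rpow_natCast R 3]
  norm_num

/-- Since `|y| ≤ |y - t𝐚| + t|𝐚|`, the decay in `(t, y)` can be bought with powers of `1 + |y - t𝐚|`
and `1 + |𝐚|`, unless `|y - t𝐚|` is below a large `t`. In that case the factor `t⁻³` comes from the
volume in `𝐚` on which the first weight lives. -/
theorem exists_lintegral_loc_le : ∃ C : ℝ, 0 ≤ C ∧ ∀ (t : ℝ), 0 < t → ∀ y : E3,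
    ∫⁻ a : E3, ENNReal.ofReal ((1 + ‖y - t • a‖) ^ (-(7 / 2) : ℝ) * ((1 + ‖a‖) ^ 7)⁻¹)
      ≤ ENNReal.ofReal (C / cubicWeight t y) := by
  have i1 : Integrable (fun x : E3 => (1 + ‖x‖) ^ (-(7 / 2) : ℝ)) :=
    integrable_one_add_norm (by rw [finrank_E3]; norm_num)
  have i2 : Integrable (fun x : E3 => (1 + ‖x‖) ^ (-4 : ℝ)) :=
    integrable_one_add_norm (by rw [finrank_E3]; norm_num)
  have n1 : 0 ≤ ∫ x : E3, (1 + ‖x‖) ^ (-(7 / 2) : ℝ) := integral_nonneg fun x => by positivity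
  have n2 : 0 ≤ ∫ x : E3, (1 + ‖x‖) ^ (-4 : ℝ) := integral_nonneg fun x => by positivity
  refine ⟨8 * ((∫ x : E3, (1 + ‖x‖) ^ (-(7 / 2) : ℝ)) + ∫ x : E3, (1 + ‖x‖) ^ (-4 : ℝ)), by positivity,
    fun t ht y => ?_⟩
  set A := ∫ x : E3, (1 + ‖x‖) ^ (-(7 / 2) : ℝ) with hA
  set B := ∫ x : E3, (1 + ‖x‖) ^ (-4 : ℝ) with hB
  have hL := cubicWeight_pos ht y
  set L := cubicWeight t y with hLd
  have key : ∀ a : E3, (1 + ‖y - t • a‖) ^ (-(7 / 2) : ℝ) * ((1 + ‖a‖) ^ 7)⁻¹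
      ≤ 8 / L * (t ^ 3 * (1 + ‖t • (t⁻¹ • y - a)‖) ^ (-(7 / 2) : ℝ) + (1 + ‖a‖) ^ (-4 : ℝ)) := by
    intro a
    have e0 : t • (t⁻¹ • y - a) = y - t • a := by
      rw [smul_sub, smul_smul, mul_inv_cancel₀ ht.ne', one_smul]
    rw [e0]
    obtain ⟨D, hD⟩ : ∃ D, D = ‖y - t • a‖ := ⟨_, rfl⟩
    obtain ⟨x, hx⟩ : ∃ x, x = ‖a‖ := ⟨_, rfl⟩
    have hD0 : 0 ≤ D := hD ▸ norm_nonneg _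
    have hx0 : 0 ≤ x := hx ▸ norm_nonneg _
    have hy : ‖y‖ ≤ D + t * x := by
      have := norm_add_le (y - t • a) (t • a)
      rw [sub_add_cancel, norm_smul, Real.norm_eq_abs, abs_of_pos ht, ← hD, ← hx] at this
      exact this
    rw [← hD, ← hx, div_mul_eq_mul_div, le_div_iff₀ hL,
      show (1 + x) ^ (-4 : ℝ) = ((1 + x) ^ 4)⁻¹ by
        rw [show (-4 : ℝ) = -((4 : ℕ) : ℝ) by norm_num, Real.rpow_neg (by positivity), Real.rpow_natCast]]
    have hP : 0 < (1 + D) ^ (-(7 / 2) : ℝ) := by positivity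
    have hP3 : (1 + D) ^ (-(7 / 2) : ℝ) * (1 + D) ^ 3 ≤ 1 := by
      rw [← Real.rpow_natCast, ← Real.rpow_add (by positivity)]
      exact Real.rpow_le_one_of_one_le_of_nonpos (by linarith) (by norm_num)
    have hx1 : 0 < 1 + x := by linarith
    have caseA : ∀ {k : ℝ}, 0 ≤ k → k ≤ 2 → t + ‖y‖ ≤ k * ((1 + x) * (1 + D)) →
        (1 + D) ^ (-(7 / 2) : ℝ) * ((1 + x) ^ 7)⁻¹ * L ≤ 8 * ((1 + x) ^ 4)⁻¹ := by
      intro k hk hk2 hle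
      have h1 : L ≤ (k * ((1 + x) * (1 + D))) ^ 3 :=
        cubicWeight_le y (by positivity) (by rwa [abs_of_pos ht])
      have hk3 : k ^ 3 ≤ 8 := by
        calc k ^ 3 ≤ 2 ^ 3 := pow_le_pow_left₀ hk hk2 3
          _ = 8 := by norm_num
      calc _ ≤ (1 + D) ^ (-(7 / 2) : ℝ) * ((1 + x) ^ 7)⁻¹ * (k * ((1 + x) * (1 + D))) ^ 3 := by gcongr
        _ = k ^ 3 * (((1 + D) ^ (-(7 / 2) : ℝ) * (1 + D) ^ 3) * ((1 + x) ^ 4)⁻¹) := by field_simp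
        _ ≤ 8 * (1 * ((1 + x) ^ 4)⁻¹) := by gcongr
        _ = _ := by ring
    have hT0 : 0 ≤ t ^ 3 * (1 + D) ^ (-(7 / 2) : ℝ) := by positivity
    have hX0 : 0 ≤ ((1 + x) ^ 4)⁻¹ := by positivity
    -- Short times, and long times with `D ≥ t`, are covered by `caseA`; only `D ≤ t` with `t ≥ 1`
    -- uses the term with `t³`.
    rcases le_total t 1 with ht1 | ht1
    · have := caseA zero_le_one (by norm_num) (by nlinarith [mul_nonneg hx0 hD0, mul_nonneg hx0 (sub_nonneg.2 ht1)])
      linarith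
    · rcases le_total t D with hDt | hDt
      · have h1 := mul_nonneg hx0 hD0
        have h2 := mul_nonneg hx0 (sub_nonneg.2 hDt)
        have := caseA (k := 2) (by norm_num) le_rfl (by nlinarith)
        linarith
      · have h1 : L ≤ (2 * t * (1 + x)) ^ 3 :=
          cubicWeight_le y (by positivity) (by rw [abs_of_pos ht]; nlinarith)
        have h2 : ((1 + x) ^ 4)⁻¹ ≤ 1 := inv_le_one_of_one_le₀ (one_le_pow₀ (by linarith))
        calc _ ≤ (1 + D) ^ (-(7 / 2) : ℝ) * ((1 + x) ^ 7)⁻¹ * (2 * t * (1 + x)) ^ 3 := by gcongr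
          _ = 8 * (t ^ 3 * (1 + D) ^ (-(7 / 2) : ℝ) * ((1 + x) ^ 4)⁻¹) := by field_simp; norm_num
          _ ≤ 8 * (t ^ 3 * (1 + D) ^ (-(7 / 2) : ℝ) * 1) := by gcongr
          _ ≤ _ := by linarith
  have j1 : Integrable (fun a : E3 => (1 + ‖t • (t⁻¹ • y - a)‖) ^ (-(7 / 2) : ℝ)) :=
    (i1.comp_smul ht.ne').comp_sub_left (t⁻¹ • y)
  have v1 : ∫ a : E3, (1 + ‖t • (t⁻¹ • y - a)‖) ^ (-(7 / 2) : ℝ) = (t ^ 3)⁻¹ * A := by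
    rw [integral_sub_left_eq_self (fun x : E3 => (1 + ‖t • x‖) ^ (-(7 / 2) : ℝ)) volume (t⁻¹ • y),
      Measure.integral_comp_smul volume (fun x : E3 => (1 + ‖x‖) ^ (-(7 / 2) : ℝ)) t, finrank_E3,
      abs_of_pos (by positivity), smul_eq_mul]
  have hi : Integrable fun a : E3 =>
      8 / L * (t ^ 3 * (1 + ‖t • (t⁻¹ • y - a)‖) ^ (-(7 / 2) : ℝ) + (1 + ‖a‖) ^ (-4 : ℝ)) :=
    ((j1.const_mul _).add i2).const_mul _
  refine (lintegral_mono fun a => ENNReal.ofReal_le_ofReal (key a)).trans ?_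
  rw [← ofReal_integral_eq_lintegral_ofReal hi (Filter.Eventually.of_forall fun a => by positivity)]
  refine ENNReal.ofReal_le_ofReal (le_of_eq ?_)
  rw [integral_const_mul, integral_add (j1.const_mul _) i2, integral_const_mul, v1, ← hB]
  field_simp

/-- Fibrewise estimation of an integral over phase space. -/
theorem integral_indicator_le_of_fibre {s : Set Phase} (hs : MeasurableSet s) {f h : Phase → ℝ}
    (hf : Measurable f) (hf0 : ∀ p, 0 ≤ f p) {g : E3 → ℝ} (hg0 : ∀ a, 0 ≤ g a) {B D : ℝ}
    (hB : 0 ≤ B) (hD : 0 ≤ D)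
    (hle : ∀ p ∈ phaseSpace, p ∈ s → f p ≤ g p.2 * h p)
    (hfib : ∀ a : E3, a ≠ 0 → ∫⁻ θ : E3 in {θ | (θ, a) ∈ s}, ENNReal.ofReal (h (θ, a)) ≤ ENNReal.ofReal B)
    (hg : ∫⁻ a, ENNReal.ofReal (g a) ≤ ENNReal.ofReal D) :
    Integrable (s.indicator f) ∧ ∫ p, s.indicator f p ≤ B * D := by
  have hm : Measurable (s.indicator f) := hf.indicator hs
  have h0 : ∀ p, 0 ≤ s.indicator f p := fun p => indicator_nonneg (fun p _ => hf0 p) p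
  have hl : ∫⁻ p, ENNReal.ofReal (s.indicator f p) ≤ ENNReal.ofReal (B * D) := by
    rw [Measure.volume_eq_prod, lintegral_prod_symm' _ (by fun_prop)]
    have hae : ∀ᵐ a : E3, a ≠ 0 := by simp [ae_iff]
    calc _ ≤ ∫⁻ a : E3, ENNReal.ofReal B * ENNReal.ofReal (g a) := by
          refine lintegral_mono_ae (hae.mono fun a ha => ?_)
          have hms : MeasurableSet {θ : E3 | (θ, a) ∈ s} :=
            (by fun_prop : Measurable fun θ : E3 => (θ, a)) hs
          have e : ∀ θ : E3, ENNReal.ofReal (s.indicator f (θ, a))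
              ≤ ENNReal.ofReal (g a) * {θ : E3 | (θ, a) ∈ s}.indicator
                (fun θ => ENNReal.ofReal (h (θ, a))) θ := fun θ => by
            by_cases hθ : (θ, a) ∈ s
            · rw [indicator_of_mem hθ, indicator_of_mem (by exact hθ), ← ENNReal.ofReal_mul (hg0 a)]
              exact ENNReal.ofReal_le_ofReal (hle (θ, a) ha hθ)
            · rw [indicator_of_notMem hθ]; simp
          refine (lintegral_mono e).trans ?_
          rw [lintegral_const_mul' _ _ ENNReal.ofReal_ne_top, lintegral_indicator hms, mul_comm]
          exact mul_le_mul_left (hfib a ha) _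
      _ = ENNReal.ofReal B * _ := lintegral_const_mul' _ _ ENNReal.ofReal_ne_top
      _ ≤ ENNReal.ofReal B * ENNReal.ofReal D := mul_le_mul_right hg _
      _ = _ := (ENNReal.ofReal_mul hB).symm
  refine ⟨⟨hm.aestronglyMeasurable, ?_⟩, ?_⟩
  · rw [hasFiniteIntegral_iff_ofReal (Filter.Eventually.of_forall h0)]
    exact hl.trans_lt ENNReal.ofReal_lt_top
  · rw [integral_eq_lintegral_of_nonneg_ae (Filter.Eventually.of_forall h0) hm.aestronglyMeasurable]
    exact ENNReal.toReal_le_of_le_ofReal (by positivity) hl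

theorem norm_sub_smul_le (q t : ℝ) (y : E3) (p : Phase) :
    ‖y - t • p.2‖ ≤ ‖y - posXt q t p‖ + disp q t p := by
  have := norm_add_le (y - posXt q t p) (posXt q t p - t • p.2)
  rwa [sub_add_sub_cancel] at this

/-- The region of phase space close to `y` at scale `R`. -/
def nearSet (q t : ℝ) (y : E3) (R : ℝ) : Set Phase := {p | ‖y - posXt q t p‖ < 3 * R}

/-- The region of phase space close to `y` at scale `R` up to the displacement. -/
def farSet (q t : ℝ) (y : E3) (R : ℝ) : Set Phase := {p | ‖y - t • p.2‖ < 3 * R * (1 + disp q t p)}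

theorem measurableSet_nearSet (q t : ℝ) (y : E3) (R : ℝ) : MeasurableSet (nearSet q t y R) := by
  have := measurable_posXt q t
  exact measurableSet_lt (by fun_prop) measurable_const

theorem measurableSet_farSet (q t : ℝ) (y : E3) (R : ℝ) : MeasurableSet (farSet q t y R) := by
  have := measurable_disp q t
  exact measurableSet_lt (by fun_prop) (by fun_prop)

/-- From a bound on the displacement to decay of the majorant. -/
theorem maj_le_of_displacement {m D M x F K : ℝ} (hm : 0 ≤ m) (hD : 0 ≤ D) (hx : 0 ≤ x) (hF : 0 < F)
    (hDM : 1 + D ≤ 4 * (1 + M)) (h : m * (1 + M) ^ (7 / 2 : ℝ) * (1 + x) ^ 7 * F ≤ K) :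
    m ≤ ((1 + D) ^ (-(7 / 2) : ℝ) * ((1 + x) ^ 7)⁻¹) * ((4 : ℝ) ^ (7 / 2 : ℝ) * K * (1 / F)) := by
  have h1 : (1 + D) ^ (7 / 2 : ℝ) ≤ 4 ^ (7 / 2 : ℝ) * (1 + M) ^ (7 / 2 : ℝ) := by
    rw [← Real.mul_rpow (by norm_num) (by linarith)]
    exact Real.rpow_le_rpow (by positivity) hDM (by norm_num)
  have h2 : 0 < (1 + D) ^ (7 / 2 : ℝ) := by positivity
  rw [Real.rpow_neg (by positivity)]
  have e : ((1 + D) ^ (7 / 2 : ℝ))⁻¹ * ((1 + x) ^ 7)⁻¹ * ((4 : ℝ) ^ (7 / 2 : ℝ) * K * (1 / F))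
      = 4 ^ (7 / 2 : ℝ) * K / ((1 + D) ^ (7 / 2 : ℝ) * (1 + x) ^ 7 * F) := by field_simp
  rw [e, le_div_iff₀ (by positivity)]
  calc m * ((1 + D) ^ (7 / 2 : ℝ) * (1 + x) ^ 7 * F)
      ≤ m * ((4 ^ (7 / 2 : ℝ) * (1 + M) ^ (7 / 2 : ℝ)) * (1 + x) ^ 7 * F) := by gcongr
    _ = 4 ^ (7 / 2 : ℝ) * (m * (1 + M) ^ (7 / 2 : ℝ) * (1 + x) ^ 7 * F) := by ring
    _ ≤ _ := by gcongr

/-- On each fibre the fold estimate bounds the weighted measure of `{|y - 𝐗̃| < 3R}` by a multiple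
of `(1 + √c) R^(5/2)`, where `R ≤ 1` absorbs `R³`. The factors `1 + √c` and `1 + κ` are supplied by
`exists_maj_le`, and the spatial decay by localization in `𝐚`. -/
theorem exists_near_le {q : ℝ} (hq : 0 < q) : ∃ C : ℝ, 0 ≤ C ∧ ∀ (t : ℝ), 0 < t → ∀ (y : E3) (R : ℝ),
    0 < R → R ≤ 1 → Integrable ((nearSet q t y R).indicator (maj q t)) ∧
      cubicWeight t y * ∫ p, (nearSet q t y R).indicator (maj q t) p
        ≤ C * (1 + t) ^ (1 / 20 : ℝ) * (R ^ 2 * √R) := by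
  obtain ⟨C1, hC1, h1⟩ := exists_maj_le hq
  obtain ⟨C2, hC2, h2⟩ := exists_lintegral_loc_le
  refine ⟨(4 : ℝ) ^ (7 / 2 : ℝ) * C1 * (1024 * 27) * C2, by positivity, fun t ht y R hR hR1 => ?_⟩
  have hL := cubicWeight_pos ht y
  set K := C1 * (1 + t) ^ (1 / 20 : ℝ) with hK
  have hK0 : 0 ≤ K := by positivity
  have hsR : 0 ≤ √R := Real.sqrt_nonneg R
  have main := integral_indicator_le_of_fibre (s := nearSet q t y R) (measurableSet_nearSet q t y R)
    (f := maj q t) (h := fun p => (4 : ℝ) ^ (7 / 2 : ℝ) * K * (1 / ((1 + kappa q p) * (1 + √(scl q p)))))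
    (g := fun a => (1 + ‖y - t • a‖) ^ (-(7 / 2) : ℝ) * ((1 + ‖a‖) ^ 7)⁻¹)
    (B := (4 : ℝ) ^ (7 / 2 : ℝ) * K * (1024 * 27) * (R ^ 2 * √R)) (D := C2 / cubicWeight t y)
    (measurable_maj q t) (maj_nonneg hq ht.le) (fun a => by positivity) (by positivity) (by positivity)
    ?_ ?_ (h2 t ht y)
  · refine ⟨main.1, ?_⟩
    calc _ ≤ cubicWeight t y * ((4 : ℝ) ^ (7 / 2 : ℝ) * K * (1024 * 27) * (R ^ 2 * √R)
          * (C2 / cubicWeight t y)) := by gcongr; exact main.2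
      _ = _ := by rw [hK]; field_simp
  · intro p hp hps
    have hk := kappa_nonneg hq p
    have hc := scl_nonneg hq p
    have hM := disp_nonneg q t p
    have hS := one_le_wS hq p
    have hm := maj_nonneg hq ht.le p
    refine maj_le_of_displacement hm (norm_nonneg _) (norm_nonneg _) (by positivity) (M := disp q t p) ?_ ?_
    -- `|y - t𝐚|` is less than `3R` plus the displacement, and `R ≤ 1` turns this into `4(1 + M)`.
    · have a1 := norm_sub_smul_le q t y p
      have a2 : ‖y - posXt q t p‖ < 3 * R := hps
      linarith
    · refine le_trans ?_ (h1 t ht.le p hp)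
      have ha := act_nonneg p
      change maj q t p * (1 + disp q t p) ^ (7 / 2 : ℝ) * (1 + act p) ^ 7 * _ ≤ _
      refine mul_le_mul_of_nonneg_left ?_ (by positivity)
      have : 0 ≤ scl q p ^ 3 * wS q p ^ (7 / 2 : ℝ) := by positivity
      linarith
  · intro a ha
    have hna := norm_pos_iff.2 ha
    have hb := lintegral_posXt_ball_le hq t ha y (r := 3 * R) (by positivity)
    obtain ⟨c, hc⟩ : ∃ c, c = √(q / ‖a‖ ^ 2) := ⟨_, rfl⟩
    have hc0 : 0 ≤ c := hc ▸ Real.sqrt_nonneg _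
    have e : ∀ θ : E3, ENNReal.ofReal ((4 : ℝ) ^ (7 / 2 : ℝ) * K * (1 / ((1 + kappa q (θ, a)) * (1 + √(scl q (θ, a))))))
        = ENNReal.ofReal ((4 : ℝ) ^ (7 / 2 : ℝ) * K * (1 / (1 + c)))
          * ENNReal.ofReal (1 / (1 + kappa q (θ, a))) := fun θ => by
      have hk := kappa_nonneg hq (θ, a)
      have : √(scl q (θ, a)) = c := by rw [hc]; rfl
      rw [← ENNReal.ofReal_mul (by positivity), this]
      congr 1
      field_simp
    simp_rw [e]
    rw [lintegral_const_mul' _ _ ENNReal.ofReal_ne_top]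
    refine (mul_le_mul_right hb _).trans ?_
    rw [← ENNReal.ofReal_mul (by positivity), ← hc]
    refine ENNReal.ofReal_le_ofReal ?_
    have h3 : √(3 * R) ≤ 3 * √R := by
      rw [Real.sqrt_mul (by norm_num)]
      gcongr
      rw [Real.sqrt_le_left (by norm_num)]; norm_num
    have hRR : R ≤ √R := by
      have := Real.sq_sqrt hR.le
      have : √R ≤ 1 := Real.sqrt_le_one.2 hR1
      nlinarith
    have h4 : (3 * R) ^ 3 + c * (3 * R) ^ 2 * √(3 * R) ≤ (1 + c) * (27 * (R ^ 2 * √R)) := by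
      calc _ ≤ 27 * (R ^ 2 * R) + c * (3 * R) ^ 2 * (3 * √R) := by
            have : (3 * R) ^ 3 = 27 * (R ^ 2 * R) := by ring
            rw [this]; gcongr
        _ ≤ 27 * (R ^ 2 * √R) + c * (3 * R) ^ 2 * (3 * √R) := by gcongr
        _ = _ := by ring
    calc _ ≤ (4 : ℝ) ^ (7 / 2 : ℝ) * K * (1 / (1 + c)) * (1024 * ((1 + c) * (27 * (R ^ 2 * √R)))) := by
          gcongr
      _ = _ := by field_simp

/-- Here the whole fibre in `ϑ` is integrated by `S^(-7/2)`, without the fold. Localization is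
applied to `y/R` and `t/R`, and the rescaled decay weight yields the factor `R³`. -/
theorem exists_far_le {q : ℝ} (hq : 0 < q) : ∃ C : ℝ, 0 ≤ C ∧ ∀ (t : ℝ), 0 < t → ∀ (y : E3) (R : ℝ),
    0 < R → Integrable ((farSet q t y R).indicator (maj q t)) ∧
      cubicWeight t y * ∫ p, (farSet q t y R).indicator (maj q t) p
        ≤ C * (1 + t) ^ (1 / 20 : ℝ) * R ^ 3 := by
  obtain ⟨C1, hC1, h1⟩ := exists_maj_le hq
  obtain ⟨C2, hC2, h2⟩ := exists_lintegral_loc_le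
  obtain ⟨C3, hC3, h3⟩ := exists_lintegral_wS_le
  refine ⟨(4 : ℝ) ^ (7 / 2 : ℝ) * C1 * C3 * C2, by positivity, fun t ht y R hR => ?_⟩
  have htR : 0 < t / R := by positivity
  have hL := cubicWeight_pos htR (R⁻¹ • y)
  rw [cubicWeight_scale hR]
  set K := C1 * (1 + t) ^ (1 / 20 : ℝ) with hK
  have hK0 : 0 ≤ K := by positivity
  have main := integral_indicator_le_of_fibre (s := farSet q t y R) (measurableSet_farSet q t y R)
    (f := maj q t)
    (h := fun p => (4 : ℝ) ^ (7 / 2 : ℝ) * K * (1 / (scl q p ^ 3 * wS q p ^ (7 / 2 : ℝ))))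
    (g := fun a => (1 + ‖R⁻¹ • y - (t / R) • a‖) ^ (-(7 / 2) : ℝ) * ((1 + ‖a‖) ^ 7)⁻¹)
    (B := (4 : ℝ) ^ (7 / 2 : ℝ) * K * C3) (D := C2 / cubicWeight (t / R) (R⁻¹ • y))
    (measurable_maj q t) (maj_nonneg hq ht.le) (fun a => by positivity) (by positivity) (by positivity)
    ?_ ?_ (h2 (t / R) htR (R⁻¹ • y))
  · refine ⟨main.1, ?_⟩
    calc _ ≤ R ^ 3 * cubicWeight (t / R) (R⁻¹ • y) * ((4 : ℝ) ^ (7 / 2 : ℝ) * K * C3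
          * (C2 / cubicWeight (t / R) (R⁻¹ • y))) := by gcongr; exact main.2
      _ = _ := by
        generalize cubicWeight (t / R) (R⁻¹ • y) = L at hL
        rw [hK]; field_simp
  · intro p hp hps
    have hk := kappa_nonneg hq p
    have hc := scl_pos hq hp
    have hM := disp_nonneg q t p
    have hS := one_le_wS hq p
    have hm := maj_nonneg hq ht.le p
    refine maj_le_of_displacement hm (norm_nonneg _) (norm_nonneg _) (by positivity) (M := disp q t p) ?_ ?_
    · have a2 : ‖y - t • p.2‖ < 3 * R * (1 + disp q t p) := hps
      have e : R⁻¹ • y - (t / R) • p.2 = R⁻¹ • (y - t • p.2) := by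
        rw [smul_sub, smul_smul, div_eq_inv_mul]
      rw [e, norm_smul, Real.norm_eq_abs, abs_of_pos (inv_pos.2 hR)]
      have : R⁻¹ * ‖y - t • p.2‖ ≤ 3 * (1 + disp q t p) := by
        rw [inv_mul_le_iff₀ hR]; linarith
      linarith
    · refine le_trans ?_ (h1 t ht.le p hp)
      have ha := act_nonneg p
      change maj q t p * (1 + disp q t p) ^ (7 / 2 : ℝ) * (1 + act p) ^ 7 * _ ≤ _
      refine mul_le_mul_of_nonneg_left ?_ (by positivity)
      have : 0 ≤ (1 + kappa q p) * (1 + √(scl q p)) := by positivity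
      linarith
  · intro a ha
    have hna := norm_pos_iff.2 ha
    have hc0 : 0 < q / ‖a‖ ^ 2 := by positivity
    have e : ∀ θ : E3, ENNReal.ofReal ((4 : ℝ) ^ (7 / 2 : ℝ) * K * (1 / (scl q (θ, a) ^ 3 * wS q (θ, a) ^ (7 / 2 : ℝ))))
        = ENNReal.ofReal ((4 : ℝ) ^ (7 / 2 : ℝ) * K / (q / ‖a‖ ^ 2) ^ 3)
          * ENNReal.ofReal (wS q (θ, a) ^ (-(7 / 2) : ℝ)) := fun θ => by
      have hS := one_le_wS hq (θ, a)
      have : scl q (θ, a) = q / ‖a‖ ^ 2 := rfl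
      rw [← ENNReal.ofReal_mul (by positivity), this, Real.rpow_neg (by linarith)]
      congr 1
      field_simp
    refine (setLIntegral_le_lintegral _ _).trans ?_
    simp_rw [e]
    rw [lintegral_const_mul' _ _ ENNReal.ofReal_ne_top]
    refine (mul_le_mul_right (h3 q hq a ha) _).trans ?_
    rw [← ENNReal.ofReal_mul (by positivity)]
    refine ENNReal.ofReal_le_ofReal (le_of_eq ?_)
    field_simp

/-! ### Pointwise control of the density by the norm -/

/-- Pointwise bounds for a density and its derivatives. -/
structure IsControlled (q N K : ℝ) (γ : Phase → ℝ) (p : Phase) : Prop where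
  sq : γ p ^ 2 ≤ N / wW q p ^ 24
  vS : |γ p * dAlong γ vecS p| ≤ K * N * ((1 + act p + lam p) / wW q p ^ 12)
  vH : |γ p * dAlong γ vecH p| ≤ K * N * ((1 + act p + lam p) / wW q p ^ 12)
  vR : ∀ i j, i ≠ j → |γ p * dAlong γ (vecR i j) p| ≤ K * N * ((1 + act p + lam p) / wW q p ^ 12)

theorem ae_norm_le_of_eLpNorm_top {f : Phase → E3} {N : ℝ≥0∞} (hN : N ≠ ⊤)
    (h : eLpNorm f ∞ volume ^ 2 ≤ N) : ∀ᵐ p, ‖f p‖ ^ 2 ≤ N.toReal := by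
  have h1 : eLpNorm (fun p => ‖f p‖) ∞ volume ^ 2 ≤ N := by rwa [eLpNorm_norm]
  exact ae_abs_le_of_eLpNorm_top hN h1

theorem le_sqrt_div {x w N : ℝ} (hw : 0 < w) (h : (w * x) ^ 2 ≤ N) : |x| ≤ √N / w := by
  rw [le_div_iff₀ hw]
  calc |x| * w = |w * x| := by rw [abs_mul, abs_of_pos hw, mul_comm]
    _ ≤ √N := Real.abs_le_sqrt h

/-- In each product the density contributes `√N` times the inverse twelfth power of the weight, and
the derivative another `√N` from the bracket norms. The relation `ξ a = q` turns the bracket weights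
into the polynomial factor `1 + a + λ`. -/
theorem ae_isControlled {q : ℝ} (hq : 0 < q) {γ : Phase → ℝ} (hγ : ContDiffOn ℝ 1 γ phaseSpace)
    (h : normN2 q γ ≠ ⊤) :
    ∀ᵐ p : Phase, p ∈ phaseSpace ∧ IsControlled q (normN2 q γ).toReal (1 + q + 1 / q) γ p := by
  have b1 := ae_abs_le_of_eLpNorm_top h (f := fun p => wW q p ^ 12 * γ p) (by unfold normN2; exact le_add_right (le_add_left le_rfl))
  have b2 := ae_abs_le_of_eLpNorm_top h (f := fun p => (1 + xi q p) / xi q p ^ 2 * poisson (xi q) γ p)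
    (by unfold normN2 normBrackets
        exact le_add_left (le_add_right (le_add_right (le_add_right le_rfl))))
  have b3 := ae_abs_le_of_eLpNorm_top h (f := fun p => xi q p ^ 2 / (1 + xi q p) * poisson (eta q) γ p)
    (by unfold normN2 normBrackets
        exact le_add_left (le_add_right (le_add_right (le_add_left le_rfl))))
  have b4 := ae_norm_le_of_eLpNorm_top h (f := fun p => poissonVec dir γ p)
    (by unfold normN2 normBrackets
        exact le_add_left (le_add_right (le_add_left le_rfl)))
  have b5 := ae_norm_le_of_eLpNorm_top h (f := fun p => (xi q p / (1 + xi q p)) • poissonVec angMom γ p)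
    (by unfold normN2 normBrackets
        exact le_add_left (le_add_left le_rfl))
  filter_upwards [b1, b2, b3, b4, b5, ae_mem_phaseSpace] with p h1 h2 h3 h4 h5 hp
  refine ⟨hp, ?_⟩
  have hd := differentiableAt_of_contDiffOn hγ hp
  have ha := act_pos hp
  have hx := xi_pos hq hp
  have hW := wW_pos hq hp
  have hl := lam_nonneg p
  have hxa : xi q p * act p = q := div_mul_cancel₀ _ ha.ne'
  obtain ⟨M, hM⟩ : ∃ M, M = √(normN2 q γ).toReal := ⟨_, rfl⟩
  have hM0 : 0 ≤ M := hM ▸ Real.sqrt_nonneg _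
  have hM2 : M * M = (normN2 q γ).toReal := by rw [hM, Real.mul_self_sqrt ENNReal.toReal_nonneg]
  have iq : 0 < 1 / q := by positivity
  have c1 : |γ p| ≤ M / wW q p ^ 12 := by rw [hM]; exact le_sqrt_div (by positivity) h1
  have c2 : |poisson (xi q) γ p| ≤ M / ((1 + xi q p) / xi q p ^ 2) := by
    rw [hM]; exact le_sqrt_div (by positivity) h2
  have c3 : |poisson (eta q) γ p| ≤ M / (xi q p ^ 2 / (1 + xi q p)) := by
    rw [hM]; exact le_sqrt_div (by positivity) h3
  have c4 : ‖poissonVec dir γ p‖ ≤ M := hM ▸ Real.le_sqrt_of_sq_le h4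
  have c5 : ‖poissonVec angMom γ p‖ ≤ M / (xi q p / (1 + xi q p)) := by
    rw [norm_smul, Real.norm_eq_abs, abs_of_pos (by positivity)] at h5
    have := le_sqrt_div (x := ‖poissonVec angMom γ p‖) (by positivity) h5
    rwa [abs_of_nonneg (norm_nonneg _), ← hM] at this
  have ex : 1 / xi q p = act p * (1 / q) := by
    rw [mul_one_div, div_eq_div_iff hx.ne' hq.ne', one_mul, mul_comm (act p), hxa]
  have hiq : act p * (1 / q) ≤ (1 + act p + lam p) * (1 / q) := by gcongr; linarith
  have hF0 : 0 ≤ (1 + act p + lam p) * q := by positivity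
  have hE : (1 + q + 1 / q) * (1 + act p + lam p) = (1 + act p + lam p) + (1 + act p + lam p) * q
    + (1 + act p + lam p) * (1 / q) := by ring
  have hE1 : 1 + lam p + act p * (1 / q) ≤ (1 + q + 1 / q) * (1 + act p + lam p) := by linarith
  have hE2 : 1 + act p * (1 / q) ≤ (1 + q + 1 / q) * (1 + act p + lam p) := by linarith
  have hE3 : q * act p ≤ (1 + q + 1 / q) * (1 + act p + lam p) := by
    have h1 : 0 ≤ q * (1 + lam p) := by positivity
    have h2 : 0 ≤ (1 + act p + lam p) * (1 / q) := by positivity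
    rw [hE]
    linarith
  have prod : ∀ {D : ℝ}, |D| ≤ M * ((1 + q + 1 / q) * (1 + act p + lam p)) →
      |γ p * D| ≤ (1 + q + 1 / q) * (normN2 q γ).toReal * ((1 + act p + lam p) / wW q p ^ 12) := by
    intro D hD
    rw [abs_mul, ← hM2]
    calc |γ p| * |D| ≤ M / wW q p ^ 12 * (M * ((1 + q + 1 / q) * (1 + act p + lam p))) := by gcongr
      _ = _ := by ring
  refine ⟨?_, prod ?_, prod ?_, fun i j hij => prod ?_⟩
  · rw [le_div_iff₀ (by positivity)]
    exact (show γ p ^ 2 * wW q p ^ 24 = (wW q p ^ 12 * γ p) ^ 2 by ring).trans_le h1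
  · rw [dAlong, indicator_of_mem hp]
    refine (abs_fderiv_vecS_le hq hd hp).trans ?_
    calc _ ≤ xi q p * (M / (xi q p ^ 2 / (1 + xi q p))) + lam p * M := by gcongr
      _ = M * (1 + lam p + 1 / xi q p) := by field_simp; ring
      _ ≤ _ := by
        rw [ex]
        exact mul_le_mul_of_nonneg_left hE1 hM0
  · rw [dAlong, indicator_of_mem hp]
    rw [poisson_xi hd hp, abs_mul, abs_of_pos (by positivity),
      show q / act p ^ 3 = xi q p * act p / act p ^ 3 by rw [hxa]] at c2
    have e : |fderiv ℝ γ p (vecH p)| ≤ M * q * act p := by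
      have h6 : xi q p * act p / act p ^ 3 * |fderiv ℝ γ p (vecH p)|
          ≤ xi q p * act p / act p ^ 3 * (M * (xi q p * act p) * act p / (1 + xi q p)) := by
        refine c2.trans (le_of_eq ?_); field_simp
      have h7 := le_of_mul_le_mul_left h6 (by positivity)
      refine h7.trans ?_
      rw [hxa]
      exact div_le_self (by positivity) (by linarith)
    refine e.trans ?_
    rw [mul_assoc]
    exact mul_le_mul_of_nonneg_left hE3 hM0
  · rw [dAlong, indicator_of_mem hp]
    refine (abs_fderiv_vecR_le hd hij).trans (c5.trans ?_)
    calc _ = M * (1 + 1 / xi q p) := by field_simp; ring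
      _ ≤ _ := by
        rw [ex]
        exact mul_le_mul_of_nonneg_left hE2 hM0

/-! ### Bounds for the cutoff -/

theorem pd_zero_of_eq {f : E3 → ℝ} {r : ℝ} (hf : ∀ x, r < ‖x‖ → f x = 0) {x : E3} (hx : r < ‖x‖) :
    fderiv ℝ f x = 0 := by
  have : f =ᶠ[nhds x] fun _ => 0 := by
    filter_upwards [(isOpen_lt continuous_const continuous_norm).mem_nhds hx] with z hz using hf z hz
  rw [this.fderiv_eq]; simp

theorem contDiff_pd {f : E3 → ℝ} (hf : ContDiff ℝ ∞ f) (j : Fin 3) : ContDiff ℝ ∞ (pd j f) := by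
  unfold pd
  exact (hf.fderiv_right (by simp)).clm_apply contDiff_const

theorem exists_bound_of_zero {F : Type*} [NormedAddCommGroup F] {f : E3 → F} (hf : Continuous f) {r : ℝ}
    (h : ∀ x, r < ‖x‖ → f x = 0) : ∃ C : ℝ, 0 ≤ C ∧ ∀ x, ‖f x‖ ≤ C := by
  obtain ⟨C, hC⟩ := (isCompact_closedBall (0 : E3) r).exists_bound_of_continuousOn hf.continuousOn
  refine ⟨max C 0, le_max_right _ _, fun x => ?_⟩
  by_cases hx : ‖x‖ ≤ r
  · exact (hC x (by simpa using hx)).trans (le_max_left _ _)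
  · rw [h x (not_le.1 hx), norm_zero]; exact le_max_right _ _

/-- Uniform bounds for the derivatives of the cutoff. -/
structure CutoffBound (φ : E3 → ℝ) (C : ℝ) : Prop where
  one_le : 1 ≤ C
  smooth : ∀ k, ContDiff ℝ ∞ (pd k φ)
  b1 : ∀ k x, |pd k φ x| ≤ C
  b2 : ∀ k x, ‖fderiv ℝ (pd k φ) x‖ ≤ C
  b3 : ∀ j k x, ‖fderiv ℝ (pd j (pd k φ)) x‖ ≤ C
  z1 : ∀ k x, 3 ≤ ‖x‖ → pd k φ x = 0
  z2 : ∀ k x, 3 ≤ ‖x‖ → fderiv ℝ (pd k φ) x = 0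

theorem exists_cutoffBound {φ : E3 → ℝ} (hφ : IsStandardCutoff φ) : ∃ C : ℝ, CutoffBound φ C := by
  have h0 : ∀ x, 2 < ‖x‖ → φ x = 0 := fun x hx => by
    by_contra hc
    have := (hφ.support_subset (subset_tsupport _ hc)).2
    linarith
  have h1 : ∀ k x, 2 < ‖x‖ → pd k φ x = 0 := fun k x hx => by rw [pd, pd_zero_of_eq h0 hx]; simp
  have h2 : ∀ k x, 2 < ‖x‖ → fderiv ℝ (pd k φ) x = 0 := fun k x hx => pd_zero_of_eq (h1 k) hx
  have h3 : ∀ j k x, 2 < ‖x‖ → fderiv ℝ (pd j (pd k φ)) x = 0 := fun j k x hx =>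
    pd_zero_of_eq (fun z hz => by rw [pd, h2 k z hz]; simp) hx
  have s1 : ∀ k, ContDiff ℝ ∞ (pd k φ) := contDiff_pd hφ.smooth
  choose C1 hC1 g1 using fun k => exists_bound_of_zero (s1 k).continuous (h1 k)
  choose C2 hC2 g2 using fun k => exists_bound_of_zero ((s1 k).continuous_fderiv (by simp)) (h2 k)
  choose C3 hC3 g3 using fun j k =>
    exists_bound_of_zero ((contDiff_pd (s1 k) j).continuous_fderiv (by simp)) (h3 j k)
  have t1 : ∀ k, C1 k ≤ ∑ k, C1 k := fun k => Finset.single_le_sum (fun i _ => hC1 i) (Finset.mem_univ k)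
  have t2 : ∀ k, C2 k ≤ ∑ k, C2 k := fun k => Finset.single_le_sum (fun i _ => hC2 i) (Finset.mem_univ k)
  have t3 : ∀ j k, C3 j k ≤ ∑ j, ∑ k, C3 j k := fun j k =>
    (Finset.single_le_sum (f := C3 j) (fun i _ => hC3 j i) (Finset.mem_univ k)).trans
      (Finset.single_le_sum (f := fun j => ∑ k, C3 j k) (fun i _ => Finset.sum_nonneg fun k _ => hC3 i k)
        (Finset.mem_univ j))
  have p1 : 0 ≤ ∑ k, C1 k := Finset.sum_nonneg fun k _ => hC1 k
  have p2 : 0 ≤ ∑ k, C2 k := Finset.sum_nonneg fun k _ => hC2 k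
  have p3 : 0 ≤ ∑ j, ∑ k, C3 j k := Finset.sum_nonneg fun j _ => Finset.sum_nonneg fun k _ => hC3 j k
  refine ⟨1 + (∑ k, C1 k) + (∑ k, C2 k) + ∑ j, ∑ k, C3 j k, by linarith, s1, fun k x => ?_, fun k x => ?_,
    fun j k x => ?_, fun k x hx => h1 k x (by linarith), fun k x hx => h2 k x (by linarith)⟩
  · exact (g1 k x).trans (by have := t1 k; linarith)
  · exact (g2 k x).trans (by have := t2 k; linarith)
  · exact (g3 j k x).trans (by have := t3 j k; linarith)

/-! ### Bounds at a fixed scale -/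

/-- Standing assumptions for the estimates of the derivative of the field. -/
structure ScaleData (q : ℝ) (φ : E3 → ℝ) (γ : Phase → ℝ) (C K N : ℝ) : Prop where
  hq : 0 < q
  cut : CutoffBound φ C
  smooth : ContDiffOn ℝ 1 γ phaseSpace
  one_le : 1 ≤ K
  nonneg : 0 ≤ N
  ctl : ∀ᵐ p : Phase, p ∈ phaseSpace ∧ IsControlled q N K γ p

theorem hasFDerivAt_pd_scale {φ : E3 → ℝ} {C : ℝ} (hC : CutoffBound φ C) (k : Fin 3) (y : E3) (R : ℝ) (x : E3) :
    HasFDerivAt (fun x => pd k φ (R⁻¹ • (y - x)))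
      ((-R⁻¹) • fderiv ℝ (pd k φ) (R⁻¹ • (y - x))) x := by
  have h1 : HasFDerivAt (fun x : E3 => R⁻¹ • (y - x)) (R⁻¹ • -(ContinuousLinearMap.id ℝ E3)) x :=
    ((hasFDerivAt_id x).const_sub y).const_smul R⁻¹
  have h2 := (((hC.smooth k).differentiable (by simp)).differentiableAt
    (x := R⁻¹ • (y - x))).hasFDerivAt.comp x h1
  refine h2.congr_fderiv ?_
  ext v
  simp

theorem one_div_pow_le_majG {q t : ℝ} (hq : 0 < q) (ht : 0 ≤ t) (p : Phase) :
    1 / wW q p ^ 24 ≤ majG q t p := by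
  have hc := scl_nonneg hq p
  have hS := one_le_wS hq p
  have hτ := one_le_tauD hq ht p
  have ha := act_nonneg p
  have hl := lam_nonneg p
  have hW := wW_nonneg q p
  have h1 : 0 ≤ (1 + act p + lam p) / wW q p ^ 12 := by positivity
  have h2 : 1 ≤ (1 + scl q p) * wS q p ^ 2 * tauD q t p :=
    one_le_mul_of_one_le_of_one_le
      (one_le_mul_of_one_le_of_one_le (by linarith) (one_le_pow₀ hS)) hτ
  have h3 : 1 / wW q p ^ 24 ≤ (1 + scl q p) * wS q p ^ 2 * tauD q t p / wW q p ^ 24 := by gcongr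
  unfold majG; linarith

theorem div_pow_le_majG {q t : ℝ} (hq : 0 < q) (ht : 0 ≤ t) (p : Phase) :
    (1 + act p + lam p) / wW q p ^ 12 ≤ majG q t p := by
  have hc := scl_nonneg hq p
  have hS := one_le_wS hq p
  have hτ := one_le_tauD hq ht p
  have hW := wW_nonneg q p
  have h1 : 0 ≤ (1 + scl q p) * wS q p ^ 2 * tauD q t p / wW q p ^ 24 := by positivity
  unfold majG; linarith

theorem majG_le_maj {q t : ℝ} (hq : 0 < q) (ht : 0 ≤ t) (p : Phase) : majG q t p ≤ maj q t p :=
  le_mul_of_one_le_left (majG_nonneg hq ht p) (one_le_majV hq p)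

theorem norm_posXt_pos {q : ℝ} (hq : 0 < q) (t : ℝ) {p : Phase} (hp : p ∈ phaseSpace) : 0 < ‖posXt q t p‖ :=
  (scl_pos hq hp).trans_le (scl_le_norm_posX hq (shift_mem t hp))

theorem one_div_norm_posXt_le {q : ℝ} (hq : 0 < q) (t : ℝ) {p : Phase} (hp : p ∈ phaseSpace) :
    1 / ‖posXt q t p‖ ≤ majV q p := by
  have hc := scl_pos hq hp
  have h1 : scl q p ≤ ‖posXt q t p‖ := scl_le_norm_posX hq (shift_mem t hp)
  have h2 : 1 / ‖posXt q t p‖ ≤ 1 / scl q p := one_div_le_one_div_of_le hc h1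
  have h3 : 0 ≤ (2 + |eta q p|) / act p := div_nonneg (by positivity) (act_nonneg p)
  unfold majV; linarith

theorem div_norm_posXt_le {q t : ℝ} (hq : 0 < q) {p : Phase} (hp : p ∈ phaseSpace) :
    t / ‖posXt q t p‖ ≤ majV q p := by
  have hc := scl_pos hq hp
  have ha := act_pos hp
  have h1 : t * act p ≤ (2 + |eta q p|) * ‖posXt q t p‖ := mul_act_le hq hp
  have h2 : t / ‖posXt q t p‖ ≤ (2 + |eta q p|) / act p := by
    rwa [div_le_div_iff₀ (norm_posXt_pos hq t hp) ha]
  have h3 : 0 < 1 / scl q p := by positivity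
  unfold majV; linarith

theorem one_div_norm_smul_le {q t : ℝ} (hq : 0 < q) (ht : 0 < t) {p : Phase} (hp : p ∈ phaseSpace) :
    1 / ‖t • p.2‖ ≤ t⁻¹ * majV q p := by
  have hc := scl_pos hq hp
  have ha := act_pos hp
  have e : 1 / ‖t • p.2‖ = t⁻¹ * (1 / act p) := by
    rw [norm_smul, Real.norm_eq_abs, abs_of_pos ht, act]; field_simp
  have h2 : 1 / act p ≤ (2 + |eta q p|) / act p := by
    gcongr; linarith [abs_nonneg (eta q p)]
  have h3 : 0 < 1 / scl q p := by positivity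
  rw [e]
  refine mul_le_mul_of_nonneg_left ?_ (by positivity)
  unfold majV; linarith

variable {q t : ℝ} {φ : E3 → ℝ} {γ : Phase → ℝ} {C K N : ℝ}

/-- Integration by parts along a scaling flow and rotations, with the majorant. -/
theorem ScaleData.abs_integral_le (D : ScaleData q φ γ C K N) (ht : 0 ≤ t) {Φ : ℝ → Phase → Phase}
    (hΦ : IsScalingFlow Φ 3) {Y E : Phase → E3} (hYm : Measurable Y) (hEm : Measurable E)
    {v : Phase → Phase} (hvc : Continuous v) (hv : ∀ p, HasDerivAt (fun s => Φ s p) (v p) 0)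
    {β : ℝ} (hβ1 : 1 ≤ |β|) (hβ2 : |β| ≤ 2) (j k : Fin 3) (hY0 : ∀ p ∈ phaseSpace, Y p ≠ 0)
    (hYd : ∀ p ∈ phaseSpace, HasDerivAt (fun s => Y (Φ s p)) (β • Y p + E p) 0)
    (hYr : ∀ i, i ≠ j → ∀ p ∈ phaseSpace, HasDerivAt (fun s => Y (flowR i j s p)) (rotGen i j (Y p)) 0)
    {y : E3} {R : ℝ} (hR : 0 < R) {s : Set Phase} (hs : Integrable (s.indicator (maj q t)))
    (hYs : ∀ p ∈ phaseSpace, ‖y - Y p‖ < 3 * R → p ∈ s) {B : ℝ} (hB : 0 < B)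
    (h1 : ∀ p ∈ phaseSpace, 1 / ‖Y p‖ ≤ B * majV q p)
    (h2 : ∀ p ∈ phaseSpace, IsControlled q N K γ p →
      1 / ‖Y p‖ * |γ p * dAlong γ v p| ≤ B * K * N * maj q t p)
    (h4 : ∀ p ∈ phaseSpace, ‖E p‖ / ‖Y p‖ * (1 / wW q p ^ 24) ≤ R * B * maj q t p)
    (h5 : ∀ p ∈ phaseSpace, ‖E p‖ / ‖Y p‖ ^ 2 * (1 / wW q p ^ 24) ≤ B * maj q t p) :
    |∫ p, pd j (pd k φ) (R⁻¹ • (y - Y p)) * γ p ^ 2|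
      ≤ R * (31 * (C * (B * K * N)) * ∫ p, s.indicator (maj q t) p) := by
  obtain ⟨hq, hC, hγ, hK, hN, hctl⟩ := D
  have hC1 := hC.one_le
  -- Nothing is assumed about `γ` where `𝐚 = 0`. Extension by zero makes it measurable and changes
  -- it only on a null set.
  set g : Phase → ℝ := phaseSpace.indicator γ with hg
  set ψ : E3 → ℝ := fun x => pd k φ (R⁻¹ • (y - x)) with hψ
  have hψs : ContDiff ℝ 1 ψ := ((hC.smooth k).of_le (by simp)).comp (by fun_prop)
  have hfd : ∀ x, fderiv ℝ ψ x = (-R⁻¹) • fderiv ℝ (pd k φ) (R⁻¹ • (y - x)) := fun x =>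
    (hasFDerivAt_pd_scale hC k y R x).fderiv
  have hRi : 0 < R⁻¹ := inv_pos.2 hR
  have hsc : ∀ x : E3, 3 * R ≤ ‖y - x‖ → 3 ≤ ‖R⁻¹ • (y - x)‖ := fun x hx => by
    rw [norm_smul, Real.norm_eq_abs, abs_of_pos hRi, ← div_eq_inv_mul, le_div_iff₀ hR]
    exact hx
  have ψb : ∀ x, |ψ x| ≤ C := fun x => hC.b1 k _
  have dψb : ∀ x, ‖fderiv ℝ ψ x‖ ≤ R⁻¹ * C := fun x => by
    rw [hfd, norm_smul, norm_neg, Real.norm_eq_abs, abs_of_pos hRi]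
    exact mul_le_mul_of_nonneg_left (hC.b2 k _) hRi.le
  have loc : ∀ {p : Phase} {b c X : ℝ}, p ∈ phaseSpace → 0 ≤ c → b ≤ c → 0 ≤ X →
      (3 * R ≤ ‖y - Y p‖ → b = 0) → b * X ≤ c * s.indicator (fun _ => X) p := by
    intro p b c X hp hc hbc hX h0
    by_cases h : p ∈ s
    · rw [indicator_of_mem h]; gcongr
    · rw [h0 (by by_contra hlt; exact h (hYs p hp (not_le.1 hlt))), zero_mul, indicator_of_notMem h, mul_zero]
  have ψz : ∀ p, 3 * R ≤ ‖y - Y p‖ → |ψ (Y p)| = 0 := fun p h => by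
    rw [abs_eq_zero]; exact hC.z1 k _ (hsc _ h)
  have dψz : ∀ p, 3 * R ≤ ‖y - Y p‖ → ‖fderiv ℝ ψ (Y p)‖ = 0 := fun p h => by
    rw [hfd, hC.z2 k _ (hsc _ h), smul_zero, norm_zero]
  set J : Phase → ℝ := fun p => C * (B * K * N) * s.indicator (maj q t) p with hJ
  have fin : ∀ {p : Phase} {b c X Z : ℝ}, p ∈ phaseSpace → 0 ≤ c → b ≤ c → 0 ≤ X →
      (3 * R ≤ ‖y - Y p‖ → b = 0) → c * X ≤ Z * maj q t p → b * X ≤ Z * s.indicator (maj q t) p := by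
    intro p b c X Z hp hc hbc hX h0 hle
    refine (loc hp hc hbc hX h0).trans ?_
    by_cases h : p ∈ s
    · rw [indicator_of_mem h, indicator_of_mem h]; exact hle
    · rw [indicator_of_notMem h, indicator_of_notMem h]; simp
  have hgp : ∀ {p}, p ∈ phaseSpace → g p = γ p := fun hp => indicator_of_mem hp _
  have hm0 : ∀ p, 0 ≤ maj q t p := maj_nonneg hq ht
  have hG0 : ∀ p, 0 ≤ majG q t p := majG_nonneg hq ht
  have hV1 : ∀ p, 1 ≤ majV q p := one_le_majV hq
  have hC0 : 0 ≤ C := by linarith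
  have hsq : ∀ {p}, IsControlled q N K γ p → γ p ^ 2 ≤ N * (1 / wW q p ^ 24) := fun h => by
    rw [mul_one_div]; exact h.sq
  -- The auxiliary constant is chosen so that its product with `J` is `R⁻¹ C N` times the localized
  -- majorant, `R⁻¹` being the cost of differentiating the rescaled cutoff.
  have main := abs_integral_fderiv_le (ψ := ψ) (Y := Y) (E := E) (γ := g) (G := dAlong γ v) (J := J)
    (Gr := fun i => dAlong γ (vecR i j)) (K := R⁻¹ / (B * K)) hψs hΦ hYm hEm
    (measurable_indicator_of_continuousOn hγ.continuousOn) (measurable_dAlong hγ hvc)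
    (fun i => measurable_dAlong hγ (continuous_vecR i j)) hβ1 hβ2 j hY0 hYd
    (fun p hp => hasDerivAt_indicator_flow hγ hΦ hp (hv p)) hYr
    (fun i hi p hp => hasDerivAt_indicator_flow hγ (isScalingFlow_flowR hi) hp (hasDerivAt_flowR i j p))
    (hs.const_mul _) ?_ ?_ ?_ ?_ ?_ ?_
  -- The integrand is `-R` times a first derivative of the rescaled cutoff; this factor `R` is the
  -- gain from the integration by parts.
  · have e : ∀ᵐ p, pd j (pd k φ) (R⁻¹ • (y - Y p)) * γ p ^ 2
        = -R * (fderiv ℝ ψ (Y p) (EuclideanSpace.single j 1) * g p ^ 2) := by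
      filter_upwards [ae_mem_phaseSpace] with p hp
      rw [hgp hp, hfd, smul_apply, smul_eq_mul, pd]
      field_simp
    rw [integral_congr_ae e, integral_const_mul, abs_mul, abs_neg, abs_of_pos hR]
    refine mul_le_mul_of_nonneg_left (main.trans (le_of_eq ?_)) hR.le
    rw [hJ, integral_const_mul]; ring
  · filter_upwards [hctl] with p ⟨hp, hc⟩
    rw [hgp hp, mul_assoc]
    refine fin hp hC0 (ψb _) (by positivity) (ψz p) ?_
    calc C * (1 / ‖Y p‖ * γ p ^ 2) ≤ C * (B * majV q p * (N * majG q t p)) := by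
          have := one_div_pow_le_majG hq ht p
          have := h1 p hp
          have hBV : 0 ≤ B * majV q p := mul_nonneg hB.le (by linarith [hV1 p])
          have := (hsq hc).trans (mul_le_mul_of_nonneg_left (one_div_pow_le_majG hq ht p) hN)
          gcongr
      _ = C * (B * 1 * N) * maj q t p := by unfold maj; ring
      _ ≤ _ := by have := hm0 p; gcongr
  · filter_upwards [hctl] with p ⟨hp, hc⟩
    rw [hgp hp, mul_assoc]
    refine fin hp hC0 (ψb _) (by positivity) (ψz p) ?_
    rw [mul_assoc]
    exact mul_le_mul_of_nonneg_left (h2 p hp hc) hC0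
  · intro i hi
    filter_upwards [hctl] with p ⟨hp, hc⟩
    rw [hgp hp, mul_assoc]
    refine fin hp hC0 (ψb _) (by positivity) (ψz p) ?_
    calc C * (1 / ‖Y p‖ * |γ p * dAlong γ (vecR i j) p|)
        ≤ C * (B * majV q p * (K * N * majG q t p)) := by
          have := h1 p hp
          have hBV : 0 ≤ B * majV q p := mul_nonneg hB.le (by linarith [hV1 p])
          have := (hc.vR i j hi).trans (mul_le_mul_of_nonneg_left (div_pow_le_majG hq ht p)
            (by positivity))
          gcongr
      _ = _ := by unfold maj; ring
  · filter_upwards [hctl] with p ⟨hp, hc⟩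
    rw [hgp hp, mul_assoc]
    refine fin hp (by positivity) (dψb _) (by positivity) (dψz p) ?_
    calc R⁻¹ * C * (‖E p‖ / ‖Y p‖ * γ p ^ 2) ≤ R⁻¹ * C * (‖E p‖ / ‖Y p‖ * (N * (1 / wW q p ^ 24))) := by
          have := hsq hc
          gcongr
      _ = R⁻¹ * C * N * (‖E p‖ / ‖Y p‖ * (1 / wW q p ^ 24)) := by ring
      _ ≤ R⁻¹ * C * N * (R * B * maj q t p) := by have := h4 p hp; gcongr
      _ = C * (B * 1 * N) * maj q t p := by field_simp
      _ ≤ _ := by have := hm0 p; gcongr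
  · filter_upwards [hctl] with p ⟨hp, hc⟩
    rw [hgp hp, mul_assoc]
    refine fin hp hC0 (ψb _) (by positivity) (ψz p) ?_
    calc C * (‖E p‖ / ‖Y p‖ ^ 2 * γ p ^ 2) ≤ C * (‖E p‖ / ‖Y p‖ ^ 2 * (N * (1 / wW q p ^ 24))) := by
          have := hsq hc
          gcongr
      _ = C * N * (‖E p‖ / ‖Y p‖ ^ 2 * (1 / wW q p ^ 24)) := by ring
      _ ≤ C * N * (B * maj q t p) := by have := h5 p hp; gcongr
      _ = C * (B * 1 * N) * maj q t p := by ring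
      _ ≤ _ := by have := hm0 p; gcongr
  · filter_upwards [hctl] with p ⟨hp, hc⟩
    rw [hgp hp]
    have e : R⁻¹ / (B * K) * J p = R⁻¹ * C * N * s.indicator (maj q t) p := by
      rw [hJ]; field_simp
    rw [e]
    refine fin hp (by positivity) (dψb _) (by positivity) (dψz p) ?_
    rw [mul_assoc (R⁻¹ * C)]
    refine mul_le_mul_of_nonneg_left ?_ (by positivity)
    exact (hsq hc).trans (mul_le_mul_of_nonneg_left
      ((one_div_pow_le_majG hq ht p).trans (majG_le_maj hq ht p)) hN)

/-- Integration by parts along `flowT`. -/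
theorem ScaleData.abs_integral_posXt_le_flowT (D : ScaleData q φ γ C K N) (ht : 0 ≤ t) (j k : Fin 3)
    {y : E3} {R : ℝ} (hR : 0 < R) {s : Set Phase} (hs : Integrable (s.indicator (maj q t)))
    (hYs : ∀ p ∈ phaseSpace, ‖y - posXt q t p‖ < 3 * R → p ∈ s) :
    |∫ p, pd j (pd k φ) (R⁻¹ • (y - posXt q t p)) * γ p ^ 2|
      ≤ R * (31 * (C * (4 * K * N)) * ∫ p, s.indicator (maj q t) p) := by
  have hq := D.hq
  have hKN : 0 ≤ K * N := mul_nonneg (by linarith [D.one_le]) D.nonneg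
  refine D.abs_integral_le ht (isScalingFlow_flowT t) (measurable_posXt q t) (E := fun _ => 0)
    measurable_const (continuous_vecT t) (hasDerivAt_flowT t) (β := -2) (by norm_num) (by norm_num) j k
    (fun p hp => norm_pos_iff.1 (norm_posXt_pos hq t hp)) (fun p hp => hasDerivAt_posXt_flowT hq t hp)
    (fun i hi p hp => hasDerivAt_posXt_flowR hq t hi hp) hR hs hYs (by norm_num) ?_ ?_ ?_ ?_
  · intro p hp
    have := one_div_norm_posXt_le hq t hp
    have := one_le_majV hq p
    linarith
  · intro p hp hc
    have hn := norm_posXt_pos hq t hp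
    have a1 := one_div_norm_posXt_le hq t hp
    have a2 := div_norm_posXt_le (t := t) hq hp
    have hV := one_le_majV hq p
    have hG := div_pow_le_majG hq ht p
    have hG0 := majG_nonneg hq ht p
    have b1 := hc.vS.trans (mul_le_mul_of_nonneg_left hG hKN)
    have b2 := hc.vH.trans (mul_le_mul_of_nonneg_left hG hKN)
    -- The factor `t` of the transport field is compensated by `t/|𝐗̃| ≤ majV`, and the coefficients
    -- `1 + 3` give the `4` in the bound.
    have e : |γ p * dAlong γ (vecT t) p| ≤ |γ p * dAlong γ vecS p| + 3 * (t * |γ p * dAlong γ vecH p|) := by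
      rw [dAlong_vecT, mul_sub]
      refine (abs_sub _ _).trans (le_of_eq ?_)
      rw [show γ p * (3 * t * dAlong γ vecH p) = 3 * t * (γ p * dAlong γ vecH p) by ring,
        abs_mul (3 * t), abs_of_nonneg (by positivity : 0 ≤ 3 * t)]
      ring
    calc 1 / ‖posXt q t p‖ * |γ p * dAlong γ (vecT t) p|
        ≤ 1 / ‖posXt q t p‖ * (|γ p * dAlong γ vecS p| + 3 * (t * |γ p * dAlong γ vecH p|)) := by gcongr
      _ = 1 / ‖posXt q t p‖ * |γ p * dAlong γ vecS p|
          + 3 * (t / ‖posXt q t p‖ * |γ p * dAlong γ vecH p|) := by ring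
      _ ≤ majV q p * (K * N * majG q t p) + 3 * (majV q p * (K * N * majG q t p)) := by gcongr
      _ = _ := by unfold maj; ring
  · intro p hp
    have := maj_nonneg hq ht p
    simp; positivity
  · intro p hp
    have := maj_nonneg hq ht p
    simp; positivity

/-- Integration by parts along `flowS`. -/
theorem ScaleData.abs_integral_posXt_le_flowS (D : ScaleData q φ γ C K N) (ht : 0 < t) (j k : Fin 3)
    {y : E3} {R : ℝ} (hR : 0 < R) {s : Set Phase} (hs : Integrable (s.indicator (maj q t)))
    (hYs : ∀ p ∈ phaseSpace, ‖y - posXt q t p‖ < 3 * R → p ∈ s) :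
    |∫ p, pd j (pd k φ) (R⁻¹ • (y - posXt q t p)) * γ p ^ 2|
      ≤ R * (31 * (C * (222 * (t⁻¹ * (1 + R⁻¹)) * K * N)) * ∫ p, s.indicator (maj q t) p) := by
  have hq := D.hq
  have hKN : 0 ≤ K * N := mul_nonneg (by linarith [D.one_le]) D.nonneg
  have hRi : 0 < R⁻¹ := inv_pos.2 hR
  have hti : 0 < t⁻¹ := inv_pos.2 ht
  have hB : t⁻¹ ≤ 222 * (t⁻¹ * (1 + R⁻¹)) := by
    have : 0 ≤ t⁻¹ * R⁻¹ := by positivity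
    nlinarith
  -- All decay in time comes from here: `|𝐗̃|` is at least `t` divided by `majV`.
  have hV' : ∀ p ∈ phaseSpace, 1 / ‖posXt q t p‖ ≤ t⁻¹ * majV q p := fun p hp => by
    have := div_norm_posXt_le (t := t) hq hp
    have hn := norm_posXt_pos hq t hp
    calc 1 / ‖posXt q t p‖ = t⁻¹ * (t / ‖posXt q t p‖) := by field_simp
      _ ≤ _ := by gcongr
  have hE : ∀ p ∈ phaseSpace, ‖errX q t p‖ * (1 / wW q p ^ 24) ≤ 222 * majG q t p := fun p hp => by
    have h1 := norm_errX_le hq ht.le hp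
    have hc := scl_nonneg hq p
    have hS := one_le_wS hq p
    have hτ := one_le_tauD hq ht.le p
    have ha := act_nonneg p
    have hl := lam_nonneg p
    have hW := wW_nonneg q p
    have h2 : 0 ≤ (1 + act p + lam p) / wW q p ^ 12 := by positivity
    have h3 : scl q p * wS q p ^ 2 * tauD q t p * (1 / wW q p ^ 24)
        ≤ (1 + scl q p) * wS q p ^ 2 * tauD q t p / wW q p ^ 24 := by
      rw [← mul_one_div ((1 + scl q p) * wS q p ^ 2 * tauD q t p)]
      gcongr; linarith
    calc _ ≤ 222 * (scl q p * wS q p ^ 2) * tauD q t p * (1 / wW q p ^ 24) := by gcongr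
      _ = 222 * (scl q p * wS q p ^ 2 * tauD q t p * (1 / wW q p ^ 24)) := by ring
      _ ≤ _ := by unfold majG; linarith
  have hE2 : ∀ p ∈ phaseSpace, ‖errX q t p‖ / ‖posXt q t p‖ * (1 / wW q p ^ 24) ≤ 222 * majG q t p :=
    fun p hp => by
    have h1 := norm_errX_le hq ht.le hp
    have hc := scl_pos hq hp
    have hn : scl q p ≤ ‖posXt q t p‖ := scl_le_norm_posX hq (shift_mem t hp)
    have hS := one_le_wS hq p
    have hτ := one_le_tauD hq ht.le p
    have ha := act_nonneg p
    have hl := lam_nonneg p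
    have hW := wW_nonneg q p
    have h2 : 0 ≤ (1 + act p + lam p) / wW q p ^ 12 := by positivity
    have h3 : wS q p ^ 2 * tauD q t p * (1 / wW q p ^ 24)
        ≤ (1 + scl q p) * wS q p ^ 2 * tauD q t p / wW q p ^ 24 := by
      rw [← mul_one_div ((1 + scl q p) * wS q p ^ 2 * tauD q t p)]
      gcongr
      exact le_mul_of_one_le_left (by positivity) (by linarith)
    have h4 : ‖errX q t p‖ / ‖posXt q t p‖ ≤ 222 * wS q p ^ 2 * tauD q t p := by
      rw [div_le_iff₀ (hc.trans_le hn)]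
      calc _ ≤ 222 * (scl q p * wS q p ^ 2) * tauD q t p := h1
        _ = 222 * wS q p ^ 2 * tauD q t p * scl q p := by ring
        _ ≤ _ := by gcongr
    calc _ ≤ 222 * wS q p ^ 2 * tauD q t p * (1 / wW q p ^ 24) := by gcongr
      _ = 222 * (wS q p ^ 2 * tauD q t p * (1 / wW q p ^ 24)) := by ring
      _ ≤ _ := by unfold majG; linarith
  refine D.abs_integral_le ht.le isScalingFlow_flowS (measurable_posXt q t) (E := errX q t)
    (measurable_errX q t) continuous_vecS hasDerivAt_flowS (β := 1) (by norm_num) (by norm_num) j k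
    (fun p hp => norm_pos_iff.1 (norm_posXt_pos hq t hp)) (fun p hp => hasDerivAt_posXt_flowS hq t hp)
    (fun i hi p hp => hasDerivAt_posXt_flowR hq t hi hp) hR hs hYs (by positivity) ?_ ?_ ?_ ?_
  · intro p hp
    have := one_le_majV hq p
    exact (hV' p hp).trans (by gcongr)
  · intro p hp hc
    have hV := one_le_majV hq p
    have hG := div_pow_le_majG hq ht.le p
    have hG0 := majG_nonneg hq ht.le p
    have b1 := hc.vS.trans (mul_le_mul_of_nonneg_left hG hKN)
    have a1 := hV' p hp
    calc _ ≤ t⁻¹ * majV q p * (K * N * majG q t p) := by gcongr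
      _ ≤ 222 * (t⁻¹ * (1 + R⁻¹)) * majV q p * (K * N * majG q t p) := by gcongr
      _ = _ := by unfold maj; ring
  · intro p hp
    have hV := one_le_majV hq p
    have hG0 := majG_nonneg hq ht.le p
    calc _ = 1 / ‖posXt q t p‖ * (‖errX q t p‖ * (1 / wW q p ^ 24)) := by ring
      _ ≤ t⁻¹ * majV q p * (222 * majG q t p) := by
        have := hV' p hp; have := hE p hp; have := wW_nonneg q p
        gcongr
      _ = 222 * t⁻¹ * maj q t p := by unfold maj; ring
      -- The term with `errX` falls on the derivative of the cutoff and gains no factor `R`; the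
      -- summand `R⁻¹` in the constant accounts for this.
      _ ≤ R * (222 * (t⁻¹ * (1 + R⁻¹))) * maj q t p := by
        have := maj_nonneg hq ht.le p
        refine mul_le_mul_of_nonneg_right ?_ this
        have e : R * (222 * (t⁻¹ * (1 + R⁻¹))) = 222 * t⁻¹ * R + 222 * t⁻¹ := by field_simp
        rw [e]
        have : 0 ≤ 222 * t⁻¹ * R := by positivity
        linarith
  · intro p hp
    have hV := one_le_majV hq p
    have hG0 := majG_nonneg hq ht.le p
    calc _ = 1 / ‖posXt q t p‖ * (‖errX q t p‖ / ‖posXt q t p‖ * (1 / wW q p ^ 24)) := by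
          rw [sq]; ring
      _ ≤ t⁻¹ * majV q p * (222 * majG q t p) := by
        have := hV' p hp; have := hE2 p hp; have := wW_nonneg q p
        gcongr
      _ = 222 * (t⁻¹ * (1 + 0)) * maj q t p := by unfold maj; ring
      _ ≤ _ := by have := maj_nonneg hq ht.le p; gcongr

/-- Integration by parts along `flowS` for the effective position. -/
theorem ScaleData.abs_integral_smul_le_flowS (D : ScaleData q φ γ C K N) (ht : 0 < t) (j k : Fin 3)
    {y : E3} {R : ℝ} (hR : 0 < R) {s : Set Phase} (hs : Integrable (s.indicator (maj q t)))
    (hYs : ∀ p ∈ phaseSpace, ‖y - t • p.2‖ < 3 * R → p ∈ s) :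
    |∫ p, pd j (pd k φ) (R⁻¹ • (y - t • p.2)) * γ p ^ 2|
      ≤ R * (31 * (C * (t⁻¹ * K * N)) * ∫ p, s.indicator (maj q t) p) := by
  have hq := D.hq
  have hKN : 0 ≤ K * N := mul_nonneg (by linarith [D.one_le]) D.nonneg
  have hti : 0 < t⁻¹ := inv_pos.2 ht
  refine D.abs_integral_le ht.le isScalingFlow_flowS (by fun_prop) (E := fun _ => 0)
    measurable_const continuous_vecS hasDerivAt_flowS (β := 1) (by norm_num) (by norm_num) j k
    (fun p hp => smul_ne_zero ht.ne' hp) (fun p hp => hasDerivAt_smul_flowS t p)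
    (fun i hi p hp => hasDerivAt_smul_flowR t i j p) hR hs hYs hti ?_ ?_ ?_ ?_
  · exact fun p hp => one_div_norm_smul_le hq ht hp
  · intro p hp hc
    have hV := one_le_majV hq p
    have hG := div_pow_le_majG hq ht.le p
    have hG0 := majG_nonneg hq ht.le p
    have b1 := hc.vS.trans (mul_le_mul_of_nonneg_left hG hKN)
    have a1 := one_div_norm_smul_le hq ht hp
    calc _ ≤ t⁻¹ * majV q p * (K * N * majG q t p) := by gcongr
      _ = _ := by unfold maj; ring
  · intro p hp
    have := maj_nonneg hq ht.le p
    simp; positivity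
  · intro p hp
    have := maj_nonneg hq ht.le p
    simp; positivity

/-! ### Fixed-scale estimates without integration by parts -/

theorem aestronglyMeasurable_of_contDiffOn {γ : Phase → ℝ} (hγ : ContDiffOn ℝ 1 γ phaseSpace) :
    AEStronglyMeasurable γ volume := by
  refine (measurable_indicator_of_continuousOn hγ.continuousOn).aestronglyMeasurable.congr ?_
  filter_upwards [ae_mem_phaseSpace] with p hp using indicator_of_mem hp _

variable {q t : ℝ} {φ : E3 → ℝ} {γ : Phase → ℝ} {C K N : ℝ}

namespace CutoffBound

theorem abs_pd_le (hC : CutoffBound φ C) (j k : Fin 3) (x : E3) : |pd j (pd k φ) x| ≤ C := by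
  have h := (fderiv ℝ (pd k φ) x).le_opNorm (EuclideanSpace.single j 1)
  have e : ‖(EuclideanSpace.single j 1 : E3)‖ = 1 := by simp
  rw [e, mul_one] at h
  exact h.trans (hC.b2 k x)

theorem pd_eq_zero (hC : CutoffBound φ C) (j k : Fin 3) {x : E3} (hx : 3 ≤ ‖x‖) : pd j (pd k φ) x = 0 := by
  rw [pd, hC.z2 k x hx]; simp

theorem continuous_pd_pd (hC : CutoffBound φ C) (j k : Fin 3) : Continuous (pd j (pd k φ)) :=
  (contDiff_pd (hC.smooth k) j).continuous

theorem abs_pd_sub_le (hC : CutoffBound φ C) (j k : Fin 3) (x z : E3) :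
    |pd j (pd k φ) x - pd j (pd k φ) z| ≤ C * ‖x - z‖ := by
  have h := Convex.norm_image_sub_le_of_norm_fderiv_le (f := pd j (pd k φ)) (C := C) (s := univ)
    (x := z) (y := x) (fun w _ => ((contDiff_pd (hC.smooth k) j).differentiable (by simp)).differentiableAt)
    (fun w _ => hC.b3 j k w) convex_univ (mem_univ _) (mem_univ _)
  exact h

end CutoffBound

theorem three_le_norm_smul {R : ℝ} (hR : 0 < R) {x : E3} (hx : 3 * R ≤ ‖x‖) : 3 ≤ ‖R⁻¹ • x‖ := by
  rwa [norm_smul, Real.norm_eq_abs, abs_of_pos (inv_pos.2 hR), ← div_eq_inv_mul, le_div_iff₀ hR]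

namespace ScaleData

theorem sq_le_maj (D : ScaleData q φ γ C K N) (ht : 0 ≤ t) {p : Phase} (h : IsControlled q N K γ p) :
    γ p ^ 2 ≤ N * maj q t p := by
  have h1 : γ p ^ 2 ≤ N * (1 / wW q p ^ 24) := by rw [mul_one_div]; exact h.sq
  exact h1.trans (mul_le_mul_of_nonneg_left
    ((one_div_pow_le_majG D.hq ht p).trans (majG_le_maj D.hq ht p)) D.nonneg)

/-- The second summand of `majG` carries the factors `c`, `S²` and `tauD` needed to absorb one power
of the displacement. -/
theorem disp_mul_sq_le (D : ScaleData q φ γ C K N) (ht : 0 ≤ t) {p : Phase} (hp : p ∈ phaseSpace)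
    (h : IsControlled q N K γ p) : disp q t p * γ p ^ 2 ≤ 62 * N * maj q t p := by
  have hq := D.hq
  have hN := D.nonneg
  have hc := scl_nonneg hq p
  have hS := one_le_wS hq p
  have hτ := one_le_tauD hq ht p
  have ha := act_nonneg p
  have hl := lam_nonneg p
  have hW := wW_nonneg q p
  have hd := disp_le hq ht hp
  have h1 : γ p ^ 2 ≤ N * (1 / wW q p ^ 24) := by rw [mul_one_div]; exact h.sq
  have h2 : 0 ≤ (1 + act p + lam p) / wW q p ^ 12 := by positivity
  have h3 : scl q p * wS q p * tauD q t p * (1 / wW q p ^ 24) ≤ majG q t p := by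
    have h4 : scl q p * wS q p * tauD q t p * (1 / wW q p ^ 24)
        ≤ (1 + scl q p) * wS q p ^ 2 * tauD q t p / wW q p ^ 24 := by
      rw [← mul_one_div ((1 + scl q p) * wS q p ^ 2 * tauD q t p)]
      gcongr
      · linarith
      · exact le_self_pow₀ hS (by norm_num)
    unfold majG; linarith
  have hd0 := disp_nonneg q t p
  calc disp q t p * γ p ^ 2 ≤ 62 * (scl q p * wS q p) * tauD q t p * (N * (1 / wW q p ^ 24)) := by gcongr
    _ = 62 * N * (scl q p * wS q p * tauD q t p * (1 / wW q p ^ 24)) := by ring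
    _ ≤ 62 * N * maj q t p := by
      have := h3.trans (majG_le_maj hq ht p)
      gcongr

/-- Integrability of the density at a fixed scale. -/
theorem integrable_pd (D : ScaleData q φ γ C K N) (ht : 0 ≤ t) (j k : Fin 3) {Y : Phase → E3}
    (hY : Measurable Y) {y : E3} {R : ℝ} (hR : 0 < R) {s : Set Phase}
    (hs : Integrable (s.indicator (maj q t)))
    (hYs : ∀ p ∈ phaseSpace, ‖y - Y p‖ < 3 * R → p ∈ s) :
    Integrable (fun p => pd j (pd k φ) (R⁻¹ • (y - Y p)) * γ p ^ 2) ∧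
    |∫ p, pd j (pd k φ) (R⁻¹ • (y - Y p)) * γ p ^ 2| ≤ C * N * ∫ p, s.indicator (maj q t) p := by
  have hm : AEStronglyMeasurable (fun p => pd j (pd k φ) (R⁻¹ • (y - Y p)) * γ p ^ 2) volume := by
    refine AEStronglyMeasurable.mul ?_ ((aestronglyMeasurable_of_contDiffOn D.smooth).pow 2)
    exact ((D.cut.continuous_pd_pd j k).measurable.comp (by fun_prop)).aestronglyMeasurable
  have hC0 : 0 ≤ C := by linarith [D.cut.one_le]
  have hle : ∀ᵐ p, ‖pd j (pd k φ) (R⁻¹ • (y - Y p)) * γ p ^ 2‖ ≤ C * N * s.indicator (maj q t) p := by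
    filter_upwards [D.ctl] with p ⟨hp, hc⟩
    rw [Real.norm_eq_abs, abs_mul, abs_of_nonneg (sq_nonneg (γ p))]
    by_cases h : p ∈ s
    · rw [indicator_of_mem h, mul_assoc]
      have := D.cut.abs_pd_le j k (R⁻¹ • (y - Y p))
      have := D.sq_le_maj ht hc
      gcongr
    · rw [D.cut.pd_eq_zero j k (three_le_norm_smul hR
        (by by_contra hlt; exact h (hYs p hp (not_le.1 hlt)))), indicator_of_notMem h]
      simp
  refine ⟨(hs.const_mul (C * N)).mono' hm hle, ?_⟩
  rw [← integral_const_mul]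
  exact norm_integral_le_of_norm_le (hs.const_mul (C * N)) hle

/-- Comparison of the exact and the effective density at a fixed large scale. -/
theorem abs_integral_sub_le (D : ScaleData q φ γ C K N) (ht : 0 ≤ t) (j k : Fin 3) {y : E3} {R : ℝ}
    (hR : 0 < R) {s : Set Phase} (hs : Integrable (s.indicator (maj q t)))
    (hYs : ∀ p ∈ phaseSpace, ‖y - posXt q t p‖ < 3 * R → p ∈ s)
    (hZs : ∀ p ∈ phaseSpace, ‖y - t • p.2‖ < 3 * R → p ∈ s) :
    |(∫ p, pd j (pd k φ) (R⁻¹ • (y - posXt q t p)) * γ p ^ 2)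
      - ∫ p, pd j (pd k φ) (R⁻¹ • (y - t • p.2)) * γ p ^ 2|
      ≤ R⁻¹ * (62 * C * N) * ∫ p, s.indicator (maj q t) p := by
  have hC0 : 0 ≤ C := by linarith [D.cut.one_le]
  have hRi : 0 < R⁻¹ := inv_pos.2 hR
  have i1 := (D.integrable_pd ht j k (measurable_posXt q t) hR hs hYs).1
  have i2 := (D.integrable_pd ht j k (Y := fun p => t • p.2) (by fun_prop) hR hs hZs).1
  rw [← integral_sub i1 i2, ← integral_const_mul, ← Real.norm_eq_abs]
  refine norm_integral_le_of_norm_le (hs.const_mul _) ?_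
  filter_upwards [D.ctl] with p ⟨hp, hc⟩
  rw [Real.norm_eq_abs, ← sub_mul, abs_mul, abs_of_nonneg (sq_nonneg (γ p))]
  by_cases h : p ∈ s
  · rw [indicator_of_mem h]
    have h1 := D.cut.abs_pd_sub_le j k (R⁻¹ • (y - posXt q t p)) (R⁻¹ • (y - t • p.2))
    have e : ‖R⁻¹ • (y - posXt q t p) - R⁻¹ • (y - t • p.2)‖ = R⁻¹ * disp q t p := by
      rw [← smul_sub, sub_sub_sub_cancel_left, norm_smul, Real.norm_eq_abs, abs_of_pos hRi, norm_sub_rev, disp]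
    rw [e] at h1
    have h2 := D.disp_mul_sq_le ht hp hc
    calc _ ≤ C * (R⁻¹ * disp q t p) * γ p ^ 2 := by gcongr
      _ = C * R⁻¹ * (disp q t p * γ p ^ 2) := by ring
      _ ≤ C * R⁻¹ * (62 * N * maj q t p) := by gcongr
      _ = _ := by ring
  · have h1 : 3 * R ≤ ‖y - posXt q t p‖ := by by_contra hlt; exact h (hYs p hp (not_le.1 hlt))
    have h2 : 3 * R ≤ ‖y - t • p.2‖ := by by_contra hlt; exact h (hZs p hp (not_le.1 hlt))
    rw [D.cut.pd_eq_zero j k (three_le_norm_smul hR h1), D.cut.pd_eq_zero j k (three_le_norm_smul hR h2),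
      indicator_of_notMem h]
    simp

end ScaleData

/-- The displacement is added to a radius `3R`, and for `R ≥ 1` the sum is below `3R(1 + disp)`. For
small `R` this inclusion fails, which is why `nearSet` is needed. -/
theorem mem_farSet_of_posXt {y : E3} {R : ℝ} (hR : 1 ≤ R) {p : Phase} (h : ‖y - posXt q t p‖ < 3 * R) :
    p ∈ farSet q t y R := by
  have h1 := norm_sub_smul_le q t y p
  have h2 := disp_nonneg q t p
  have h3 : ‖y - t • p.2‖ < 3 * R * (1 + disp q t p) := by nlinarith
  exact h3

theorem mem_farSet_of_smul {y : E3} {R : ℝ} (hR : 0 < R) {p : Phase} (h : ‖y - t • p.2‖ < 3 * R) :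
    p ∈ farSet q t y R := by
  have h2 := disp_nonneg q t p
  have h3 : ‖y - t • p.2‖ < 3 * R * (1 + disp q t p) := by nlinarith
  exact h3

/-- The factor `R` gained by integrating by parts reduces the prefactor `R⁻³` to `R⁻²`, leaving `√R`
against the near volume `R^(5/2)` and `R` against the far volume `R³`. -/
theorem mul_abs_scale_le {L I c X m R : ℝ} (hL : 0 ≤ L) (hc : 0 ≤ c) (hR : 0 < R)
    (h : |m| ≤ R * (c * I)) (hI : L * I ≤ X) : L * |-(R ^ 3)⁻¹ * m| ≤ (R ^ 2)⁻¹ * (c * X) := by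
  have hi : 0 < (R ^ 3)⁻¹ := by positivity
  rw [abs_mul, abs_neg, abs_of_pos hi]
  calc L * ((R ^ 3)⁻¹ * |m|) ≤ L * ((R ^ 3)⁻¹ * (R * (c * I))) := by gcongr
    _ = (R ^ 2)⁻¹ * (c * (L * I)) := by field_simp
    _ ≤ _ := by gcongr

/-- The six bounds at a fixed scale. -/
structure ScaleBounds (q t : ℝ) (φ : E3 → ℝ) (γ : Phase → ℝ) (j k : Fin 3) (y : E3) (A : ℝ) : Prop where
  small : ∀ R, 0 < R → R ≤ 1 → cubicWeight t y * |scaleF φ q t γ j k y R| ≤ A * √R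
  small_decay : ∀ R, 0 < R → R ≤ 1 → cubicWeight t y * |scaleF φ q t γ j k y R| ≤ A * (t⁻¹ / √R)
  large_decay : ∀ R, 1 ≤ R → cubicWeight t y * |scaleF φ q t γ j k y R| ≤ A * (t⁻¹ * R)
  large_sub : ∀ R, 1 ≤ R →
    cubicWeight t y * |scaleF φ q t γ j k y R - effScaleF φ t γ j k y R| ≤ A * R⁻¹
  eff_decay : ∀ R, 0 < R → cubicWeight t y * |effScaleF φ t γ j k y R| ≤ A * (t⁻¹ * R)
  eff : ∀ R, 0 < R → cubicWeight t y * |effScaleF φ t γ j k y R| ≤ A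

/-- `small` uses `flowT`, the decaying bounds use `flowS`, each on the near or far region.
`large_sub` is the Lipschitz bound of the cutoff times the displacement, and `eff` needs only the
size of the density. -/
theorem exists_scaleBounds {q : ℝ} (hq : 0 < q) (C K : ℝ) : ∃ A : ℝ, 0 ≤ A ∧ ∀ (φ : E3 → ℝ) (γ : Phase → ℝ) (N : ℝ),
    ScaleData q φ γ C K N → ∀ t : ℝ, 0 < t → ∀ (j k : Fin 3) (y : E3),
      ScaleBounds q t φ γ j k y (A * (1 + t) ^ (1 / 20 : ℝ) * N) := by
  obtain ⟨Cn, hCn, hn⟩ := exists_near_le hq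
  obtain ⟨Cf, hCf, hf⟩ := exists_far_le hq
  -- `444 = 2 · 222`, because `1 + R⁻¹` in the `flowS` estimate is at most twice the larger of its
  -- terms.
  refine ⟨31 * 444 * |C| * (1 + |K|) * (Cn + Cf), by positivity, fun φ γ N D t ht j k y => ?_⟩
  have hC1 := D.cut.one_le
  have hK1 := D.one_le
  have hN := D.nonneg
  rw [abs_of_nonneg (by linarith : 0 ≤ C), abs_of_nonneg (by linarith : 0 ≤ K)]
  have hL := cubicWeight_pos ht y
  have hti : 0 < t⁻¹ := inv_pos.2 ht
  obtain ⟨T, hT⟩ : ∃ T, T = (1 + t) ^ (1 / 20 : ℝ) := ⟨_, rfl⟩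
  have hT0 : 0 ≤ T := by rw [hT]; positivity
  rw [← hT]
  have final : ∀ {m k' cc x : ℝ}, 0 ≤ x → 0 ≤ cc → m ≤ k' * C * K * cc * T * N * x → 0 ≤ k' → k' ≤ 31 * 444 →
      cc ≤ Cn + Cf → m ≤ 31 * 444 * C * (1 + K) * (Cn + Cf) * T * N * x := by
    intro m k' cc x hx h0 hm hk0 hk hcc
    refine hm.trans ?_
    gcongr
    linarith
  have hfm : ∀ R, 1 ≤ R → ∀ p ∈ phaseSpace, ‖y - posXt q t p‖ < 3 * R → p ∈ farSet q t y R :=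
    fun R hR p _ h => mem_farSet_of_posXt hR h
  have hfe : ∀ R, 0 < R → ∀ p ∈ phaseSpace, ‖y - t • p.2‖ < 3 * R → p ∈ farSet q t y R :=
    fun R hR p _ h => mem_farSet_of_smul hR h
  refine ⟨fun R hR hR1 => ?_, fun R hR hR1 => ?_, fun R hR1 => ?_, fun R hR1 => ?_, fun R hR => ?_, fun R hR => ?_⟩
  · obtain ⟨i1, i2⟩ := hn t ht y R hR hR1
    rw [← hT] at i2
    have h1 := D.abs_integral_posXt_le_flowT ht.le j k (y := y) hR i1 (fun p _ h => h)
    have h2 := mul_abs_scale_le hL.le (by positivity) hR h1 i2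
    refine final (Real.sqrt_nonneg R) hCn (h2.trans (le_of_eq ?_)) (k' := 31 * 4) (by norm_num) (by norm_num) (by linarith)
    field_simp
  · obtain ⟨i1, i2⟩ := hn t ht y R hR hR1
    rw [← hT] at i2
    have hRi : 1 ≤ R⁻¹ := (one_le_inv₀ hR).2 hR1
    have h1 := D.abs_integral_posXt_le_flowS ht j k (y := y) hR i1 (fun p _ h => h)
    have h2 := mul_abs_scale_le hL.le (by positivity) hR h1 i2
    have hs : 0 < √R := Real.sqrt_pos.2 hR
    refine final (by positivity) hCn (h2.trans ?_) (k' := 31 * 444) (by norm_num) (by norm_num) (by linarith)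
    calc _ ≤ (R ^ 2)⁻¹ * (31 * (C * (222 * (t⁻¹ * (R⁻¹ + R⁻¹)) * K * N)) * (Cn * T * (R ^ 2 * √R))) := by
          gcongr
      _ = 31 * 444 * C * K * Cn * T * N * (t⁻¹ * (√R * R⁻¹)) := by field_simp; ring
      _ = _ := by
        congr 2
        have h3 := Real.mul_self_sqrt hR.le
        refine eq_inv_of_mul_eq_one_left ?_
        calc √R * R⁻¹ * √R = √R * √R * R⁻¹ := by ring
          _ = 1 := by rw [h3, mul_inv_cancel₀ hR.ne']
  · have hR : 0 < R := by linarith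
    obtain ⟨i1, i2⟩ := hf t ht y R hR
    rw [← hT] at i2
    have hRi : R⁻¹ ≤ 1 := inv_le_one_of_one_le₀ hR1
    have h1 := D.abs_integral_posXt_le_flowS ht j k (y := y) hR i1 (hfm R hR1)
    have h2 := mul_abs_scale_le hL.le (by positivity) hR h1 i2
    refine final (by positivity) hCf (h2.trans ?_) (k' := 31 * 444) (by norm_num) (by norm_num) (by linarith)
    calc _ ≤ (R ^ 2)⁻¹ * (31 * (C * (222 * (t⁻¹ * (1 + 1)) * K * N)) * (Cf * T * R ^ 3)) := by gcongr
      _ = _ := by field_simp; ring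
  · have hR : 0 < R := by linarith
    obtain ⟨i1, i2⟩ := hf t ht y R hR
    rw [← hT] at i2
    have h1 := D.abs_integral_sub_le ht.le j k (y := y) hR i1 (hfm R hR1) (hfe R hR)
    have h3 : R⁻¹ * (62 * C * N) * ∫ p, (farSet q t y R).indicator (maj q t) p
        = R * (R⁻¹ ^ 2 * (62 * C * N) * ∫ p, (farSet q t y R).indicator (maj q t) p) := by field_simp
    rw [h3] at h1
    have h2 := mul_abs_scale_le hL.le (by positivity) hR h1 i2
    rw [scaleF, effScaleF, ← mul_sub]
    refine final (by positivity) hCf (h2.trans ?_) (k' := 62) (by norm_num) (by norm_num) (by linarith)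
    calc _ = 62 * C * 1 * Cf * T * N * R⁻¹ := by field_simp
      _ ≤ _ := by gcongr
  · obtain ⟨i1, i2⟩ := hf t ht y R hR
    rw [← hT] at i2
    have h1 := D.abs_integral_smul_le_flowS ht j k (y := y) hR i1 (hfe R hR)
    have h2 := mul_abs_scale_le hL.le (by positivity) hR h1 i2
    refine final (by positivity) hCf (h2.trans (le_of_eq ?_)) (k' := 31) (by norm_num) (by norm_num) (by linarith)
    field_simp
  · obtain ⟨i1, i2⟩ := hf t ht y R hR
    rw [← hT] at i2
    have h1 := (D.integrable_pd ht.le j k (Y := fun p => t • p.2) (by fun_prop) (y := y) hR i1 (hfe R hR)).2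
    have h3 : C * N * ∫ p, (farSet q t y R).indicator (maj q t) p
        = R * (R⁻¹ * (C * N) * ∫ p, (farSet q t y R).indicator (maj q t) p) := by field_simp
    rw [h3] at h1
    have h2 := mul_abs_scale_le hL.le (by positivity) hR h1 i2
    rw [← mul_one (31 * 444 * C * (1 + K) * (Cn + Cf) * T * N)]
    refine final zero_le_one hCf (h2.trans ?_) (k' := 1) (by norm_num) (by norm_num) (by linarith)
    calc _ = 1 * C * 1 * Cf * T * N * 1 := by field_simp
      _ ≤ _ := by gcongr

/-! ### Interpolation and integration over the scales -/

theorem le_rpow_mul_rpow {x a b θ : ℝ} (hx : 0 ≤ x) (ha : x ≤ a) (hb : x ≤ b) (h0 : 0 ≤ θ) (h1 : θ ≤ 1) :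
    x ≤ a ^ (1 - θ) * b ^ θ := by
  rcases hx.eq_or_lt with rfl | hx'
  · positivity
  calc x = x ^ (1 - θ) * x ^ θ := by rw [← Real.rpow_add hx']; simp
    _ ≤ _ := by
      have h2 : 0 ≤ 1 - θ := by linarith
      have h3 : 0 ≤ a := hx.trans ha
      gcongr

/-- The profile of the scale integrand. -/
def scaleProfile (R : ℝ) : ℝ := if R ≤ 1 then R ^ (1 / 5 : ℝ) else R ^ (-(1 / 2) : ℝ)

theorem integrableOn_scaleProfile : IntegrableOn (fun R => scaleProfile R / R) (Ioi 0) ∧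
    ∫ R in Ioi (0 : ℝ), scaleProfile R / R ≤ 7 := by
  have e1 : EqOn (fun R : ℝ => R ^ (-(4 / 5) : ℝ)) (fun R => scaleProfile R / R) (Ioc 0 1) := fun R hR => by
    simp only [scaleProfile, if_pos hR.2]
    rw [show (-(4 / 5) : ℝ) = 1 / 5 - 1 by norm_num, Real.rpow_sub_one hR.1.ne']
  have e2 : EqOn (fun R : ℝ => R ^ (-(3 / 2) : ℝ)) (fun R => scaleProfile R / R) (Ioi 1) := fun R hR => by
    have h1 : 1 < R := hR
    simp only [scaleProfile, if_neg (not_le.2 h1)]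
    rw [show (-(3 / 2) : ℝ) = -(1 / 2) - 1 by norm_num, Real.rpow_sub_one (by linarith)]
  have i1 : IntegrableOn (fun R => scaleProfile R / R) (Ioc 0 1) :=
    IntegrableOn.congr_fun (intervalIntegral.intervalIntegrable_rpow' (a := 0) (b := 1) (by norm_num)).1 e1
      measurableSet_Ioc
  have i2 : IntegrableOn (fun R => scaleProfile R / R) (Ioi 1) :=
    IntegrableOn.congr_fun (integrableOn_Ioi_rpow_of_lt (by norm_num) one_pos) e2 measurableSet_Ioi
  have hu : Ioc (0 : ℝ) 1 ∪ Ioi 1 = Ioi 0 := Ioc_union_Ioi_eq_Ioi zero_le_one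
  refine ⟨by rw [← hu]; exact i1.union i2, ?_⟩
  -- The two pieces integrate to `5` and `2`.
  rw [← hu, setIntegral_union (Ioc_disjoint_Ioi le_rfl) measurableSet_Ioi i1 i2,
    ← setIntegral_congr_fun measurableSet_Ioc e1, ← setIntegral_congr_fun measurableSet_Ioi e2,
    integral_Ioi_rpow_of_lt (by norm_num) one_pos, ← intervalIntegral.integral_of_le zero_le_one,
    integral_rpow (Or.inl (by norm_num))]
  norm_num

theorem one_add_rpow_le {t : ℝ} (ht : 0 < t) : (1 + t) ^ (1 / 20 : ℝ) ≤ 2 * max 1 (t ^ (1 / 20 : ℝ)) := by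
  rcases le_total t 1 with h | h
  · calc (1 + t) ^ (1 / 20 : ℝ) ≤ 2 ^ (1 / 20 : ℝ) := Real.rpow_le_rpow (by linarith) (by linarith) (by norm_num)
      _ ≤ 2 ^ (1 : ℝ) := Real.rpow_le_rpow_of_exponent_le (by norm_num) (by norm_num)
      _ = 2 * 1 := by norm_num
      _ ≤ _ := by gcongr; exact le_max_left _ _
  · calc (1 + t) ^ (1 / 20 : ℝ) ≤ (2 * t) ^ (1 / 20 : ℝ) :=
          Real.rpow_le_rpow (by linarith) (by linarith) (by norm_num)
      _ = 2 ^ (1 / 20 : ℝ) * t ^ (1 / 20 : ℝ) := Real.mul_rpow (by norm_num) ht.le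
      _ ≤ 2 ^ (1 : ℝ) * t ^ (1 / 20 : ℝ) := by
        gcongr
        · norm_num
        · norm_num
      _ = 2 * t ^ (1 / 20 : ℝ) := by norm_num
      _ ≤ _ := by gcongr; exact le_max_right _ _

/-- Interpolation of the bounds at a fixed scale. -/
theorem ScaleBounds.abs_sub_le {q t : ℝ} {φ : E3 → ℝ} {γ : Phase → ℝ} {j k : Fin 3} {y : E3} {A N : ℝ} (hA : 0 ≤ A)
    (hN : 0 ≤ N) (ht : 0 < t) (h : ScaleBounds q t φ γ j k y (A * (1 + t) ^ (1 / 20 : ℝ) * N)) {R : ℝ} (hR : 0 < R) :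
    cubicWeight t y * |scaleF φ q t γ j k y R - effScaleF φ t γ j k y R|
      ≤ 6 * A * N * t ^ (-(1 / 5) : ℝ) * scaleProfile R := by
  have hL := cubicWeight_pos ht y
  have hT := one_add_rpow_le ht
  set L := cubicWeight t y
  set T := (1 + t) ^ (1 / 20 : ℝ)
  set F := scaleF φ q t γ j k y R with hF
  set G := effScaleF φ t γ j k y R with hG
  have hT0 : 0 ≤ T := by positivity
  obtain ⟨B, hB⟩ : ∃ B, B = A * T * N := ⟨_, rfl⟩
  have hB0 : 0 ≤ B := by rw [hB]; positivity
  rw [← hB] at h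
  have hti : 0 < t⁻¹ := inv_pos.2 ht
  have tri : L * |F - G| ≤ L * |F| + L * |G| := by
    rw [← mul_add]; exact mul_le_mul_of_nonneg_left (abs_sub _ _) hL.le
  have hX0 : 0 ≤ L * |F| := by positivity
  have hY0 : 0 ≤ L * |G| := by positivity
  have hZ0 : 0 ≤ L * |F - G| := by positivity
  rcases le_total t 1 with ht1 | ht1
  · -- short times
    have hBT : B ≤ 2 * A * N := by
      have h1 : t ^ (1 / 20 : ℝ) ≤ 1 := Real.rpow_le_one ht.le ht1 (by norm_num)
      rw [max_eq_left h1] at hT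
      calc B ≤ A * (2 * 1) * N := by rw [hB]; gcongr
        _ = _ := by ring
    have ht5 : 1 ≤ t ^ (-(1 / 5) : ℝ) := Real.one_le_rpow_of_pos_of_le_one_of_nonpos ht ht1 (by norm_num)
    rcases le_or_gt R 1 with hR1 | hR1
    · rw [scaleProfile, if_pos hR1]
      have g1 : L * |F| ≤ 2 * A * N * (t ^ (-(1 / 5) : ℝ) * R ^ (1 / 5 : ℝ)) := by
        have h1 := h.small R hR hR1
        have h2 : √R ≤ R ^ (1 / 5 : ℝ) := by
          rw [Real.sqrt_eq_rpow]
          exact Real.rpow_le_rpow_of_exponent_ge hR hR1 (by norm_num)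
        calc _ ≤ B * √R := h1
          _ ≤ 2 * A * N * (1 * R ^ (1 / 5 : ℝ)) := by rw [one_mul]; gcongr
          _ ≤ _ := by gcongr
      have g2 : L * |G| ≤ 2 * A * N * (t ^ (-(1 / 5) : ℝ) * R ^ (1 / 5 : ℝ)) := by
        -- For short times the bound with `t⁻¹` must not be used in full. Its fifth root produces
        -- exactly `t^(-1/5)`, together with the power `R^(1/5)` that makes small scales integrable.
        have h1 := le_rpow_mul_rpow (θ := 1 / 5) hY0 (h.eff R hR) (h.eff_decay R hR) (by norm_num) (by norm_num)
        have e : B ^ (1 - 1 / 5 : ℝ) * B ^ (1 / 5 : ℝ) = B := by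
          rcases hB0.eq_or_lt with h0 | h0
          · rw [← h0]; norm_num
          · rw [← Real.rpow_add h0]; norm_num
        rw [Real.mul_rpow hB0 (by positivity), ← mul_assoc, e, Real.mul_rpow hti.le hR.le, Real.inv_rpow ht.le,
          ← Real.rpow_neg ht.le] at h1
        exact h1.trans (by gcongr)
      have : 0 ≤ A * N * (t ^ (-(1 / 5) : ℝ) * R ^ (1 / 5 : ℝ)) := by positivity
      linarith
    · rw [scaleProfile, if_neg (not_le.2 hR1)]
      have h1 := h.large_sub R hR1.le
      have h2 : R⁻¹ ≤ R ^ (-(1 / 2) : ℝ) := by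
        rw [← Real.rpow_neg_one]
        exact Real.rpow_le_rpow_of_exponent_le hR1.le (by norm_num)
      calc _ ≤ B * R⁻¹ := h1
        _ ≤ 2 * A * N * (1 * R ^ (-(1 / 2) : ℝ)) := by rw [one_mul]; gcongr
        _ ≤ 2 * A * N * (t ^ (-(1 / 5) : ℝ) * R ^ (-(1 / 2) : ℝ)) := by gcongr
        _ ≤ _ := by
          have : 0 ≤ A * N * (t ^ (-(1 / 5) : ℝ) * R ^ (-(1 / 2) : ℝ)) := by positivity
          linarith
  · -- long times
    -- The interpolations below gain `t^(-1/4)`, and the growth `(1 + t)^(1/20)` contained in `B`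
    -- leaves `t^(-1/5)`.
    have hBT : B * t ^ (-(1 / 4) : ℝ) ≤ 2 * A * N * t ^ (-(1 / 5) : ℝ) := by
      rw [max_eq_right (Real.one_le_rpow ht1 (by norm_num))] at hT
      calc B * t ^ (-(1 / 4) : ℝ) ≤ A * (2 * t ^ (1 / 20 : ℝ)) * N * t ^ (-(1 / 4) : ℝ) := by rw [hB]; gcongr
        _ = 2 * A * N * (t ^ (1 / 20 : ℝ) * t ^ (-(1 / 4) : ℝ)) := by ring
        _ = _ := by rw [← Real.rpow_add ht]; norm_num
    rcases le_or_gt R 1 with hR1 | hR1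
    · rw [scaleProfile, if_pos hR1]
      have hr : R ^ (1 / 4 : ℝ) ≤ R ^ (1 / 5 : ℝ) := Real.rpow_le_rpow_of_exponent_ge hR hR1 (by norm_num)
      have g1 : L * |F| ≤ 2 * A * N * t ^ (-(1 / 5) : ℝ) * R ^ (1 / 5 : ℝ) := by
        -- Three parts `√R` and one part `t⁻¹/√R` combine to `t^(-1/4) R^(1/4)`, still integrable
        -- against `dR/R` at zero.
        have h1 := le_rpow_mul_rpow (θ := 1 / 4) hX0 (h.small R hR hR1) (h.small_decay R hR hR1)
          (by norm_num) (by norm_num)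
        have e : (B * √R) ^ (1 - 1 / 4 : ℝ) * (B * (t⁻¹ / √R)) ^ (1 / 4 : ℝ)
            = B * t ^ (-(1 / 4) : ℝ) * R ^ (1 / 4 : ℝ) := by
          rcases hB0.eq_or_lt with h0 | h0
          · rw [← h0]; norm_num
          · have e1 : t⁻¹ / √R = t⁻¹ * R ^ (-(1 / 2) : ℝ) := by
              rw [Real.rpow_neg hR.le, ← Real.sqrt_eq_rpow, div_eq_mul_inv]
            rw [e1, Real.sqrt_eq_rpow, Real.mul_rpow hB0 (by positivity), Real.mul_rpow hB0 (by positivity),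
              Real.mul_rpow hti.le (by positivity), Real.inv_rpow ht.le, ← Real.rpow_neg ht.le, ← Real.rpow_mul hR.le,
              ← Real.rpow_mul hR.le]
            calc _ = (B ^ (1 - 1 / 4 : ℝ) * B ^ (1 / 4 : ℝ)) * t ^ (-(1 / 4) : ℝ)
                  * (R ^ (1 / 2 * (1 - 1 / 4) : ℝ) * R ^ (-(1 / 2) * (1 / 4) : ℝ)) := by ring
              _ = _ := by rw [← Real.rpow_add h0, ← Real.rpow_add hR]; norm_num
        rw [e] at h1
        exact h1.trans (by gcongr)
      have g2 : L * |G| ≤ 2 * A * N * t ^ (-(1 / 5) : ℝ) * R ^ (1 / 5 : ℝ) := by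
        refine (h.eff_decay R hR).trans ?_
        have h2 : R ≤ R ^ (1 / 5 : ℝ) := by
          calc R = R ^ (1 : ℝ) := (Real.rpow_one R).symm
            _ ≤ _ := Real.rpow_le_rpow_of_exponent_ge hR hR1 (by norm_num)
        have h3 : t⁻¹ ≤ t ^ (-(1 / 4) : ℝ) := by
          rw [← Real.rpow_neg_one]
          exact Real.rpow_le_rpow_of_exponent_le ht1 (by norm_num)
        calc B * (t⁻¹ * R) ≤ B * (t ^ (-(1 / 4) : ℝ) * R ^ (1 / 5 : ℝ)) := by gcongr
          _ = B * t ^ (-(1 / 4) : ℝ) * R ^ (1 / 5 : ℝ) := by ring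
          _ ≤ _ := by gcongr
      have : 0 ≤ A * N * t ^ (-(1 / 5) : ℝ) * R ^ (1 / 5 : ℝ) := by positivity
      linarith
    · rw [scaleProfile, if_neg (not_le.2 hR1)]
      have hb : L * |F - G| ≤ B * (2 * (t⁻¹ * R)) := by
        have := h.large_decay R hR1.le; have := h.eff_decay R hR
        linarith
      -- Three parts `R⁻¹` and one part `t⁻¹ R` combine to `t^(-1/4) R^(-1/2)`, integrable against
      -- `dR/R` at infinity.
      have h1 := le_rpow_mul_rpow (θ := 1 / 4) hZ0 (h.large_sub R hR1.le) hb (by norm_num) (by norm_num)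
      have e : (B * R⁻¹) ^ (1 - 1 / 4 : ℝ) * (B * (2 * (t⁻¹ * R))) ^ (1 / 4 : ℝ)
          = 2 ^ (1 / 4 : ℝ) * (B * t ^ (-(1 / 4) : ℝ)) * R ^ (-(1 / 2) : ℝ) := by
        rcases hB0.eq_or_lt with h0 | h0
        · rw [← h0]; norm_num
        · rw [← Real.rpow_neg_one R, Real.mul_rpow hB0 (by positivity), Real.mul_rpow hB0 (by positivity),
            Real.mul_rpow (by norm_num) (by positivity), Real.mul_rpow hti.le hR.le, Real.inv_rpow ht.le,
            ← Real.rpow_neg ht.le, ← Real.rpow_mul hR.le]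
          calc _ = 2 ^ (1 / 4 : ℝ) * ((B ^ (1 - 1 / 4 : ℝ) * B ^ (1 / 4 : ℝ)) * t ^ (-(1 / 4) : ℝ))
                * (R ^ (-1 * (1 - 1 / 4) : ℝ) * R ^ (1 / 4 : ℝ)) := by ring
            _ = _ := by rw [← Real.rpow_add h0, ← Real.rpow_add hR]; norm_num
      rw [e] at h1
      have h2 : (2 : ℝ) ^ (1 / 4 : ℝ) ≤ 2 := by
        calc (2 : ℝ) ^ (1 / 4 : ℝ) ≤ 2 ^ (1 : ℝ) := Real.rpow_le_rpow_of_exponent_le (by norm_num) (by norm_num)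
          _ = 2 := Real.rpow_one 2
      calc _ ≤ _ := h1
        _ ≤ 2 * (2 * A * N * t ^ (-(1 / 5) : ℝ)) * R ^ (-(1 / 2) : ℝ) := by gcongr
        _ ≤ _ := by
          have : 0 ≤ A * N * t ^ (-(1 / 5) : ℝ) * R ^ (-(1 / 2) : ℝ) := by positivity
          linarith

/-- The weight in the `L²` half of `N₁` is bounded below because `ξ a = q`, so `γ` itself is square
integrable. -/
theorem integrable_sq_of_normN1 {q : ℝ} (hq : 0 < q) {γ : Phase → ℝ} (hγ : AEStronglyMeasurable γ volume)
    (h : normN1 q γ ≠ ⊤) : Integrable (fun p => γ p ^ 2) := by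
  have h1 : eLpNorm (fun p => (xi q p ^ 2 + act p ^ 3 + |eta q p| ^ 2 + lam p) * γ p) 2 volume < ⊤ := by
    have h2 : eLpNorm (fun p => (xi q p ^ 2 + act p ^ 3 + |eta q p| ^ 2 + lam p) * γ p) 2 volume ^ 2 ≠ ⊤ :=
      ne_top_of_le_ne_top h (le_add_right le_rfl)
    exact lt_top_iff_ne_top.2 fun h3 => h2 (by rw [h3]; simp)
  have hm : AEStronglyMeasurable (fun p => (xi q p ^ 2 + act p ^ 3 + |eta q p| ^ 2 + lam p) * γ p) volume := by
    refine AEStronglyMeasurable.mul (Measurable.aestronglyMeasurable ?_) hγ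
    have := measurable_eta q; have := measurable_xi q; have := measurable_act; have := measurable_lam
    fun_prop
  set m := min 1 (q ^ 2) with hmd
  have hm0 : 0 < m := by positivity
  have hLp : MemLp γ 2 volume := by
    refine MemLp.of_le_mul (c := m⁻¹) ⟨hm, h1⟩ hγ ?_
    filter_upwards [ae_mem_phaseSpace] with p hp
    have ha := act_pos hp
    have hx := xi_pos hq hp
    have hl := lam_nonneg p
    have hxa : xi q p * act p = q := div_mul_cancel₀ _ ha.ne'
    have hw : m ≤ xi q p ^ 2 + act p ^ 3 + |eta q p| ^ 2 + lam p := by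
      have h0 := sq_nonneg |eta q p|
      rcases le_total (act p) 1 with h3 | h3
      · have h4 : q ≤ xi q p := by exact hxa.symm.trans_le (mul_le_of_le_one_right hx.le h3)
        have h5 : q ^ 2 ≤ xi q p ^ 2 := pow_le_pow_left₀ hq.le h4 2
        have h6 : 0 ≤ act p ^ 3 := by positivity
        have h7 : m ≤ q ^ 2 := min_le_right _ _
        linarith
      · have h5 : 1 ≤ act p ^ 3 := one_le_pow₀ h3
        have h6 : 0 ≤ xi q p ^ 2 := by positivity
        have h7 : m ≤ 1 := min_le_left _ _
        linarith
    rw [norm_mul, ← div_eq_inv_mul, le_div_iff₀ hm0, mul_comm, Real.norm_of_nonneg (hm0.le.trans hw)]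
    gcongr
  exact hLp.integrable_sq

/-! ### Convergence of the scale integrals, dominated independently of `y` -/

namespace ScaleData

variable {q t : ℝ} {φ : E3 → ℝ} {γ : Phase → ℝ} {C K N : ℝ}

theorem abs_integral_le_integral_sq (D : ScaleData q φ γ C K N) (hi : Integrable (fun p => γ p ^ 2))
    (j k : Fin 3) (f : Phase → E3) :
    |∫ p, pd j (pd k φ) (f p) * γ p ^ 2| ≤ C * ∫ p, γ p ^ 2 := by
  rw [← integral_const_mul, ← Real.norm_eq_abs]
  refine norm_integral_le_of_norm_le (hi.const_mul _) (Filter.Eventually.of_forall fun p => ?_)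
  rw [Real.norm_eq_abs, abs_mul, abs_of_nonneg (sq_nonneg (γ p))]
  have := D.cut.abs_pd_le j k (f p)
  gcongr

/-- A majorant, integrable over the scales. -/
def scaleMaj (b c : ℝ) (R : ℝ) : ℝ := if R ≤ 1 then b * R ^ (-(1 / 2) : ℝ) else c * R ^ (-4 : ℝ)

theorem integrableOn_scaleMaj (b c : ℝ) : IntegrableOn (scaleMaj b c) (Ioi 0) := by
  have e1 : EqOn (fun R : ℝ => b * R ^ (-(1 / 2) : ℝ)) (scaleMaj b c) (Ioc 0 1) := fun R hR => by
    simp only [scaleMaj, if_pos hR.2]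
  have e2 : EqOn (fun R : ℝ => c * R ^ (-4 : ℝ)) (scaleMaj b c) (Ioi 1) := fun R hR => by
    simp only [scaleMaj, if_neg (not_le.2 (show 1 < R from hR))]
  rw [← (Ioc_union_Ioi_eq_Ioi zero_le_one : Ioc (0 : ℝ) 1 ∪ Ioi 1 = Ioi 0)]
  exact (IntegrableOn.congr_fun ((intervalIntegral.intervalIntegrable_rpow' (a := 0) (b := 1)
    (by norm_num)).1.const_mul b) e1 measurableSet_Ioc).union
    (IntegrableOn.congr_fun ((integrableOn_Ioi_rpow_of_lt (by norm_num) one_pos).const_mul c) e2 measurableSet_Ioi)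

theorem abs_div_le_scaleMaj (D : ScaleData q φ γ C K N) (hi : Integrable (fun p => γ p ^ 2)) (j k : Fin 3)
    {Y : Phase → E3} {y : E3} {b R : ℝ} (hR : 0 < R)
    (h : R ≤ 1 → |-(R ^ 3)⁻¹ * ∫ p, pd j (pd k φ) (R⁻¹ • (y - Y p)) * γ p ^ 2| ≤ b * √R) :
    |(-(R ^ 3)⁻¹ * ∫ p, pd j (pd k φ) (R⁻¹ • (y - Y p)) * γ p ^ 2) / R|
      ≤ scaleMaj b (C * ∫ p, γ p ^ 2) R := by
  rw [abs_div, abs_of_pos hR, div_le_iff₀ hR, scaleMaj]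
  split_ifs with hR1
  · refine (h hR1).trans (le_of_eq ?_)
    rw [mul_assoc, Real.sqrt_eq_rpow]
    congr 1
    rw [← Real.rpow_add_one hR.ne']; norm_num
  · rw [abs_mul, abs_neg, abs_of_pos (by positivity), show (-4 : ℝ) = -((4 : ℕ) : ℝ) by norm_num,
      Real.rpow_neg hR.le, Real.rpow_natCast]
    have := D.abs_integral_le_integral_sq hi j k (fun p => R⁻¹ • (y - Y p))
    calc _ ≤ (R ^ 3)⁻¹ * (C * ∫ p, γ p ^ 2) := by gcongr
      _ = _ := by field_simp

theorem aestronglyMeasurable_scale (D : ScaleData q φ γ C K N) (j k : Fin 3) {Y : Phase → E3}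
    (hY : Measurable Y) (y : E3) : AEStronglyMeasurable
      (fun R : ℝ => (-(R ^ 3)⁻¹ * ∫ p, pd j (pd k φ) (R⁻¹ • (y - Y p)) * γ p ^ 2) / R)
      (volume.restrict (Ioi 0)) := by
  have e : ∀ R : ℝ, ∫ p, pd j (pd k φ) (R⁻¹ • (y - Y p)) * γ p ^ 2
      = ∫ p, pd j (pd k φ) (R⁻¹ • (y - Y p)) * phaseSpace.indicator γ p ^ 2 := fun R => by
    refine integral_congr_ae ?_
    filter_upwards [ae_mem_phaseSpace] with p hp
    rw [indicator_of_mem hp]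
  simp_rw [e]
  have hg := measurable_indicator_of_continuousOn D.smooth.continuousOn
  have hc := (D.cut.continuous_pd_pd j k).measurable
  have hm : StronglyMeasurable fun x : ℝ × Phase =>
      pd j (pd k φ) (x.1⁻¹ • (y - Y x.2)) * phaseSpace.indicator γ x.2 ^ 2 :=
    Measurable.stronglyMeasurable (by fun_prop)
  have := hm.integral_prod_right' (ν := (volume : Measure Phase))
  have hm2 := this.measurable
  exact Measurable.aestronglyMeasurable (by fun_prop)

end ScaleData

/-- The constants `b` and `c` depend on `t` and `γ` but not on `y`: this uniform domination is what
later permits differentiation in `y`. Small scales are dominated by `√R`, large ones by `R⁻³` and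
the `L²` norm. -/
theorem exists_scale_integral_le {q : ℝ} (hq : 0 < q) {φ : E3 → ℝ} (hφ : IsStandardCutoff φ) :
    ∃ A : ℝ, 0 ≤ A ∧ ∀ t : ℝ, 0 < t → ∀ γ : Phase → ℝ, ContDiffOn ℝ 1 γ phaseSpace → normN2 q γ ≠ ⊤ →
      ∃ b c : ℝ, ∀ (y : E3) (j k : Fin 3),
        (∀ R, 0 < R → |scaleF φ q t γ j k y R / R| ≤ ScaleData.scaleMaj b c R) ∧
        IntegrableOn (fun R : ℝ => scaleF φ q t γ j k y R / R) (Ioi 0) volume ∧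
        IntegrableOn (fun R : ℝ => effScaleF φ t γ j k y R / R) (Ioi 0) volume ∧
        (t ^ 2 + ‖y‖ ^ 2) ^ (3 / 2 : ℝ) * |fieldF φ q t γ j k y - effF φ t γ j k y|
          ≤ A * t ^ (-(1 / 5) : ℝ) * (normN2 q γ).toReal := by
  obtain ⟨C, hC⟩ := exists_cutoffBound hφ
  obtain ⟨A, hA, hb⟩ := exists_scaleBounds hq C (1 + q + 1 / q)
  -- `6` from the interpolated bound at each scale times `7` from the integral of the profile.
  refine ⟨42 * A, by positivity, fun t ht γ hγ hN => ?_⟩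
  set N := (normN2 q γ).toReal with hNd
  have hN0 : 0 ≤ N := ENNReal.toReal_nonneg
  have hiq : 0 < 1 / q := by positivity
  have D : ScaleData q φ γ C (1 + q + 1 / q) N := ⟨hq, hC, hγ, by linarith, hN0, ae_isControlled hq hγ hN⟩
  have hN1 : normN1 q γ ≠ ⊤ := ne_top_of_le_ne_top hN (by
    unfold normN2; rw [add_assoc]; exact le_add_right le_rfl)
  have hi := integrable_sq_of_normN1 hq (aestronglyMeasurable_of_contDiffOn hγ) hN1
  obtain ⟨B, hB⟩ : ∃ B, B = A * (1 + t) ^ (1 / 20 : ℝ) * N := ⟨_, rfl⟩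
  have hB0 : 0 ≤ B := by rw [hB]; positivity
  refine ⟨B * (1 + t⁻¹) / t ^ 3, C * ∫ p, γ p ^ 2, fun y j k => ?_⟩
  have hS := hb φ γ N D t ht j k y
  have hL := cubicWeight_pos ht y
  -- Dividing by `t³` instead of the full decay weight removes the dependence on `y`.
  have hLt : t ^ 3 ≤ cubicWeight t y := by
    unfold cubicWeight
    calc t ^ 3 = (t ^ 2) ^ (3 / 2 : ℝ) := by
          rw [← Real.rpow_natCast t 2, ← Real.rpow_mul ht.le, ← Real.rpow_natCast t 3]; norm_num
      _ ≤ _ := Real.rpow_le_rpow (by positivity) (by nlinarith [sq_nonneg ‖y‖]) (by norm_num)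
  have hti : 0 < t⁻¹ := inv_pos.2 ht
  have conv : ∀ {x z : ℝ}, 0 ≤ x → 0 ≤ z → cubicWeight t y * x ≤ B * (1 + t⁻¹) * z →
      x ≤ B * (1 + t⁻¹) / t ^ 3 * z := fun {x z} hx hz h => by
    rw [div_mul_eq_mul_div, le_div_iff₀ (by positivity), mul_comm]
    exact (mul_le_mul_of_nonneg_right hLt hx).trans h
  have hx0 : ∀ R, 0 < R → R ≤ 1 → |scaleF φ q t γ j k y R| ≤ B * (1 + t⁻¹) / t ^ 3 * √R := fun R hR hR1 => by
    refine conv (abs_nonneg _) (Real.sqrt_nonneg R) ((hS.small R hR hR1).trans ?_)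
    rw [← hB]
    have := Real.sqrt_nonneg R
    gcongr
    nlinarith
  have hx1 : ∀ R, 0 < R → R ≤ 1 → |effScaleF φ t γ j k y R| ≤ B * (1 + t⁻¹) / t ^ 3 * √R := fun R hR hR1 => by
    refine conv (abs_nonneg _) (Real.sqrt_nonneg R) ((hS.eff_decay R hR).trans ?_)
    rw [← hB, mul_assoc]
    have h0 := Real.sqrt_nonneg R
    have h1 : R ≤ √R := by
      have := Real.sq_sqrt hR.le
      have : √R ≤ 1 := Real.sqrt_le_one.2 hR1
      nlinarith
    gcongr
    linarith
  have b0 : ∀ R, 0 < R → |scaleF φ q t γ j k y R / R|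
      ≤ ScaleData.scaleMaj (B * (1 + t⁻¹) / t ^ 3) (C * ∫ p, γ p ^ 2) R := fun R hR =>
    D.abs_div_le_scaleMaj hi j k hR (hx0 R hR)
  have b1 : ∀ R, 0 < R → |effScaleF φ t γ j k y R / R|
      ≤ ScaleData.scaleMaj (B * (1 + t⁻¹) / t ^ 3) (C * ∫ p, γ p ^ 2) R := fun R hR =>
    D.abs_div_le_scaleMaj hi j k (Y := fun p => t • p.2) hR (hx1 R hR)
  have i0 : IntegrableOn (fun R : ℝ => scaleF φ q t γ j k y R / R) (Ioi 0) volume :=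
    (ScaleData.integrableOn_scaleMaj _ _).mono' (D.aestronglyMeasurable_scale j k (measurable_posXt q t) y)
      ((ae_restrict_iff' measurableSet_Ioi).2 (Filter.Eventually.of_forall fun R hR => b0 R hR))
  have i1 : IntegrableOn (fun R : ℝ => effScaleF φ t γ j k y R / R) (Ioi 0) volume :=
    (ScaleData.integrableOn_scaleMaj _ _).mono'
      (D.aestronglyMeasurable_scale j k (Y := fun p => t • p.2) (by fun_prop) y)
      ((ae_restrict_iff' measurableSet_Ioi).2 (Filter.Eventually.of_forall fun R hR => b1 R hR))
  refine ⟨b0, i0, i1, ?_⟩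
  obtain ⟨p1, p2⟩ := integrableOn_scaleProfile
  rw [fieldF, effF, ← integral_sub i0 i1]
  change cubicWeight t y * _ ≤ _
  have hle : |∫ R in Ioi (0 : ℝ), (scaleF φ q t γ j k y R / R - effScaleF φ t γ j k y R / R)|
      ≤ ∫ R in Ioi (0 : ℝ), 6 * A * N * t ^ (-(1 / 5) : ℝ) / cubicWeight t y * (scaleProfile R / R) := by
    rw [← Real.norm_eq_abs]
    refine norm_integral_le_of_norm_le (p1.const_mul _)
      ((ae_restrict_iff' measurableSet_Ioi).2 (Filter.Eventually.of_forall fun R hR => ?_))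
    have hR0 : 0 < R := hR
    have h1 := hS.abs_sub_le hA hN0 ht hR0
    rw [Real.norm_eq_abs, ← sub_div, abs_div, abs_of_pos hR0, ← mul_div_assoc]
    gcongr
    rwa [div_mul_eq_mul_div, le_div_iff₀ hL, mul_comm]
  rw [integral_const_mul] at hle
  calc _ ≤ cubicWeight t y * (6 * A * N * t ^ (-(1 / 5) : ℝ) / cubicWeight t y * 7) := by
        have h0 : 0 ≤ 6 * A * N * t ^ (-(1 / 5) : ℝ) / cubicWeight t y := by positivity
        refine mul_le_mul_of_nonneg_left (hle.trans ?_) hL.le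
        gcongr
    _ = _ := by field_simp; ring

/-! ### Differentiation of the field -/

theorem pd_comm {f : E3 → ℝ} (hf : ContDiff ℝ ∞ f) (j k : Fin 3) (x : E3) : pd k (pd j f) x = pd j (pd k f) x := by
  have hd : DifferentiableAt ℝ (fderiv ℝ f) x :=
    ((hf.fderiv_right (m := ∞) (by simp)).differentiable (by simp)).differentiableAt
  have e : ∀ i l : Fin 3, pd i (pd l f) x
      = fderiv ℝ (fderiv ℝ f) x (EuclideanSpace.single i 1) (EuclideanSpace.single l 1) := fun i l => by
    have h : HasFDerivAt (pd l f) ((fderiv ℝ (fderiv ℝ f) x).flip (EuclideanSpace.single l 1)) x := by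
      have := hd.hasFDerivAt.clm_apply (hasFDerivAt_const (EuclideanSpace.single l (1 : ℝ) : E3) x)
      refine this.congr_fderiv ?_
      ext v; simp
    rw [pd, h.fderiv]; rfl
  have hs : IsSymmSndFDerivAt ℝ f x := hf.contDiffAt.isSymmSndFDerivAt (by
    simp only [minSmoothness_of_isRCLikeNormedField]
    exact WithTop.coe_le_coe.2 (le_top : (2 : ℕ∞) ≤ ⊤))
  rw [e, e]
  exact hs _ _

variable {q t : ℝ} {φ : E3 → ℝ} {γ : Phase → ℝ} {C K N : ℝ}

theorem hasDerivAt_integral_pd (hφ : IsStandardCutoff φ) (hC : CutoffBound φ C)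
    (hγ : AEStronglyMeasurable γ volume) (hi : Integrable (fun p => γ p ^ 2)) (j k : Fin 3)
    {Y : Phase → E3} (hY : Measurable Y) (y : E3) {R : ℝ} (hR : 0 < R) (s : ℝ) :
    HasDerivAt (fun s : ℝ => ∫ p, pd j φ (R⁻¹ • (y + s • EuclideanSpace.single k 1 - Y p)) * γ p ^ 2)
      (R⁻¹ * ∫ p, pd j (pd k φ) (R⁻¹ • (y + s • EuclideanSpace.single k 1 - Y p)) * γ p ^ 2) s := by
  have hRi : 0 < R⁻¹ := inv_pos.2 hR
  have hm1 : Measurable (pd j φ) := (hC.smooth j).continuous.measurable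
  have hm2 : Measurable (pd j (pd k φ)) := (hC.continuous_pd_pd j k).measurable
  have hd : ∀ (p : Phase) (s : ℝ), HasDerivAt
      (fun s : ℝ => pd j φ (R⁻¹ • (y + s • EuclideanSpace.single k 1 - Y p)) * γ p ^ 2)
      (R⁻¹ * pd j (pd k φ) (R⁻¹ • (y + s • EuclideanSpace.single k 1 - Y p)) * γ p ^ 2) s := fun p s => by
    have h1 : HasDerivAt (fun s : ℝ => R⁻¹ • (y + s • (EuclideanSpace.single k 1 : E3) - Y p))
        (R⁻¹ • EuclideanSpace.single k 1) s := by
      have h := ((((hasDerivAt_id s).smul_const (EuclideanSpace.single k (1 : ℝ) : E3)).const_add y).sub_const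
        (Y p)).const_smul R⁻¹
      exact HasDerivAt.congr_deriv (show HasDerivAt
        (fun s : ℝ => R⁻¹ • (y + s • (EuclideanSpace.single k 1 : E3) - Y p)) _ s from h) (by rw [one_smul])
    have h2 := (((hC.smooth j).differentiable (by simp)).differentiableAt
      (x := R⁻¹ • (y + s • EuclideanSpace.single k 1 - Y p))).hasFDerivAt.comp_hasDerivAt s h1
    refine (h2.mul_const (γ p ^ 2)).congr_deriv ?_
    -- Differentiation produces `∂_k ∂_j φ`; symmetry of second derivatives restores the order used
    -- in `scaleF`.
    rw [map_smul, smul_eq_mul, ← pd_comm hφ.smooth j k]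
    rfl
  have key := hasDerivAt_integral_of_dominated_loc_of_deriv_le (μ := (volume : Measure Phase)) (x₀ := s)
    (F := fun s p => pd j φ (R⁻¹ • (y + s • EuclideanSpace.single k 1 - Y p)) * γ p ^ 2)
    (F' := fun s p => R⁻¹ * pd j (pd k φ) (R⁻¹ • (y + s • EuclideanSpace.single k 1 - Y p)) * γ p ^ 2)
    (bound := fun p => R⁻¹ * C * γ p ^ 2) (s := univ) Filter.univ_mem
    (Filter.Eventually.of_forall fun s => ?_) ?_ ?_ ?_ (hi.const_mul _)
    (Filter.Eventually.of_forall fun p s _ => hd p s)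
  · refine key.2.congr_deriv ?_
    rw [← integral_const_mul]
    congr 1
    ext p; ring
  · exact AEStronglyMeasurable.mul (Measurable.aestronglyMeasurable (by fun_prop)) (hγ.pow 2)
  · refine (hi.const_mul C).mono'
      (AEStronglyMeasurable.mul (Measurable.aestronglyMeasurable (by fun_prop)) (hγ.pow 2))
      (Filter.Eventually.of_forall fun p => ?_)
    rw [Real.norm_eq_abs, abs_mul, abs_of_nonneg (sq_nonneg (γ p))]
    have := hC.b1 j (R⁻¹ • (y + s • EuclideanSpace.single k 1 - Y p))
    gcongr
  · exact AEStronglyMeasurable.mul (Measurable.aestronglyMeasurable (by fun_prop)) (hγ.pow 2)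
  · refine Filter.Eventually.of_forall fun p s _ => ?_
    rw [Real.norm_eq_abs, abs_mul, abs_mul, abs_of_nonneg (sq_nonneg (γ p)), abs_of_pos hRi]
    have := hC.abs_pd_le j k (R⁻¹ • (y + s • EuclideanSpace.single k 1 - Y p))
    gcongr

/-- The Coulomb integral cannot be differentiated through its kernel, whose derivative has degree
`-3`. In the scale representation each piece is smooth in `y` with derivative `scaleF`, and the
majorant `b` permits differentiation under the integral over `R`. -/
theorem hasLineDerivAt_fieldE (hφ : IsStandardCutoff φ) (hC : CutoffBound φ C)
    (hγ : AEStronglyMeasurable γ volume) (hi : Integrable (fun p => γ p ^ 2)) (j k : Fin 3)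
    (hc : ∀ y : E3, Integrable (fun p : Phase => 1 / ‖y - posXt q t p‖ ^ 2 * γ p ^ 2)) {b : ℝ → ℝ}
    (hb : IntegrableOn b (Ioi 0))
    (hF : ∀ (y : E3) (R : ℝ), 0 < R → |scaleF φ q t γ j k y R / R| ≤ b R)
    (hFi : ∀ y : E3, IntegrableOn (fun R : ℝ => scaleF φ q t γ j k y R / R) (Ioi 0)) (y : E3) :
    HasLineDerivAt ℝ (fieldE q t γ j) (fieldF φ q t γ j k y) y (EuclideanSpace.single k 1) := by
  have hX := measurable_posXt q t
  have hrep : ∀ y : E3, IntegrableOn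
      (fun R : ℝ => (-(R ^ 2)⁻¹ * ∫ p, pd j φ (R⁻¹ • (y - posXt q t p)) * γ p ^ 2) / R) (Ioi 0) ∧
      ∫ R in Ioi (0 : ℝ), (-(R ^ 2)⁻¹ * ∫ p, pd j φ (R⁻¹ • (y - posXt q t p)) * γ p ^ 2) / R
        = fieldE q t γ j y := fun y =>
    integral_scales_coulomb hφ j (Y := fun p => y - posXt q t p) (by fun_prop) (hγ.pow 2) (hc y)
  set ER : ℝ → ℝ → ℝ := fun s R => (-(R ^ 2)⁻¹
    * ∫ p, pd j φ (R⁻¹ • (y + s • EuclideanSpace.single k 1 - posXt q t p)) * γ p ^ 2) / R with hER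
  set FR : ℝ → ℝ → ℝ := fun s R => scaleF φ q t γ j k (y + s • EuclideanSpace.single k 1) R / R with hFR
  have hd : ∀ R : ℝ, 0 < R → ∀ s, HasDerivAt (fun s => ER s R) (FR s R) s := fun R hR0 s => by
    have h1 := ((hasDerivAt_integral_pd hφ hC hγ hi j k hX y hR0 s).const_mul (-(R ^ 2)⁻¹)).div_const R
    have e : ∀ I : ℝ, -(R ^ 2)⁻¹ * (R⁻¹ * I) / R = -(R ^ 3)⁻¹ * I / R := fun I => by field_simp
    exact h1.congr_deriv (e _)
  have hERi : ∀ s, IntegrableOn (ER s) (Ioi 0) := fun s => (hrep _).1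
  have hERv : ∀ s, ∫ R in Ioi (0 : ℝ), ER s R = fieldE q t γ j (y + s • EuclideanSpace.single k 1) :=
    fun s => (hrep _).2
  have hFRi : ∀ s, IntegrableOn (FR s) (Ioi 0) := fun s => hFi _
  have hFRb : ∀ s R, 0 < R → |FR s R| ≤ b R := fun s R hR => hF _ R hR
  have hFR0 : ∫ R in Ioi (0 : ℝ), FR 0 R = fieldF φ q t γ j k y := by
    rw [hFR]; simp only [zero_smul, add_zero]; rfl
  clear_value ER FR
  have key := (hasDerivAt_integral_of_dominated_loc_of_deriv_le (μ := (volume : Measure ℝ).restrict (Ioi 0))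
    (x₀ := (0 : ℝ)) (F := ER) (F' := FR) (bound := b) (s := univ) Filter.univ_mem
    (Filter.Eventually.of_forall fun s => (hERi s).aestronglyMeasurable) (hERi 0)
    (hFRi 0).aestronglyMeasurable
    ((ae_restrict_iff' measurableSet_Ioi).2 (Filter.Eventually.of_forall fun R hR s _ => hFRb s R hR)) hb
    ((ae_restrict_iff' measurableSet_Ioi).2 (Filter.Eventually.of_forall fun R hR s _ => hd R hR s))).2
  simp only [hERv, hFR0] at key
  exact key

theorem exists_fieldF_le {q : ℝ} (hq : 0 < q) {φ : E3 → ℝ} (hφ : IsStandardCutoff φ) :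
    ∃ C : ℝ, 0 ≤ C ∧ ∀ t : ℝ, 0 < t → ∀ γ : Phase → ℝ,
      ContDiffOn ℝ 1 γ phaseSpace → normN2 q γ ≠ ⊤ → ∀ (y : E3) (j k : Fin 3),
        IntegrableOn (fun R : ℝ => scaleF φ q t γ j k y R / R) (Ioi 0) volume ∧
        IntegrableOn (fun R : ℝ => effScaleF φ t γ j k y R / R) (Ioi 0) volume ∧
        HasLineDerivAt ℝ (fieldE q t γ j) (fieldF φ q t γ j k y) y (EuclideanSpace.single k 1) ∧
        (t ^ 2 + ‖y‖ ^ 2) ^ (3 / 2 : ℝ) * |fieldF φ q t γ j k y - effF φ t γ j k y|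
          ≤ C * t ^ (-(1 / 5) : ℝ) * (normN2 q γ).toReal := by
  obtain ⟨A, hA, h⟩ := exists_scale_integral_le hq hφ
  obtain ⟨C, hC⟩ := exists_cutoffBound hφ
  obtain ⟨C1, -, h1⟩ := exists_field_le hq hφ
  refine ⟨A, hA, fun t ht γ hγ hN y j k => ?_⟩
  obtain ⟨b, c, h2⟩ := h t ht γ hγ hN
  have hm := aestronglyMeasurable_of_contDiffOn hγ
  have hN1 : normN1 q γ ≠ ⊤ := ne_top_of_le_ne_top hN (by
    unfold normN2; rw [add_assoc]; exact le_add_right le_rfl)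
  refine ⟨(h2 y j k).2.1, (h2 y j k).2.2.1, ?_, (h2 y j k).2.2.2⟩
  exact hasLineDerivAt_fieldE hφ hC hm (integrable_sq_of_normN1 hq hm hN1) j k
    (fun y => (h1 t ht γ hm hN1 y j).1) (ScaleData.integrableOn_scaleMaj b c) (fun y => (h2 y j k).1)
    (fun y => (h2 y j k).2.1) y

end KeplerGas

end

/-! ### The proposition -/

theorem mainTheorem6 (q : ℝ) (hq : 0 < q) (φ : KeplerGas.E3 → ℝ)
    (hφ : KeplerGas.IsStandardCutoff φ) :
    ∃ C : ℝ, 0 < C ∧ ∀ (t : ℝ), 0 < t → ∀ γ : KeplerGas.Phase → ℝ,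
      (AEStronglyMeasurable γ volume → KeplerGas.normN1 q γ ≠ ⊤ →
        ∀ (y : KeplerGas.E3) (j : Fin 3),
          Integrable (fun p : KeplerGas.Phase =>
            KeplerGas.coulombKernel j (y - KeplerGas.posXt q t p) * γ p ^ 2) volume ∧
          IntegrableOn (fun R : ℝ => KeplerGas.effScaleE φ t γ j y R / R) (Ioi 0) volume ∧
          (t ^ 2 + ‖y‖ ^ 2) * |KeplerGas.fieldE q t γ j y - KeplerGas.effE φ t γ j y|
            ≤ C * t ^ (-(1 / 5) : ℝ) * (KeplerGas.normN1 q γ).toReal) ∧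
      (ContDiffOn ℝ 1 γ KeplerGas.phaseSpace → KeplerGas.normN2 q γ ≠ ⊤ →
        ∀ (y : KeplerGas.E3) (j k : Fin 3),
          IntegrableOn (fun R : ℝ => KeplerGas.scaleF φ q t γ j k y R / R) (Ioi 0) volume ∧
          IntegrableOn (fun R : ℝ => KeplerGas.effScaleF φ t γ j k y R / R) (Ioi 0) volume ∧
          HasLineDerivAt ℝ (KeplerGas.fieldE q t γ j) (KeplerGas.fieldF φ q t γ j k y) y
            (EuclideanSpace.single k 1) ∧
          (t ^ 2 + ‖y‖ ^ 2) ^ (3 / 2 : ℝ)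
              * |KeplerGas.fieldF φ q t γ j k y - KeplerGas.effF φ t γ j k y|
            ≤ C * t ^ (-(1 / 5) : ℝ) * (KeplerGas.normN2 q γ).toReal) := by
  obtain ⟨C1, hC1, h1⟩ := KeplerGas.exists_field_le hq hφ
  obtain ⟨C2, hC2, h2⟩ := KeplerGas.exists_fieldF_le hq hφ
  -- The summand `1` secures strict positivity of the constant.
  refine ⟨C1 + C2 + 1, by positivity, fun t ht γ => ⟨fun hγ hN y j => ?_, fun hγ hN y j k => ?_⟩⟩
  · obtain ⟨-, g1, g2, g3⟩ := h1 t ht γ hγ hN y j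
    refine ⟨g1, g2, g3.trans ?_⟩
    gcongr
    linarith
  · obtain ⟨g1, g2, g3, g4⟩ := h2 t ht γ hγ hN y j k
    refine ⟨g1, g2, g3, g4.trans ?_⟩
    gcongr
    linarith
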